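/- Let $K$ be a field of characteristic $0$. Let $\mathcal S_*$ and $\mathcal T_*$ be (symmetric) topological operads with $\mathcal S_*(0)$, $\mathcal S_*(1)$, $\mathcal T_*(0)$, $\mathcal T_*(1)$ one-point spaces, i.e. reduced topological $\Lambda$-operads $\mathcal S,\mathcal T$ (the suboperads of operations of positive arity, with the restriction operators given by inserting the operation of arity $0$), and let $f:\mathcal S_*\to\mathcal T_*$ be a map of topological operads, i.e. a map $f:\mathcal S\to\mathcal T$ of $\Lambda$-operads. *The two-coloured operad.* For such an operad $\mathcal X$ let $\mathcal X_{triv}$ be the operad with colours $1,2$ with $\mathcal X_{triv}^2(k,l)=\mathcal X_*(l)$ and $\mathcal X_{triv}^1(k,0)=*$ ($k$ inputs of colour $1$, $l$ inputs of colour $2$, upper index $=$ colour of the output), let $\mathcal X_{paint}$ be the one with $\mathcal X_{paint}^2(k,l)=\mathcal X_*(k+l)$ and $\mathcal X_{paint}^1(k,0)=\mathcal X_*(k)$ (all other spaces are empty), and let $\mathcal X_{paint}\to\mathcal X_{triv}$ be the map which inserts the operation of arity $0$ in all inputs of colour $1$. Let $\mathsf{ESC}_f$ be the homotopy pullback (triples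 of two points and a connecting path) of $\mathcal S_{triv}\to\mathcal T_{triv}\leftarrow\mathcal T_{paint}$. *Chains.* Let $C(-)$ denote singular cubical chains over $K$, modulo degenerate cubes and modulo the relations $c\circ\sigma=\mathrm{sgn}(\sigma)\,c$ for permutations $\sigma$ of the coordinates, with cohomological grading. This is a lax symmetric monoidal functor (by products of cubes), so that $P=C(\mathcal S)$ and $Q=C(\mathcal T)$ are dg operads (without operations of arity $0$), and $M=C(\mathsf{ESC}_f^2(\bullet,0))$, in positive arities, is an operadic $P$-$Q$-bimodule: $\mathcal S$ is mapped to $\mathsf{ESC}_f^2(0,\bullet)$ by means of constant paths, and $\mathcal T$ to $\mathsf{ESC}_f^1(\bullet,0)$. Let $\mathbb 1\in M(1)$ be the class of the point of $\mathsf{ESC}_f^2(1,0)$ which is given by the unit of $\mathcal T$. *Torsors and encoded maps.* A $P$-$Q$-bimodule $M$ with a degree $0$ cocycle $\mathbb 1\in M(1)$ is an operadic right torsor if $H(M(1))$ is one-dimensional, concentrated in degree $0$ and generated by the class of $\mathbb 1$, and if $Q\to M$, $q\mapsto\mathbb 1\circ q$, is a quasi-isomorphism. A resolution of $(M,\mathbb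 1)$ is a quasi-isomorphism of $P$-$Q$-bimodules $\widehat M\to M$ with a cocycle in $\widehat M(1)$ over $\mathbb 1$ such that the induced map $\iota:Q\to\widehat M$ is a cofibration of right $Q$-modules (in the projective model structure). If $\pi:\widehat M\to Q$ is a map of right $Q$-modules with $\pi\iota=\mathrm{id}$ and if $\varphi\mapsto\iota\varphi\pi$ is a quasi-isomorphism, then the operad map up to homotopy $P\dashrightarrow Q$ encoded by $(\widehat M,\pi)$ is the zigzag of non-unital dg operads $$P\longrightarrow \mathrm{End}_Q(\widehat M)\xleftarrow{\ \iota(-)\pi\ }\mathrm{End}_Q(Q)\longrightarrow Q ,$$ where $\mathrm{End}_Q$ denotes the endomorphism operads of right $Q$-modules and the last map, $\varphi\mapsto\varphi(\mathrm{id},\dots,\mathrm{id})$, is the canonical identification. Operad maps up to homotopy are compared in the localization of the category of non-unital dg operads at the quasi-isomorphisms. **Proposition.** In this setting, $(M,\mathbb 1)$ is an operadic right $P$-$Q$-torsor, it has a resolution, and for every resolution $\widehat M$ there is a right $Q$-module map $\pi:\widehat M\to Q$ with $\pi\iota=\mathrm{id}$. For every resolution and every such $\pi$, the map $\iota(-)\pi$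 and the map $\mathrm{End}_Q(Q)\to Q$ are quasi-isomorphisms, and the operad map up to homotopy $P\dashrightarrow Q$ encoded by $M$ is homotopic to (i.e. equal, in this localization, to) the map $C(f):P\to Q$ induced by $f$. -/

import Mathlib

open CategoryTheory

universe u v w

namespace OperadTorsor

section

/-- The sign `(-1) ^ s`, for `s` an integer modulo two. -/
def sg (s : ZMod 2) : ℤ := if s = 0 then 1 else -1

theorem sg_zero : sg 0 = 1 := rfl

theorem sg_add (s t : ZMod 2) : sg (s + t) = sg s * sg t := by
  revert s t; decide

theorem sg_smul {V : Type*} [AddCommGroup V] (s t : ZMod 2) (x : V) :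
    sg s • sg t • x = sg (s + t) • x := by
  rw [smul_smul, sg_add]

theorem sg_add_one {V : Type*} [AddCommGroup V] (s : ZMod 2) (x : V) :
    sg (s + 1) • x = - (sg s • x) := by
  rw [sg_add]; simp [sg]

/-- Indicator (modulo two) of the relation `i < j`. -/
def lo (i j : ℕ) : ZMod 2 := if i < j then 1 else 0

theorem lo_self (i : ℕ) : lo i i = 0 := by simp [lo]

theorem lo_swap {i j : ℕ} (h : i ≠ j) : lo j i = lo i j + 1 := by
  unfold lo
  rcases lt_or_gt_of_ne h with h | h
  · rw [if_neg (by omega), if_pos h]; decide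
  · rw [if_pos h, if_neg (by omega)]; decide

/-- Arities are finite sets of natural numbers ("labels"). `Ins A x B C` says that `C` is the
set of inputs obtained from `A` by replacing the input `x` by the set of inputs `B`. -/
structure Ins (A : Finset ℕ) (x : ℕ) (B C : Finset ℕ) : Prop where
  mem : x ∈ A
  disj : Disjoint (A.erase x) B
  eq : C = A.erase x ∪ B

/-- `N` is the disjoint union of the sets `A j`, `j ∈ J`. -/
structure Part {J : Finset ℕ} (A : J → Finset ℕ) (N : Finset ℕ) : Prop where
  disj : ∀ i j : J, i ≠ j → Disjoint (A i) (A j)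
  mem_iff : ∀ n, n ∈ N ↔ ∃ j : J, n ∈ A j

/-- Cochain complexes of `K`-vector spaces. -/
abbrev Cx (K : Type u) [Field K] := CochainComplex (ModuleCat.{w} K) ℤ

variable (K : Type u) [Field K]

/-- A non-unital (symmetric) dg operad, in terms of partial compositions: `comp` inserts an
operation of arity `B` into the input `x` of an operation of arity `A`. -/
structure NUOperad where
  X : Finset ℕ → Cx.{u, w} K
  rel : ∀ {A B : Finset ℕ} (f : ℕ → ℕ), Set.BijOn f A B → (X A ⟶ X B)
  comp : ∀ {A : Finset ℕ} {x : ℕ} {B C : Finset ℕ}, Ins A x B C → ∀ {i j n : ℤ}, i + j = n →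
    ((X A).X i →ₗ[K] (X B).X j →ₗ[K] (X C).X n)
  rel_congr : ∀ {A B : Finset ℕ} (f g : ℕ → ℕ) (hf : Set.BijOn f A B) (hg : Set.BijOn g A B),
    Set.EqOn f g A → rel f hf = rel g hg
  rel_id : ∀ {A : Finset ℕ} (h : Set.BijOn id (A : Set ℕ) A), rel id h = 𝟙 (X A)
  rel_trans : ∀ {A B C : Finset ℕ} (f g : ℕ → ℕ) (hf : Set.BijOn f A B) (hg : Set.BijOn g B C)
    (h : Set.BijOn (g ∘ f) A C), rel (g ∘ f) h = rel f hf ≫ rel g hg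
  d_comp : ∀ {A : Finset ℕ} {x : ℕ} {B C : Finset ℕ} (h : Ins A x B C) {i j n i' j' n' : ℤ}
    (hn : i + j = n) (hi : i + 1 = i') (hj : j + 1 = j') (hn' : n + 1 = n')
    (a : (X A).X i) (b : (X B).X j),
    (X C).d n n' (comp h hn a b) =
      comp h (show i' + j = n' by omega) ((X A).d i i' a) b +
      sg i • comp h (show i + j' = n' by omega) a ((X B).d j j' b)
  rel_comp : ∀ {A : Finset ℕ} {x : ℕ} {B C A' B' C' : Finset ℕ} (h : Ins A x B C) (f g k : ℕ → ℕ)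
    (h' : Ins A' (f x) B' C')
    (hf : Set.BijOn f A A') (hg : Set.BijOn g B B') (hk : Set.BijOn k C C'),
    Set.EqOn k f (A.erase x) → Set.EqOn k g B →
    ∀ {i j n : ℤ} (hn : i + j = n) (a : (X A).X i) (b : (X B).X j),
    (rel k hk).f n (comp h hn a b) = comp h' hn ((rel f hf).f i a) ((rel g hg).f j b)
  assoc_seq : ∀ {A : Finset ℕ} {x : ℕ} {B C : Finset ℕ} {y : ℕ} {D E F : Finset ℕ}
    (h₁ : Ins A x B C) (h₂ : Ins C y D F) (h₃ : Ins B y D E) (h₄ : Ins A x E F)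
    {i j l m n p : ℤ} (hm : i + j = m) (hn : m + l = n) (hp : j + l = p) (hq : i + p = n)
    (a : (X A).X i) (b : (X B).X j) (c : (X D).X l),
    comp h₂ hn (comp h₁ hm a b) c = comp h₄ hq a (comp h₃ hp b c)
  assoc_par : ∀ {A : Finset ℕ} {x : ℕ} {B C : Finset ℕ} {y : ℕ} {D E F : Finset ℕ}, x ≠ y →
    ∀ (h₁ : Ins A x B C) (h₂ : Ins C y D F) (h₃ : Ins A y D E) (h₄ : Ins E x B F)
    {i j l m n p : ℤ} (hm : i + j = m) (hn : m + l = n) (hp : i + l = p) (hq : p + j = n)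
    (a : (X A).X i) (b : (X B).X j) (c : (X D).X l),
    comp h₂ hn (comp h₁ hm a b) c = sg (j * l) • comp h₄ hq (comp h₃ hp a c) b

variable {K}

namespace NUOperad

/-- Morphisms of non-unital dg operads. -/
@[ext]
structure Hom (P Q : NUOperad.{u, w} K) where
  app : ∀ A, P.X A ⟶ Q.X A
  rel : ∀ {A B : Finset ℕ} (f : ℕ → ℕ) (hf : Set.BijOn f A B),
    P.rel f hf ≫ app B = app A ≫ Q.rel f hf
  comp : ∀ {A : Finset ℕ} {x : ℕ} {B C : Finset ℕ} (h : Ins A x B C) {i j n : ℤ} (hn : i + j = n)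
    (a : (P.X A).X i) (b : (P.X B).X j),
    (app C).f n (P.comp h hn a b) = Q.comp h hn ((app A).f i a) ((app B).f j b)

instance : Category (NUOperad.{u, w} K) where
  Hom := Hom
  id P := ⟨fun A => 𝟙 _, by simp, by simp⟩
  comp F G := ⟨fun A => F.app A ≫ G.app A,
    fun f hf => by rw [← Category.assoc, F.rel, Category.assoc, G.rel, Category.assoc],
    fun h _ _ _ hn a b => by simp [F.comp, G.comp]⟩
  id_comp F := by apply Hom.ext; simp
  comp_id F := by apply Hom.ext; simp
  assoc F G H := by apply Hom.ext; simp

/-- The quasi-isomorphisms of non-unital dg operads. -/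
def quasiIso : MorphismProperty (NUOperad.{u, w} K) :=
  fun _ _ F => ∀ A, QuasiIso (Hom.app F A)

end NUOperad

variable (K) in
/-- A (unital, symmetric) dg operad. The element `one x` is the unit, viewed as an operation with
a single input labelled by `x`. -/
structure DGOperad extends NUOperad.{u, w} K where
  one : ∀ x : ℕ, (X {x}).X 0
  d_one : ∀ x, (X {x}).d 0 1 (one x) = 0
  rel_one : ∀ (x : ℕ) (f : ℕ → ℕ) (hf : Set.BijOn f ({x} : Finset ℕ) ({f x} : Finset ℕ)),
    (rel f hf).f 0 (one x) = one (f x)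
  one_comp : ∀ {A : Finset ℕ} {x : ℕ} (h : Ins {x} x A A) {n : ℤ} (hn : 0 + n = n)
    (a : (X A).X n), comp h hn (one x) a = a
  comp_one : ∀ {A : Finset ℕ} {x : ℕ} (h : Ins A x {x} A) {n : ℤ} (hn : n + 0 = n)
    (a : (X A).X n), comp h hn a (one x) = a

/-- A right module over a dg operad `Q`: `act` inserts an operation of `Q` into an input. -/
structure RightMod (Q : DGOperad.{u, w} K) where
  X : Finset ℕ → Cx.{u, w} K
  rel : ∀ {A B : Finset ℕ} (f : ℕ → ℕ), Set.BijOn f A B → (X A ⟶ X B)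
  act : ∀ {A : Finset ℕ} {x : ℕ} {B C : Finset ℕ}, Ins A x B C → ∀ {i j n : ℤ}, i + j = n →
    ((X A).X i →ₗ[K] (Q.X B).X j →ₗ[K] (X C).X n)
  rel_congr : ∀ {A B : Finset ℕ} (f g : ℕ → ℕ) (hf : Set.BijOn f A B) (hg : Set.BijOn g A B),
    Set.EqOn f g A → rel f hf = rel g hg
  rel_id : ∀ {A : Finset ℕ} (h : Set.BijOn id (A : Set ℕ) A), rel id h = 𝟙 (X A)
  rel_trans : ∀ {A B C : Finset ℕ} (f g : ℕ → ℕ) (hf : Set.BijOn f A B) (hg : Set.BijOn g B C)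
    (h : Set.BijOn (g ∘ f) A C), rel (g ∘ f) h = rel f hf ≫ rel g hg
  d_act : ∀ {A : Finset ℕ} {x : ℕ} {B C : Finset ℕ} (h : Ins A x B C) {i j n i' j' n' : ℤ}
    (hn : i + j = n) (hi : i + 1 = i') (hj : j + 1 = j') (hn' : n + 1 = n')
    (a : (X A).X i) (b : (Q.X B).X j),
    (X C).d n n' (act h hn a b) =
      act h (show i' + j = n' by omega) ((X A).d i i' a) b +
      sg i • act h (show i + j' = n' by omega) a ((Q.X B).d j j' b)
  rel_act : ∀ {A : Finset ℕ} {x : ℕ} {B C A' B' C' : Finset ℕ} (h : Ins A x B C) (f g k : ℕ → ℕ)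
    (h' : Ins A' (f x) B' C')
    (hf : Set.BijOn f A A') (hg : Set.BijOn g B B') (hk : Set.BijOn k C C'),
    Set.EqOn k f (A.erase x) → Set.EqOn k g B →
    ∀ {i j n : ℤ} (hn : i + j = n) (a : (X A).X i) (b : (Q.X B).X j),
    (rel k hk).f n (act h hn a b) = act h' hn ((rel f hf).f i a) ((Q.rel g hg).f j b)
  assoc_seq : ∀ {A : Finset ℕ} {x : ℕ} {B C : Finset ℕ} {y : ℕ} {D E F : Finset ℕ}
    (h₁ : Ins A x B C) (h₂ : Ins C y D F) (h₃ : Ins B y D E) (h₄ : Ins A x E F)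
    {i j l m n p : ℤ} (hm : i + j = m) (hn : m + l = n) (hp : j + l = p) (hq : i + p = n)
    (a : (X A).X i) (b : (Q.X B).X j) (c : (Q.X D).X l),
    act h₂ hn (act h₁ hm a b) c = act h₄ hq a (Q.comp h₃ hp b c)
  assoc_par : ∀ {A : Finset ℕ} {x : ℕ} {B C : Finset ℕ} {y : ℕ} {D E F : Finset ℕ}, x ≠ y →
    ∀ (h₁ : Ins A x B C) (h₂ : Ins C y D F) (h₃ : Ins A y D E) (h₄ : Ins E x B F)
    {i j l m n p : ℤ} (hm : i + j = m) (hn : m + l = n) (hp : i + l = p) (hq : p + j = n)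
    (a : (X A).X i) (b : (Q.X B).X j) (c : (Q.X D).X l),
    act h₂ hn (act h₁ hm a b) c = sg (j * l) • act h₄ hq (act h₃ hp a c) b
  act_one : ∀ {A : Finset ℕ} {x : ℕ} (h : Ins A x {x} A) {n : ℤ} (hn : n + 0 = n)
    (a : (X A).X n), act h hn a (Q.one x) = a

namespace RightMod

variable {Q : DGOperad.{u, w} K}

/-- Morphisms of right modules. -/
@[ext]
structure Hom (M N : RightMod Q) where
  app : ∀ A, M.X A ⟶ N.X A
  rel : ∀ {A B : Finset ℕ} (f : ℕ → ℕ) (hf : Set.BijOn f A B),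
    M.rel f hf ≫ app B = app A ≫ N.rel f hf
  act : ∀ {A : Finset ℕ} {x : ℕ} {B C : Finset ℕ} (h : Ins A x B C) {i j n : ℤ} (hn : i + j = n)
    (a : (M.X A).X i) (b : (Q.X B).X j),
    (app C).f n (M.act h hn a b) = N.act h hn ((app A).f i a) b

instance : Category (RightMod Q) where
  Hom := Hom
  id P := ⟨fun A => 𝟙 _, by simp, by simp⟩
  comp F G := ⟨fun A => F.app A ≫ G.app A,
    fun f hf => by rw [← Category.assoc, F.rel, Category.assoc, G.rel, Category.assoc],
    fun h _ _ _ hn a b => by simp [F.act, G.act]⟩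
  id_comp F := by apply Hom.ext; simp
  comp_id F := by apply Hom.ext; simp
  assoc F G H := by apply Hom.ext; simp

end RightMod

/-- A dg operad as a right module over itself. -/
def DGOperad.regular (Q : DGOperad.{u, w} K) : RightMod Q where
  X := Q.X
  rel := Q.rel
  act := Q.comp
  rel_congr := Q.rel_congr
  rel_id := Q.rel_id
  rel_trans := Q.rel_trans
  d_act := Q.d_comp
  rel_act := Q.rel_comp
  assoc_seq := Q.assoc_seq
  assoc_par := Q.assoc_par
  act_one := Q.comp_one

end

section

variable {K : Type u} [Field K]

theorem part_iff {J : Finset ℕ} {A : ℕ → Finset ℕ} {N : Finset ℕ} :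
    Part (fun j : J => A j) N ↔
      (∀ i ∈ J, ∀ j ∈ J, i ≠ j → Disjoint (A i) (A j)) ∧ ∀ n, n ∈ N ↔ ∃ j ∈ J, n ∈ A j := by
  constructor
  · rintro ⟨h, h'⟩
    refine ⟨fun i hi j hj hij => h ⟨i, hi⟩ ⟨j, hj⟩ fun e => hij (congrArg Subtype.val e), fun n => ?_⟩
    rw [h']; simp
  · rintro ⟨h, h'⟩
    refine ⟨fun i j hij => h i i.2 j j.2 fun e => hij (Subtype.ext e), fun n => ?_⟩
    rw [h']; simp

namespace RightMod

variable {Q : DGOperad.{u, w} K} (M : RightMod Q)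

/-- A homogeneous element of some component of a right module. -/
structure Elt where
  ar : Finset ℕ
  deg : ℤ
  val : (M.X ar).X deg

variable {M}

/-- The differential of an element. -/
def Elt.d (e : M.Elt) : M.Elt := ⟨e.ar, e.deg + 1, (M.X e.ar).d _ _ e.val⟩

/-- Relabelling of the inputs of an element. -/
def Elt.rel (e : M.Elt) (f : ℕ → ℕ) {B : Finset ℕ} (h : Set.BijOn f e.ar B) : M.Elt :=
  ⟨B, e.deg, (M.rel f h).f _ e.val⟩

/-- Insertion of an operation of `Q` in an input of an element. -/
def Elt.act (e : M.Elt) {x : ℕ} {B C : Finset ℕ} (h : Ins e.ar x B C) {l n : ℤ}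
    (hn : e.deg + l = n) (q : (Q.X B).X l) : M.Elt :=
  ⟨C, n, M.act h hn e.val q⟩

variable (M)

/-- Functions which take a family of elements of `M` to elements of `M`. -/
abbrev PreEnd := (ℕ → M.Elt) → ∀ (N : Finset ℕ) (r : ℤ), (M.X N).X r

variable {M}

/-- The condition that `φ` is (the extension by zero of) a morphism of right `Q`-modules
`M ^ ⊗ J → M` of degree `d`. Here `φ m N r` is the component in arity `N` and degree `r` of the
value of `φ` on the tensor product of the elements `m j`, `j ∈ J`, in increasing order. -/
structure IsEnd (J : Finset ℕ) (d : ℤ) (φ : M.PreEnd) : Prop where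
  supp : ∀ m N r, φ m N r ≠ 0 →
    Part (fun j : J => (m j).ar) N ∧ d + ∑ j ∈ J, (m j).deg = r
  loc : ∀ m m', (∀ j ∈ J, m j = m' j) → φ m = φ m'
  lin : ∀ m, ∀ j ∈ J, ∀ A k N r, IsLinearMap K fun u : (M.X A).X k =>
    φ (Function.update m j ⟨A, k, u⟩) N r
  rel : ∀ m m' N N' (f : ℕ → ℕ) (hf : Set.BijOn f (N : Finset ℕ) (N' : Finset ℕ)),
    Part (fun j : J => (m j).ar) N →
    (∀ j ∈ J, ∃ (B : Finset ℕ) (hB : Set.BijOn f (m j).ar B), m' j = (m j).rel f hB) →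
    ∀ r, φ m' N' r = (M.rel f hf).f r (φ m N r)
  act : ∀ m, ∀ j ∈ J, ∀ (e : M.Elt) {x B C N N'} (h : Ins e.ar x B C) (h' : Ins N x B N'),
    Part (fun i : J => (Function.update m j e i).ar) N →
    ∀ {l n r r' : ℤ} (hn : e.deg + l = n) (hr : r + l = r') (q : (Q.X B).X l),
    φ (Function.update m j (e.act h hn q)) N' r' =
      sg (l * ∑ i ∈ J, lo j i * (m i).deg) •
        M.act h' hr (φ (Function.update m j e) N r) q

theorem IsEnd.zero' {J d} {φ : M.PreEnd} (hφ : IsEnd J d φ) (m) {j} (hj : j ∈ J) (A k N r) :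
    φ (Function.update m j ⟨A, k, 0⟩) N r = 0 := by
  exact (hφ.lin m j hj A k N r).map_zero

theorem IsEnd.zsmul' {J d} {φ : M.PreEnd} (hφ : IsEnd J d φ) (m) {j} (hj : j ∈ J) (A k)
    (c : ℤ) (u : (M.X A).X k) (N r) :
    φ (Function.update m j ⟨A, k, c • u⟩) N r = c • φ (Function.update m j ⟨A, k, u⟩) N r := by
  exact map_zsmul (hφ.lin m j hj A k N r).mk' c u

theorem IsEnd.eq_zero {J d} {φ : M.PreEnd} (hφ : IsEnd J d φ) {m N r}
    (h : ¬ (Part (fun j : J => (m j).ar) N ∧ d + ∑ j ∈ J, (m j).deg = r)) : φ m N r = 0 := by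
  by_contra h'
  exact h (hφ.supp _ _ _ h')

/-- Degree `d` morphisms of right `Q`-modules `M ^ ⊗ J → M`. -/
def endSub (M : RightMod Q) (J : Finset ℕ) (d : ℤ) : Submodule K M.PreEnd where
  carrier := {φ | IsEnd J d φ}
  zero_mem' := by
    constructor
    case lin => exact fun m j hj A k N r => (0 : (M.X A).X k →ₗ[K] (M.X N).X r).isLinear
    all_goals simp
  add_mem' := by
    intro φ ψ hφ hψ
    constructor
    · intro m N r h
      by_contra h'
      exact h (by simp [hφ.eq_zero h', hψ.eq_zero h'])
    · intro m m' h
      simp [hφ.loc m m' h, hψ.loc m m' h]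
    · intro m j hj A k N r
      exact ((hφ.lin m j hj A k N r).mk' + (hψ.lin m j hj A k N r).mk').isLinear
    · intro m m' N N' f hf hP h r
      simp only [Pi.add_apply]
      rw [hφ.rel m m' N N' f hf hP h, hψ.rel m m' N N' f hf hP h, map_add]
    · intro m j hj e x B C N N' h h' hP l n r r' hn hr q
      simp only [Pi.add_apply]
      rw [hφ.act m j hj e h h' hP hn hr, hψ.act m j hj e h h' hP hn hr, map_add, LinearMap.add_apply,
        smul_add]
  smul_mem' := by
    intro c φ hφ
    constructor
    · intro m N r h
      by_contra h'
      exact h (by simp [hφ.eq_zero h'])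
    · intro m m' h
      simp [hφ.loc m m' h]
    · intro m j hj A k N r
      exact (c • (hφ.lin m j hj A k N r).mk').isLinear
    · intro m m' N N' f hf hP h r
      simp only [Pi.smul_apply]
      rw [hφ.rel m m' N N' f hf hP h, map_smul]
    · intro m j hj e x B C N N' h h' hP l n r r' hn hr q
      simp only [Pi.smul_apply]
      rw [hφ.act m j hj e h h' hP hn hr, map_smul, LinearMap.smul_apply, smul_comm]

/-- The differential of a degree `d` morphism `M ^ ⊗ J → M`. -/
def dEnd (J : Finset ℕ) (d : ℤ) : M.PreEnd →ₗ[K] M.PreEnd where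
  toFun φ m N r := (M.X N).d (r - 1) r (φ m N (r - 1)) -
    sg d • ∑ j ∈ J, sg (∑ i ∈ J, lo i j * (m i).deg) • φ (Function.update m j (m j).d) N r
  map_add' φ ψ := by
    funext m N r
    simp only [Pi.add_apply, map_add, smul_add, Finset.sum_add_distrib]
    abel
  map_smul' c φ := by
    funext m N r
    simp only [Pi.smul_apply, map_smul, smul_sub, RingHom.id_apply, Finset.smul_sum]
    simp only [smul_comm c]

/-- The exponent of the sign in the relabelling of inputs by `f`. -/
def relExp (J : Finset ℕ) (f : ℕ → ℕ) (k : ℕ → ZMod 2) : ZMod 2 :=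
  ∑ i ∈ J, ∑ j ∈ J, lo i j * lo (f j) (f i) * k i * k j

/-- Permutation of the factors of `M ^ ⊗ J`. -/
def relEnd (J : Finset ℕ) (f : ℕ → ℕ) : M.PreEnd →ₗ[K] M.PreEnd where
  toFun φ m N r := sg (relExp J f fun i => (m (f i)).deg) • φ (m ∘ f) N r
  map_add' φ ψ := by funext m N r; simp
  map_smul' c φ := by funext m N r; simp [smul_comm c]

/-- The exponent of the sign in the composition of a morphism `M ^ ⊗ J → M` with a morphism
`M ^ ⊗ I → M` of degree `q` inserted in position `x`. -/
def compExp (J : Finset ℕ) (x : ℕ) (I : Finset ℕ) (q : ZMod 2) (k : ℕ → ZMod 2) : ZMod 2 :=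
  ∑ j ∈ J.erase x, (q * lo j x + ∑ i ∈ I, (lo i j + lo x j) * k i) * k j

/-- The composition of `φ : M ^ ⊗ J → M` with a morphism `ψ : M ^ ⊗ I → M` of degree `q`
inserted in position `x`. -/
def compEnd (J : Finset ℕ) (x : ℕ) (I : Finset ℕ) (q : ℤ) (φ ψ : M.PreEnd) : M.PreEnd :=
  fun m N r => sg (compExp J x I q fun i => (m i).deg) •
    φ (Function.update m x ⟨I.biUnion fun i => (m i).ar, q + ∑ i ∈ I, (m i).deg, ψ m _ _⟩) N r

end RightMod

end

section

variable {K : Type u} [Field K]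

theorem z2 (a : ZMod 2) : a + a = 0 := by revert a; decide

namespace RightMod
variable {Q : DGOperad.{u, w} K} {M : RightMod Q}

theorem deg_upd (m : ℕ → M.Elt) (j : ℕ) (e : M.Elt) (i : ℕ) :
    (Function.update m j e i).deg = if i = j then e.deg else (m i).deg := by
  by_cases h : i = j
  · subst h; simp
  · simp [h]

theorem ar_upd (m : ℕ → M.Elt) (j : ℕ) (e : M.Elt) (i : ℕ) :
    (Function.update m j e i).ar = if i = j then e.ar else (m i).ar := by
  by_cases h : i = j
  · subst h; simp
  · simp [h]

theorem sum_deg_upd {J : Finset ℕ} (m : ℕ → M.Elt) {j : ℕ} (hj : j ∈ J) (e : M.Elt) :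
    ∑ i ∈ J, (Function.update m j e i).deg = e.deg - (m j).deg + ∑ i ∈ J, (m i).deg := by
  rw [← Finset.add_sum_erase _ _ hj, ← Finset.add_sum_erase J (fun i => (m i).deg) hj]
  rw [Finset.sum_congr rfl (g := fun i => (m i).deg)]
  · simp; ring
  · intro i hi
    rw [Function.update_of_ne (Finset.ne_of_mem_erase hi)]

/-- The exponent for the differential and the action. -/
theorem sum_lo_upd {J : Finset ℕ} (m : ℕ → M.Elt) {j : ℕ} (hj : j ∈ J) (e : M.Elt) (c : ℕ) :
    ∑ i ∈ J, lo i c * ((Function.update m j e i).deg : ZMod 2) =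
      lo j c * (e.deg - (m j).deg) + ∑ i ∈ J, lo i c * ((m i).deg : ZMod 2) := by
  rw [← Finset.add_sum_erase _ _ hj,
    ← Finset.add_sum_erase J (fun i => lo i c * ((m i).deg : ZMod 2)) hj]
  rw [Finset.sum_congr rfl (g := fun i => lo i c * ((m i).deg : ZMod 2))]
  · simp; ring
  · intro i hi
    rw [Function.update_of_ne (Finset.ne_of_mem_erase hi)]

theorem sum_lo_upd' {J : Finset ℕ} (m : ℕ → M.Elt) {j : ℕ} (hj : j ∈ J) (e : M.Elt) (c : ℕ) :
    ∑ i ∈ J, lo c i * ((Function.update m j e i).deg : ZMod 2) =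
      lo c j * (e.deg - (m j).deg) + ∑ i ∈ J, lo c i * ((m i).deg : ZMod 2) := by
  rw [← Finset.add_sum_erase _ _ hj,
    ← Finset.add_sum_erase J (fun i => lo c i * ((m i).deg : ZMod 2)) hj]
  rw [Finset.sum_congr rfl (g := fun i => lo c i * ((m i).deg : ZMod 2))]
  · simp; ring
  · intro i hi
    rw [Function.update_of_ne (Finset.ne_of_mem_erase hi)]

theorem part_upd {J : Finset ℕ} (m : ℕ → M.Elt) (j : ℕ) (e : M.Elt) (h : e.ar = (m j).ar) (N) :
    Part (fun i : J => (Function.update m j e i).ar) N ↔ Part (fun i : J => (m i).ar) N := by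
  have : (fun i : J => (Function.update m j e i).ar) = fun i : J => (m i).ar := by
    funext i
    rw [ar_upd]; split_ifs with h'
    · rw [h, h']
    · rfl
  rw [this]

theorem elt_d_rel (e : M.Elt) (f : ℕ → ℕ) {B : Finset ℕ} (h : Set.BijOn f e.ar B) :
    (e.rel f h).d = (e.d).rel f (B := B) h := by
  simp only [Elt.rel, Elt.d, Elt.mk.injEq, heq_eq_eq, true_and]
  have := (M.rel f h).comm e.deg (e.deg + 1)
  exact congrArg (fun t => (ModuleCat.Hom.hom t) e.val) this

theorem rel_d {A B : Finset ℕ} (f : ℕ → ℕ) (h : Set.BijOn f (A : Set ℕ) B) (i j : ℤ)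
    (x : (M.X A).X i) :
    (M.rel f h).f j ((M.X A).d i j x) = (M.X B).d i j ((M.rel f h).f i x) := by
  have := (M.rel f h).comm i j
  exact (congrArg (fun t => (ModuleCat.Hom.hom t) x) this).symm

theorem IsEnd.dEnd {J : Finset ℕ} {d d' : ℤ} (hd : d + 1 = d') {φ : M.PreEnd} (hφ : IsEnd J d φ) :
    IsEnd J d' (dEnd J d φ) := by
  subst hd
  constructor
  · intro m N r h
    by_contra h'
    apply h
    simp only [RightMod.dEnd, LinearMap.coe_mk, AddHom.coe_mk]
    rw [hφ.eq_zero (by intro h; apply h'; exact ⟨h.1, by omega⟩), map_zero, Finset.sum_eq_zero,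
      smul_zero, sub_zero]
    intro j hj
    rw [hφ.eq_zero, smul_zero]
    rintro ⟨h1, h2⟩
    apply h'
    rw [part_upd _ _ _ (by rfl)] at h1
    rw [sum_deg_upd _ hj] at h2
    refine ⟨h1, ?_⟩
    simp only [Elt.d] at h2
    omega
  · intro m m' h
    funext N r
    simp only [RightMod.dEnd, LinearMap.coe_mk, AddHom.coe_mk]
    rw [hφ.loc m m' h]
    congr 2
    apply Finset.sum_congr rfl
    intro j hj
    rw [h j hj, hφ.loc (Function.update m j (m' j).d) (Function.update m' j (m' j).d)]
    · congr 2
      apply Finset.sum_congr rfl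
      intro i hi
      rw [h i hi]
    · intro i hi
      by_cases e : i = j
      · subst e; simp
      · simp [e, h i hi]
  · intro m j hj A k N r
    have : (fun u : (M.X A).X k => RightMod.dEnd J d φ (Function.update m j ⟨A, k, u⟩) N r) =
      (((M.X N).d (r - 1) r).hom ∘ₗ (hφ.lin m j hj A k N (r - 1)).mk' -
        sg d • (sg (∑ i ∈ J, lo i j * (m i).deg) • (hφ.lin m j hj A (k + 1) N r).mk' ∘ₗ
            ((M.X A).d k (k + 1)).hom +
          ∑ i ∈ (J.erase j).attach,
            sg (lo j i * (k - (m j).deg) + ∑ c ∈ J, lo c i * (m c).deg) •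
            (hφ.lin (Function.update m i (m i).d) j hj A k N r).mk') :
          (M.X A).X k →ₗ[K] (M.X N).X r) := by
      funext u
      simp only [RightMod.dEnd, LinearMap.coe_mk, AddHom.coe_mk, LinearMap.sub_apply,
        LinearMap.smul_apply, LinearMap.add_apply, LinearMap.comp_apply, IsLinearMap.mk'_apply,
        LinearMap.sum_apply]
      congr 2
      rw [← Finset.add_sum_erase _ _ hj, sum_lo_upd _ hj]
      congr 1
      · rw [Function.update_idem, Function.update_self, lo_self, zero_mul, zero_add]; rfl
      · rw [← Finset.sum_attach]
        apply Finset.sum_congr rfl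
        rintro ⟨i, hi⟩ -
        rw [sum_lo_upd _ hj]
        have hij : i ≠ j := Finset.ne_of_mem_erase hi
        simp only
        rw [Function.update_of_ne hij, Function.update_comm hij.symm]
    rw [this]
    exact LinearMap.isLinear _
  · intro m m' N N' f hf hP h r
    simp only [RightMod.dEnd, LinearMap.coe_mk, AddHom.coe_mk]
    rw [hφ.rel m m' N N' f hf hP h, map_sub, rel_d, map_zsmul, map_sum]
    congr 2
    apply Finset.sum_congr rfl
    intro j hj
    rw [map_zsmul]
    congr 1
    · congr 1
      apply Finset.sum_congr rfl
      intro i hi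
      obtain ⟨B, hB, e⟩ := h i hi
      rw [e]; rfl
    · apply hφ.rel _ _ _ _ f hf
      · rw [part_upd]; exact hP; rfl
      · intro i hi
        by_cases e : i = j
        · subst e
          obtain ⟨B, hB, e⟩ := h i hi
          simp only [Function.update_self]
          exact ⟨B, hB, by rw [e, elt_d_rel]⟩
        · simp only [Function.update_of_ne e]
          exact h i hi
  · intro m j hj e x B C N N' h h' hP l n r r' hn hr q
    simp only [RightMod.dEnd, LinearMap.coe_mk, AddHom.coe_mk]
    rw [hφ.act m j hj e h h' hP hn (show r - 1 + l = r' - 1 by omega), map_zsmul,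
      M.d_act h' _ (show r - 1 + 1 = r by omega) rfl (show r' - 1 + 1 = r' by omega)]
    have hS : ∀ e' : M.Elt, ∀ N r, (∑ i ∈ J, sg (∑ c ∈ J, lo c i * ((Function.update m j e' c).deg)) •
        φ (Function.update (Function.update m j e') i (Function.update m j e' i).d) N r) = _ :=
      fun e' N r => (Finset.add_sum_erase J _ hj).symm
    rw [hS, hS]
    simp only [Function.update_self, Function.update_idem, sum_lo_upd m hj, lo_self, zero_mul,
      zero_add]
    set σ : ZMod 2 := ∑ i ∈ J, lo i j * ((m i).deg : ZMod 2) with hσ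
    set τ : ZMod 2 := ∑ i ∈ J, lo j i * ((m i).deg : ZMod 2) with hτ
    have hστ : ∑ i ∈ J, ((Function.update m j e i).deg : ZMod 2) = σ + τ + e.deg := by
      rw [hσ, hτ, ← Finset.sum_add_distrib, ← Finset.add_sum_erase _ _ hj,
        ← Finset.add_sum_erase J (fun i => lo i j * ((m i).deg : ZMod 2) + _) hj]
      simp only [lo_self, zero_mul, zero_add, Function.update_self]
      rw [add_comm]
      congr 1
      apply Finset.sum_congr rfl
      intro i hi
      rw [Function.update_of_ne (Finset.ne_of_mem_erase hi), lo_swap (Finset.ne_of_mem_erase hi)]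
      have := z2 (lo i j)
      linear_combination (-(m i).deg : ZMod 2) * this
    -- the term of the differential at `j`
    have e1 : (e.act h hn q).d = ⟨C, n + 1,
        M.act h (show e.deg + 1 + l = n + 1 by omega)
          ((M.X e.ar).d e.deg (e.deg + 1) e.val) q +
        sg e.deg • M.act h (show e.deg + (l + 1) = n + 1 by omega) e.val
          ((Q.X B).d l (l + 1) q)⟩ := by
      simp only [Elt.d, Elt.act, Elt.mk.injEq, heq_eq_eq, true_and]
      exact M.d_act h _ rfl rfl rfl _ _
    have hd1 : φ (Function.update m j (e.act h hn q).d) N' r' =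
        sg (l * τ) • M.act h' hr (φ (Function.update m j e.d) N r) q +
        sg (e.deg + (l + 1) * τ) • M.act h' (show r - 1 + (l + 1) = r' by omega)
          (φ (Function.update m j e) N (r - 1)) ((Q.X B).d l (l + 1) q) := by
      rw [e1]
      erw [(hφ.lin m j hj C (n + 1) N' r').map_add]
      rw [hφ.zsmul' m hj, ← sg_smul]
      congr 2
      · refine hφ.act m j hj e.d h h' ?_ (show e.deg + 1 + l = n + 1 by omega) hr q
        rw [← Function.update_idem (f := m) (a := j) (v := e)]
        rw [part_upd]; exact hP; rw [Function.update_self]; rfl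
      · have := hφ.act m j hj e h h' hP (n := n + 1) (by omega)
          (show r - 1 + (l + 1) = r' by omega) ((Q.X B).d l (l + 1) q)
        push_cast at this
        exact this
    have hd2 : ∀ i ∈ J.erase j,
        sg (lo j i * ((e.act h hn q).deg - (m j).deg) + ∑ c ∈ J, lo c i * (m c).deg) •
        φ (Function.update (Function.update m j (e.act h hn q)) i
          (Function.update m j (e.act h hn q) i).d) N' r' =
        sg (l * τ) • sg (lo j i * (e.deg - (m j).deg) + ∑ c ∈ J, lo c i * (m c).deg) •
          M.act h' hr (φ (Function.update (Function.update m j e) i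
            (Function.update m j e i).d) N r) q := by
      intro i hi
      have hij : i ≠ j := Finset.ne_of_mem_erase hi
      rw [Function.update_of_ne hij, Function.update_comm hij.symm, Function.update_of_ne hij,
        Function.update_comm hij.symm,
        hφ.act (Function.update m i (m i).d) j hj e h h' _ hn hr q,
        sum_lo_upd' m (Finset.mem_of_mem_erase hi), sg_smul, sg_smul]
      · congr 2
        have e5 : (((e.act h hn q).deg : ℤ) : ZMod 2) = e.deg + l := by
          simp only [Elt.act]; rw [← hn]; push_cast; rfl
        have e6 : (((m i).d.deg : ℤ) : ZMod 2) = (m i).deg + 1 := by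
          simp only [Elt.d]; push_cast; rfl
        rw [e5, e6]
        have := z2 (lo j i * l)
        linear_combination this
      · rw [Function.update_comm hij, part_upd]
        · exact hP
        · rw [Function.update_of_ne hij]; rfl
    rw [hd1, Finset.sum_congr rfl hd2]
    set φ' := φ (Function.update m j e) N (r - 1) with hφ'
    have hpar : sg (r - 1 : ℤ) • M.act h' (show r - 1 + (l + 1) = r' by omega)
          φ' ((Q.X B).d l (l + 1) q) =
        sg (d + σ + τ + e.deg) • M.act h' (show r - 1 + (l + 1) = r' by omega)
          φ' ((Q.X B).d l (l + 1) q) := by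
      by_cases h0 : φ' = 0
      · simp [h0]
      · congr 2
        rw [← (hφ.supp _ _ _ h0).2]
        push_cast
        rw [hστ]
        ring
    rw [hpar]
    simp only [map_sub, map_add, map_sum, map_zsmul, LinearMap.sub_apply, LinearMap.add_apply,
      LinearMap.smul_apply, LinearMap.sum_apply, smul_add, smul_sub, sg_smul, Finset.smul_sum]
    have q1 : (d + (σ + (e.deg + (l + 1) * τ)) : ZMod 2) =
      l * τ + (d + σ + τ + e.deg) := by ring
    have q2 : (d + (σ + l * τ) : ZMod 2) = l * τ + (d + σ) := by ring
    have q3 : ∀ s : ZMod 2, d + (l * τ + s) = l * τ + (d + s) := fun s => by ring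
    simp only [q1, q2, q3]
    clear_value τ σ
    abel

end RightMod

end

section

variable {K : Type u} [Field K]

theorem sum_antisymm {V : Type*} [AddCommGroup V] (J : Finset ℕ) (G : ℕ → ℕ → V)
    (h : ∀ i ∈ J, G i i = 0) (h' : ∀ i ∈ J, ∀ j ∈ J, i ≠ j → G i j + G j i = 0) :
    ∑ i ∈ J, ∑ j ∈ J, G i j = 0 := by
  rw [← Finset.sum_product']
  apply Finset.sum_involution (fun p _ => (p.2, p.1))
  · rintro ⟨i, j⟩ hp
    simp only [Finset.mem_product] at hp
    by_cases e : i = j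
    · subst e; simp [h i hp.1]
    · exact h' i hp.1 j hp.2 e
  · rintro ⟨i, j⟩ hp h0 e
    simp only [Finset.mem_product, Prod.mk.injEq] at hp e
    apply h0
    obtain ⟨rfl, -⟩ := e
    exact h _ hp.1
  · rintro ⟨i, j⟩ hp
    simpa [and_comm] using hp
  · rintro ⟨i, j⟩ hp
    rfl

namespace RightMod
variable {Q : DGOperad.{u, w} K} {M : RightMod Q}

theorem degs_upd (m : ℕ → M.Elt) (j : ℕ) (e : M.Elt) :
    (fun i => ((Function.update m j e i).deg : ZMod 2)) =
      Function.update (fun i => ((m i).deg : ZMod 2)) j e.deg := by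
  funext i
  by_cases h : i = j
  · subst h; simp
  · simp [h]

theorem elt_dd (e : M.Elt) : e.d.d = ⟨e.ar, e.deg + 1 + 1, 0⟩ := by
  simp only [Elt.d, Elt.mk.injEq, heq_eq_eq, true_and]
  exact congrArg (fun t => (ModuleCat.Hom.hom t) e.val)
    ((M.X e.ar).d_comp_d e.deg (e.deg + 1) (e.deg + 1 + 1))

theorem dEnd_dEnd {J : Finset ℕ} {d d' : ℤ} (hd : d + 1 = d') {φ : M.PreEnd} (hφ : IsEnd J d φ) :
    RightMod.dEnd J d' (RightMod.dEnd J d φ) = 0 := by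
  subst hd
  funext m N r
  simp only [RightMod.dEnd, LinearMap.coe_mk, AddHom.coe_mk, Pi.zero_apply, map_sub, map_zsmul,
    map_sum, smul_sub, Finset.sum_sub_distrib]
  have h1 : (M.X N).d (r - 1) r ((M.X N).d (r - 1 - 1) (r - 1) (φ m N (r - 1 - 1))) = 0 :=
    congrArg (fun t => (ModuleCat.Hom.hom t) (φ m N (r - 1 - 1)))
      ((M.X N).d_comp_d (r - 1 - 1) (r - 1) r)
  rw [h1]
  have h2 : ∑ j ∈ J, sg (∑ i ∈ J, lo i j * (m i).deg) • sg d • ∑ j' ∈ J,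
      sg (∑ i ∈ J, lo i j' * ((Function.update m j (m j).d) i).deg) •
      φ (Function.update (Function.update m j (m j).d) j' (Function.update m j (m j).d j').d) N r
      = 0 := by
    simp only [Finset.smul_sum, sg_smul]
    apply sum_antisymm
    · intro j hj
      rw [Function.update_self, Function.update_idem, elt_dd, hφ.zero' m hj, smul_zero]
    · intro i hi j hj hij
      rw [Function.update_of_ne hij.symm, Function.update_of_ne hij, Function.update_comm hij,
        sum_lo_upd _ hi, sum_lo_upd _ hj]
      have e : ∀ k, (((m k).d.deg : ℤ) : ZMod 2) - (m k).deg = 1 := by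
        intro k; simp [Elt.d]
      rw [e, e, lo_swap hij, ← neg_eq_iff_add_eq_zero, ← sg_add_one]
      congr 2
      ring
  rw [h2]
  push_cast
  rw [sg_add_one]
  simp

theorem relExp_update {J : Finset ℕ} {f : ℕ → ℕ} (hf : Set.InjOn f J) (k : ℕ → ZMod 2) {j : ℕ}
    (hj : j ∈ J) (c : ZMod 2) :
    relExp J f (Function.update k j c) =
      relExp J f k + (c - k j) * ∑ i ∈ J, (lo i j + lo (f i) (f j)) * k i := by
  have key : ∀ k' : ℕ → ZMod 2, relExp J f k' =
      k' j * ∑ i ∈ J.erase j, (lo i j + lo (f i) (f j)) * k' i +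
      ∑ i ∈ J.erase j, ∑ i' ∈ J.erase j, lo i i' * lo (f i') (f i) * k' i * k' i' := by
    intro k'
    unfold relExp
    rw [← Finset.add_sum_erase _ _ hj, ← Finset.add_sum_erase _ _ hj]
    simp only [lo_self, zero_mul, zero_add]
    have : ∀ i ∈ J.erase j, ∑ i' ∈ J, lo i i' * lo (f i') (f i) * k' i * k' i' =
        lo i j * lo (f j) (f i) * k' i * k' j +
        ∑ i' ∈ J.erase j, lo i i' * lo (f i') (f i) * k' i * k' i' := fun i _ =>
      (Finset.add_sum_erase _ _ hj).symm
    rw [Finset.sum_congr rfl this, Finset.sum_add_distrib, ← add_assoc, Finset.mul_sum,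
      ← Finset.sum_add_distrib]
    congr 1
    apply Finset.sum_congr rfl
    intro i hi
    have hij := Finset.ne_of_mem_erase hi
    have hfij : f i ≠ f j := fun e => hij (hf (Finset.mem_of_mem_erase hi) hj e)
    rw [lo_swap hij, lo_swap hfij]
    have := z2 (lo i j * lo (f i) (f j))
    linear_combination (k' j * k' i) * this
  rw [key, key k, ← Finset.add_sum_erase J _ hj]
  simp only [lo_self, Function.update_self, add_zero, zero_mul, zero_add]
  have h1 : ∀ i ∈ J.erase j, Function.update k j c i = k i := fun i hi =>
    Function.update_of_ne (Finset.ne_of_mem_erase hi) _ _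
  rw [Finset.sum_congr rfl (fun i hi => by rw [h1 i hi]),
    Finset.sum_congr (s₂ := J.erase j) rfl
      (fun i hi => Finset.sum_congr rfl fun i' hi' => by rw [h1 i hi, h1 i' hi'])]
  ring

theorem update_comp_of {J J' : Finset ℕ} {f : ℕ → ℕ} (hf : Set.BijOn f J J') (m : ℕ → M.Elt)
    {j : ℕ} (hj : j ∈ J) (e : M.Elt) :
    ∀ i ∈ J, (Function.update m (f j) e ∘ f) i = Function.update (m ∘ f) j e i := by
  intro i hi
  by_cases h : i = j
  · subst h; simp
  · have : f i ≠ f j := fun e => h (hf.injOn hi hj e)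
    simp [h, this]

theorem relExp_congr {J : Finset ℕ} (f : ℕ → ℕ) {k k' : ℕ → ZMod 2} (h : ∀ i ∈ J, k i = k' i) :
    relExp J f k = relExp J f k' := by
  unfold relExp
  apply Finset.sum_congr rfl; intro i hi
  apply Finset.sum_congr rfl; intro j hj
  rw [h i hi, h j hj]

theorem degs_comp {J J' : Finset ℕ} {f : ℕ → ℕ} (hf : Set.BijOn f J J') (m : ℕ → M.Elt)
    {j : ℕ} (hj : j ∈ J) (e : M.Elt) : ∀ i ∈ J, ((Function.update m (f j) e (f i)).deg : ZMod 2) =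
      Function.update (fun i => ((m (f i)).deg : ZMod 2)) j e.deg i := by
  intro i hi
  have := update_comp_of hf m hj e i hi
  simp only [Function.comp] at this
  rw [this]
  exact congrFun (degs_upd (m ∘ f) j e) i

theorem part_comp {J J' : Finset ℕ} {f : ℕ → ℕ} (hf : Set.BijOn f J J') (A : ℕ → Finset ℕ) (N) :
    Part (fun j : J => A (f j)) N ↔ Part (fun j : J' => A j) N := by
  rw [part_iff (A := fun j => A (f j)), part_iff]
  constructor
  · rintro ⟨h1, h2⟩
    refine ⟨fun i hi j hj hij => ?_, fun n => ?_⟩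
    · obtain ⟨i, hi1, rfl⟩ := hf.surjOn hi
      obtain ⟨j, hj1, rfl⟩ := hf.surjOn hj
      exact h1 i hi1 j hj1 (fun e => hij (by rw [e]))
    · rw [h2]
      constructor
      · rintro ⟨j, hj, h⟩; exact ⟨f j, hf.mapsTo hj, h⟩
      · rintro ⟨j, hj, h⟩
        obtain ⟨j, hj', rfl⟩ := hf.surjOn hj
        exact ⟨j, hj', h⟩
  · rintro ⟨h1, h2⟩
    refine ⟨fun i hi j hj hij => h1 _ (hf.mapsTo hi) _ (hf.mapsTo hj)
      fun e => hij (hf.injOn hi hj e), fun n => ?_⟩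
    rw [h2]
    constructor
    · rintro ⟨j, hj, h⟩
      obtain ⟨j, hj', rfl⟩ := hf.surjOn hj
      exact ⟨j, hj', h⟩
    · rintro ⟨j, hj, h⟩; exact ⟨f j, hf.mapsTo hj, h⟩

theorem sum_bijOn {V : Type*} [AddCommMonoid V] {J J' : Finset ℕ} {f : ℕ → ℕ}
    (hf : Set.BijOn f J J') (g : ℕ → V) : ∑ j ∈ J', g j = ∑ i ∈ J, g (f i) := by
  symm
  apply Finset.sum_bij (fun i _ => f i) (fun i hi => hf.mapsTo hi)
    (fun i hi j hj e => hf.injOn hi hj e) (fun j hj => ?_) (fun _ _ => rfl)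
  obtain ⟨i, hi, e⟩ := hf.surjOn hj
  exact ⟨i, hi, e⟩

theorem IsEnd.relEnd {J J' : Finset ℕ} {f : ℕ → ℕ} (hf : Set.BijOn f J J') {d : ℤ} {φ : M.PreEnd}
    (hφ : IsEnd J d φ) : IsEnd J' d (relEnd J f φ) := by
  constructor
  · intro m N r h
    have : φ (m ∘ f) N r ≠ 0 := by
      intro h0; apply h; simp [RightMod.relEnd, h0]
    obtain ⟨h1, h2⟩ := hφ.supp _ _ _ this
    refine ⟨(part_comp hf fun j => (m j).ar) N |>.1 h1, ?_⟩
    rw [sum_bijOn hf]; exact h2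
  · intro m m' h
    funext N r
    simp only [RightMod.relEnd, LinearMap.coe_mk, AddHom.coe_mk]
    have : ∀ j ∈ J, m (f j) = m' (f j) := fun j hj => h _ (hf.mapsTo hj)
    rw [hφ.loc (m ∘ f) (m' ∘ f) this]
    congr 2
    exact relExp_congr f fun i hi => by rw [this i hi]
  · intro m j' hj' A k N r
    obtain ⟨j, hj, rfl⟩ := hf.surjOn hj'
    have : (fun u : (M.X A).X k => RightMod.relEnd J f φ (Function.update m (f j) ⟨A, k, u⟩) N r) =
      (sg (relExp J f (Function.update (fun i => ((m (f i)).deg : ZMod 2)) j k)) •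
        (hφ.lin (m ∘ f) j hj A k N r).mk' : (M.X A).X k →ₗ[K] (M.X N).X r) := by
      funext u
      simp only [RightMod.relEnd, LinearMap.coe_mk, AddHom.coe_mk, LinearMap.smul_apply,
        IsLinearMap.mk'_apply]
      rw [hφ.loc _ _ (update_comp_of hf m hj _)]
      congr 2
      exact relExp_congr f (degs_comp hf m hj _)
    rw [this]
    exact LinearMap.isLinear _
  · intro m m' N N' g hg hP h r
    simp only [RightMod.relEnd, LinearMap.coe_mk, AddHom.coe_mk]
    rw [hφ.rel (m ∘ f) (m' ∘ f) N N' g hg ((part_comp hf fun j => (m j).ar) N |>.2 hP)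
      (fun j hj => h _ (hf.mapsTo hj)), map_zsmul]
    congr 2
    refine relExp_congr f fun i hi => ?_
    obtain ⟨B, hB, e⟩ := h _ (hf.mapsTo hi)
    rw [e]; rfl
  · intro m j' hj' e x B C N N' h h' hP l n r r' hn hr q
    obtain ⟨j, hj, rfl⟩ := hf.surjOn hj'
    simp only [RightMod.relEnd, LinearMap.coe_mk, AddHom.coe_mk]
    have hP' : Part (fun i : J => (Function.update (m ∘ f) j e i).ar) N := by
      have := (part_comp hf fun j' => (Function.update m (f j) e j').ar) N |>.2 hP
      convert this using 2 with i
      rw [← update_comp_of hf m hj e i i.2]; rfl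
    rw [hφ.loc _ _ (update_comp_of hf m hj _), hφ.loc _ _ (update_comp_of hf m hj e),
      hφ.act (m ∘ f) j hj e h h' hP' hn hr q]
    rw [sg_smul, map_zsmul, LinearMap.smul_apply, sg_smul]
    congr 2
    have ex : ∀ e' : M.Elt, relExp J f (fun i => ((Function.update m (f j) e' (f i)).deg : ZMod 2))
        = relExp J f (fun i => ((m (f i)).deg : ZMod 2)) + (e'.deg - (m (f j)).deg) *
          ∑ i ∈ J, (lo i j + lo (f i) (f j)) * (m (f i)).deg := by
      intro e'
      rw [← relExp_update hf.injOn (fun i => ((m (f i)).deg : ZMod 2)) hj]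
      exact relExp_congr f (degs_comp hf m hj _)
    rw [ex, ex, sum_bijOn hf]
    have e5 : (((e.act h hn q).deg : ℤ) : ZMod 2) = e.deg + l := by
      simp only [Elt.act]; rw [← hn]; push_cast; rfl
    rw [e5]
    have : ∑ i ∈ J, (lo i j + lo (f i) (f j)) * ((m (f i)).deg : ZMod 2) =
        ∑ i ∈ J, lo j i * ((m (f i)).deg : ZMod 2) +
        ∑ i ∈ J, lo (f j) (f i) * ((m (f i)).deg : ZMod 2) := by
      rw [← Finset.sum_add_distrib]
      apply Finset.sum_congr rfl; intro i hi
      by_cases hij : i = j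
      · subst hij; simp [lo_self]
      · have hfij : f i ≠ f j := fun e => hij (hf.injOn hi hj e)
        rw [lo_swap hij, lo_swap hfij]
        have := z2 ((m (f i)).deg : ZMod 2)
        linear_combination -this
    rw [this]
    simp only [Function.comp]
    have := z2 (l * ∑ i ∈ J, lo j i * ((m (f i)).deg : ZMod 2))
    linear_combination this

end RightMod

end

section

variable {K : Type u} [Field K]

theorem part_ins {J : Finset ℕ} {x : ℕ} {I C : Finset ℕ} (h : Ins J x I C) {A A' : ℕ → Finset ℕ}
    (hA : ∀ j ∈ J.erase x, A' j = A j)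
    {N : Finset ℕ} (h1 : Part (fun i : I => A i) (A' x)) (h2 : Part (fun j : J => A' j) N) :
    Part (fun c : C => A c) N := by
  rw [part_iff] at h1 h2 ⊢
  obtain ⟨hx, hd, rfl⟩ := h
  rw [Finset.disjoint_left] at hd
  simp only [Finset.mem_union, Finset.mem_erase, Finset.disjoint_left] at *
  obtain ⟨h1, h1'⟩ := h1
  obtain ⟨h2, h2'⟩ := h2
  constructor
  · rintro i (hi | hi) j (hj | hj) hij n hni hnj
    · exact h2 i hi.2 j hj.2 hij (by rwa [hA i hi]) (by rwa [hA j hj])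
    · exact h2 i hi.2 x hx hi.1 (by rwa [hA i hi]) ((h1' n).2 ⟨j, hj, hnj⟩)
    · exact h2 j hj.2 x hx hj.1 (by rwa [hA j hj]) ((h1' n).2 ⟨i, hi, hni⟩)
    · exact h1 i hi j hj hij hni hnj
  · intro n
    rw [h2']
    constructor
    · rintro ⟨j, hj, hn⟩
      by_cases e : j = x
      · subst e
        obtain ⟨i, hi, hn⟩ := (h1' n).1 hn
        exact ⟨i, Or.inr hi, hn⟩
      · exact ⟨j, Or.inl ⟨e, hj⟩, by rwa [← hA j ⟨e, hj⟩]⟩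
    · rintro ⟨j, hj | hj, hn⟩
      · exact ⟨j, hj.2, by rwa [hA j hj]⟩
      · exact ⟨x, hx, (h1' n).2 ⟨j, hj, hn⟩⟩

theorem part_ins_left {J : Finset ℕ} {x : ℕ} {I C : Finset ℕ} (h : Ins J x I C)
    {A : ℕ → Finset ℕ} {N : Finset ℕ} (h1 : Part (fun c : C => A c) N) :
    Part (fun i : I => A i) (I.biUnion A) := by
  rw [part_iff] at h1 ⊢
  obtain ⟨hx, hd, rfl⟩ := h
  exact ⟨fun i hi j hj => h1.1 i (by simp [hi]) j (by simp [hj]), by simp⟩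

theorem part_ins_right {J : Finset ℕ} {x : ℕ} {I C : Finset ℕ} (h : Ins J x I C)
    {A A' : ℕ → Finset ℕ} (hA : ∀ j ∈ J.erase x, A' j = A j) (hx : A' x = I.biUnion A)
    {N : Finset ℕ} (h1 : Part (fun c : C => A c) N) : Part (fun j : J => A' j) N := by
  rw [part_iff] at h1 ⊢
  obtain ⟨hx', hd, rfl⟩ := h
  rw [Finset.disjoint_left] at hd
  simp only [Finset.mem_union, Finset.mem_erase, Finset.disjoint_left] at *
  obtain ⟨h1, h1'⟩ := h1
  constructor
  · intro i hi j hj hij n hni hnj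
    by_cases ei : i = x
    · subst ei
      have ej : j ≠ i := fun e => hij e.symm
      rw [hx, Finset.mem_biUnion] at hni
      rw [hA j ⟨ej, hj⟩] at hnj
      obtain ⟨i', hi', hn⟩ := hni
      exact h1 i' (Or.inr hi') j (Or.inl ⟨ej, hj⟩)
        (fun e => hd ⟨ej, hj⟩ (by rwa [← e])) hn hnj
    · rw [hA i ⟨ei, hi⟩] at hni
      by_cases ej : j = x
      · subst ej
        rw [hx, Finset.mem_biUnion] at hnj
        obtain ⟨i', hi', hn⟩ := hnj
        exact h1 i' (Or.inr hi') i (Or.inl ⟨ei, hi⟩)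
          (fun e => hd ⟨ei, hi⟩ (by rwa [← e])) hn hni
      · rw [hA j ⟨ej, hj⟩] at hnj
        exact h1 i (Or.inl ⟨ei, hi⟩) j (Or.inl ⟨ej, hj⟩) hij hni hnj
  · intro n
    rw [h1']
    constructor
    · rintro ⟨j, hj | hj, hn⟩
      · exact ⟨j, hj.2, by rwa [hA j hj]⟩
      · exact ⟨x, hx', by rw [hx, Finset.mem_biUnion]; exact ⟨j, hj, hn⟩⟩
    · rintro ⟨j, hj, hn⟩
      by_cases e : j = x
      · subst e
        rw [hx, Finset.mem_biUnion] at hn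
        obtain ⟨i, hi, hn⟩ := hn
        exact ⟨i, Or.inr hi, hn⟩
      · exact ⟨j, Or.inl ⟨e, hj⟩, by rwa [← hA j ⟨e, hj⟩]⟩

theorem Ins.sum {V : Type*} [AddCommMonoid V] {J : Finset ℕ} {x : ℕ} {I C : Finset ℕ}
    (h : Ins J x I C) (g : ℕ → V) : ∑ c ∈ C, g c = ∑ j ∈ J.erase x, g j + ∑ i ∈ I, g i := by
  rw [h.eq, Finset.sum_union h.disj]

theorem Ins.notMem_right {J : Finset ℕ} {x : ℕ} {I C : Finset ℕ} (h : Ins J x I C) {j : ℕ}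
    (hj : j ∈ J.erase x) : j ∉ I := fun hi => Finset.disjoint_left.1 h.disj hj hi

theorem Ins.notMem_left {J : Finset ℕ} {x : ℕ} {I C : Finset ℕ} (h : Ins J x I C) {i : ℕ}
    (hi : i ∈ I) : i ∉ J.erase x := fun hj => Finset.disjoint_left.1 h.disj hj hi

theorem Ins.mem_iff {J : Finset ℕ} {x : ℕ} {I C : Finset ℕ} (h : Ins J x I C) {c : ℕ} :
    c ∈ C ↔ c ∈ J.erase x ∨ c ∈ I := by rw [h.eq, Finset.mem_union]

namespace RightMod
variable {Q : DGOperad.{u, w} K} {M : RightMod Q}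

theorem relEnd_id (J : Finset ℕ) (φ : M.PreEnd) : relEnd J id φ = φ := by
  funext m N r
  have : relExp J id (fun i => ((m i).deg : ZMod 2)) = 0 := by
    unfold relExp
    refine Finset.sum_eq_zero fun i _ => Finset.sum_eq_zero fun j _ => ?_
    have : lo i j * lo j i = 0 := by unfold lo; split_ifs <;> first | omega | simp
    simp [this]
  simp only [relEnd, LinearMap.coe_mk, AddHom.coe_mk, id]
  rw [this, sg_zero, one_smul]; rfl

theorem relEnd_congr {J : Finset ℕ} {f g : ℕ → ℕ} (h : Set.EqOn f g J) {d : ℤ} {φ : M.PreEnd}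
    (hφ : IsEnd J d φ) : relEnd J f φ = relEnd J g φ := by
  funext m N r
  simp only [relEnd, LinearMap.coe_mk, AddHom.coe_mk]
  rw [hφ.loc (m ∘ f) (m ∘ g) fun j hj => by simp [h hj]]
  congr 2
  unfold relExp
  apply Finset.sum_congr rfl; intro i hi
  apply Finset.sum_congr rfl; intro j hj
  simp only [h hi, h hj]

theorem relExp_comp {J J' : Finset ℕ} {f g : ℕ → ℕ} (hf : Set.BijOn f J J')
    (hg : Set.InjOn g J') (k : ℕ → ZMod 2) :
    relExp J (g ∘ f) (k ∘ f) = relExp J' g k + relExp J f (k ∘ f) := by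
  rw [← sub_eq_zero]
  unfold relExp
  rw [sum_bijOn hf, ← Finset.sum_add_distrib, ← Finset.sum_sub_distrib]
  rw [Finset.sum_congr rfl fun i hi => by
    rw [sum_bijOn hf, ← Finset.sum_add_distrib, ← Finset.sum_sub_distrib]]
  apply sum_antisymm
  · intro i hi; simp [lo_self]
  · intro i hi j hj hij
    have h1 : f i ≠ f j := fun e => hij (hf.injOn hi hj e)
    have h2 : g (f i) ≠ g (f j) := fun e => h1 (hg (hf.mapsTo hi) (hf.mapsTo hj) e)
    simp only [Function.comp]
    rw [lo_swap hij, lo_swap h1, lo_swap h2]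
    generalize lo i j = a
    generalize lo (f i) (f j) = b
    generalize lo (g (f i)) (g (f j)) = c
    generalize k (f i) = p
    generalize k (f j) = q
    revert a b c p q
    decide

theorem relEnd_comp {J J' : Finset ℕ} {f g : ℕ → ℕ} (hf : Set.BijOn f J J')
    (hg : Set.InjOn g J') (φ : M.PreEnd) :
    relEnd J (g ∘ f) φ = relEnd J' g (relEnd J f φ) := by
  funext m N r
  simp only [relEnd, LinearMap.coe_mk, AddHom.coe_mk]
  rw [sg_smul]
  have := relExp_comp hf hg (fun i => ((m (g i)).deg : ZMod 2))
  rw [← Function.comp_assoc]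
  congr 2

theorem dEnd_relEnd {J J' : Finset ℕ} {f : ℕ → ℕ} (hf : Set.BijOn f J J') {d : ℤ} {φ : M.PreEnd}
    (hφ : IsEnd J d φ) : dEnd J' d (relEnd J f φ) = relEnd J f (dEnd J d φ) := by
  funext m N r
  simp only [relEnd, dEnd, LinearMap.coe_mk, AddHom.coe_mk]
  rw [map_zsmul, smul_sub, sum_bijOn hf]
  congr 1
  rw [smul_comm]
  congr 1
  rw [Finset.smul_sum]
  apply Finset.sum_congr rfl
  intro j hj
  rw [hφ.loc _ _ (update_comp_of hf m hj _), sg_smul, sg_smul, sum_bijOn hf]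
  congr 2
  rw [relExp_congr f (degs_comp hf m hj _), relExp_update hf.injOn _ hj]
  have e6 : (((m (f j)).d.deg : ℤ) : ZMod 2) = (m (f j)).deg + 1 := by
    simp only [Elt.d]; push_cast; rfl
  rw [e6]
  simp only [add_sub_cancel_left, one_mul, add_mul, Finset.sum_add_distrib, Function.comp]
  have := z2 (∑ i ∈ J, lo (f i) (f j) * ((m (f i)).deg : ZMod 2))
  linear_combination this

/-- The value of `ψ`, as an element of `M`. -/
def block (I : Finset ℕ) (q : ℤ) (ψ : M.PreEnd) (m : ℕ → M.Elt) : M.Elt :=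
  ⟨I.biUnion fun i => (m i).ar, q + ∑ i ∈ I, (m i).deg, ψ m _ _⟩

theorem compEnd_apply (J : Finset ℕ) (x : ℕ) (I : Finset ℕ) (q : ℤ) (φ ψ : M.PreEnd) (m N r) :
    compEnd J x I q φ ψ m N r = sg (compExp J x I q fun i => (m i).deg) •
      φ (Function.update m x (block I q ψ m)) N r := rfl

theorem compExp_congr {J : Finset ℕ} {x : ℕ} {I C : Finset ℕ} (h : Ins J x I C) (q : ZMod 2)
    {k k' : ℕ → ZMod 2} (hk : ∀ c ∈ C, k c = k' c) : compExp J x I q k = compExp J x I q k' := by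
  unfold compExp
  apply Finset.sum_congr rfl; intro j hj
  rw [hk j (h.mem_iff.2 (Or.inl hj))]
  congr 2
  apply Finset.sum_congr rfl; intro i hi
  rw [hk i (h.mem_iff.2 (Or.inr hi))]

theorem compExp_update_left {J : Finset ℕ} {x : ℕ} {I C : Finset ℕ} (h : Ins J x I C)
    (q : ZMod 2) (k : ℕ → ZMod 2) {j : ℕ} (hj : j ∈ J.erase x) (c : ZMod 2) :
    compExp J x I q (Function.update k j c) = compExp J x I q k +
      (c - k j) * (q * lo j x + ∑ i ∈ I, (lo i j + lo x j) * k i) := by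
  unfold compExp
  have h1 : ∀ j', ∑ i ∈ I, (lo i j' + lo x j') * Function.update k j c i =
      ∑ i ∈ I, (lo i j' + lo x j') * k i := fun j' => by
    apply Finset.sum_congr rfl; intro i hi
    rw [Function.update_of_ne]
    rintro rfl
    exact h.notMem_right hj hi
  simp only [h1]
  rw [← Finset.add_sum_erase _ _ hj, ← Finset.add_sum_erase (J.erase x) _ hj,
    Function.update_self]
  have h2 : ∀ i ∈ (J.erase x).erase j, Function.update k j c i = k i := fun i hi =>
    Function.update_of_ne (Finset.ne_of_mem_erase hi) _ _
  have h3 : ∑ i' ∈ (J.erase x).erase j, (q * lo i' x + ∑ i ∈ I, (lo i i' + lo x i') * k i) *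
      Function.update k j c i' = ∑ i' ∈ (J.erase x).erase j,
        (q * lo i' x + ∑ i ∈ I, (lo i i' + lo x i') * k i) * k i' :=
    Finset.sum_congr rfl fun i hi => by rw [h2 i hi]
  rw [h3]
  ring

theorem compExp_update_right {J : Finset ℕ} {x : ℕ} {I C : Finset ℕ} (h : Ins J x I C)
    (q : ZMod 2) (k : ℕ → ZMod 2) {i : ℕ} (hi : i ∈ I) (c : ZMod 2) :
    compExp J x I q (Function.update k i c) = compExp J x I q k +
      (c - k i) * ∑ j ∈ J.erase x, (lo i j + lo x j) * k j := by
  unfold compExp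
  rw [Finset.mul_sum, ← Finset.sum_add_distrib]
  apply Finset.sum_congr rfl; intro j hj
  rw [Function.update_of_ne (by rintro rfl; exact h.notMem_right hj hi)]
  rw [← Finset.add_sum_erase _ _ hi, ← Finset.add_sum_erase I _ hi, Function.update_self]
  have h2 : ∀ i' ∈ I.erase i, Function.update k i c i' = k i' := fun i hi =>
    Function.update_of_ne (Finset.ne_of_mem_erase hi) _ _
  have h3 : ∑ i' ∈ I.erase i, (lo i' j + lo x j) * Function.update k i c i' =
      ∑ i' ∈ I.erase i, (lo i' j + lo x j) * k i' :=
    Finset.sum_congr rfl fun i hi => by rw [h2 i hi]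
  rw [h3]
  ring

theorem block_loc {J : Finset ℕ} {q : ℤ} {ψ : M.PreEnd} (hψ : IsEnd J q ψ) {m m' : ℕ → M.Elt}
    (h : ∀ j ∈ J, m j = m' j) : block J q ψ m = block J q ψ m' := by
  have h1 : (J.biUnion fun i => (m i).ar) = J.biUnion fun i => (m' i).ar :=
    Finset.biUnion_congr rfl fun i hi => by rw [h i hi]
  have h2 : ∑ i ∈ J, (m i).deg = ∑ i ∈ J, (m' i).deg :=
    Finset.sum_congr rfl fun i hi => by rw [h i hi]
  unfold block
  rw [hψ.loc m m' h, h1, h2]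

end RightMod

end

section

variable {K : Type u} [Field K]

namespace RightMod
variable {Q : DGOperad.{u, w} K} {M : RightMod Q}

theorem biUnion_upd_subset {I : Finset ℕ} {A : ℕ → Finset ℕ} {N : Finset ℕ}
    {C : Finset ℕ} (hI : I ⊆ C) (h1 : Part (fun c : C => A c) N) : I.biUnion A ⊆ N := by
  intro n hn
  rw [part_iff] at h1
  rw [Finset.mem_biUnion] at hn
  obtain ⟨i, hi, hn⟩ := hn
  exact (h1.2 n).2 ⟨i, hI hi, hn⟩

theorem bijOn_biUnion {I : Finset ℕ} {A A' : ℕ → Finset ℕ} {f : ℕ → ℕ}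
    (hf : Set.InjOn f (I.biUnion A : Finset ℕ)) (h : ∀ i ∈ I, Set.BijOn f (A i) (A' i)) :
    Set.BijOn f (I.biUnion A : Finset ℕ) (I.biUnion A' : Finset ℕ) := by
  refine ⟨?_, hf, ?_⟩
  · intro n hn
    simp only [Finset.coe_biUnion, Set.mem_iUnion, Finset.mem_coe] at hn ⊢
    obtain ⟨i, hi, hn⟩ := hn
    exact ⟨i, hi, (h i hi).mapsTo hn⟩
  · intro n hn
    simp only [Finset.coe_biUnion, Set.mem_iUnion, Finset.mem_coe] at hn
    obtain ⟨i, hi, hn⟩ := hn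
    obtain ⟨k, hk, rfl⟩ := (h i hi).surjOn hn
    refine ⟨k, ?_, rfl⟩
    simp only [Finset.coe_biUnion, Set.mem_iUnion, Finset.mem_coe]
    exact ⟨i, hi, hk⟩

theorem block_rel {I : Finset ℕ} {q : ℤ} {ψ : M.PreEnd} (hψ : IsEnd I q ψ) {m m' : ℕ → M.Elt}
    {f : ℕ → ℕ} (hf : Set.InjOn f (I.biUnion fun i => (m i).ar : Finset ℕ))
    (hP : Part (fun i : I => (m i).ar) (I.biUnion fun i => (m i).ar))
    (h : ∀ j ∈ I, ∃ (B : Finset ℕ) (hB : Set.BijOn f (m j).ar B), m' j = (m j).rel f hB) :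
    ∃ (B : Finset ℕ) (hB : Set.BijOn f (I.biUnion fun i => (m i).ar : Finset ℕ) B),
      block I q ψ m' = (block I q ψ m).rel f hB := by
  refine ⟨I.biUnion fun i => (m' i).ar, bijOn_biUnion hf fun i hi => ?_, ?_⟩
  · obtain ⟨B, hB, e⟩ := h i hi
    rw [e]; exact hB
  · have h2 : ∑ i ∈ I, (m' i).deg = ∑ i ∈ I, (m i).deg :=
      Finset.sum_congr rfl fun i hi => by obtain ⟨B, hB, e⟩ := h i hi; rw [e]; rfl
    unfold block Elt.rel
    rw [h2, hψ.rel m m' _ _ f _ hP h]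

theorem ins_biUnion {I : Finset ℕ} {A A' : ℕ → Finset ℕ} {c y : ℕ} {B N N' : Finset ℕ}
    (hc : c ∈ I) (hA : ∀ i ∈ I, i ≠ c → A' i = A i) (h : Ins (A c) y B (A' c))
    (hd : ∀ i ∈ I, i ≠ c → Disjoint (A i) (A c)) (hI : I.biUnion A ⊆ N) (h' : Ins N y B N') :
    Ins (I.biUnion A) y B (I.biUnion A') := by
  refine ⟨Finset.mem_biUnion.2 ⟨c, hc, h.mem⟩, ?_, ?_⟩
  · exact Finset.disjoint_of_subset_left (Finset.erase_subset_erase _ hI) h'.disj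
  · ext n
    simp only [Finset.mem_biUnion, Finset.mem_union, Finset.mem_erase]
    constructor
    · rintro ⟨i, hi, hn⟩
      by_cases e : i = c
      · subst e
        rw [h.eq, Finset.mem_union, Finset.mem_erase] at hn
        rcases hn with hn | hn
        · exact Or.inl ⟨hn.1, i, hi, hn.2⟩
        · exact Or.inr hn
      · rw [hA i hi e] at hn
        refine Or.inl ⟨?_, i, hi, hn⟩
        rintro rfl
        exact Finset.disjoint_left.1 (hd i hi e) hn h.mem
    · rintro (⟨hny, i, hi, hn⟩ | hn)
      · by_cases e : i = c
        · subst e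
          refine ⟨i, hi, ?_⟩
          rw [h.eq]; simp [hny, hn]
        · exact ⟨i, hi, by rwa [hA i hi e]⟩
      · refine ⟨c, hc, ?_⟩
        rw [h.eq]; simp [hn]

theorem degs_cast_block {I : Finset ℕ} {q : ℤ} {ψ : M.PreEnd} (m : ℕ → M.Elt) :
    (((block I q ψ m).deg : ℤ) : ZMod 2) = q + ∑ i ∈ I, ((m i).deg : ZMod 2) := by
  simp [block]

theorem sum_lo_block {J : Finset ℕ} {x : ℕ} {I C : Finset ℕ} (h : Ins J x I C) (q : ℤ)
    (ψ : M.PreEnd) (m : ℕ → M.Elt) (c : ℕ) :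
    ∑ i ∈ J, lo c i * ((Function.update m x (block I q ψ m) i).deg : ZMod 2) =
      lo c x * (q + ∑ i ∈ I, ((m i).deg : ZMod 2)) +
        ∑ i ∈ J.erase x, lo c i * ((m i).deg : ZMod 2) := by
  rw [sum_lo_upd' m h.mem, degs_cast_block, ← Finset.add_sum_erase _ _ h.mem]
  ring

theorem IsEnd.compEnd {J : Finset ℕ} {x : ℕ} {I C : Finset ℕ} (h : Ins J x I C) {p q n : ℤ}
    (hn : p + q = n) {φ ψ : M.PreEnd} (hφ : IsEnd J p φ) (hψ : IsEnd I q ψ) :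
    IsEnd C n (compEnd J x I q φ ψ) := by
  subst hn
  have hIC : I ⊆ C := fun i hi => h.mem_iff.2 (Or.inr hi)
  constructor
  · intro m N r h0
    rw [compEnd_apply] at h0
    have h1 : φ (Function.update m x (block I q ψ m)) N r ≠ 0 := fun e => h0 (by rw [e, smul_zero])
    have h2 : ψ m (I.biUnion fun i => (m i).ar) (q + ∑ i ∈ I, (m i).deg) ≠ 0 := by
      intro e
      apply h1
      unfold block
      rw [e]
      exact hφ.zero' m h.mem _ _ _ _
    obtain ⟨h3, h4⟩ := hφ.supp _ _ _ h1
    obtain ⟨h5, -⟩ := hψ.supp _ _ _ h2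
    constructor
    · refine part_ins h (A := fun i => (m i).ar)
        (A' := fun j => (Function.update m x (block I q ψ m) j).ar) ?_ ?_ h3
      · intro j hj
        simp only [Function.update_of_ne (Finset.ne_of_mem_erase hj)]
      · simp only [Function.update_self]; exact h5
    · rw [sum_deg_upd _ h.mem] at h4
      rw [h.sum, ← h4, ← Finset.add_sum_erase _ _ h.mem]
      simp only [block]
      ring
  · intro m m' hm
    funext N r
    rw [compEnd_apply, compEnd_apply, compExp_congr h q (k' := fun i => ((m' i).deg : ZMod 2)),
      block_loc hψ (m' := m'), hφ.loc (Function.update m x _) (Function.update m' x _)]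
    · intro j hj
      by_cases e : j = x
      · subst e; simp
      · rw [Function.update_of_ne e, Function.update_of_ne e]
        exact hm j (h.mem_iff.2 (Or.inl (Finset.mem_erase.2 ⟨e, hj⟩)))
    · intro i hi; exact hm i (hIC hi)
    · intro c hc; rw [hm c hc]
  · intro m c hc A k N r
    rcases h.mem_iff.1 hc with hcJ | hcI
    · have hcx : c ≠ x := Finset.ne_of_mem_erase hcJ
      have : (fun u : (M.X A).X k => RightMod.compEnd J x I q φ ψ (Function.update m c ⟨A, k, u⟩) N r)
          = (sg (compExp J x I q (Function.update (fun i => ((m i).deg : ZMod 2)) c k)) •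
          (hφ.lin (Function.update m x (block I q ψ m)) c (Finset.mem_of_mem_erase hcJ) A k N r).mk' :
          (M.X A).X k →ₗ[K] (M.X N).X r) := by
        funext u
        rw [compEnd_apply, degs_upd]
        simp only [LinearMap.smul_apply, IsLinearMap.mk'_apply]
        rw [block_loc hψ (m := Function.update m c _) (m' := m), Function.update_comm hcx]
        intro i hi
        rw [Function.update_of_ne]
        rintro rfl; exact h.notMem_right hcJ hi
      rw [this]
      exact LinearMap.isLinear _
    · have hcJ := h.notMem_left hcI
      have ha : ∀ u : (M.X A).X k, (I.biUnion fun i => (Function.update m c ⟨A, k, u⟩ i).ar) =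
          I.biUnion fun i => (Function.update m c ⟨A, k, 0⟩ i).ar := fun u =>
        Finset.biUnion_congr rfl fun i _ => by simp only [ar_upd]
      have hb : ∀ u : (M.X A).X k, (q + ∑ i ∈ I, (Function.update m c ⟨A, k, u⟩ i).deg) =
          q + ∑ i ∈ I, (Function.update m c ⟨A, k, 0⟩ i).deg := fun u => by
        simp only [deg_upd]
      have : (fun u : (M.X A).X k => RightMod.compEnd J x I q φ ψ (Function.update m c ⟨A, k, u⟩) N r)
          = (sg (compExp J x I q (Function.update (fun i => ((m i).deg : ZMod 2)) c k)) •
          (hφ.lin m x h.mem _ _ N r).mk' ∘ₗ (hψ.lin m c hcI A k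
            (I.biUnion fun i => (Function.update m c ⟨A, k, 0⟩ i).ar)
            (q + ∑ i ∈ I, (Function.update m c ⟨A, k, 0⟩ i).deg)).mk' :
          (M.X A).X k →ₗ[K] (M.X N).X r) := by
        funext u
        rw [compEnd_apply, degs_upd]
        simp only [LinearMap.smul_apply, IsLinearMap.mk'_apply, LinearMap.comp_apply]
        unfold block
        rw [ha u, hb u]
        congr 1
        refine congrFun (congrFun (hφ.loc _ _ fun j hj => ?_) _) _
        by_cases e : j = x
        · subst e; simp
        · rw [Function.update_of_ne e, Function.update_of_ne e, Function.update_of_ne]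
          rintro rfl
          exact hcJ (Finset.mem_erase.2 ⟨e, hj⟩)
      rw [this]
      exact LinearMap.isLinear _
  · intro m m' N N' f hf hP hm r
    rw [compEnd_apply, compEnd_apply, compExp_congr h q (k' := fun i => ((m i).deg : ZMod 2)),
      map_zsmul]
    · have hBN := biUnion_upd_subset (A := fun i => (m i).ar) hIC hP
      obtain ⟨B, hB, e⟩ := block_rel (q := q) hψ (hf.injOn.mono (by exact_mod_cast hBN))
        (part_ins_left h (A := fun i => (m i).ar) hP) fun i hi => hm i (hIC hi)
      congr 1
      refine hφ.rel _ _ N N' f hf ?_ ?_ r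
      · refine part_ins_right h (A := fun i => (m i).ar)
          (A' := fun j => (Function.update m x (block I q ψ m) j).ar) ?_ ?_ hP
        · intro j hj
          simp only [Function.update_of_ne (Finset.ne_of_mem_erase hj)]
        · simp only [Function.update_self]; rfl
      · intro j hj
        by_cases ej : j = x
        · subst ej
          simp only [Function.update_self]
          exact ⟨B, hB, e⟩
        · simp only [Function.update_of_ne ej]
          exact hm j (h.mem_iff.2 (Or.inl (Finset.mem_erase.2 ⟨ej, hj⟩)))
    · intro c hc
      obtain ⟨B, hB, e⟩ := hm c hc
      rw [e]; rfl
  · intro m c hc e y B D N N' hD hN hP l n r r' hn hr a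
    have e5 : (((e.act hD hn a).deg : ℤ) : ZMod 2) = e.deg + l := by
      simp only [Elt.act]; rw [← hn]; push_cast; rfl
    rcases h.mem_iff.1 hc with hcJ | hcI
    · have hcx : c ≠ x := Finset.ne_of_mem_erase hcJ
      have hbl : ∀ e' : M.Elt, block I q ψ (Function.update m c e') = block I q ψ m := by
        intro e'
        apply block_loc hψ
        intro i hi
        rw [Function.update_of_ne]
        rintro rfl; exact h.notMem_right hcJ hi
      rw [compEnd_apply, compEnd_apply, hbl, hbl, Function.update_comm hcx,
        Function.update_comm hcx, hφ.act _ c (Finset.mem_of_mem_erase hcJ) e hD hN _ hn hr,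
        map_zsmul, LinearMap.smul_apply, sg_smul, sg_smul, degs_upd, degs_upd,
        compExp_update_left h _ _ hcJ, compExp_update_left h _ _ hcJ, sum_lo_block h, h.sum, e5]
      · congr 2
        have : ∑ i ∈ I, (lo i c + lo x c) * ((m i).deg : ZMod 2) =
            ∑ i ∈ I, lo c i * ((m i).deg : ZMod 2) + lo c x * ∑ i ∈ I, ((m i).deg : ZMod 2) := by
          rw [Finset.mul_sum, ← Finset.sum_add_distrib]
          apply Finset.sum_congr rfl
          intro i hi
          have hic : i ≠ c := by rintro rfl; exact h.notMem_right hcJ hi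
          rw [lo_swap hic, lo_swap hcx]
          have := z2 ((m i).deg : ZMod 2)
          have := z2 (lo c x * (m i).deg : ZMod 2)
          grind
        rw [this]
        generalize ∑ i ∈ I, lo c i * ((m i).deg : ZMod 2) = s1
        generalize ∑ i ∈ I, ((m i).deg : ZMod 2) = s2
        generalize ∑ i ∈ J.erase x, lo c i * ((m i).deg : ZMod 2) = s3
        have := z2 (l * lo c x * q : ZMod 2)
        have := z2 (l * lo c x * s2 : ZMod 2)
        grind
      · rw [Function.update_comm hcx.symm]
        have := part_ins_right h (A := fun i => (Function.update m c e i).ar)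
          (A' := fun j => (Function.update (Function.update m c e) x
            (block I q ψ (Function.update m c e)) j).ar) ?_ ?_ hP
        · rw [hbl] at this; exact this
        · intro j hj
          simp only [Function.update_of_ne (Finset.ne_of_mem_erase hj)]
        · simp only [Function.update_self]; rfl
    · have hcJ := h.notMem_left hcI
      have hPI := part_ins_left h (A := fun i => (Function.update m c e i).ar) hP
      have hIN := biUnion_upd_subset (A := fun i => (Function.update m c e i).ar) hIC hP
      have hins : Ins (I.biUnion fun i => (Function.update m c e i).ar) y B
          (I.biUnion fun i => (Function.update m c (e.act hD hn a) i).ar) := by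
        refine ins_biUnion hcI ?_ ?_ ?_ hIN hN
        · intro i hi hic
          simp only [Function.update_of_ne hic]
        · simp only [Function.update_self]; exact hD
        · intro i hi hic
          exact ((part_iff (A := fun i => (Function.update m c e i).ar)).1 hPI).1 i hi c hcI hic
      have hdeg : (block I q ψ (Function.update m c e)).deg + l =
          q + ∑ i ∈ I, (Function.update m c (e.act hD hn a) i).deg := by
        simp only [block, sum_deg_upd m hcI, Elt.act]
        omega
      have hbl : block I q ψ (Function.update m c (e.act hD hn a)) =
          ⟨_, _, sg (l * ∑ i ∈ I, lo c i * (m i).deg) •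
            M.act hins hdeg (block I q ψ (Function.update m c e)).val a⟩ := by
        unfold block
        rw [hψ.act m c hcI e hD hins hPI hn hdeg]
        rfl
      have hup : ∀ e' b, φ (Function.update (Function.update m c e') x b) =
          φ (Function.update m x b) := by
        intro e' b
        apply hφ.loc
        intro j hj
        by_cases e : j = x
        · subst e; simp
        · rw [Function.update_of_ne e, Function.update_of_ne e, Function.update_of_ne]
          rintro rfl
          exact hcJ (Finset.mem_erase.2 ⟨e, hj⟩)
      rw [compEnd_apply, compEnd_apply, hup, hup, hbl, hφ.zsmul' m h.mem]
      have := hφ.act m x h.mem (block I q ψ (Function.update m c e)) hins hN ?_ hdeg hr a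
      · refine (congrArg (fun z => sg _ • sg _ • z) this).trans ?_
        rw [map_zsmul, LinearMap.smul_apply, sg_smul, sg_smul, sg_smul, degs_upd, degs_upd,
          compExp_update_right h _ _ hcI, compExp_update_right h _ _ hcI, h.sum, e5,
          ← Finset.add_sum_erase _ _ h.mem, lo_self, zero_mul, zero_add]
        congr 2
        simp only [add_mul, Finset.sum_add_distrib]
        generalize ∑ i ∈ I, lo c i * ((m i).deg : ZMod 2) = s1
        generalize ∑ i ∈ J.erase x, lo x i * ((m i).deg : ZMod 2) = s2
        generalize ∑ i ∈ J.erase x, lo c i * ((m i).deg : ZMod 2) = s3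
        have := z2 (l * s2 : ZMod 2)
        grind
      · refine part_ins_right h (A := fun i => (Function.update m c e i).ar)
          (A' := fun j => (Function.update m x (block I q ψ (Function.update m c e)) j).ar) ?_ ?_ hP
        · intro j hj
          simp only [Function.update_of_ne (Finset.ne_of_mem_erase hj)]
          rw [Function.update_of_ne]
          rintro rfl; exact hcJ hj
        · simp only [Function.update_self]; rfl

end RightMod

end

section

variable {K : Type u} [Field K]

theorem lo_add {i j : ℕ} (h : i ≠ j) (a : ZMod 2) : lo i j * a + lo j i * a = a := by
  rw [lo_swap h]
  have := z2 (lo i j * a)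
  linear_combination this

namespace RightMod
variable {Q : DGOperad.{u, w} K} {M : RightMod Q}

theorem dEnd_apply {J : Finset ℕ} {d : ℤ} (φ : M.PreEnd) (m N) {r r' : ℤ} (h : r' + 1 = r) :
    dEnd J d φ m N r = (M.X N).d r' r (φ m N r') - sg d • ∑ j ∈ J,
      sg (∑ i ∈ J, lo i j * (m i).deg) • φ (Function.update m j (m j).d) N r := by
  obtain rfl : r' = r - 1 := by omega
  rfl

theorem compExp_add_one (J : Finset ℕ) (x : ℕ) (I : Finset ℕ) (q : ZMod 2) (k : ℕ → ZMod 2) :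
    compExp J x I (q + 1) k = compExp J x I q k + ∑ j ∈ J.erase x, lo j x * k j := by
  unfold compExp
  rw [← Finset.sum_add_distrib]
  apply Finset.sum_congr rfl; intro j hj
  ring

theorem IsEnd.upd_x {J : Finset ℕ} {p : ℤ} {φ : M.PreEnd} (hφ : IsEnd J p φ) (m : ℕ → M.Elt) (x : ℕ)
    {c : ℕ} (hc : c ∉ J.erase x) (e b : M.Elt) :
    φ (Function.update (Function.update m c e) x b) = φ (Function.update m x b) := by
  apply hφ.loc
  intro j hj
  by_cases e : j = x
  · subst e; simp
  · rw [Function.update_of_ne e, Function.update_of_ne e, Function.update_of_ne]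
    rintro rfl
    exact hc (Finset.mem_erase.2 ⟨e, hj⟩)

theorem block_upd {I : Finset ℕ} {q : ℤ} {ψ : M.PreEnd} (hψ : IsEnd I q ψ) (m : ℕ → M.Elt) {c : ℕ}
    (hc : c ∉ I) (e : M.Elt) : block I q ψ (Function.update m c e) = block I q ψ m := by
  apply block_loc hψ
  intro i hi
  rw [Function.update_of_ne]
  rintro rfl; exact hc hi

theorem block_dEnd {I : Finset ℕ} {q : ℤ} {ψ : M.PreEnd} (m : ℕ → M.Elt) :
    block I (q + 1) (RightMod.dEnd I q ψ) m =
      ⟨I.biUnion fun i => (m i).ar, (block I q ψ m).deg + 1,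
        (M.X (I.biUnion fun i => (m i).ar)).d (q + ∑ i ∈ I, (m i).deg) ((block I q ψ m).deg + 1)
          (ψ m (I.biUnion fun i => (m i).ar) (q + ∑ i ∈ I, (m i).deg)) -
        sg q • ∑ i ∈ I, sg (∑ i' ∈ I, lo i' i * (m i').deg) •
          ψ (Function.update m i (m i).d) (I.biUnion fun i => (m i).ar)
            ((block I q ψ m).deg + 1)⟩ := by
  have e : q + 1 + ∑ i ∈ I, (m i).deg = (block I q ψ m).deg + 1 := by simp only [block]; ring
  unfold block at e ⊢
  rw [e]
  rw [dEnd_apply ψ m _ rfl]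

theorem block_upd_d {I : Finset ℕ} {q : ℤ} {ψ : M.PreEnd} (m : ℕ → M.Elt) {i : ℕ} (hi : i ∈ I) :
    block I q ψ (Function.update m i (m i).d) =
      ⟨I.biUnion fun i => (m i).ar, (block I q ψ m).deg + 1,
        ψ (Function.update m i (m i).d) (I.biUnion fun i => (m i).ar)
          ((block I q ψ m).deg + 1)⟩ := by
  have h1 : (I.biUnion fun j => (Function.update m i (m i).d j).ar) =
      I.biUnion fun i => (m i).ar := by
    apply Finset.biUnion_congr rfl
    intro j hj
    rw [ar_upd]
    split_ifs with h
    · subst h; rfl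
    · rfl
  have h2 : q + ∑ j ∈ I, (Function.update m i (m i).d j).deg = (block I q ψ m).deg + 1 := by
    rw [sum_deg_upd m hi]; simp only [block, Elt.d]; ring
  unfold block at h2 ⊢
  rw [h1, h2]

theorem dEnd_compEnd {J : Finset ℕ} {x : ℕ} {I C : Finset ℕ} (h : Ins J x I C) {p q n : ℤ}
    (hn : p + q = n) {φ ψ : M.PreEnd} (hφ : IsEnd J p φ) (hψ : IsEnd I q ψ) :
    dEnd C n (compEnd J x I q φ ψ) = compEnd J x I q (dEnd J p φ) ψ +
      sg p • compEnd J x I (q + 1) φ (dEnd I q ψ) := by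
  subst hn
  funext m N r
  simp only [Pi.add_apply, Pi.smul_apply]
  rw [dEnd_apply _ _ _ (sub_add_cancel r 1), compEnd_apply, compEnd_apply, compEnd_apply,
    dEnd_apply _ _ _ (sub_add_cancel r 1), map_zsmul, smul_sub, block_dEnd]
  push_cast
  rw [compExp_add_one]
  set b := block I q ψ m with hb
  set B := I.biUnion fun i => (m i).ar with hB
  set E := compExp J x I q (fun i => ((m i).deg : ZMod 2)) with hE
  -- expand the value at the differential of `ψ`
  have h1 : φ (Function.update m x ⟨B, b.deg + 1, (M.X B).d (q + ∑ i ∈ I, (m i).deg) (b.deg + 1) (ψ m B (q + ∑ i ∈ I, (m i).deg)) -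
        sg q • ∑ i ∈ I, sg (∑ i' ∈ I, lo i' i * (m i').deg) •
          ψ (Function.update m i (m i).d) B (b.deg + 1)⟩) N r =
      φ (Function.update m x b.d) N r - sg q • ∑ i ∈ I, sg (∑ i' ∈ I, lo i' i * (m i').deg) •
        φ (Function.update m x (block I q ψ (Function.update m i (m i).d))) N r := by
    have := (hφ.lin m x h.mem B (b.deg + 1) N r).mk'.map_sub
      ((M.X B).d (q + ∑ i ∈ I, (m i).deg) (b.deg + 1) (ψ m B (q + ∑ i ∈ I, (m i).deg))) (sg q • ∑ i ∈ I,
      sg (∑ i' ∈ I, lo i' i * (m i').deg) • ψ (Function.update m i (m i).d) B (b.deg + 1))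
    rw [map_zsmul, map_sum] at this
    simp only [map_zsmul] at this
    refine this.trans ?_
    simp only [IsLinearMap.mk'_apply]
    congr 2
    apply Finset.sum_congr rfl
    intro i hi
    rw [block_upd_d m hi]
  rw [h1, h.sum, ← Finset.add_sum_erase J _ h.mem]
  -- left terms
  have h2 : ∀ j ∈ J.erase x, sg (∑ i ∈ C, lo i j * ((m i).deg : ZMod 2)) •
      compEnd J x I q φ ψ (Function.update m j (m j).d) N r =
      sg (E + q + (∑ i ∈ J, lo i j * ((Function.update m x b i).deg : ZMod 2))) •
      φ (Function.update (Function.update m x b) j ((Function.update m x b j).d)) N r := by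
    intro j hj
    have hjx : j ≠ x := Finset.ne_of_mem_erase hj
    rw [compEnd_apply, block_upd hψ m (h.notMem_right hj), ← hb, Function.update_of_ne hjx,
      Function.update_comm hjx, sg_smul, degs_upd, compExp_update_left h _ _ hj, ← hE, h.sum,
      sum_lo_upd m h.mem, hb, degs_cast_block, ← Finset.add_sum_erase J _ h.mem]
    congr 2
    have e6 : (((m j).d.deg : ℤ) : ZMod 2) = (m j).deg + 1 := by
      simp only [Elt.d]; push_cast; rfl
    rw [e6]
    simp only [add_mul, Finset.sum_add_distrib, ← Finset.mul_sum, add_sub_cancel_left, one_mul]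
    have := lo_add hjx q
    have := z2 (lo x j * q)
    have := z2 (lo x j * (m x).deg)
    have := z2 (∑ i ∈ I, lo i j * ((m i).deg : ZMod 2))
    grind
  have h3 : ∀ i ∈ I, sg (∑ i' ∈ C, lo i' i * ((m i').deg : ZMod 2)) •
      compEnd J x I q φ ψ (Function.update m i (m i).d) N r =
      sg (E + (∑ j ∈ J.erase x, lo j x * ((m j).deg : ZMod 2)) +
        ∑ i' ∈ I, lo i' i * ((m i').deg : ZMod 2)) •
      φ (Function.update m x (block I q ψ (Function.update m i (m i).d))) N r := by
    intro i hi
    rw [compEnd_apply, hφ.upd_x _ _ (h.notMem_left hi), sg_smul, degs_upd,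
      compExp_update_right h _ _ hi, ← hE, h.sum]
    congr 2
    have e6 : (((m i).d.deg : ℤ) : ZMod 2) = (m i).deg + 1 := by
      simp only [Elt.d]; push_cast; rfl
    rw [e6, add_sub_cancel_left, one_mul]
    have : ∑ j ∈ J.erase x, lo j i * ((m j).deg : ZMod 2) +
        ∑ j ∈ J.erase x, (lo i j + lo x j) * ((m j).deg : ZMod 2) =
        ∑ j ∈ J.erase x, lo j x * ((m j).deg : ZMod 2) := by
      rw [← Finset.sum_add_distrib]
      apply Finset.sum_congr rfl
      intro j hj
      have hij : j ≠ i := fun e => h.notMem_right hj (e ▸ hi)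
      have := lo_add hij ((m j).deg : ZMod 2)
      have := lo_add (Finset.ne_of_mem_erase hj) ((m j).deg : ZMod 2)
      have := z2 (lo x j * ((m j).deg : ZMod 2))
      grind
    rw [← this]
    ring
  rw [Finset.sum_congr rfl h2, Finset.sum_congr rfl h3, Function.update_self, Function.update_idem]
  have h4 : ∑ i ∈ J, lo i x * ((Function.update m x b i).deg : ZMod 2) =
      ∑ j ∈ J.erase x, lo j x * ((m j).deg : ZMod 2) := by
    rw [sum_lo_upd m h.mem, ← Finset.add_sum_erase J _ h.mem, lo_self]
    ring
  rw [h4]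
  simp only [smul_add, smul_sub, Finset.smul_sum, sg_smul]
  set s := ∑ j ∈ J.erase x, lo j x * ((m j).deg : ZMod 2) with hs
  have q1 : ∀ t : ZMod 2, (p + q + (E + q + t) : ZMod 2) = E + (p + t) := fun t => by
    have := z2 (q : ZMod 2)
    grind
  have q2 : ∀ t : ZMod 2, (p + q + (E + s + t) : ZMod 2) = p + (E + s) + (q + t) := fun t => by
    ring
  have q3 : (E + (p + s) : ZMod 2) = p + (E + s) := by ring
  simp only [q1, q2, q3]
  simp only [add_assoc]
  abel

end RightMod

end

section

variable {K : Type u} [Field K]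

namespace RightMod
variable {Q : DGOperad.{u, w} K} {M : RightMod Q}

theorem relExp_erase {J : Finset ℕ} {f : ℕ → ℕ} (hf : Set.InjOn f J) {x : ℕ} (hx : x ∈ J)
    (k : ℕ → ZMod 2) : relExp J f k = relExp (J.erase x) f k +
      k x * ∑ j ∈ J.erase x, (lo j x + lo (f j) (f x)) * k j := by
  have h := relExp_update hf (Function.update k x 0) hx (k x)
  have h0 : relExp J f (Function.update k x 0) = relExp (J.erase x) f k := by
    unfold relExp
    rw [← Finset.add_sum_erase _ _ hx]
    simp only [Function.update_self, mul_zero, zero_mul, Finset.sum_const_zero, zero_add]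
    apply Finset.sum_congr rfl; intro i hi
    rw [← Finset.add_sum_erase _ _ hx]
    simp only [Function.update_self, mul_zero, zero_add]
    apply Finset.sum_congr rfl; intro j hj
    rw [Function.update_of_ne (Finset.ne_of_mem_erase hi),
      Function.update_of_ne (Finset.ne_of_mem_erase hj)]
  rw [Function.update_idem, Function.update_eq_self, h0, Function.update_self, sub_zero,
    ← Finset.add_sum_erase _ _ hx, Function.update_self, mul_zero, zero_add] at h
  rw [h]
  congr 2
  apply Finset.sum_congr rfl; intro j hj
  rw [Function.update_of_ne (Finset.ne_of_mem_erase hj)]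

theorem relExp_union {A B : Finset ℕ} (hd : Disjoint A B) {f : ℕ → ℕ}
    (hf : Set.InjOn f (A ∪ B : Finset ℕ)) (k : ℕ → ZMod 2) :
    relExp (A ∪ B) f k = relExp A f k + relExp B f k +
      ∑ j ∈ A, (∑ i ∈ B, (lo i j + lo (f i) (f j)) * k i) * k j := by
  unfold relExp
  rw [Finset.sum_union hd]
  simp only [Finset.sum_union hd, Finset.sum_add_distrib, Finset.sum_mul]
  rw [Finset.sum_comm (s := B) (t := A)]
  have : ∀ j ∈ A, ∀ i ∈ B, (lo i j + lo (f i) (f j)) * k i * k j =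
      lo j i * lo (f i) (f j) * k j * k i + lo i j * lo (f j) (f i) * k i * k j := by
    intro j hj i hi
    have hij : i ≠ j := fun e => Finset.disjoint_left.1 hd hj (e ▸ hi)
    have hfij : f i ≠ f j := fun e => hij (hf (by simp [hi]) (by simp [hj]) e)
    rw [lo_swap hij, lo_swap hfij]
    have := z2 (lo i j * lo (f i) (f j) * k i * k j)
    grind
  rw [Finset.sum_congr rfl fun j hj => Finset.sum_congr rfl (this j hj)]
  simp only [Finset.sum_add_distrib]
  ring

theorem exp_rel_comp {J : Finset ℕ} {x : ℕ} {I C J' I' C' : Finset ℕ} (h : Ins J x I C)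
    {f g k : ℕ → ℕ} (h' : Ins J' (f x) I' C')
    (hf : Set.BijOn f J J') (hg : Set.BijOn g I I') (hk : Set.BijOn k C C')
    (h1 : Set.EqOn k f (J.erase x)) (h2 : Set.EqOn k g I) (q : ZMod 2) (κ : ℕ → ZMod 2) :
    relExp C k (κ ∘ k) + compExp J x I q (κ ∘ k) = compExp J' (f x) I' q κ +
      (relExp J f (Function.update (κ ∘ f) x (q + ∑ i ∈ I', κ i)) + relExp I g (κ ∘ g)) := by
  have hkf : relExp (J.erase x) k (κ ∘ k) = relExp (J.erase x) f (κ ∘ f) := by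
    unfold relExp
    apply Finset.sum_congr rfl; intro i hi
    apply Finset.sum_congr rfl; intro j hj
    simp only [Function.comp, h1 hi, h1 hj]
  have hkg : relExp I k (κ ∘ k) = relExp I g (κ ∘ g) := by
    unfold relExp
    apply Finset.sum_congr rfl; intro i hi
    apply Finset.sum_congr rfl; intro j hj
    simp only [Function.comp, h2 hi, h2 hj]
  have hfe : Set.BijOn f (J.erase x : Finset ℕ) (J'.erase (f x) : Finset ℕ) := by
    rw [Finset.coe_erase, Finset.coe_erase]
    exact hf.sdiff_singleton h.mem
  have hu : relExp (J.erase x) f (Function.update (κ ∘ f) x (q + ∑ i ∈ I', κ i)) =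
      relExp (J.erase x) f (κ ∘ f) := by
    apply relExp_congr
    intro i hi
    rw [Function.update_of_ne (Finset.ne_of_mem_erase hi)]
  have hk' := hk.injOn
  rw [h.eq] at hk' ⊢
  rw [relExp_union h.disj hk', hkf, hkg, relExp_erase hf.injOn h.mem (Function.update _ _ _), hu]
  unfold compExp
  rw [sum_bijOn hfe, Function.update_self, sum_bijOn hg, Finset.mul_sum]
  have : ∀ j ∈ J.erase x, (∑ i ∈ I, (lo i j + lo (k i) (k j)) * (κ ∘ k) i) * (κ ∘ k) j +
      (q * lo j x + ∑ i ∈ I, (lo i j + lo x j) * (κ ∘ k) i) * (κ ∘ k) j =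
      (q * lo (f j) (f x) + ∑ i ∈ I', (lo i (f j) + lo (f x) (f j)) * κ i) * κ (f j) +
      (q + ∑ i ∈ I, κ (g i)) * ((lo j x + lo (f j) (f x)) *
        Function.update (κ ∘ f) x (q + ∑ i ∈ I, κ (g i)) j) := by
    intro j hj
    rw [Function.update_of_ne (Finset.ne_of_mem_erase hj), sum_bijOn hg]
    have hjx := Finset.ne_of_mem_erase hj
    have hfjx : f j ≠ f x := fun e => hjx (hf.injOn (Finset.mem_of_mem_erase hj) h.mem e)
    have e1 : ∀ i ∈ I, (lo i j + lo (k i) (k j)) * (κ ∘ k) i + (lo i j + lo x j) * (κ ∘ k) i =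
        (lo (g i) (f j) + lo (f x) (f j)) * κ (g i) +
          κ (g i) * (lo j x + lo (f j) (f x)) := by
      intro i hi
      simp only [Function.comp, h1 hj, h2 hi]
      rw [lo_swap hjx, lo_swap hfjx]
      generalize lo i j = a
      generalize lo j x = b
      generalize lo (f j) (f x) = c
      generalize lo (g i) (f j) = d
      generalize κ (g i) = e
      revert a b c d e
      decide
    have e2 := Finset.sum_congr (s₁ := I) rfl e1
    simp only [Finset.sum_add_distrib, ← Finset.sum_mul] at e2 ⊢
    have e3 : (κ ∘ k) j = κ (f j) := by simp only [Function.comp]; rw [h1 hj]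
    have e4 : (κ ∘ f) j = κ (f j) := rfl
    rw [e3, e4]
    have := z2 (q * lo (f j) (f x) * κ (f j))
    linear_combination κ (f j) * e2 - this
  have := Finset.sum_congr (s₁ := J.erase x) rfl this
  simp only [Finset.sum_add_distrib (s := J.erase x)] at this
  linear_combination this

theorem relEnd_compEnd {J : Finset ℕ} {x : ℕ} {I C J' I' C' : Finset ℕ} (h : Ins J x I C)
    {f g k : ℕ → ℕ} (h' : Ins J' (f x) I' C')
    (hf : Set.BijOn f J J') (hg : Set.BijOn g I I') (hk : Set.BijOn k C C')
    (h1 : Set.EqOn k f (J.erase x)) (h2 : Set.EqOn k g I) {p q : ℤ} {φ ψ : M.PreEnd}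
    (hφ : IsEnd J p φ) (hψ : IsEnd I q ψ) :
    relEnd C k (compEnd J x I q φ ψ) =
      compEnd J' (f x) I' q (relEnd J f φ) (relEnd I g ψ) := by
  funext m N r
  have hb : block I' q (relEnd I g ψ) m = ⟨(block I q ψ (m ∘ k)).ar, (block I q ψ (m ∘ k)).deg,
      sg (relExp I g fun i => (m (g i)).deg) • (block I q ψ (m ∘ k)).val⟩ := by
    have e1 : (I'.biUnion fun i => (m i).ar) = I.biUnion fun i => ((m ∘ g) i).ar := by
      ext n
      simp only [Finset.mem_biUnion]
      constructor
      · rintro ⟨i, hi, hn⟩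
        obtain ⟨i, hi', rfl⟩ := hg.surjOn hi
        exact ⟨i, hi', hn⟩
      · rintro ⟨i, hi, hn⟩
        exact ⟨g i, hg.mapsTo (Finset.mem_coe.2 hi), hn⟩
    rw [block_loc hψ (m := m ∘ k) (m' := m ∘ g) fun i hi => by simp [h2 hi]]
    unfold block
    rw [e1, sum_bijOn hg]
    simp only [Function.comp]
    rfl
  rw [compEnd_apply, hb]
  simp only [relEnd, LinearMap.coe_mk, AddHom.coe_mk]
  rw [compEnd_apply, hφ.loc (Function.update m (f x) _ ∘ f) _ (update_comp_of hf m h.mem _),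
    hφ.zsmul' _ h.mem, sg_smul, sg_smul, sg_smul]
  congr 1
  · have := exp_rel_comp h h' hf hg hk h1 h2 q (fun i => ((m i).deg : ZMod 2))
    simp only [Function.comp_def] at this ⊢
    rw [this, ← add_assoc]
    congr 3
    apply relExp_congr
    intro i hi
    rw [deg_upd]
    by_cases e : i = x
    · subst e
      rw [Function.update_self, if_pos rfl, degs_cast_block, sum_bijOn hg]
      congr 1
      apply Finset.sum_congr rfl; intro i hi
      rw [h2 hi]
    · rw [Function.update_of_ne e, if_neg fun e' => e (hf.injOn hi h.mem e')]
  · refine congrFun (congrFun (hφ.loc _ _ fun j hj => ?_) _) _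
    by_cases e : j = x
    · subst e; simp
    · rw [Function.update_of_ne e, Function.update_of_ne e]
      simp only [Function.comp]
      rw [h1 (Finset.mem_coe.2 (Finset.mem_erase.2 ⟨e, hj⟩))]

theorem ins_erase_seq {A : Finset ℕ} {x : ℕ} {B C : Finset ℕ} {y : ℕ} {D E F : Finset ℕ}
    (h₁ : Ins A x B C) (h₂ : Ins C y D F) (h₃ : Ins B y D E) :
    C.erase y = A.erase x ∪ B.erase y := by
  rw [h₁.eq, Finset.erase_union_distrib, Finset.erase_eq_of_notMem (h₁.notMem_left h₃.mem)]

theorem exp_seq {A : Finset ℕ} {x : ℕ} {B C : Finset ℕ} {y : ℕ} {D E F : Finset ℕ}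
    (h₁ : Ins A x B C) (h₂ : Ins C y D F) (h₃ : Ins B y D E) (h₄ : Ins A x E F)
    (j l : ZMod 2) (κ : ℕ → ZMod 2) :
    compExp C y D l κ + compExp A x B j (Function.update κ y (l + ∑ d ∈ D, κ d)) =
      compExp A x E (j + l) κ + compExp B y D l κ := by
  have hy : y ∉ A.erase x := h₁.notMem_left h₃.mem
  unfold compExp
  rw [ins_erase_seq h₁ h₂ h₃, Finset.sum_union (Finset.disjoint_of_subset_right
    (Finset.erase_subset _ _) h₁.disj)]
  rw [add_right_comm, ← Finset.sum_add_distrib]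
  congr 1
  apply Finset.sum_congr rfl; intro a ha
  have hay : a ≠ y := fun e => hy (e ▸ ha)
  have hax := Finset.ne_of_mem_erase ha
  rw [Function.update_of_ne hay, h₃.sum, ← Finset.add_sum_erase B _ h₃.mem, Function.update_self,
    Finset.sum_congr (s₁ := B.erase y) rfl fun b hb => by
      rw [Function.update_of_ne (Finset.ne_of_mem_erase hb)]]
  simp only [add_mul, Finset.sum_add_distrib, ← Finset.mul_sum]
  rw [lo_swap hax, lo_swap hay]
  generalize ∑ i ∈ D, lo i a * κ i = s1
  generalize ∑ i ∈ D, κ i = s2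
  generalize ∑ i ∈ B.erase y, lo i a * κ i = s3
  generalize ∑ i ∈ B.erase y, κ i = s4
  generalize lo a x = a1
  generalize lo a y = a2
  generalize κ a = a3
  have := z2 (l * a2 * a3)
  have := z2 (s2 * a2 * a3)
  have := z2 (s2 * a3)
  have := z2 (l * a3)
  grind

theorem exp_par {A : Finset ℕ} {x : ℕ} {B C : Finset ℕ} {y : ℕ} {D E F : Finset ℕ} (hxy : x ≠ y)
    (h₁ : Ins A x B C) (h₂ : Ins C y D F) (h₃ : Ins A y D E) (h₄ : Ins E x B F)
    (j l : ZMod 2) (κ : ℕ → ZMod 2) :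
    compExp C y D l κ + compExp A x B j (Function.update κ y (l + ∑ d ∈ D, κ d)) =
      j * l + (compExp E x B j κ +
        compExp A y D l (Function.update κ x (j + ∑ b ∈ B, κ b))) := by
  have hxA := h₁.mem
  have hyA := h₃.mem
  have hyB : y ∉ B := h₁.notMem_right (Finset.mem_erase.2 ⟨hxy.symm, hyA⟩)
  have hxD : x ∉ D := h₃.notMem_right (Finset.mem_erase.2 ⟨hxy, hxA⟩)
  have hC : C.erase y = (A.erase x).erase y ∪ B := by
    rw [h₁.eq, Finset.erase_union_distrib, Finset.erase_eq_of_notMem hyB]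
  have hE : E.erase x = (A.erase x).erase y ∪ D := by
    rw [h₃.eq, Finset.erase_union_distrib, Finset.erase_eq_of_notMem hxD, Finset.erase_right_comm]
  have hBD : ∀ b ∈ B, ∀ d ∈ D, b ≠ d := by
    rintro b hb _ hd rfl
    refine h₂.notMem_left hd (Finset.mem_erase.2 ⟨?_, h₁.mem_iff.2 (Or.inr hb)⟩)
    rintro rfl; exact hyB hb
  have hR1 : ∀ r ∈ (A.erase x).erase y, r ≠ x ∧ r ≠ y := by
    intro r hr
    simp only [Finset.mem_erase] at hr
    exact ⟨hr.2.1, hr.1⟩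
  unfold compExp
  rw [hC, hE, Finset.sum_union (Finset.disjoint_of_subset_left (Finset.erase_subset _ _) h₁.disj),
    Finset.sum_union (Finset.disjoint_of_subset_left
      (by rw [Finset.erase_right_comm]; exact Finset.erase_subset _ _) h₃.disj),
    ← Finset.add_sum_erase (A.erase x) _ (Finset.mem_erase.2 ⟨hxy.symm, hyA⟩),
    ← Finset.add_sum_erase (A.erase y) _ (Finset.mem_erase.2 ⟨hxy, hxA⟩), Finset.erase_right_comm]
  rw [Function.update_self, Function.update_self]
  have k1 : ∀ j', ∑ i ∈ B, (lo i j' + lo x j') * Function.update κ y (l + ∑ d ∈ D, κ d) i =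
      ∑ i ∈ B, (lo i j' + lo x j') * κ i := fun j' => Finset.sum_congr rfl fun i hi => by
    rw [Function.update_of_ne (by rintro rfl; exact hyB hi)]
  have k2 : ∀ j', ∑ i ∈ D, (lo i j' + lo y j') * Function.update κ x (j + ∑ d ∈ B, κ d) i =
      ∑ i ∈ D, (lo i j' + lo y j') * κ i := fun j' => Finset.sum_congr rfl fun i hi => by
    rw [Function.update_of_ne (by rintro rfl; exact hxD hi)]
  simp only [k1, k2]
  have k3 : ∑ r ∈ (A.erase y).erase x, (j * lo r x + ∑ i ∈ B, (lo i r + lo x r) * κ i) *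
      Function.update κ y (l + ∑ d ∈ D, κ d) r =
      ∑ r ∈ (A.erase y).erase x, (j * lo r x + ∑ i ∈ B, (lo i r + lo x r) * κ i) * κ r :=
    Finset.sum_congr rfl fun r hr => by
      rw [Finset.erase_right_comm] at hr
      rw [Function.update_of_ne (hR1 r hr).2]
  have k4 : ∑ r ∈ (A.erase y).erase x, (l * lo r y + ∑ i ∈ D, (lo i r + lo y r) * κ i) *
      Function.update κ x (j + ∑ d ∈ B, κ d) r =
      ∑ r ∈ (A.erase y).erase x, (l * lo r y + ∑ i ∈ D, (lo i r + lo y r) * κ i) * κ r :=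
    Finset.sum_congr rfl fun r hr => by
      rw [Finset.erase_right_comm] at hr
      rw [Function.update_of_ne (hR1 r hr).1]
  rw [k3, k4]
  have key : ∑ b ∈ B, (l * lo b y + ∑ d ∈ D, (lo d b + lo y b) * κ d) * κ b +
      (j * lo y x + ∑ b ∈ B, (lo b y + lo x y) * κ b) * (l + ∑ d ∈ D, κ d) =
      j * l + (∑ d ∈ D, (j * lo d x + ∑ b ∈ B, (lo b d + lo x d) * κ b) * κ d +
        (l * lo x y + ∑ d ∈ D, (lo d x + lo y x) * κ d) * (j + ∑ b ∈ B, κ b)) := by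
    have c1 : ∑ b ∈ B, (l * lo b y + ∑ d ∈ D, (lo d b + lo y b) * κ d) * κ b =
        l * ∑ b ∈ B, lo b y * κ b + ∑ b ∈ B, ∑ d ∈ D, lo d b * κ d * κ b +
          (∑ b ∈ B, lo y b * κ b) * ∑ d ∈ D, κ d := by
      rw [Finset.mul_sum, Finset.sum_mul, ← Finset.sum_add_distrib, ← Finset.sum_add_distrib]
      apply Finset.sum_congr rfl; intro b hb
      simp only [add_mul, Finset.sum_add_distrib, ← Finset.mul_sum, ← Finset.sum_mul]
      ring
    have c2 : ∑ d ∈ D, (j * lo d x + ∑ b ∈ B, (lo b d + lo x d) * κ b) * κ d =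
        j * ∑ d ∈ D, lo d x * κ d + ∑ b ∈ B, ∑ d ∈ D, lo b d * κ d * κ b +
          (∑ d ∈ D, lo x d * κ d) * ∑ b ∈ B, κ b := by
      rw [Finset.sum_comm, Finset.mul_sum, Finset.sum_mul, ← Finset.sum_add_distrib,
        ← Finset.sum_add_distrib]
      apply Finset.sum_congr rfl; intro b hb
      simp only [add_mul, Finset.sum_add_distrib, ← Finset.mul_sum, ← Finset.sum_mul]
      rw [Finset.sum_congr (s₁ := B) rfl fun i _ => mul_right_comm (lo i b) (κ b) (κ i),
        ← Finset.sum_mul]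
      ring
    have c3 : ∑ b ∈ B, ∑ d ∈ D, lo d b * κ d * κ b + ∑ b ∈ B, ∑ d ∈ D, lo b d * κ d * κ b =
        (∑ b ∈ B, κ b) * ∑ d ∈ D, κ d := by
      rw [Finset.sum_mul_sum, ← Finset.sum_add_distrib]
      apply Finset.sum_congr rfl; intro b hb
      rw [← Finset.sum_add_distrib]
      apply Finset.sum_congr rfl; intro d hd
      have := lo_add (hBD b hb d hd) (κ d * κ b)
      linear_combination this
    have c4 : ∑ b ∈ B, lo b y * κ b + ∑ b ∈ B, lo y b * κ b = ∑ b ∈ B, κ b := by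
      rw [← Finset.sum_add_distrib]
      apply Finset.sum_congr rfl; intro b hb
      exact lo_add (by rintro rfl; exact hyB hb) _
    have c5 : ∑ d ∈ D, lo d x * κ d + ∑ d ∈ D, lo x d * κ d = ∑ d ∈ D, κ d := by
      rw [← Finset.sum_add_distrib]
      apply Finset.sum_congr rfl; intro d hd
      exact lo_add (by rintro rfl; exact hxD hd) _
    rw [c1, c2]
    simp only [add_mul (lo _ _), Finset.sum_add_distrib, ← Finset.mul_sum]
    rw [lo_swap hxy]
    generalize ∑ b ∈ B, ∑ d ∈ D, lo d b * κ d * κ b = X at *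
    generalize ∑ b ∈ B, ∑ d ∈ D, lo b d * κ d * κ b = X' at *
    generalize ∑ b ∈ B, lo b y * κ b = p1 at *
    generalize ∑ b ∈ B, lo y b * κ b = p2 at *
    generalize ∑ d ∈ D, lo d x * κ d = q1 at *
    generalize ∑ d ∈ D, lo x d * κ d = q2 at *
    generalize ∑ b ∈ B, κ b = P at *
    generalize ∑ d ∈ D, κ d = R at *
    generalize lo x y = a at *
    subst c4 c5
    obtain rfl : X' = X + (p1 + p2) * (q1 + q2) := by
      have := z2 X
      linear_combination c3 - this
    clear c3 c1 c2 k1 k2 k3 k4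
    revert j l a X p1 p2 q1 q2
    decide
  linear_combination key

end RightMod

end

section

variable {K : Type u} [Field K]

namespace RightMod
variable {Q : DGOperad.{u, w} K} {M : RightMod Q}

theorem block_compEnd {B : Finset ℕ} {y : ℕ} {D E : Finset ℕ} (h : Ins B y D E) {j l : ℤ}
    {ψ χ : M.PreEnd} (m : ℕ → M.Elt) :
    block E (j + l) (compEnd B y D l ψ χ) m =
      ⟨(block B j ψ (Function.update m y (block D l χ m))).ar,
        (block B j ψ (Function.update m y (block D l χ m))).deg,
        sg (compExp B y D l fun i => (m i).deg) •
          (block B j ψ (Function.update m y (block D l χ m))).val⟩ := by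
  have e1 : (E.biUnion fun i => (m i).ar) =
      B.biUnion fun i => (Function.update m y (block D l χ m) i).ar := by
    ext n
    simp only [Finset.mem_biUnion, h.mem_iff, Finset.mem_erase, ar_upd, block]
    constructor
    · rintro ⟨i, hi | hi, hn⟩
      · exact ⟨i, hi.2, by rw [if_neg hi.1]; exact hn⟩
      · exact ⟨y, h.mem, by rw [if_pos rfl, Finset.mem_biUnion]; exact ⟨i, hi, hn⟩⟩
    · rintro ⟨i, hi, hn⟩
      by_cases e : i = y
      · rw [if_pos e, Finset.mem_biUnion] at hn
        obtain ⟨i, hi, hn⟩ := hn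
        exact ⟨i, Or.inr hi, hn⟩
      · rw [if_neg e] at hn
        exact ⟨i, Or.inl ⟨e, hi⟩, hn⟩
  have e2 : j + l + ∑ i ∈ E, (m i).deg =
      j + ∑ i ∈ B, (Function.update m y (block D l χ m) i).deg := by
    rw [sum_deg_upd m h.mem, h.sum, ← Finset.add_sum_erase B _ h.mem]
    simp only [block]
    ring
  conv_lhs => unfold block
  rw [e1, e2]
  rfl

theorem compEnd_seq {A : Finset ℕ} {x : ℕ} {B C : Finset ℕ} {y : ℕ} {D E F : Finset ℕ}
    (h₁ : Ins A x B C) (h₂ : Ins C y D F) (h₃ : Ins B y D E) (h₄ : Ins A x E F)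
    {i j l : ℤ} {φ ψ χ : M.PreEnd} (hφ : IsEnd A i φ) :
    compEnd C y D l (compEnd A x B j φ ψ) χ =
      compEnd A x E (j + l) φ (compEnd B y D l ψ χ) := by
  funext m N r
  rw [compEnd_apply, compEnd_apply, compEnd_apply, block_compEnd h₃, hφ.zsmul' m h₁.mem,
    hφ.upd_x _ _ (h₁.notMem_left h₃.mem), sg_smul, sg_smul, degs_upd, degs_cast_block]
  congr 2
  push_cast
  exact exp_seq h₁ h₂ h₃ h₄ _ _ _

theorem compEnd_par {A : Finset ℕ} {x : ℕ} {B C : Finset ℕ} {y : ℕ} {D E F : Finset ℕ}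
    (hxy : x ≠ y) (h₁ : Ins A x B C) (h₂ : Ins C y D F) (h₃ : Ins A y D E) (h₄ : Ins E x B F)
    {j l : ℤ} {φ ψ χ : M.PreEnd} (hψ : IsEnd B j ψ) (hχ : IsEnd D l χ) :
    compEnd C y D l (compEnd A x B j φ ψ) χ =
      sg (j * l) • compEnd E x B j (compEnd A y D l φ χ) ψ := by
  have hyB : y ∉ B := h₁.notMem_right (Finset.mem_erase.2 ⟨hxy.symm, h₃.mem⟩)
  have hxD : x ∉ D := h₃.notMem_right (Finset.mem_erase.2 ⟨hxy, h₁.mem⟩)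
  funext m N r
  simp only [Pi.smul_apply]
  rw [compEnd_apply, compEnd_apply, compEnd_apply, compEnd_apply, block_upd hψ m hyB,
    block_upd hχ m hxD, Function.update_comm hxy, sg_smul, sg_smul, sg_smul, degs_upd, degs_upd,
    degs_cast_block, degs_cast_block]
  congr 2
  rw [add_assoc]
  exact exp_par hxy h₁ h₂ h₃ h₄ _ _ _

theorem compEnd_add_right {J : Finset ℕ} {x : ℕ} {I C : Finset ℕ} (h : Ins J x I C) {p q : ℤ}
    {φ ψ ψ' : M.PreEnd} (hφ : IsEnd J p φ) :
    compEnd J x I q φ (ψ + ψ') = compEnd J x I q φ ψ + compEnd J x I q φ ψ' := by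
  funext m N r
  simp only [Pi.add_apply, compEnd_apply]
  rw [← smul_add]
  congr 1
  exact (hφ.lin m x h.mem _ _ N r).map_add _ _

theorem compEnd_smul_right {J : Finset ℕ} {x : ℕ} {I C : Finset ℕ} (h : Ins J x I C) {p q : ℤ}
    {φ ψ : M.PreEnd} (hφ : IsEnd J p φ) (c : K) :
    compEnd J x I q φ (c • ψ) = c • compEnd J x I q φ ψ := by
  funext m N r
  simp only [Pi.smul_apply, compEnd_apply]
  rw [smul_comm c]
  congr 1
  exact (hφ.lin m x h.mem _ _ N r).map_smul _ _

/-- The composition in the endomorphism operad. -/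
def compEndL (M : RightMod Q) {J : Finset ℕ} {x : ℕ} {I C : Finset ℕ} (h : Ins J x I C)
    {i j n : ℤ} (hn : i + j = n) : endSub M J i →ₗ[K] endSub M I j →ₗ[K] endSub M C n :=
  LinearMap.mk₂ K (fun φ ψ => ⟨compEnd J x I j φ.1 ψ.1, φ.2.compEnd h hn ψ.2⟩)
    (fun φ φ' ψ => Subtype.ext (by
      funext m N r
      simp [compEnd_apply]))
    (fun c φ ψ => Subtype.ext (by
      funext m N r
      simp [compEnd_apply, smul_comm c]))
    (fun φ ψ ψ' => Subtype.ext (compEnd_add_right h φ.2))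
    (fun c φ ψ => Subtype.ext (compEnd_smul_right h φ.2 c))

/-- The differential of the endomorphism operad. -/
def dEndL (M : RightMod Q) (J : Finset ℕ) {i j : ℤ} (h : i + 1 = j) :
    endSub M J i →ₗ[K] endSub M J j :=
  ((dEnd J i).comp (endSub M J i).subtype).codRestrict _ fun φ => IsEnd.dEnd h φ.2

/-- The relabelling of inputs in the endomorphism operad. -/
def relEndL (M : RightMod Q) {J J' : Finset ℕ} (f : ℕ → ℕ) (hf : Set.BijOn f J J') (i : ℤ) :
    endSub M J i →ₗ[K] endSub M J' i :=
  ((relEnd J f).comp (endSub M J i).subtype).codRestrict _ fun φ => IsEnd.relEnd hf φ.2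

variable (M) in
/-- The complex of morphisms of right `Q`-modules `M ^ ⊗ J → M`. -/
def endCx (J : Finset ℕ) : Cx.{u, w} K where
  X i := ModuleCat.of K (endSub M J i)
  d i j := if h : i + 1 = j then ModuleCat.ofHom (dEndL M J h) else 0
  shape i j h := dif_neg h
  d_comp_d' i j k h h' := by
    obtain rfl : i + 1 = j := h
    obtain rfl : i + 1 + 1 = k := h'
    rw [dif_pos rfl, dif_pos rfl]
    apply ModuleCat.hom_ext
    apply LinearMap.ext
    intro φ
    exact Subtype.ext (dEnd_dEnd rfl φ.2)

theorem endCx_d (J : Finset ℕ) {i j : ℤ} (h : i + 1 = j) (φ : endSub M J i) :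
    (endCx M J).d i j φ = dEndL M J h φ := by
  simp only [endCx, dif_pos h]
  rfl

variable (M) in
/-- The endomorphism operad of a right `Q`-module: its operations with set of inputs `J` are the
morphisms of right `Q`-modules `M ^ ⊗ J → M`. -/
def End : NUOperad.{u, w} K where
  X J := endCx M J
  rel f hf :=
    { f := fun i => ModuleCat.ofHom (relEndL M f hf i)
      comm' := by
        intro i j h
        obtain rfl : i + 1 = j := h
        apply ModuleCat.hom_ext
        apply LinearMap.ext
        intro φ
        refine (endCx_d _ rfl _).trans (Eq.trans ?_
          (congrArg (relEndL M f hf (i + 1)) (endCx_d _ rfl φ)).symm)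
        exact Subtype.ext (dEnd_relEnd hf φ.2) }
  comp h _ _ _ hn := compEndL M h hn
  rel_congr f g hf hg h := by
    ext i φ
    exact Subtype.ext (relEnd_congr h φ.2)
  rel_id h := by
    ext i φ
    exact Subtype.ext (relEnd_id _ φ.1)
  rel_trans f g hf hg h := by
    ext i φ
    exact Subtype.ext (relEnd_comp hf hg.injOn φ.1)
  d_comp h := by
    intro i j n i' j' n' hn hi hj hn' φ ψ
    subst hi hj
    refine (endCx_d _ hn' _).trans ?_
    refine Eq.trans ?_ (congrArg₂ (fun a b => compEndL M h _ a ψ + sg i • compEndL M h _ φ b)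
      (endCx_d _ rfl φ) (endCx_d _ rfl ψ)).symm
    exact Subtype.ext (dEnd_compEnd h hn φ.2 ψ.2)
  rel_comp h f g k h' hf hg hk h1 h2 := by
    intro i j n hn φ ψ
    exact Subtype.ext (relEnd_compEnd h h' hf hg hk h1 h2 φ.2 ψ.2)
  assoc_seq h₁ h₂ h₃ h₄ := by
    intro i j l m n p hm hn hp hq φ ψ χ
    subst hp
    exact Subtype.ext (compEnd_seq h₁ h₂ h₃ h₄ φ.2)
  assoc_par hxy h₁ h₂ h₃ h₄ := by
    intro i j l m n p hm hn hp hq φ ψ χ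
    exact Subtype.ext (compEnd_par hxy h₁ h₂ h₃ h₄ ψ.2 χ.2)

end RightMod

end

section

variable {K : Type u} [Field K]

namespace RightMod
variable {Q : DGOperad.{u, w} K}

/-- The image of an element under a morphism of right modules. -/
def Elt.map {M N : RightMod Q} (F : M ⟶ N) (e : M.Elt) : N.Elt :=
  ⟨e.ar, e.deg, (Hom.app F e.ar).f e.deg e.val⟩

section conj
variable {M N : RightMod Q} (ι : N ⟶ M) (π : M ⟶ N)

theorem map_upd (m : ℕ → M.Elt) (j : ℕ) (e : M.Elt) :
    (fun i => (Function.update m j e i).map π) =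
      Function.update (fun i => (m i).map π) j (e.map π) := by
  funext i
  by_cases h : i = j
  · subst h; simp
  · simp [h]

theorem Elt.map_d (e : M.Elt) : e.d.map π = (e.map π).d := by
  simp only [Elt.map, Elt.d, Elt.mk.injEq, heq_eq_eq, true_and]
  exact (congrArg (fun t => (ModuleCat.Hom.hom t) e.val)
    ((Hom.app π e.ar).comm e.deg (e.deg + 1))).symm

theorem Hom.app_rel {M N : RightMod Q} (F : M ⟶ N) {A B : Finset ℕ} (f : ℕ → ℕ)
    (hf : Set.BijOn f (A : Set ℕ) B) (i : ℤ) (a : (M.X A).X i) :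
    (Hom.app F B).f i ((M.rel f hf).f i a) = (N.rel f hf).f i ((Hom.app F A).f i a) :=
  congrArg (fun t => (ModuleCat.Hom.hom (HomologicalComplex.Hom.f t i)) a) (Hom.rel F f hf)

theorem Hom.app_d {M N : RightMod Q} (F : M ⟶ N) {A : Finset ℕ} (i j : ℤ) (a : (M.X A).X i) :
    (Hom.app F A).f j ((M.X A).d i j a) = (N.X A).d i j ((Hom.app F A).f i a) :=
  (congrArg (fun t => (ModuleCat.Hom.hom t) a) ((Hom.app F A).comm i j)).symm

/-- Pre- and postcomposition with `π` and `ι`. -/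
def conjPre : N.PreEnd →ₗ[K] M.PreEnd where
  toFun φ m B r := (Hom.app ι B).f r (φ (fun i => (m i).map π) B r)
  map_add' φ ψ := by funext m B r; simp
  map_smul' c φ := by funext m B r; simp

theorem conjPre_apply (φ : N.PreEnd) (m B r) :
    conjPre ι π φ m B r = (Hom.app ι B).f r (φ (fun i => (m i).map π) B r) := rfl

theorem IsEnd.conj {J : Finset ℕ} {d : ℤ} {φ : N.PreEnd} (hφ : IsEnd J d φ) :
    IsEnd J d (conjPre ι π φ) := by
  constructor
  · intro m B r h
    exact hφ.supp _ _ _ fun e => h (by rw [conjPre_apply, e, map_zero])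
  · intro m m' h
    funext B r
    rw [conjPre_apply, conjPre_apply, hφ.loc _ (fun i => (m' i).map π)]
    intro j hj
    rw [h j hj]
  · intro m j hj A k B r
    have : (fun u : (M.X A).X k => conjPre ι π φ (Function.update m j ⟨A, k, u⟩) B r) =
        ((Hom.app ι B).f r).hom ∘ₗ (hφ.lin (fun i => (m i).map π) j hj A k B r).mk' ∘ₗ
          ((Hom.app π A).f k).hom := by
      funext u
      rw [conjPre_apply, map_upd]
      rfl
    rw [this]
    exact LinearMap.isLinear _
  · intro m m' B B' f hf hP h r
    rw [conjPre_apply, conjPre_apply, hφ.rel (fun i => (m i).map π) _ B B' f hf hP, Hom.app_rel]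
    intro j hj
    obtain ⟨D, hD, e⟩ := h j hj
    refine ⟨D, hD, ?_⟩
    rw [e]
    simp only [Elt.map, Elt.rel, Elt.mk.injEq, heq_eq_eq, true_and]
    exact Hom.app_rel π f hD _ _
  · intro m j hj e x B C D D' h h' hP l n r r' hn hr q
    have e1 : (e.act h hn q).map π = Elt.act (e.map π) h hn q := by
      simp only [Elt.map, Elt.act, Elt.mk.injEq, heq_eq_eq, true_and]
      exact Hom.act π h hn e.val q
    rw [conjPre_apply, conjPre_apply, map_upd, map_upd, e1,
      hφ.act _ j hj (e.map π) h h' (N := D) _ hn hr q, map_zsmul, Hom.act]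
    · rfl
    · rw [← map_upd]; exact hP

theorem map_map_id (hπ : ι ≫ π = 𝟙 N) (A : Finset ℕ) (i : ℤ) (a : (N.X A).X i) :
    (Hom.app π A).f i ((Hom.app ι A).f i a) = a :=
  congrArg (fun t => (ModuleCat.Hom.hom (HomologicalComplex.Hom.f (Hom.app t A) i)) a) hπ

/-- The morphism of (non-unital) operads `φ ↦ ι φ π`. -/
def conj (hπ : ι ≫ π = 𝟙 N) : N.End ⟶ M.End where
  app J :=
    { f := fun i => ModuleCat.ofHom
        (((conjPre ι π).comp (endSub N J i).subtype).codRestrict (endSub M J i)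
          fun φ => IsEnd.conj ι π φ.2)
      comm' := by
        intro i j h
        obtain rfl : i + 1 = j := h
        apply ModuleCat.hom_ext
        apply LinearMap.ext
        intro φ
        refine (endCx_d _ rfl _).trans (Eq.trans ?_ (congrArg
          (((conjPre ι π).comp (endSub N J (i + 1)).subtype).codRestrict (endSub M J (i + 1))
          fun φ => IsEnd.conj ι π φ.2) (endCx_d _ rfl φ)).symm)
        apply Subtype.ext
        funext m B r
        change dEnd J i (conjPre ι π φ.1) m B r = conjPre ι π (dEnd J i φ.1) m B r
        rw [conjPre_apply, dEnd_apply _ _ _ (sub_add_cancel r 1),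
          dEnd_apply _ _ _ (sub_add_cancel r 1), map_sub, map_zsmul, map_sum, conjPre_apply,
          Hom.app_d]
        congr 2
        apply Finset.sum_congr rfl
        intro j hj
        rw [conjPre_apply, map_upd, Elt.map_d, map_zsmul]
        rfl }
  rel f hf := by
    ext i φ
    apply Subtype.ext
    funext m B r
    exact map_zsmul ((Hom.app ι B).f r).hom _ _
  comp := by
    intro A x B C h i j n hn φ ψ
    apply Subtype.ext
    funext m D r
    change conjPre ι π (compEnd A x B j φ.1 ψ.1) m D r =
      compEnd A x B j (conjPre ι π φ.1) (conjPre ι π ψ.1) m D r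
    have hb : (block B j (conjPre ι π ψ.1) m).map π = block B j ψ.1 (fun i => (m i).map π) := by
      unfold block Elt.map
      simp only [Elt.mk.injEq, heq_eq_eq, true_and]
      exact map_map_id ι π hπ _ _ _
    rw [conjPre_apply, compEnd_apply, compEnd_apply, map_zsmul, conjPre_apply, map_upd, hb]
    rfl

end conj

section ev

/-- The units of an operad. -/
def units (Q : DGOperad.{u, w} K) : ℕ → Q.regular.Elt := fun j => ⟨{j}, 0, Q.one j⟩

theorem units_part (Q : DGOperad.{u, w} K) (J : Finset ℕ) :
    Part (fun j : J => (units Q j).ar) J := by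
  rw [part_iff (A := fun j => (units Q j).ar)]
  simp [units]

theorem block_units (I : Finset ℕ) (q : ℤ) (ψ : Q.regular.PreEnd) :
    block I q ψ (units Q) = ⟨I, q, ψ (units Q) I q⟩ := by
  have e1 : (I.biUnion fun i => (units Q i).ar) = I := by simp [units]
  have e2 : q + ∑ i ∈ I, (units Q i).deg = q := by simp [units]
  unfold block
  rw [e1, e2]

/-- The morphism of (non-unital) operads from the endomorphisms of the right module `Q` to `Q`,
given by evaluation at the units. -/
def ev (Q : DGOperad.{u, w} K) : Q.regular.End ⟶ Q.toNUOperad where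
  app J :=
    { f := fun i => ModuleCat.ofHom
        (((LinearMap.proj i ∘ₗ LinearMap.proj J ∘ₗ LinearMap.proj (units Q)) :
          Q.regular.PreEnd →ₗ[K] (Q.X J).X i).comp (endSub Q.regular J i).subtype)
      comm' := by
        intro i j h
        obtain rfl : i + 1 = j := h
        apply ModuleCat.hom_ext
        apply LinearMap.ext
        intro φ
        refine Eq.trans ?_ (congrArg (fun φ : endSub Q.regular J (i + 1) => φ.1 (units Q) J (i + 1))
          (endCx_d _ rfl φ)).symm
        change (Q.X J).d i (i + 1) (φ.1 (units Q) J i) = dEnd J i φ.1 (units Q) J (i + 1)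
        rw [dEnd_apply _ _ _ rfl, Finset.sum_eq_zero, smul_zero, sub_zero]
        · rfl
        · intro j hj
          have : (units Q j).d = ⟨{j}, 0 + 1, 0⟩ := by
            simp only [units, Elt.d, Elt.mk.injEq, heq_eq_eq, true_and]
            exact Q.d_one j
          rw [this, φ.2.zero' _ hj, smul_zero] }
  rel {A B} f hf := by
    ext i φ
    change sg (relExp A f fun i => (units Q (f i)).deg) • φ.1 (units Q ∘ f) B i =
      (Q.rel f hf).f i (φ.1 (units Q) A i)
    have h0 : relExp A f (fun i => ((units Q (f i)).deg : ZMod 2)) = 0 := by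
      simp [relExp, units]
    rw [h0, sg_zero, one_smul]
    refine φ.2.rel (units Q) (units Q ∘ f) A B f hf (units_part Q A) ?_ i
    intro j hj
    have hj' : Set.BijOn f ({j} : Finset ℕ) ({f j} : Finset ℕ) := by simp
    refine ⟨{f j}, hj', ?_⟩
    exact congrArg (Elt.mk (M := Q.regular) {f j} 0) (Q.rel_one j f hj').symm
  comp {A x B C} h i j n hn φ ψ := by
    change compEnd A x B j φ.1 ψ.1 (units Q) C n =
      Q.comp h hn (φ.1 (units Q) A i) (ψ.1 (units Q) B j)
    have h0 : compExp A x B j (fun i => ((units Q i).deg : ZMod 2)) = 0 := by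
      simp [compExp, units]
    rw [compEnd_apply, h0, sg_zero, one_smul, block_units]
    have hx : Ins {x} x B B := ⟨by simp, by simp, by simp⟩
    have h1 : (units Q x).act hx (zero_add j) (ψ.1 (units Q) B j) =
        ⟨B, j, ψ.1 (units Q) B j⟩ := by
      simp only [units, Elt.act, Elt.mk.injEq, heq_eq_eq, true_and]
      exact Q.one_comp hx _ _
    have h2 : (j : ZMod 2) * ∑ i ∈ A, lo x i * ((units Q i).deg : ZMod 2) = 0 := by
      simp [units]
    have h3 := φ.2.act (units Q) x h.mem (units Q x) hx h
      (by rw [Function.update_eq_self]; exact units_part Q A) (zero_add j) hn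
      (ψ.1 (units Q) B j)
    rw [h2, sg_zero, one_smul, h1, Function.update_eq_self] at h3
    exact h3

end ev

end RightMod

end

section

variable {K : Type u} [Field K]

theorem ins_self (x : ℕ) (A : Finset ℕ) : Ins {x} x A A := ⟨by simp, by simp, by simp⟩

namespace RightMod
variable {Q : DGOperad.{u, w} K}

/-- An operation of the endomorphism operad, as a function. -/
def toPre (M : RightMod Q) {J : Finset ℕ} {d : ℤ} (φ : (M.End.X J).X d) : M.PreEnd :=
  (show M.endSub J d from φ).1

/-- The morphism of right modules `q ↦ e ∘ q` defined by a cocycle `e` of arity one. -/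
def unitMap (M : RightMod Q) (e : (M.X {0}).X 0) (he : (M.X {0}).d 0 1 e = 0) :
    Q.regular ⟶ M where
  app A :=
    { f := fun i => ModuleCat.ofHom (M.act (ins_self 0 A) (zero_add i) e)
      comm' := by
        intro i j h
        obtain rfl : i + 1 = j := h
        apply ModuleCat.hom_ext
        apply LinearMap.ext
        intro (q : (Q.X A).X i)
        refine (M.d_act (ins_self 0 A) (zero_add i) (zero_add 1) rfl rfl e q).trans ?_
        rw [he, map_zero, LinearMap.zero_apply, zero_add]
        exact one_smul ℤ _ }
  rel {A B} f hf := by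
    ext i q
    have hid : Set.BijOn id (({0} : Finset ℕ) : Set ℕ) ({0} : Finset ℕ) := Set.bijOn_id _
    have h := M.rel_act (ins_self 0 A) id f f (ins_self 0 B) hid hf hf (by simp)
      (fun _ _ => rfl) (zero_add i) e q
    rw [M.rel_id] at h
    exact h.symm
  act {A x B C} h i j n hn a b :=
    (M.assoc_seq (ins_self 0 A) h h (ins_self 0 C) (zero_add i) hn hn (zero_add n) e a b).symm

/-- Quasi-isomorphisms of right modules. -/
def IsQuasiIso {M N : RightMod Q} (F : M ⟶ N) : Prop := ∀ A, QuasiIso (Hom.app F A)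

/-- Cofibrations of right modules (in the projective model structure): the morphisms with the left
lifting property for all surjective quasi-isomorphisms. -/
def IsCofibration {M N : RightMod Q} (F : M ⟶ N) : Prop :=
  ∀ (X Y : RightMod Q) (G : X ⟶ Y), IsQuasiIso G →
    (∀ A i, Function.Surjective ((Hom.app G A).f i)) → HasLiftingProperty F G

end RightMod

/-- A bimodule over dg operads `P` (acting on the left) and `Q` (acting on the right). The left
action `P(J) ⊗ M(A₁) ⊗ ⋯ ⊗ M(Aₙ) ⟶ M(A₁ ⊔ ⋯ ⊔ Aₙ)`, which has to be associative, equivariant and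
compatible with the right action, is the same as a morphism of operads from `P` to the
endomorphism operad of the right module `M`. -/
structure Bimod (P Q : DGOperad.{u, w} K) extends RightMod Q where
  left : P.toNUOperad ⟶ toRightMod.End
  left_one : ∀ (x : ℕ) (m : ℕ → toRightMod.Elt),
    toRightMod.toPre ((NUOperad.Hom.app left {x}).f 0 (P.one x)) m (m x).ar (m x).deg = (m x).val

namespace Bimod
variable {P Q : DGOperad.{u, w} K}

/-- The left action: the value of `p ∈ P(J)` on the elements `m j`, `j ∈ J`, in the component of
arity `N` and degree `r`. -/
def lact (M : Bimod P Q) {J : Finset ℕ} {d : ℤ} (p : (P.X J).X d) : M.toRightMod.PreEnd :=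
  M.toRightMod.toPre ((NUOperad.Hom.app M.left J).f d p)

/-- The condition that a morphism of right modules between bimodules is compatible with the left
actions. -/
def IsLeftLinear {M N : Bimod P Q} (F : M.toRightMod ⟶ N.toRightMod) : Prop :=
  ∀ (J : Finset ℕ) (d : ℤ) (p : (P.X J).X d) (m : ℕ → M.toRightMod.Elt) (A : Finset ℕ) (r : ℤ),
    (RightMod.Hom.app F A).f r (M.lact p m A r) = N.lact p (fun j => (m j).map F) A r

/-- The condition that the bimodule `M` is an operadic right torsor, with the class of the cocycle
`e ∈ M(1)` as a generator of the cohomology of `M(1)`. -/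
structure IsTorsor (M : Bimod P Q) (e : (M.X {0}).X 0) : Prop where
  d_eq : (M.X {0}).d 0 1 e = 0
  exactAt : ∀ i : ℤ, i ≠ 0 → (M.X {0}).ExactAt i
  generates : ∀ z : (M.X {0}).X 0, (M.X {0}).d 0 1 z = 0 →
    ∃! c : K, ∃ y : (M.X {0}).X (-1), z = c • e + (M.X {0}).d (-1) 0 y
  quasiIso : RightMod.IsQuasiIso (M.toRightMod.unitMap e d_eq)

/-- A resolution of a bimodule `M` with a distinguished cocycle `e ∈ M(1)`: a quasi-isomorphism of
bimodules `N ⟶ M`, and a cocycle `one ∈ N(1)` over `e` such that the map `Q ⟶ N`,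
`q ↦ one ∘ q` is a cofibration of right modules. -/
structure Resolution (M : Bimod P Q) (e : (M.X {0}).X 0) where
  N : Bimod P Q
  p : N.toRightMod ⟶ M.toRightMod
  p_left : IsLeftLinear p
  p_quasiIso : RightMod.IsQuasiIso p
  one : (N.X {0}).X 0
  d_one : (N.X {0}).d 0 1 one = 0
  p_one : (RightMod.Hom.app p {0}).f 0 one = e
  cofibration : RightMod.IsCofibration (N.toRightMod.unitMap one d_one)

namespace Resolution
variable {M : Bimod P Q} {e : (M.X {0}).X 0} (R : Resolution M e)

/-- The map `Q ⟶ N`, `q ↦ one ∘ q`. -/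
def ι : Q.regular ⟶ R.N.toRightMod := R.N.toRightMod.unitMap R.one R.d_one

/-- The condition that the operad map up to homotopy defined by a resolution, and a retraction `π`
of the inclusion `ι` of `Q`, is homotopic to the operad map `g`. The former is the zigzag
`P ⟶ End_Q(N) ⟵ End_Q(Q) ⟶ Q`, where the map in the middle is `φ ↦ ι φ π`, the map on the right is
the isomorphism `φ ↦ φ(1, …, 1)`, and where both maps have to be quasi-isomorphisms; the maps
are compared in the homotopy category, the localization of the category of dg operads at the
quasi-isomorphisms. -/
structure Encodes (π : R.N.toRightMod ⟶ Q.regular) (hπ : R.ι ≫ π = 𝟙 Q.regular)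
    (g : P.toNUOperad ⟶ Q.toNUOperad) : Prop where
  quasiIso_conj : NUOperad.quasiIso (RightMod.conj R.ι π hπ)
  quasiIso_ev : NUOperad.quasiIso (RightMod.ev Q)
  homotopic : ∃ t : NUOperad.quasiIso.Q.obj P.toNUOperad ⟶
      NUOperad.quasiIso.Q.obj Q.regular.End,
    t ≫ NUOperad.quasiIso.Q.map (RightMod.conj R.ι π hπ) = NUOperad.quasiIso.Q.map R.N.left ∧
    t ≫ NUOperad.quasiIso.Q.map (RightMod.ev Q) = NUOperad.quasiIso.Q.map g

end Resolution
end Bimod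

end

section

/-- A finite set of inputs, with colours (the colours of the labels outside `set` are
irrelevant). -/
structure Ar (Γ : Type) where
  set : Finset ℕ
  col : ℕ → Γ

variable {Γ : Type}

/-- The set `A` of inputs, all of colour `c`. -/
def Ar.const (c : Γ) (A : Finset ℕ) : Ar Γ := ⟨A, fun _ => c⟩

/-- `f` restricts to a colour preserving bijection from `A` to `B`. -/
structure ReIn (f : ℕ → ℕ) (A B : Ar Γ) : Prop where
  bij : Set.BijOn f A.set B.set
  col : ∀ a ∈ A.set, B.col (f a) = A.col a

/-- `C` is the set of inputs obtained from `A` by replacing the input `x`, which has colour `c`, by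
the set of inputs `B`. -/
structure CIns (A : Ar Γ) (x : ℕ) (c : Γ) (B C : Ar Γ) : Prop where
  ins : Ins A.set x B.set C.set
  col : A.col x = c
  left : ∀ a ∈ A.set.erase x, C.col a = A.col a
  right : ∀ b ∈ B.set, C.col b = B.col b

/-- `A` consists of the single input `x`, of colour `c`. -/
structure IsOne (A : Ar Γ) (x : ℕ) (c : Γ) : Prop where
  set : A.set = {x}
  col : A.col x = c

/-- A topological operad with set of colours `Γ`, in terms of partial compositions: `X c A` is the
space of operations with output colour `c` and inputs `A`, and `comp` inserts an operation into the
input `x` of another one. -/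
structure TopOperad (Γ : Type) where
  X : Γ → Ar Γ → Type v
  [top : ∀ c A, TopologicalSpace (X c A)]
  rel : ∀ {c : Γ} {A B : Ar Γ} (f : ℕ → ℕ), ReIn f A B → C(X c A, X c B)
  comp : ∀ {c : Γ} {A : Ar Γ} {x : ℕ} {d : Γ} {B C : Ar Γ}, CIns A x d B C →
    C(X c A × X d B, X c C)
  one : ∀ {A : Ar Γ} {x : ℕ} {c : Γ}, IsOne A x c → X c A
  rel_congr : ∀ {c : Γ} {A B : Ar Γ} (f g : ℕ → ℕ) (hf : ReIn f A B) (hg : ReIn g A B),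
    Set.EqOn f g A.set → ∀ a : X c A, rel f hf a = rel g hg a
  rel_id : ∀ {c : Γ} {A : Ar Γ} (h : ReIn id A A) (a : X c A), rel id h a = a
  rel_trans : ∀ {c : Γ} {A B C : Ar Γ} (f g : ℕ → ℕ) (hf : ReIn f A B) (hg : ReIn g B C)
    (h : ReIn (g ∘ f) A C) (a : X c A), rel (g ∘ f) h a = rel g hg (rel f hf a)
  rel_comp : ∀ {c : Γ} {A : Ar Γ} {x : ℕ} {d : Γ} {B C A' B' C' : Ar Γ} (h : CIns A x d B C)
    (f g k : ℕ → ℕ) (h' : CIns A' (f x) d B' C') (hf : ReIn f A A') (hg : ReIn g B B')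
    (hk : ReIn k C C'), Set.EqOn k f (A.set.erase x) → Set.EqOn k g B.set →
    ∀ (a : X c A) (b : X d B), rel k hk (comp h (a, b)) = comp h' (rel f hf a, rel g hg b)
  assoc_seq : ∀ {c : Γ} {A : Ar Γ} {x : ℕ} {d : Γ} {B C : Ar Γ} {y : ℕ} {e : Γ} {D E F : Ar Γ}
    (h₁ : CIns A x d B C) (h₂ : CIns C y e D F) (h₃ : CIns B y e D E) (h₄ : CIns A x d E F)
    (a : X c A) (b : X d B) (z : X e D),
    comp h₂ (comp h₁ (a, b), z) = comp h₄ (a, comp h₃ (b, z))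
  assoc_par : ∀ {c : Γ} {A : Ar Γ} {x : ℕ} {d : Γ} {B C : Ar Γ} {y : ℕ} {e : Γ} {D E F : Ar Γ},
    x ≠ y → ∀ (h₁ : CIns A x d B C) (h₂ : CIns C y e D F) (h₃ : CIns A y e D E)
    (h₄ : CIns E x d B F) (a : X c A) (b : X d B) (z : X e D),
    comp h₂ (comp h₁ (a, b), z) = comp h₄ (comp h₃ (a, z), b)
  rel_one : ∀ {A B : Ar Γ} {x : ℕ} {c : Γ} (hA : IsOne A x c) (f : ℕ → ℕ) (hB : IsOne B (f x) c)
    (hf : ReIn f A B), rel f hf (one hA) = one hB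
  one_comp : ∀ {A : Ar Γ} {x : ℕ} {c : Γ} (hA : IsOne A x c) {B : Ar Γ} (h : CIns A x c B B)
    (b : X c B), comp h (one hA, b) = b
  comp_one : ∀ {c : Γ} {A : Ar Γ} {x : ℕ} {d : Γ} {B : Ar Γ} (hB : IsOne B x d)
    (h : CIns A x d B A) (a : X c A), comp h (a, one hB) = a

attribute [instance] TopOperad.top

/-- Change of colours. -/
def Ar.map {Δ : Type} (γ : Γ → Δ) (A : Ar Γ) : Ar Δ := ⟨A.set, fun n => γ (A.col n)⟩

theorem ReIn.map {Δ : Type} (γ : Γ → Δ) {f : ℕ → ℕ} {A B : Ar Γ} (h : ReIn f A B) :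
    ReIn f (A.map γ) (B.map γ) := ⟨h.bij, fun a ha => congrArg γ (h.col a ha)⟩

theorem CIns.map {Δ : Type} (γ : Γ → Δ) {A : Ar Γ} {x : ℕ} {d : Γ} {B C : Ar Γ}
    (h : CIns A x d B C) : CIns (A.map γ) x (γ d) (B.map γ) (C.map γ) :=
  ⟨h.ins, congrArg γ h.col, fun a ha => congrArg γ (h.left a ha),
    fun b hb => congrArg γ (h.right b hb)⟩

theorem IsOne.map {Δ : Type} (γ : Γ → Δ) {A : Ar Γ} {x : ℕ} {c : Γ} (h : IsOne A x c) :
    IsOne (A.map γ) x (γ c) := ⟨h.set, congrArg γ h.col⟩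

/-- Morphisms of topological operads over a map of the sets of colours. -/
structure TopOperad.Hom {Δ : Type} (γ : Γ → Δ) (S : TopOperad.{v} Γ) (T : TopOperad.{v} Δ) where
  app : ∀ c A, C(S.X c A, T.X (γ c) (A.map γ))
  rel : ∀ {c : Γ} {A B : Ar Γ} (f : ℕ → ℕ) (hf : ReIn f A B) (a : S.X c A),
    app c B (S.rel f hf a) = T.rel f (hf.map γ) (app c A a)
  comp : ∀ {c : Γ} {A : Ar Γ} {x : ℕ} {d : Γ} {B C : Ar Γ} (h : CIns A x d B C) (a : S.X c A)
    (b : S.X d B), app c C (S.comp h (a, b)) = T.comp (h.map γ) (app c A a, app d B b)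
  one : ∀ {A : Ar Γ} {x : ℕ} {c : Γ} (h : IsOne A x c),
    app c A (S.one h) = T.one (h.map γ)

variable (K : Type u) [Field K]

/-- A dg operad with set of colours `Γ`. -/
structure ColDGOperad (Γ : Type) where
  X : Γ → Ar Γ → Cx.{u, w} K
  rel : ∀ {c : Γ} {A B : Ar Γ} (f : ℕ → ℕ), ReIn f A B → (X c A ⟶ X c B)
  comp : ∀ {c : Γ} {A : Ar Γ} {x : ℕ} {d : Γ} {B C : Ar Γ}, CIns A x d B C →
    ∀ {i j n : ℤ}, i + j = n → ((X c A).X i →ₗ[K] (X d B).X j →ₗ[K] (X c C).X n)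
  one : ∀ {A : Ar Γ} {x : ℕ} {c : Γ}, IsOne A x c → (X c A).X 0
  rel_congr : ∀ {c : Γ} {A B : Ar Γ} (f g : ℕ → ℕ) (hf : ReIn f A B) (hg : ReIn g A B),
    Set.EqOn f g A.set → rel (c := c) f hf = rel g hg
  rel_id : ∀ {c : Γ} {A : Ar Γ} (h : ReIn id A A), rel id h = 𝟙 (X c A)
  rel_trans : ∀ {c : Γ} {A B C : Ar Γ} (f g : ℕ → ℕ) (hf : ReIn f A B) (hg : ReIn g B C)
    (h : ReIn (g ∘ f) A C), rel (c := c) (g ∘ f) h = rel f hf ≫ rel g hg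
  d_comp : ∀ {c : Γ} {A : Ar Γ} {x : ℕ} {d : Γ} {B C : Ar Γ} (h : CIns A x d B C)
    {i j n i' j' n' : ℤ} (hn : i + j = n) (hi : i + 1 = i') (hj : j + 1 = j') (hn' : n + 1 = n')
    (a : (X c A).X i) (b : (X d B).X j),
    (X c C).d n n' (comp h hn a b) =
      comp h (show i' + j = n' by omega) ((X c A).d i i' a) b +
      sg i • comp h (show i + j' = n' by omega) a ((X d B).d j j' b)
  rel_comp : ∀ {c : Γ} {A : Ar Γ} {x : ℕ} {d : Γ} {B C A' B' C' : Ar Γ} (h : CIns A x d B C)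
    (f g k : ℕ → ℕ) (h' : CIns A' (f x) d B' C') (hf : ReIn f A A') (hg : ReIn g B B')
    (hk : ReIn k C C'), Set.EqOn k f (A.set.erase x) → Set.EqOn k g B.set →
    ∀ {i j n : ℤ} (hn : i + j = n) (a : (X c A).X i) (b : (X d B).X j),
    (rel k hk).f n (comp h hn a b) = comp h' hn ((rel f hf).f i a) ((rel g hg).f j b)
  assoc_seq : ∀ {c : Γ} {A : Ar Γ} {x : ℕ} {d : Γ} {B C : Ar Γ} {y : ℕ} {e : Γ} {D E F : Ar Γ}
    (h₁ : CIns A x d B C) (h₂ : CIns C y e D F) (h₃ : CIns B y e D E) (h₄ : CIns A x d E F)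
    {i j l m n p : ℤ} (hm : i + j = m) (hn : m + l = n) (hp : j + l = p) (hq : i + p = n)
    (a : (X c A).X i) (b : (X d B).X j) (z : (X e D).X l),
    comp h₂ hn (comp h₁ hm a b) z = comp h₄ hq a (comp h₃ hp b z)
  assoc_par : ∀ {c : Γ} {A : Ar Γ} {x : ℕ} {d : Γ} {B C : Ar Γ} {y : ℕ} {e : Γ} {D E F : Ar Γ},
    x ≠ y → ∀ (h₁ : CIns A x d B C) (h₂ : CIns C y e D F) (h₃ : CIns A y e D E)
    (h₄ : CIns E x d B F)
    {i j l m n p : ℤ} (hm : i + j = m) (hn : m + l = n) (hp : i + l = p) (hq : p + j = n)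
    (a : (X c A).X i) (b : (X d B).X j) (z : (X e D).X l),
    comp h₂ hn (comp h₁ hm a b) z = sg (j * l) • comp h₄ hq (comp h₃ hp a z) b
  d_one : ∀ {A : Ar Γ} {x : ℕ} {c : Γ} (hA : IsOne A x c), (X c A).d 0 1 (one hA) = 0
  rel_one : ∀ {A B : Ar Γ} {x : ℕ} {c : Γ} (hA : IsOne A x c) (f : ℕ → ℕ) (hB : IsOne B (f x) c)
    (hf : ReIn f A B), (rel f hf).f 0 (one hA) = one hB
  one_comp : ∀ {A : Ar Γ} {x : ℕ} {c : Γ} (hA : IsOne A x c) {B : Ar Γ} (h : CIns A x c B B)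
    {n : ℤ} (hn : 0 + n = n) (b : (X c B).X n), comp h hn (one hA) b = b
  comp_one : ∀ {c : Γ} {A : Ar Γ} {x : ℕ} {d : Γ} {B : Ar Γ} (hB : IsOne B x d)
    (h : CIns A x d B A) {n : ℤ} (hn : n + 0 = n) (a : (X c A).X n), comp h hn a (one hB) = a

theorem ReIn.const {c : Γ} {A B : Finset ℕ} {f : ℕ → ℕ} (h : Set.BijOn f (A : Set ℕ) B) :
    ReIn f (Ar.const c A) (Ar.const c B) := ⟨h, fun _ _ => rfl⟩

theorem CIns.const {c : Γ} {A B C : Finset ℕ} {x : ℕ} (h : Ins A x B C) :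
    CIns (Ar.const c A) x c (Ar.const c B) (Ar.const c C) :=
  ⟨h, rfl, fun _ _ => rfl, fun _ _ => rfl⟩

variable {K}

/-- The operad consisting of the operations of a coloured dg operad all of whose inputs, and whose
output, are of colour `c`. -/
def ColDGOperad.mono (D : ColDGOperad.{u, w} K Γ) (c : Γ) : DGOperad.{u, w} K where
  X A := D.X c (Ar.const c A)
  rel f hf := D.rel f (.const hf)
  comp h := D.comp (.const h)
  one x := D.one (A := Ar.const c {x}) (x := x) ⟨rfl, rfl⟩
  rel_congr f g _ _ h := D.rel_congr f g _ _ h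
  rel_id _ := D.rel_id _
  rel_trans f g _ _ _ := D.rel_trans f g _ _ _
  d_comp _ := D.d_comp _
  rel_comp _ f g k _ _ _ _ h1 h2 := D.rel_comp _ f g k _ _ _ _ h1 h2
  assoc_seq _ _ _ _ := D.assoc_seq _ _ _ _
  assoc_par h _ _ _ _ := D.assoc_par h _ _ _ _
  d_one _ := D.d_one _
  rel_one _ f _ := D.rel_one _ f _ _
  one_comp _ := D.one_comp _ _
  comp_one _ := D.comp_one _ _

end

section

/-- Reindexing of coordinates. -/
def pre (r : ℕ → ℕ) : C(ℕ → unitInterval, ℕ → unitInterval) := ⟨fun t j => t (r j), by fun_prop⟩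

/-- Insertion of a coordinate `ε` in position `k`. -/
def face (k : ℕ) (ε : unitInterval) : C(ℕ → unitInterval, ℕ → unitInterval) :=
  ⟨fun t j => if j < k then t j else if j = k then ε else t (j - 1),
    continuous_pi fun j => by split_ifs <;> fun_prop⟩

theorem pre_apply (r : ℕ → ℕ) (t : ℕ → unitInterval) (j : ℕ) : pre r t j = t (r j) := rfl

theorem face_apply (k : ℕ) (ε : unitInterval) (t : ℕ → unitInterval) (j : ℕ) :
    face k ε t j = if j < k then t j else if j = k then ε else t (j - 1) := rfl

/-- Singular cubes of dimension `-i` in `Y`: it is convenient to view them as maps depending on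
the first `-i` coordinates of a sequence. -/
structure IsCube {Y : Type v} [TopologicalSpace Y] (i : ℤ) (σ : C(ℕ → unitInterval, Y)) :
    Prop where
  le : i ≤ 0
  dep : ∀ s t : ℕ → unitInterval, (∀ k : ℕ, (k : ℤ) < -i → s k = t k) → σ s = σ t

/-- Degenerate cubes: those which do not depend on one of their coordinates. -/
def IsDegen {Y : Type v} [TopologicalSpace Y] (i : ℤ) (σ : C(ℕ → unitInterval, Y)) : Prop :=
  ∃ k : ℕ, (k : ℤ) < -i ∧ ∀ s t : ℕ → unitInterval, (∀ l, l ≠ k → s l = t l) → σ s = σ t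

/-- The transposition of two adjacent coordinates. -/
def swapAt (k : ℕ) : C(ℕ → unitInterval, ℕ → unitInterval) := pre (Equiv.swap k (k + 1))

theorem swapAt_apply (k : ℕ) (t : ℕ → unitInterval) (j : ℕ) :
    swapAt k t j = if j = k then t (k + 1) else if j = k + 1 then t k else t j := by
  simp only [swapAt, pre_apply, Equiv.swap_apply_def]
  split_ifs <;> rfl

variable (K : Type u) [Field K] (Y : Type v) [TopologicalSpace Y]

/-- The relations between singular cubes: degenerate cubes vanish, and exchanging two adjacent
coordinates of a cube changes the sign. -/
noncomputable def cubeRel (i : ℤ) :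
    Submodule K ({σ : C(ℕ → unitInterval, Y) // IsCube i σ} →₀ K) :=
  Submodule.span K
    ({z | ∃ σ, IsDegen i σ.1 ∧ z = Finsupp.single σ 1} ∪
      {z | ∃ σ τ, ∃ k : ℕ, (k : ℤ) + 1 < -i ∧ τ.1 = σ.1.comp (swapAt k) ∧
        z = Finsupp.single τ 1 + Finsupp.single σ 1})

/-- Singular cubical chains of `Y` in degree `i` (of dimension `-i`). -/
abbrev Ch (i : ℤ) : Type (max u v) :=
  ({σ : C(ℕ → unitInterval, Y) // IsCube i σ} →₀ K) ⧸ cubeRel K Y i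

variable {Y}

open Classical in
/-- The chain defined by a cube. -/
noncomputable def br (i : ℤ) (σ : C(ℕ → unitInterval, Y)) : Ch K Y i :=
  if h : IsCube i σ then (cubeRel K Y i).mkQ (Finsupp.single ⟨σ, h⟩ 1) else 0

variable {K}

theorem br_degen {i : ℤ} {σ : C(ℕ → unitInterval, Y)} (h : IsDegen i σ) : br K i σ = 0 := by
  unfold br
  split_ifs with h'
  · rw [Submodule.mkQ_apply, Submodule.Quotient.mk_eq_zero]
    exact Submodule.subset_span (Or.inl ⟨⟨σ, h'⟩, h, rfl⟩)
  · rfl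

theorem IsCube.pre {i : ℤ} {σ : C(ℕ → unitInterval, Y)} (h : IsCube i σ) {r : ℕ → ℕ}
    (hr : ∀ k : ℕ, (k : ℤ) < -i → (r k : ℤ) < -i) : IsCube i (σ.comp (pre r)) :=
  ⟨h.le, fun _ _ hst => h.dep _ _ fun k hk => hst _ (hr k hk)⟩

theorem IsCube.swapAt {i : ℤ} {σ : C(ℕ → unitInterval, Y)} (h : IsCube i σ) {k : ℕ}
    (hk : (k : ℤ) + 1 < -i) : IsCube i (σ.comp (swapAt k)) := by
  apply h.pre
  intro l hl
  rw [Equiv.swap_apply_def]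
  split_ifs <;> omega

theorem br_swap {i : ℤ} {σ : C(ℕ → unitInterval, Y)} (h : IsCube i σ) {k : ℕ}
    (hk : (k : ℤ) + 1 < -i) : br K i (σ.comp (swapAt k)) = - br K i σ := by
  rw [eq_neg_iff_add_eq_zero]
  unfold br
  rw [dif_pos h, dif_pos (h.swapAt hk), ← map_add, Submodule.mkQ_apply,
    Submodule.Quotient.mk_eq_zero]
  exact Submodule.subset_span (Or.inr ⟨⟨σ, h⟩, ⟨_, h.swapAt hk⟩, k, hk, rfl, rfl⟩)

section lift
variable {V : Type*} [AddCommGroup V] [Module K V] {i : ℤ} (g : C(ℕ → unitInterval, Y) → V)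
  (h1 : ∀ σ, IsCube i σ → IsDegen i σ → g σ = 0)
  (h2 : ∀ σ, IsCube i σ → ∀ k : ℕ, (k : ℤ) + 1 < -i → g (σ.comp (swapAt k)) = - g σ)

/-- Linear maps on cubical chains. -/
noncomputable def liftCh : Ch K Y i →ₗ[K] V :=
  (cubeRel K Y i).liftQ (Finsupp.linearCombination K fun σ => g σ.1) (by
    unfold cubeRel
    rw [Submodule.span_le]
    rintro z (⟨σ, hσ, rfl⟩ | ⟨σ, τ, k, hk, hτ, rfl⟩)
    · simp [h1 σ.1 σ.2 hσ]
    · simp [hτ, h2 σ.1 σ.2 k hk])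

theorem liftCh_br {σ : C(ℕ → unitInterval, Y)} (h : IsCube i σ) :
    liftCh (K := K) g h1 h2 (br K i σ) = g σ := by
  unfold liftCh br
  rw [dif_pos h]
  simp

theorem Ch_ext {F G : Ch K Y i →ₗ[K] V} (h : ∀ σ, IsCube i σ → F (br K i σ) = G (br K i σ)) :
    F = G := by
  apply Submodule.linearMap_qext
  apply Finsupp.lhom_ext'
  intro σ
  apply LinearMap.ext_ring
  have := h σ.1 σ.2
  unfold br at this
  rw [dif_pos σ.2] at this
  exact this

end lift

/-- The alternating sum of the faces of a cube. -/
noncomputable def bdry (K : Type u) [Field K] (i j : ℤ) (σ : C(ℕ → unitInterval, Y)) : Ch K Y j :=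
  ∑ k ∈ Finset.range (-i).toNat,
    sg k • (br K j (σ.comp (face k 1)) - br K j (σ.comp (face k 0)))

theorem IsCube.face {i j : ℤ} (hij : i + 1 = j) {σ : C(ℕ → unitInterval, Y)} (h : IsCube i σ)
    {k : ℕ} (hk : (k : ℤ) < -i) (ε : unitInterval) : IsCube j (σ.comp (face k ε)) := by
  refine ⟨by omega, fun s t hst => h.dep _ _ fun l hl => ?_⟩
  rw [face_apply, face_apply]
  split_ifs
  · exact hst _ (by omega)
  · rfl
  · exact hst _ (by omega)

theorem degen_face {i j : ℤ} (hij : i + 1 = j) {σ : C(ℕ → unitInterval, Y)} {k : ℕ}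
    (hk : (k : ℤ) < -i)
    (h : ∀ s t : ℕ → unitInterval, (∀ l, l ≠ k → s l = t l) → σ s = σ t) {k' : ℕ}
    (hk' : (k' : ℤ) < -i) (hkk : k' ≠ k) (ε : unitInterval) :
    IsDegen j (σ.comp (face k' ε)) := by
  refine ⟨if k < k' then k else k - 1, ?_, fun s t hst => h _ _ fun l hl => ?_⟩
  · split_ifs <;> omega
  · rw [face_apply, face_apply]
    split_ifs at hst ⊢
    all_goals first | rfl | exact hst _ (by omega)

theorem bdry_degen {i j : ℤ} (hij : i + 1 = j) {σ : C(ℕ → unitInterval, Y)}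
    (h : IsDegen i σ) : bdry K i j σ = 0 := by
  obtain ⟨k, hk, h⟩ := h
  refine Finset.sum_eq_zero fun k' hk' => ?_
  rw [Finset.mem_range] at hk'
  by_cases e : k' = k
  · subst e
    have : σ.comp (face k' 1) = σ.comp (face k' 0) := by
      ext t
      refine h _ _ fun l hl => ?_
      rw [face_apply, face_apply, if_neg hl, if_neg hl]
    rw [this, sub_self, smul_zero]
  · rw [br_degen (degen_face hij hk h (by omega) e 1), br_degen (degen_face hij hk h (by omega) e 0),
      sub_self, smul_zero]

theorem br_swap_face {i j : ℤ} (hij : i + 1 = j) {σ : C(ℕ → unitInterval, Y)} (hσ : IsCube i σ)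
    {k : ℕ} (hk : (k : ℤ) + 1 < -i) {k' : ℕ} (hk' : (k' : ℤ) < -i) (ε : unitInterval) :
    sg k' • br K j ((σ.comp (swapAt k)).comp (face k' ε)) =
      - (sg (Equiv.swap k (k + 1) k' : ℕ) •
        br K j (σ.comp (face (Equiv.swap k (k + 1) k') ε))) := by
  by_cases e1 : k' = k
  · subst e1
    have : (σ.comp (swapAt k')).comp (face k' ε) = σ.comp (face (k' + 1) ε) := by
      ext t
      simp only [ContinuousMap.comp_apply]
      congr 1
      funext l
      rw [swapAt_apply, face_apply, face_apply, face_apply, face_apply]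
      split_ifs <;> first | omega | rfl | skip
      all_goals (congr 1; try omega)
    rw [this, Equiv.swap_apply_left, Nat.cast_add, Nat.cast_one, sg_add_one, neg_neg]
  by_cases e2 : k' = k + 1
  · subst e2
    have : (σ.comp (swapAt k)).comp (face (k + 1) ε) = σ.comp (face k ε) := by
      ext t
      simp only [ContinuousMap.comp_apply]
      congr 1
      funext l
      rw [swapAt_apply, face_apply, face_apply, face_apply, face_apply]
      split_ifs <;> first | omega | rfl | skip
      all_goals (congr 1; try omega)
    rw [this, Equiv.swap_apply_right, Nat.cast_add, Nat.cast_one, sg_add_one]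
  · rw [Equiv.swap_apply_of_ne_of_ne e1 e2, ← smul_neg]
    congr 1
    have : (σ.comp (swapAt k)).comp (face k' ε) =
        (σ.comp (face k' ε)).comp (swapAt (if k < k' then k else k - 1)) := by
      ext t
      simp only [ContinuousMap.comp_apply]
      congr 1
      funext l
      rw [swapAt_apply, face_apply, face_apply, face_apply, face_apply]
      simp only [swapAt_apply]
      split_ifs <;> first | omega | rfl | skip
      all_goals (congr 1; try omega)
    rw [this, br_swap (hσ.face hij hk' ε)]
    split_ifs <;> omega

theorem bdry_swap {i j : ℤ} (hij : i + 1 = j) {σ : C(ℕ → unitInterval, Y)} (hσ : IsCube i σ)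
    {k : ℕ} (hk : (k : ℤ) + 1 < -i) : bdry K i j (σ.comp (swapAt k)) = - bdry K i j σ := by
  unfold bdry
  rw [← Finset.sum_neg_distrib]
  refine Finset.sum_equiv (Equiv.swap k (k + 1)) (fun l => ?_) fun l hl => ?_
  · rw [Finset.mem_range, Finset.mem_range, Equiv.swap_apply_def]
    split_ifs <;> omega
  · rw [Finset.mem_range] at hl
    rw [smul_sub, br_swap_face hij hσ hk (by omega), br_swap_face hij hσ hk (by omega), smul_sub]
    abel

/-- The boundary operator. -/
noncomputable def dCh (K : Type u) [Field K] (Y : Type v) [TopologicalSpace Y] {i j : ℤ}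
    (hij : i + 1 = j) : Ch K Y i →ₗ[K] Ch K Y j :=
  liftCh (bdry K i j) (fun _ _ h => bdry_degen hij h) (fun _ h _ hk => bdry_swap hij h hk)

theorem dCh_br {i j : ℤ} (hij : i + 1 = j) {σ : C(ℕ → unitInterval, Y)} (hσ : IsCube i σ) :
    dCh K Y hij (br K i σ) = bdry K i j σ := liftCh_br _ _ _ hσ

theorem face_face {k l : ℕ} (h : l < k) (ε δ : unitInterval) :
    (face k ε).comp (face l δ) = (face l δ).comp (face (k - 1) ε) := by
  ext t m
  congr 1
  simp only [ContinuousMap.comp_apply, face_apply]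
  split_ifs <;> first | omega | rfl | skip
  all_goals (congr 1; try omega)

theorem dCh_dCh {i j k : ℤ} (hij : i + 1 = j) (hjk : j + 1 = k) :
    (dCh K Y hjk).comp (dCh K Y hij) = 0 := by
  apply Ch_ext
  intro σ hσ
  rw [LinearMap.comp_apply, dCh_br hij hσ, LinearMap.zero_apply]
  unfold bdry
  rw [map_sum]
  have h1 : ∀ a ∈ Finset.range (-i).toNat, dCh K Y hjk (sg a •
      (br K j (σ.comp (face a 1)) - br K j (σ.comp (face a 0)))) =
      ∑ b ∈ Finset.range (-j).toNat, sg (a + b) •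
        (br K k (σ.comp ((face a 1).comp (face b 1))) - br K k (σ.comp ((face a 1).comp (face b 0)))
        - (br K k (σ.comp ((face a 0).comp (face b 1))) -
          br K k (σ.comp ((face a 0).comp (face b 0))))) := by
    intro a ha
    rw [Finset.mem_range] at ha
    rw [map_zsmul, map_sub, dCh_br hjk (hσ.face hij (by omega) 1),
      dCh_br hjk (hσ.face hij (by omega) 0)]
    unfold bdry
    rw [← Finset.sum_sub_distrib, Finset.smul_sum]
    apply Finset.sum_congr rfl
    intro b hb
    rw [← smul_sub, sg_smul]
    rfl
  rw [Finset.sum_congr rfl h1, ← Finset.sum_product']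
  refine Finset.sum_involution
    (fun p _ => if p.2 < p.1 then (p.2, p.1 - 1) else (p.2 + 1, p.1)) ?_ ?_ ?_ ?_
  · rintro ⟨a, b⟩ hp
    simp only [Finset.mem_product, Finset.mem_range] at hp
    dsimp only
    split_ifs with h
    · rw [face_face h 1 1, face_face h 1 0, face_face h 0 1, face_face h 0 0]
      have e : ((a : ZMod 2) + b) = (b + (a - 1 : ℕ)) + 1 := by
        rw [Nat.cast_sub (by omega)]; push_cast; ring
      rw [e, sg_add_one]
      simp only [smul_sub]
      abel
    · have h' : a < b + 1 := by omega
      rw [face_face h' 1 1, face_face h' 1 0, face_face h' 0 1, face_face h' 0 0]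
      have e : (((b + 1 : ℕ) : ZMod 2) + a) = (a + b) + 1 := by push_cast; ring
      rw [e, sg_add_one]
      simp only [smul_sub, Nat.add_sub_cancel]
      abel
  · rintro ⟨a, b⟩ hp - h
    simp only at h
    split_ifs at h <;> (rw [Prod.mk.injEq] at h; omega)
  · rintro ⟨a, b⟩ hp
    simp only [Finset.mem_product, Finset.mem_range] at hp ⊢
    split_ifs <;> (simp only; omega)
  · rintro ⟨a, b⟩ hp
    dsimp only
    by_cases h : b < a
    · have h' : ¬ (a - 1 < b) := by omega
      simp only [h, h', if_true, if_false, Prod.mk.injEq]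
      exact ⟨by omega, trivial⟩
    · have h' : a < b + 1 := by omega
      simp [h, h']

variable (K Y) in
/-- The complex of (normalized, symmetrized) singular cubical chains of a space, in non-positive
cohomological degrees. -/
noncomputable def chains : Cx.{u, max u v} K where
  X i := ModuleCat.of K (Ch K Y i)
  d i j := if h : i + 1 = j then ModuleCat.ofHom (dCh K Y h) else 0
  shape i j h := dif_neg h
  d_comp_d' i j k h h' := by
    obtain rfl : i + 1 = j := h
    obtain rfl : i + 1 + 1 = k := h'
    rw [dif_pos rfl, dif_pos rfl, ← ModuleCat.ofHom_comp, dCh_dCh]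
    rfl

theorem chains_d {i j : ℤ} (h : i + 1 = j) (a : Ch K Y i) :
    (chains K Y).d i j a = dCh K Y h a := by
  simp only [chains, dif_pos h]
  rfl

variable {Z : Type v} [TopologicalSpace Z]

theorem IsCube.map {i : ℤ} {σ : C(ℕ → unitInterval, Y)} (h : IsCube i σ) (F : C(Y, Z)) :
    IsCube i (F.comp σ) := ⟨h.le, fun s t hst => congrArg F (h.dep s t hst)⟩

theorem IsDegen.map {i : ℤ} {σ : C(ℕ → unitInterval, Y)} (h : IsDegen i σ) (F : C(Y, Z)) :
    IsDegen i (F.comp σ) := by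
  obtain ⟨k, hk, h⟩ := h
  exact ⟨k, hk, fun s t hst => congrArg F (h s t hst)⟩

/-- Functoriality of chains. -/
noncomputable def mapCh (K : Type u) [Field K] (F : C(Y, Z)) (i : ℤ) : Ch K Y i →ₗ[K] Ch K Z i :=
  liftCh (fun σ => br K i (F.comp σ)) (fun _ _ h => br_degen (h.map F))
    (fun σ h k hk => br_swap (σ := F.comp σ) (h.map F) hk)

theorem mapCh_br (F : C(Y, Z)) {i : ℤ} {σ : C(ℕ → unitInterval, Y)} (h : IsCube i σ) :
    mapCh K F i (br K i σ) = br K i (F.comp σ) := liftCh_br _ _ _ h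

theorem mapCh_dCh (F : C(Y, Z)) {i j : ℤ} (hij : i + 1 = j) :
    (mapCh K F j).comp (dCh K Y hij) = (dCh K Z hij).comp (mapCh K F i) := by
  apply Ch_ext
  intro σ hσ
  rw [LinearMap.comp_apply, LinearMap.comp_apply, mapCh_br F hσ, dCh_br hij hσ,
    dCh_br hij (hσ.map F)]
  unfold bdry
  rw [map_sum]
  apply Finset.sum_congr rfl
  intro k hk
  rw [Finset.mem_range] at hk
  rw [map_zsmul, map_sub, mapCh_br F (hσ.face hij (by omega) 1),
    mapCh_br F (hσ.face hij (by omega) 0)]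
  rfl

/-- The morphism of complexes of chains defined by a continuous map. -/
noncomputable def mapChains (K : Type u) [Field K] (F : C(Y, Z)) : chains K Y ⟶ chains K Z where
  f i := ModuleCat.ofHom (mapCh K F i)
  comm' i j h := by
    obtain rfl : i + 1 = j := h
    apply ModuleCat.hom_ext
    apply LinearMap.ext
    intro a
    refine (chains_d rfl _).trans (Eq.trans ?_ (congrArg (mapCh K F (i + 1)) (chains_d rfl a)).symm)
    exact (LinearMap.congr_fun (mapCh_dCh F rfl) a).symm

end

section

variable {K : Type u} [Field K] {Y Z W : Type v} [TopologicalSpace Y] [TopologicalSpace Z]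
  [TopologicalSpace W]

theorem Ch_induction {i : ℤ} {p : Ch K Y i → Prop} (h0 : p 0)
    (hadd : ∀ a b, p a → p b → p (a + b)) (hsmul : ∀ (c : K) a, p a → p (c • a))
    (hbr : ∀ σ, IsCube i σ → p (br K i σ)) (a : Ch K Y i) : p a := by
  have key : (⊤ : Submodule K (Ch K Y i)) = Submodule.span K {a | ∃ σ : C(ℕ → unitInterval, Y), IsCube i σ ∧ a = br K i σ} := by
    have : (Submodule.span K {a | ∃ σ : C(ℕ → unitInterval, Y), IsCube i σ ∧ a = br K i σ}).mkQ = 0 := by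
      apply Ch_ext
      intro σ hσ
      rw [Submodule.mkQ_apply, LinearMap.zero_apply, Submodule.Quotient.mk_eq_zero]
      exact Submodule.subset_span ⟨σ, hσ, rfl⟩
    rw [← Submodule.ker_mkQ (Submodule.span K _), this, LinearMap.ker_zero]
  have ha : a ∈ Submodule.span K {a | ∃ σ : C(ℕ → unitInterval, Y), IsCube i σ ∧ a = br K i σ} := key ▸ Submodule.mem_top
  induction ha using Submodule.span_induction with
  | mem x h => obtain ⟨σ, hσ, rfl⟩ := h; exact hbr σ hσ
  | zero => exact h0
  | add x y _ _ hx hy => exact hadd _ _ hx hy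
  | smul c x _ hx => exact hsmul _ _ hx

/-- The product of the cubes `σ` (of dimension `-i`) and `τ`, composed with `F`. -/
def prodCube (F : C(Y × Z, W)) (i : ℤ) (σ : C(ℕ → unitInterval, Y)) (τ : C(ℕ → unitInterval, Z)) :
    C(ℕ → unitInterval, W) :=
  F.comp (σ.prodMk (τ.comp (pre fun j => j + (-i).toNat)))

theorem prodCube_apply (F : C(Y × Z, W)) (i : ℤ) (σ : C(ℕ → unitInterval, Y))
    (τ : C(ℕ → unitInterval, Z)) (t : ℕ → unitInterval) :
    prodCube F i σ τ t = F (σ t, τ fun j => t (j + (-i).toNat)) := rfl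

section
variable (F : C(Y × Z, W)) {i j n : ℤ} (hn : i + j = n) {σ : C(ℕ → unitInterval, Y)}
  {τ : C(ℕ → unitInterval, Z)}

theorem IsCube.prodCube (hn : i + j = n) (hσ : IsCube i σ) (hτ : IsCube j τ) : IsCube n (prodCube F i σ τ) := by
  have := hσ.le
  have := hτ.le
  refine ⟨by omega, fun s t hst => ?_⟩
  rw [prodCube_apply, prodCube_apply, hσ.dep s t fun k hk => hst k (by omega), hτ.dep]
  intro k hk
  exact hst _ (by omega)

theorem degen_prod_left (hn : i + j = n) (hσ : IsCube i σ) (hτ : IsCube j τ) (h : IsDegen i σ) :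
    IsDegen n (prodCube F i σ τ) := by
  have := hτ.le
  obtain ⟨k, hk, h⟩ := h
  refine ⟨k, by omega, fun s t hst => ?_⟩
  have h2 : (fun j => s (j + (-i).toNat)) = fun j => t (j + (-i).toNat) := by
    funext l; exact hst _ (by omega)
  rw [prodCube_apply, prodCube_apply, h s t hst, h2]

theorem degen_prod_right (hn : i + j = n) (hσ : IsCube i σ) (h : IsDegen j τ) :
    IsDegen n (prodCube F i σ τ) := by
  have := hσ.le
  obtain ⟨k, hk, h⟩ := h
  refine ⟨k + (-i).toNat, by omega, fun s t hst => ?_⟩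
  rw [prodCube_apply, prodCube_apply, hσ.dep s t fun l hl => hst l (by omega),
    h _ _ fun l hl => hst _ (by omega)]

theorem swap_prod_left {k : ℕ} (hk : (k : ℤ) + 1 < -i) :
    prodCube F i (σ.comp (swapAt k)) τ = (prodCube F i σ τ).comp (swapAt k) := by
  ext t
  rw [ContinuousMap.comp_apply, prodCube_apply, prodCube_apply]
  refine congrArg (fun z => F (σ (swapAt k t), τ z)) ?_
  funext l
  rw [swapAt_apply, if_neg (by omega), if_neg (by omega)]

theorem swap_prod_right (hσ : IsCube i σ) {k : ℕ} :
    prodCube F i σ (τ.comp (swapAt k)) =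
      (prodCube F i σ τ).comp (swapAt (k + (-i).toNat)) := by
  ext t
  rw [ContinuousMap.comp_apply, prodCube_apply, prodCube_apply]
  congr 2
  · apply hσ.dep
    intro l hl
    rw [swapAt_apply, if_neg (by omega), if_neg (by omega)]
  · rw [ContinuousMap.comp_apply]
    congr 1
    funext l
    rw [swapAt_apply, swapAt_apply]
    split_ifs <;> first | omega | rfl | skip
    congr 1; omega

/-- The product of a fixed cube with chains. -/
noncomputable def prodChAux (K : Type u) [Field K] (hσ : IsCube i σ) : Ch K Z j →ₗ[K] Ch K W n :=
  liftCh (fun τ => br K n (prodCube F i σ τ))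
    (fun _ _ h => br_degen (degen_prod_right F hn hσ h))
    (fun τ hτ k hk => by
      have := hσ.le
      rw [swap_prod_right F hσ, br_swap (hσ.prodCube F hn hτ) (by omega)])

theorem prodChAux_br (hσ : IsCube i σ) (hτ : IsCube j τ) :
    prodChAux F hn K hσ (br K j τ) = br K n (prodCube F i σ τ) := liftCh_br _ _ _ hτ

open Classical in
/-- The exterior product of chains, composed with a continuous map `F`. -/
noncomputable def prodCh (K : Type u) [Field K] : Ch K Y i →ₗ[K] Ch K Z j →ₗ[K] Ch K W n :=
  liftCh (fun σ => if h : IsCube i σ then prodChAux F hn K h else 0)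
    (fun σ hσ h => by
      rw [dif_pos hσ]
      apply Ch_ext
      intro τ hτ
      rw [prodChAux_br F hn hσ hτ, br_degen (degen_prod_left F hn hσ hτ h), LinearMap.zero_apply])
    (fun σ hσ k hk => by
      rw [dif_pos hσ, dif_pos (hσ.swapAt hk)]
      apply Ch_ext
      intro τ hτ
      have := hτ.le
      rw [prodChAux_br F hn (hσ.swapAt hk) hτ, swap_prod_left F hk,
        br_swap (hσ.prodCube F hn hτ) (by omega), LinearMap.neg_apply, prodChAux_br F hn hσ hτ])

theorem prodCh_br (hσ : IsCube i σ) (hτ : IsCube j τ) :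
    prodCh F hn K (br K i σ) (br K j τ) = br K n (prodCube F i σ τ) := by
  unfold prodCh
  rw [liftCh_br _ _ _ hσ, dif_pos hσ, prodChAux_br F hn hσ hτ]

theorem face_prod_left {i' : ℤ} (hi : i + 1 = i') {k : ℕ} (hk : (k : ℤ) < -i) (ε : unitInterval) :
    (prodCube F i σ τ).comp (face k ε) = prodCube F i' (σ.comp (face k ε)) τ := by
  ext t
  rw [ContinuousMap.comp_apply, prodCube_apply, prodCube_apply]
  congr 3
  funext l
  rw [face_apply, if_neg (by omega), if_neg (by omega)]
  congr 1; omega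

theorem face_prod_right (hσ : IsCube i σ) {k : ℕ} (ε : unitInterval) :
    (prodCube F i σ τ).comp (face ((-i).toNat + k) ε) = prodCube F i σ (τ.comp (face k ε)) := by
  ext t
  rw [ContinuousMap.comp_apply, prodCube_apply, prodCube_apply]
  congr 2
  · apply hσ.dep
    intro l hl
    rw [face_apply, if_pos (by omega)]
  · rw [ContinuousMap.comp_apply]
    congr 1
    funext l
    rw [face_apply, face_apply]
    split_ifs <;> first | omega | rfl | skip
    congr 1; omega

theorem dCh_prodCh {i' j' n' : ℤ} (hi : i + 1 = i') (hj : j + 1 = j') (hn' : n + 1 = n')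
    (a : Ch K Y i) (b : Ch K Z j) :
    dCh K W hn' (prodCh F hn K a b) = prodCh F (show i' + j = n' by omega) K (dCh K Y hi a) b +
      sg i • prodCh F (show i + j' = n' by omega) K a (dCh K Z hj b) := by
  induction a using Ch_induction with
  | h0 => simp
  | hadd a a' ha ha' =>
    simp only [map_add, LinearMap.add_apply, ha, ha', smul_add]
    abel
  | hsmul c a ha => simp only [map_smul, LinearMap.smul_apply, ha, smul_add, smul_comm c]
  | hbr σ hσ =>
  induction b using Ch_induction with
  | h0 => simp
  | hadd a a' ha ha' =>
    simp only [map_add, ha, ha', smul_add]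
    abel
  | hsmul c a ha => simp only [map_smul, ha, smul_add, smul_comm c]
  | hbr τ hτ =>
  have hi0 := hσ.le
  have hj0 := hτ.le
  rw [prodCh_br F hn hσ hτ, dCh_br hn' (hσ.prodCube F hn hτ), dCh_br hi hσ, dCh_br hj hτ]
  unfold bdry
  have e : (-n).toNat = (-i).toNat + (-j).toNat := by omega
  rw [e, Finset.sum_range_add, map_sum, map_sum, LinearMap.sum_apply, Finset.smul_sum]
  congr 1
  · apply Finset.sum_congr rfl
    intro k hk
    rw [Finset.mem_range] at hk
    have hk' : (k : ℤ) < -i := by omega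
    rw [map_zsmul, LinearMap.smul_apply, map_sub, LinearMap.sub_apply,
      prodCh_br F _ (hσ.face hi hk' 1) hτ, prodCh_br F _ (hσ.face hi hk' 0) hτ,
      face_prod_left F hi hk', face_prod_left F hi hk']
  · apply Finset.sum_congr rfl
    intro k hk
    rw [Finset.mem_range] at hk
    have hk' : (k : ℤ) < -j := by omega
    rw [map_zsmul, map_sub, prodCh_br F _ hσ (hτ.face hj hk' 1),
      prodCh_br F _ hσ (hτ.face hj hk' 0), face_prod_right F hσ, face_prod_right F hσ, sg_smul]
    congr 2
    rw [Nat.cast_add]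
    congr 1
    have : (((-i).toNat : ℤ) : ZMod 2) = ((-i : ℤ) : ZMod 2) := by
      rw [Int.toNat_of_nonneg (by omega)]
    rw [Int.cast_natCast] at this
    rw [this, Int.cast_neg]
    have := z2 (i : ZMod 2)
    linear_combination -this

end

/-- The permutation of coordinates exchanging the blocks `[a, a + p)` and `[a + p, a + p + q)`. -/
def blk (a p q : ℕ) (j : ℕ) : ℕ :=
  if j < a then j else if j < a + p then j + q else if j < a + p + q then j - p else j

theorem br_cyc {i : ℤ} {ρ : C(ℕ → unitInterval, Y)} (hρ : IsCube i ρ) (a m : ℕ)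
    (h : (a + m : ℤ) < -i) : br K i (ρ.comp (pre (blk a 1 m))) = sg m • br K i ρ := by
  induction m with
  | zero =>
    have : ρ.comp (pre (blk a 1 0)) = ρ := by
      ext t
      refine congrArg ρ ?_
      funext j
      rw [pre_apply]
      unfold blk
      split_ifs <;> first | omega | rfl
    rw [this]
    exact (one_smul ℤ _).symm
  | succ m ih =>
    have : ρ.comp (pre (blk a 1 (m + 1))) = (ρ.comp (pre (blk a 1 m))).comp (swapAt (a + m)) := by
      ext t
      simp only [ContinuousMap.comp_apply]
      congr 1
      funext j
      rw [pre_apply, pre_apply, swapAt_apply]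
      unfold blk
      split_ifs <;> first | omega | rfl | skip
      all_goals (congr 1; omega)
    push_cast at h
    rw [this, br_swap, ih (by omega), Nat.cast_add, Nat.cast_one, sg_add_one]
    · apply hρ.pre
      intro k hk
      unfold blk
      split_ifs <;> omega
    · push_cast; omega

theorem br_blk {i : ℤ} {ρ : C(ℕ → unitInterval, Y)} (hρ : IsCube i ρ) (a p q : ℕ)
    (h : (a + p + q : ℤ) ≤ -i) : br K i (ρ.comp (pre (blk a p q))) = sg (p * q) • br K i ρ := by
  induction p generalizing ρ with
  | zero =>
    have : ρ.comp (pre (blk a 0 q)) = ρ := by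
      ext t
      refine congrArg ρ ?_
      funext j
      rw [pre_apply]
      unfold blk
      split_ifs <;> first | omega | rfl
    rw [this, Nat.cast_zero, zero_mul]
    exact (one_smul ℤ _).symm
  | succ p ih =>
    have : ρ.comp (pre (blk a (p + 1) q)) =
        (ρ.comp (pre (blk (a + p) 1 q))).comp (pre (blk a p q)) := by
      ext t
      simp only [ContinuousMap.comp_apply]
      congr 1
      funext j
      rw [pre_apply, pre_apply, pre_apply]
      unfold blk
      split_ifs <;> first | omega | rfl | skip
      all_goals (congr 1; omega)
    push_cast at h
    rw [this, ih, br_cyc hρ _ _ (by push_cast; omega), sg_smul]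
    · congr 2
      push_cast
      ring
    · apply hρ.pre
      intro k hk
      unfold blk
      split_ifs <;> omega
    · omega

end

section

variable {K : Type u} [Field K]

theorem isCube_const {Y : Type v} [TopologicalSpace Y] (y : Y) :
    IsCube 0 (ContinuousMap.const (ℕ → unitInterval) y) :=
  ⟨le_rfl, fun _ _ _ => rfl⟩

theorem Ch_hom_ext {Y : Type v} [TopologicalSpace Y] {C : Cx.{u, max u v} K}
    {F G : chains K Y ⟶ C}
    (h : ∀ i σ, IsCube i σ → F.f i (br K i σ) = G.f i (br K i σ)) : F = G := by
  apply HomologicalComplex.hom_ext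
  intro i
  apply ModuleCat.hom_ext
  exact Ch_ext (h i)

variable {Γ : Type} (S : TopOperad.{v} Γ)

namespace TopOperad

variable (K) in
/-- The composition of chains. -/
noncomputable def compCh {c : Γ} {A : Ar Γ} {x : ℕ} {d : Γ} {B C : Ar Γ} (h : CIns A x d B C)
    {i j n : ℤ} (hn : i + j = n) : Ch K (S.X c A) i →ₗ[K] Ch K (S.X d B) j →ₗ[K] Ch K (S.X c C) n :=
  prodCh (S.comp h) hn K

theorem compCh_rel {c : Γ} {A : Ar Γ} {x : ℕ} {d : Γ} {B C A' B' C' : Ar Γ} (h : CIns A x d B C)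
    (f g k : ℕ → ℕ) (h' : CIns A' (f x) d B' C') (hf : ReIn f A A') (hg : ReIn g B B')
    (hk : ReIn k C C') (h1 : Set.EqOn k f (A.set.erase x)) (h2 : Set.EqOn k g B.set)
    {i j n : ℤ} (hn : i + j = n) (a : Ch K (S.X c A) i) (b : Ch K (S.X d B) j) :
    mapCh K (S.rel k hk) n (S.compCh K h hn a b) =
      S.compCh K h' hn (mapCh K (S.rel f hf) i a) (mapCh K (S.rel g hg) j b) := by
  induction a using Ch_induction with
  | h0 => simp
  | hadd a a' ha ha' => simp only [map_add, LinearMap.add_apply, ha, ha']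
  | hsmul c a ha => simp only [map_smul, LinearMap.smul_apply, ha]
  | hbr σ hσ =>
  induction b using Ch_induction with
  | h0 => simp
  | hadd a a' ha ha' => simp only [map_add, ha, ha']
  | hsmul c a ha => simp only [map_smul, ha]
  | hbr τ hτ =>
  unfold compCh
  rw [prodCh_br _ _ hσ hτ, mapCh_br _ (hσ.prodCube _ hn hτ), mapCh_br _ hσ, mapCh_br _ hτ,
    prodCh_br _ _ (hσ.map _) (hτ.map _)]
  congr 1
  ext t
  exact S.rel_comp h f g k h' hf hg hk h1 h2 _ _

theorem compCh_seq {c : Γ} {A : Ar Γ} {x : ℕ} {d : Γ} {B C : Ar Γ} {y : ℕ} {e : Γ} {D E F : Ar Γ}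
    (h₁ : CIns A x d B C) (h₂ : CIns C y e D F) (h₃ : CIns B y e D E) (h₄ : CIns A x d E F)
    {i j l m n p : ℤ} (hm : i + j = m) (hn : m + l = n) (hp : j + l = p) (hq : i + p = n)
    (a : Ch K (S.X c A) i) (b : Ch K (S.X d B) j) (z : Ch K (S.X e D) l) :
    S.compCh K h₂ hn (S.compCh K h₁ hm a b) z = S.compCh K h₄ hq a (S.compCh K h₃ hp b z) := by
  induction a using Ch_induction with
  | h0 => simp
  | hadd a a' ha ha' => simp only [map_add, LinearMap.add_apply, ha, ha']
  | hsmul c a ha => simp only [map_smul, LinearMap.smul_apply, ha]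
  | hbr σ hσ =>
  induction b using Ch_induction with
  | h0 => simp
  | hadd a a' ha ha' => simp only [map_add, LinearMap.add_apply, ha, ha']
  | hsmul c a ha => simp only [map_smul, LinearMap.smul_apply, ha]
  | hbr τ hτ =>
  induction z using Ch_induction with
  | h0 => simp
  | hadd a a' ha ha' => simp only [map_add, ha, ha']
  | hsmul c a ha => simp only [map_smul, ha]
  | hbr ζ hζ =>
  have := hσ.le
  have := hτ.le
  unfold compCh
  rw [prodCh_br _ _ hσ hτ, prodCh_br _ _ hτ hζ, prodCh_br _ _ (hσ.prodCube _ hm hτ) hζ,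
    prodCh_br _ _ hσ (hτ.prodCube _ hp hζ)]
  congr 1
  ext t
  refine (S.assoc_seq h₁ h₂ h₃ h₄ _ _ _).trans ?_
  have e1 : (fun j => t (j + (-m).toNat)) = fun l => t (l + (-j).toNat + (-i).toNat) := by
    funext l
    congr 1
    omega
  rw [prodCube_apply, prodCube_apply]
  exact congrArg (fun s => S.comp h₄ (σ t, S.comp h₃ (τ fun j => t (j + (-i).toNat), ζ s))) e1

theorem compCh_par {c : Γ} {A : Ar Γ} {x : ℕ} {d : Γ} {B C : Ar Γ} {y : ℕ} {e : Γ} {D E F : Ar Γ}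
    (hxy : x ≠ y) (h₁ : CIns A x d B C) (h₂ : CIns C y e D F) (h₃ : CIns A y e D E)
    (h₄ : CIns E x d B F)
    {i j l m n p : ℤ} (hm : i + j = m) (hn : m + l = n) (hp : i + l = p) (hq : p + j = n)
    (a : Ch K (S.X c A) i) (b : Ch K (S.X d B) j) (z : Ch K (S.X e D) l) :
    S.compCh K h₂ hn (S.compCh K h₁ hm a b) z =
      sg (j * l) • S.compCh K h₄ hq (S.compCh K h₃ hp a z) b := by
  induction a using Ch_induction with
  | h0 => simp
  | hadd a a' ha ha' => simp only [map_add, LinearMap.add_apply, ha, ha', smul_add]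
  | hsmul c a ha => simp only [map_smul, LinearMap.smul_apply, ha, smul_comm c]
  | hbr σ hσ =>
  induction b using Ch_induction with
  | h0 => simp
  | hadd a a' ha ha' => simp only [map_add, LinearMap.add_apply, ha, ha', smul_add]
  | hsmul c a ha => simp only [map_smul, LinearMap.smul_apply, ha, smul_comm c]
  | hbr τ hτ =>
  induction z using Ch_induction with
  | h0 => simp
  | hadd a a' ha ha' => simp only [map_add, LinearMap.add_apply, ha, ha', smul_add]
  | hsmul c a ha => simp only [map_smul, LinearMap.smul_apply, ha, smul_comm c]
  | hbr ζ hζ =>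
  have hi0 := hσ.le
  have hj0 := hτ.le
  have hl0 := hζ.le
  unfold compCh
  rw [prodCh_br _ _ hσ hτ, prodCh_br _ _ hσ hζ, prodCh_br _ _ (hσ.prodCube _ hm hτ) hζ,
    prodCh_br _ _ (hσ.prodCube _ hp hζ) hτ]
  have key := br_blk (K := K) ((hσ.prodCube (S.comp h₃) hp hζ).prodCube (S.comp h₄) hq hτ)
    (-i).toNat (-l).toNat (-j).toNat (by omega)
  have e1 : ∀ k : ℤ, k ≤ 0 → (((-k).toNat : ℕ) : ZMod 2) = k := by
    intro k hk
    have : (((-k).toNat : ℤ) : ZMod 2) = ((-k : ℤ) : ZMod 2) := by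
      rw [Int.toNat_of_nonneg (by omega)]
    rw [Int.cast_natCast] at this
    rw [this, Int.cast_neg]
    have := z2 (k : ZMod 2)
    linear_combination -this
  rw [e1 _ hl0, e1 _ hj0, mul_comm] at key
  rw [← key]
  congr 1
  ext t
  refine (S.assoc_par hxy h₁ h₂ h₃ h₄ _ _ _).trans ?_
  change S.comp h₄ (S.comp h₃ (σ t, ζ fun k => t (k + (-m).toNat)), τ fun k => t (k + (-i).toNat)) =
    S.comp h₄ (S.comp h₃ (σ (pre (blk (-i).toNat (-l).toNat (-j).toNat) t),
      ζ fun k => pre (blk (-i).toNat (-l).toNat (-j).toNat) t (k + (-i).toNat)),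
      τ fun k => pre (blk (-i).toNat (-l).toNat (-j).toNat) t (k + (-p).toNat))
  have e2 : σ (pre (blk (-i).toNat (-l).toNat (-j).toNat) t) = σ t := by
    apply hσ.dep
    intro k hk
    rw [pre_apply]
    unfold blk
    rw [if_pos (by omega)]
  have e3 : ζ (fun k => pre (blk (-i).toNat (-l).toNat (-j).toNat) t (k + (-i).toNat)) =
      ζ (fun k => t (k + (-m).toNat)) := by
    apply hζ.dep
    intro k hk
    rw [pre_apply]
    unfold blk
    rw [if_neg (by omega), if_pos (by omega)]
    congr 1; omega
  have e4 : τ (fun k => pre (blk (-i).toNat (-l).toNat (-j).toNat) t (k + (-p).toNat)) =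
      τ (fun k => t (k + (-i).toNat)) := by
    apply hτ.dep
    intro k hk
    rw [pre_apply]
    unfold blk
    rw [if_neg (by omega), if_neg (by omega), if_pos (by omega)]
    congr 1; omega
  rw [e2, e3, e4]

theorem compCh_one_left {A : Ar Γ} {x : ℕ} {c : Γ} (hA : IsOne A x c) {B : Ar Γ}
    (h : CIns A x c B B) {n : ℤ} (hn : 0 + n = n) (b : Ch K (S.X c B) n) :
    S.compCh K h hn (br K 0 (ContinuousMap.const _ (S.one hA))) b = b := by
  induction b using Ch_induction with
  | h0 => simp
  | hadd a a' ha ha' => simp only [map_add, ha, ha']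
  | hsmul c a ha => simp only [map_smul, ha]
  | hbr τ hτ =>
  unfold compCh
  rw [prodCh_br _ _ (isCube_const _) hτ]
  congr 1
  ext t
  exact S.one_comp hA h _

theorem compCh_one_right {c : Γ} {A : Ar Γ} {x : ℕ} {d : Γ} {B : Ar Γ} (hB : IsOne B x d)
    (h : CIns A x d B A) {n : ℤ} (hn : n + 0 = n) (a : Ch K (S.X c A) n) :
    S.compCh K h hn a (br K 0 (ContinuousMap.const _ (S.one hB))) = a := by
  induction a using Ch_induction with
  | h0 => simp
  | hadd a a' ha ha' => simp only [map_add, LinearMap.add_apply, ha, ha']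
  | hsmul c a ha => simp only [map_smul, LinearMap.smul_apply, ha]
  | hbr σ hσ =>
  unfold compCh
  rw [prodCh_br _ _ hσ (isCube_const _)]
  congr 1
  ext t
  exact S.comp_one hB h _

variable (K) in
/-- The coloured dg operad of chains of a topological operad. -/
noncomputable def chains : ColDGOperad.{u, max u v} K Γ where
  X c A := OperadTorsor.chains K (S.X c A)
  rel f hf := mapChains K (S.rel f hf)
  comp h _ _ _ hn := S.compCh K h hn
  one h := br K 0 (ContinuousMap.const _ (S.one h))
  rel_congr f g hf hg h := by
    congr 1
    ext a
    exact S.rel_congr f g hf hg h a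
  rel_id h := by
    apply Ch_hom_ext
    intro i σ hσ
    refine (mapCh_br _ hσ).trans (congrArg (br K i) ?_)
    ext t
    exact S.rel_id h _
  rel_trans f g hf hg h := by
    apply Ch_hom_ext
    intro i σ hσ
    refine (mapCh_br _ hσ).trans (Eq.trans ?_ (Eq.trans (congrArg (mapCh K (S.rel g hg) i)
      (mapCh_br _ hσ)) (mapCh_br _ (hσ.map _))).symm)
    refine congrArg (br K i) ?_
    ext t
    exact S.rel_trans f g hf hg h _
  d_comp h _ _ _ _ _ _ hn hi hj hn' a b := by
    refine (chains_d hn' _).trans ((dCh_prodCh (S.comp h) hn hi hj hn' a b).trans ?_)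
    exact (congrArg₂ (fun y z => S.compCh K h (show _ + _ = _ by omega) y b +
      sg _ • S.compCh K h (show _ + _ = _ by omega) a z) (chains_d hi a) (chains_d hj b)).symm
  rel_comp h f g k h' hf hg hk h1 h2 _ _ _ hn a b :=
    S.compCh_rel h f g k h' hf hg hk h1 h2 hn a b
  assoc_seq h₁ h₂ h₃ h₄ _ _ _ _ _ _ hm hn hp hq a b z :=
    S.compCh_seq h₁ h₂ h₃ h₄ hm hn hp hq a b z
  assoc_par hxy h₁ h₂ h₃ h₄ _ _ _ _ _ _ hm hn hp hq a b z :=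
    S.compCh_par hxy h₁ h₂ h₃ h₄ hm hn hp hq a b z
  d_one h := by
    refine (chains_d (by norm_num) _).trans ((dCh_br _ (isCube_const _)).trans ?_)
    simp [bdry]
    rfl
  rel_one hA f hB hf := by
    refine (mapCh_br _ (isCube_const _)).trans (congrArg (br K 0) ?_)
    ext t
    exact S.rel_one hA f hB hf
  one_comp hA B h n hn b := by
    exact S.compCh_one_left hA h hn b
  comp_one hB h n hn a := S.compCh_one_right hB h hn a

end TopOperad

end

section

variable {K : Type u} [Field K]

namespace TopOperad

section chainsMap
variable {Γ Δ : Type} {S : TopOperad.{v} Γ} {T : TopOperad.{v} Δ} {γ : Γ → Δ} (F : Hom γ S T)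

theorem Hom.compCh {c : Γ} {A : Ar Γ} {x : ℕ} {d : Γ} {B C : Ar Γ} (h : CIns A x d B C)
    {i j n : ℤ} (hn : i + j = n) (a : Ch K (S.X c A) i) (b : Ch K (S.X d B) j) :
    mapCh K (F.app c C) n (S.compCh K h hn a b) =
      T.compCh K (h.map γ) hn (mapCh K (F.app c A) i a) (mapCh K (F.app d B) j b) := by
  induction a using Ch_induction with
  | h0 => simp
  | hadd a a' ha ha' => simp only [map_add, LinearMap.add_apply, ha, ha']
  | hsmul c a ha => simp only [map_smul, LinearMap.smul_apply, ha]
  | hbr σ hσ =>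
  induction b using Ch_induction with
  | h0 => simp
  | hadd a a' ha ha' => simp only [map_add, ha, ha']
  | hsmul c a ha => simp only [map_smul, ha]
  | hbr τ hτ =>
  unfold TopOperad.compCh
  rw [prodCh_br _ _ hσ hτ, mapCh_br _ (hσ.prodCube _ hn hτ), mapCh_br _ hσ, mapCh_br _ hτ,
    prodCh_br _ _ (hσ.map _) (hτ.map _)]
  congr 1
  ext t
  exact F.comp h _ _

/-- The morphism of (one-coloured) dg operads of chains defined by a morphism of topological
operads. -/
noncomputable def Hom.chains (K : Type u) [Field K] (c : Γ) :
    ((S.chains K).mono c).toNUOperad ⟶ ((T.chains K).mono (γ c)).toNUOperad where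
  app A := mapChains K (F.app c (Ar.const c A))
  rel f hf := by
    apply Ch_hom_ext
    intro i σ hσ
    refine Eq.trans (congrArg (mapCh K _ i) (mapCh_br _ hσ)) ((mapCh_br _ (hσ.map _)).trans
      (Eq.trans ?_ (Eq.trans (congrArg (mapCh K _ i) (mapCh_br _ hσ)) (mapCh_br _ (hσ.map _))).symm))
    refine congrArg (br K i) ?_
    ext t
    exact F.rel f _ _
  comp h _ _ _ hn a b := F.compCh (CIns.const h) hn a b

end chainsMap

/-! ### Unitary operads -/

/-- The condition that there is precisely one operation without inputs. A one-coloured operad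
with this property is (equivalent to) a `Λ`-operad: the insertion of the operation without inputs
gives the restriction operators. -/
class IsLambda (T : TopOperad.{v} Unit) : Prop where
  unique : ∀ A : Ar Unit, A.set = ∅ → Nonempty (Unique (T.X () A))

/-- The condition that the unit is the only operation with a single input. -/
class IsReduced (T : TopOperad.{v} Unit) : Prop where
  unique : ∀ A : Ar Unit, A.set.card = 1 → Nonempty (Unique (T.X () A))

/-- Sets of inputs of a single colour. -/
abbrev ar (A : Finset ℕ) : Ar Unit := ⟨A, fun _ => ()⟩

theorem reIn {f : ℕ → ℕ} {A B : Ar Unit} (h : Set.BijOn f A.set B.set) : ReIn f A B :=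
  ⟨h, fun _ _ => rfl⟩

theorem cIns {A : Ar Unit} {x : ℕ} {B C : Ar Unit} (h : Ins A.set x B.set C.set) :
    CIns A x () B C := ⟨h, rfl, fun _ _ => rfl, fun _ _ => rfl⟩

section res
variable (T : TopOperad.{v} Unit) [IsLambda T]

/-- The operation without inputs. -/
noncomputable def pt : T.X () (ar ∅) := (IsLambda.unique (T := T) (ar ∅) rfl).some.default

theorem eq_of_empty {A : Ar Unit} (hA : A.set = ∅) (a b : T.X () A) : a = b :=
  have := (IsLambda.unique (T := T) A hA).some
  Subsingleton.elim a b

theorem ins_empty {A : Finset ℕ} {x : ℕ} (hx : x ∈ A) : Ins A x ∅ (A.erase x) :=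
  ⟨hx, by simp, by simp⟩

/-- Insertion of the operation without inputs in the input `x`. -/
noncomputable def cap {A : Finset ℕ} {x : ℕ} (hx : x ∈ A) : C(T.X () (ar A), T.X () (ar (A.erase x))) :=
  (T.comp (cIns (A := ar A) (B := ar ∅) (C := ar (A.erase x)) (ins_empty hx))).comp
    ((ContinuousMap.id _).prodMk (ContinuousMap.const _ T.pt))

/-- `B` is obtained from `A` by removing the elements of the list `l`. -/
structure Rem (l : List ℕ) (A B : Finset ℕ) : Prop where
  nodup : l.Nodup
  subset : ∀ x ∈ l, x ∈ A
  mem_iff : ∀ n, n ∈ B ↔ n ∈ A ∧ n ∉ l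

theorem Rem.nil {A B : Finset ℕ} (h : Rem [] A B) : A = B := by
  ext n; simp [h.mem_iff]

theorem Rem.tail {x : ℕ} {l : List ℕ} {A B : Finset ℕ} (h : Rem (x :: l) A B) :
    Rem l (A.erase x) B := by
  obtain ⟨h1, h2, h3⟩ := h
  simp only [List.nodup_cons] at h1
  refine ⟨h1.2, fun y hy => Finset.mem_erase.2 ⟨?_, h2 y (by simp [hy])⟩, fun n => ?_⟩
  · rintro rfl; exact h1.1 hy
  · rw [h3, Finset.mem_erase, List.mem_cons]; tauto

theorem Rem.head {x : ℕ} {l : List ℕ} {A B : Finset ℕ} (h : Rem (x :: l) A B) : x ∈ A :=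
  h.subset x (by simp)

theorem bij_id {A B : Finset ℕ} (h : A = B) : Set.BijOn id (A : Set ℕ) B := by
  rw [h]; exact Set.bijOn_id _

/-- Insertion of the operation without inputs in the inputs which are in a list. -/
noncomputable def resL : ∀ (l : List ℕ) {A B : Finset ℕ}, Rem l A B → C(T.X () (ar A), T.X () (ar B))
  | [], _, _, h => T.rel id (reIn (bij_id h.nil))
  | _ :: l, _, _, h => (resL l h.tail).comp (T.cap h.head)

theorem rem_sort {A B : Finset ℕ} (h : B ⊆ A) : Rem (A \ B).toList A B := by
  refine ⟨Finset.nodup_toList _, fun x hx => ?_, fun n => ?_⟩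
  · rw [Finset.mem_toList, Finset.mem_sdiff] at hx
    exact hx.1
  · rw [Finset.mem_toList, Finset.mem_sdiff]
    have := @h n
    tauto

/-- The restriction operators of a unitary operad: insertion of the operation without inputs
in all inputs which are not in `B`. -/
noncomputable def res {A B : Finset ℕ} (h : B ⊆ A) : C(T.X () (ar A), T.X () (ar B)) :=
  T.resL (A \ B).toList (rem_sort h)

variable {T}

theorem cap_rel {A A' : Finset ℕ} (f : ℕ → ℕ) (hf : Set.BijOn f (A : Set ℕ) A') {x y : ℕ} (hx : x ∈ A)
    (hy : y ∈ A') (hxy : f x = y) (hf' : Set.BijOn f (A.erase x : Finset ℕ) (A'.erase y : Finset ℕ))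
    (t : T.X () (ar A)) :
    T.cap hy (T.rel f (reIn (A := ar A) (B := ar A') hf) t) = T.rel f (reIn hf') (T.cap hx t) := by
  subst hxy
  have h0 : Set.BijOn f ((∅ : Finset ℕ) : Set ℕ) (∅ : Finset ℕ) := by simp
  refine Eq.trans ?_ (T.rel_comp (cIns (A := ar A) (B := ar ∅) (C := ar (A.erase x)) (ins_empty hx))
    f f f (cIns (A := ar A') (B := ar ∅) (C := ar (A'.erase (f x))) (ins_empty hy)) (reIn hf)
    (reIn h0) (reIn hf') (fun _ _ => rfl) (fun _ _ => rfl) t T.pt).symm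
  exact congrArg (fun p => T.comp _ (T.rel f (reIn hf) t, p)) (T.eq_of_empty rfl _ _)

theorem bijOn_erase {A A' : Finset ℕ} {f : ℕ → ℕ} (hf : Set.BijOn f (A : Set ℕ) A') {x : ℕ}
    (hx : x ∈ A) : Set.BijOn f (A.erase x : Finset ℕ) (A'.erase (f x) : Finset ℕ) := by
  rw [Finset.coe_erase, Finset.coe_erase]
  exact hf.sdiff_singleton hx

theorem resL_rel (f : ℕ → ℕ) (l : List ℕ) {A A' B B' : Finset ℕ} (hf : Set.BijOn f (A : Set ℕ) A')
    (hB : Set.BijOn f (B : Set ℕ) B') (h : Rem l A B) (h' : Rem (l.map f) A' B')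
    (t : T.X () (ar A)) :
    T.resL (l.map f) h' (T.rel f (reIn hf) t) = T.rel f (reIn hB) (T.resL l h t) := by
  induction l generalizing A A' with
  | nil =>
    obtain rfl := h.nil
    simp only [List.map_nil, resL]
    rw [← T.rel_trans f id _ _ (reIn hB : ReIn f (ar A) (ar B')),
      ← T.rel_trans id f _ _ (reIn hB : ReIn f (ar A) (ar B'))]
    rfl
  | cons x l ih =>
    simp only [List.map_cons, resL, ContinuousMap.comp_apply]
    rw [cap_rel f hf h.head h'.head rfl (bijOn_erase hf h.head)]
    exact ih (bijOn_erase hf h.head) h.tail h'.tail _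

theorem cap_cap {A : Finset ℕ} {x y : ℕ} (hx : x ∈ A) (hy : y ∈ A) (hxy : x ≠ y)
    (hy' : y ∈ A.erase x) (hx' : x ∈ A.erase y)
    (he : Set.BijOn id (((A.erase y).erase x : Finset ℕ) : Set ℕ) ((A.erase x).erase y : Finset ℕ))
    (t : T.X () (ar A)) :
    T.cap hy' (T.cap hx t) = T.rel id (reIn he) (T.cap hx' (T.cap hy t)) := by
  have e : (A.erase x).erase y = (A.erase y).erase x := Finset.erase_right_comm
  have key := T.assoc_par hxy (cIns (A := ar A) (B := ar ∅) (C := ar (A.erase x)) (ins_empty hx))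
    (cIns (A := ar (A.erase x)) (B := ar ∅) (C := ar ((A.erase x).erase y)) (ins_empty hy'))
    (cIns (A := ar A) (B := ar ∅) (C := ar (A.erase y)) (ins_empty hy))
    (cIns (A := ar (A.erase y)) (x := x) (B := ar ∅) (C := ar ((A.erase x).erase y))
      (by rw [e]; exact ins_empty hx')) t T.pt T.pt
  refine key.trans ?_
  have := T.rel_comp
    (cIns (A := ar (A.erase y)) (B := ar ∅) (C := ar ((A.erase y).erase x)) (ins_empty hx'))
    id id id (cIns (A := ar (A.erase y)) (x := x) (B := ar ∅) (C := ar ((A.erase x).erase y))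
      (by rw [e]; exact ins_empty hx')) (reIn (Set.bijOn_id _)) (reIn (Set.bijOn_id _)) (reIn he)
      (fun _ _ => rfl) (fun _ _ => rfl) (T.cap hy t) T.pt
  rw [T.rel_id, T.rel_id] at this
  exact this.symm

theorem resL_perm {l l' : List ℕ} (p : l.Perm l') {A B : Finset ℕ} (h : Rem l A B)
    (h' : Rem l' A B) (t : T.X () (ar A)) : T.resL l h t = T.resL l' h' t := by
  induction p generalizing A with
  | nil => rfl
  | cons x p ih => exact ih h.tail h'.tail _
  | swap x y l =>
    simp only [resL, ContinuousMap.comp_apply]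
    have hne : y ≠ x := by
      have := h.nodup
      simp only [List.nodup_cons, List.mem_cons, not_or] at this
      exact this.1.1
    have he : Set.BijOn id (((A.erase x).erase y : Finset ℕ) : Set ℕ)
        ((A.erase y).erase x : Finset ℕ) := bij_id Finset.erase_right_comm
    rw [cap_cap h.head h'.head hne h.tail.head h'.tail.head he]
    have := resL_rel id l he (Set.bijOn_id (B : Set ℕ)) h'.tail.tail
      (by rw [List.map_id]; exact h.tail.tail) (T.cap h'.tail.head (T.cap h'.head t))
    rw [T.rel_id] at this
    simp only [List.map_id] at this
    exact this
  | trans p q ih1 ih2 =>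
    rename_i l1 l2 l3
    have h2 : Rem l2 A B := ⟨p.nodup_iff.1 h.nodup, fun x hx => h.subset x (p.mem_iff.2 hx),
      fun n => by rw [h.mem_iff, p.mem_iff]⟩
    rw [ih1 h h2, ih2 h2 h']

theorem res_eq {l : List ℕ} {A B : Finset ℕ} (h : Rem l A B) (hBA : B ⊆ A) (t : T.X () (ar A)) :
    T.res hBA t = T.resL l h t := by
  apply resL_perm
  rw [List.perm_ext_iff_of_nodup (Finset.nodup_toList _) h.nodup]
  intro n
  rw [Finset.mem_toList, Finset.mem_sdiff, h.mem_iff]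
  have := h.subset n
  tauto

theorem res_rel (f : ℕ → ℕ) {A A' B B' : Finset ℕ} (hf : Set.BijOn f (A : Set ℕ) A')
    (hB : Set.BijOn f (B : Set ℕ) B') (h : B ⊆ A) (h' : B' ⊆ A') (t : T.X () (ar A)) :
    T.res h' (T.rel f (reIn hf) t) = T.rel f (reIn hB) (T.res h t) := by
  have hl := rem_sort h
  have hl' : Rem ((A \ B).toList.map f) A' B' := by
    refine ⟨?_, ?_, fun n => ?_⟩
    · refine List.Nodup.map_on (fun x hx y hy e => hf.injOn ?_ ?_ e) (Finset.nodup_toList _)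
      · exact hl.subset x hx
      · exact hl.subset y hy
    · intro y hy
      obtain ⟨x, hx, rfl⟩ := List.mem_map.1 hy
      exact hf.mapsTo (hl.subset x hx)
    · constructor
      · intro hn
        refine ⟨h' hn, fun hn' => ?_⟩
        obtain ⟨x, hx, rfl⟩ := List.mem_map.1 hn'
        obtain ⟨y, hy, e⟩ := hB.surjOn hn
        have : y = x := hf.injOn (h hy) (hl.subset x hx) e
        subst this
        exact ((hl.mem_iff y).1 hy).2 hx
      · rintro ⟨hn, hn'⟩
        obtain ⟨x, hx, rfl⟩ := hf.surjOn hn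
        refine hB.mapsTo ((hl.mem_iff x).2 ⟨hx, fun hx' => hn' (List.mem_map_of_mem hx')⟩)
  rw [res_eq hl' h', resL_rel f _ hf hB hl hl']
  rfl

theorem resL_append {l l' : List ℕ} {A B C : Finset ℕ} (h : Rem (l ++ l') A C) (h1 : Rem l A B)
    (h2 : Rem l' B C) (t : T.X () (ar A)) : T.resL (l ++ l') h t = T.resL l' h2 (T.resL l h1 t) := by
  induction l generalizing A with
  | nil =>
    obtain rfl := h1.nil
    simp only [List.nil_append, resL, T.rel_id]
  | cons x l ih => exact ih h.tail h1.tail _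

theorem Rem.unique {l : List ℕ} {A B B' : Finset ℕ} (h : Rem l A B) (h' : Rem l A B') : B = B' := by
  ext n; rw [h.mem_iff, h'.mem_iff]

theorem resL_comp_left (l : List ℕ) {A A' B C C' : Finset ℕ} {x : ℕ} (h : Ins A x B C)
    (h' : Ins A' x B C') (hA : Rem l A A') (hC : Rem l C C') (t : T.X () (ar A))
    (s : T.X () (ar B)) :
    T.resL l hC (T.comp (cIns (A := ar A) (B := ar B) (C := ar C) h) (t, s)) =
      T.comp (cIns (A := ar A') (B := ar B) (C := ar C') h') (T.resL l hA t, s) := by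
  induction l generalizing A C with
  | nil =>
    obtain rfl := hA.nil
    obtain rfl := hC.nil
    simp only [resL, T.rel_id]
  | cons y l ih =>
    have hx : x ∈ A' := h'.mem
    have hxy : x ≠ y := by
      rintro rfl
      exact ((hA.mem_iff x).1 hx).2 (by simp)
    have hy : y ∈ A := hA.head
    have hyB : y ∉ B := h.notMem_right (Finset.mem_erase.2 ⟨hxy.symm, hy⟩)
    have h'' : Ins (A.erase y) x B (C.erase y) := by
      refine ⟨Finset.mem_erase.2 ⟨hxy, h.mem⟩, ?_, ?_⟩
      · exact Finset.disjoint_of_subset_left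
          (Finset.erase_subset_erase _ (Finset.erase_subset _ _)) h.disj
      · rw [h.eq, Finset.erase_union_distrib, Finset.erase_eq_of_notMem hyB,
          Finset.erase_right_comm]
    simp only [resL, ContinuousMap.comp_apply]
    rw [← ih h'' hA.tail hC.tail]
    congr 1
    exact T.assoc_par hxy (cIns (A := ar A) (B := ar B) (C := ar C) h)
      (cIns (A := ar C) (B := ar ∅) (C := ar (C.erase y)) (ins_empty hC.head))
      (cIns (A := ar A) (B := ar ∅) (C := ar (A.erase y)) (ins_empty hy))
      (cIns (A := ar (A.erase y)) (B := ar B) (C := ar (C.erase y)) h'') t s T.pt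

theorem resL_comp_right (l : List ℕ) {A B B' C C' : Finset ℕ} {x : ℕ} (h : Ins A x B C)
    (h' : Ins A x B' C') (hB : Rem l B B') (hC : Rem l C C') (t : T.X () (ar A))
    (s : T.X () (ar B)) :
    T.resL l hC (T.comp (cIns (A := ar A) (B := ar B) (C := ar C) h) (t, s)) =
      T.comp (cIns (A := ar A) (B := ar B') (C := ar C') h') (t, T.resL l hB s) := by
  induction l generalizing B C with
  | nil =>
    obtain rfl := hB.nil
    obtain rfl := hC.nil
    simp only [resL, T.rel_id]
  | cons y l ih =>
    have hy : y ∈ B := hB.head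
    have hyA : y ∉ A.erase x := h.notMem_left hy
    have h'' : Ins A x (B.erase y) (C.erase y) := by
      refine ⟨h.mem, Finset.disjoint_of_subset_right (Finset.erase_subset _ _) h.disj, ?_⟩
      rw [h.eq, Finset.erase_union_distrib, Finset.erase_eq_of_notMem hyA]
    simp only [resL, ContinuousMap.comp_apply]
    rw [← ih h'' hB.tail hC.tail]
    congr 1
    exact T.assoc_seq (cIns (A := ar A) (B := ar B) (C := ar C) h)
      (cIns (A := ar C) (B := ar ∅) (C := ar (C.erase y)) (ins_empty hC.head))
      (cIns (A := ar B) (B := ar ∅) (C := ar (B.erase y)) (ins_empty hy))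
      (cIns (A := ar A) (B := ar (B.erase y)) (C := ar (C.erase y)) h'') t s T.pt

theorem res_comp {A A' B B' C C' : Finset ℕ} {x : ℕ} (h : Ins A x B C) (h' : Ins A' x B' C')
    (hA : A' ⊆ A) (hB : B' ⊆ B) (hC : C' ⊆ C) (t : T.X () (ar A)) (s : T.X () (ar B)) :
    T.res hC (T.comp (cIns (A := ar A) (B := ar B) (C := ar C) h) (t, s)) =
      T.comp (cIns (A := ar A') (B := ar B') (C := ar C') h') (T.res hA t, T.res hB s) := by
  have lA := rem_sort hA
  have lB := rem_sort hB
  set l := (A \ A').toList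
  set l' := (B \ B').toList
  have hlx : ∀ y ∈ l, y ≠ x := by
    rintro y hy rfl
    exact ((lA.mem_iff y).1 h'.mem).2 hy
  have hlB : ∀ y ∈ l, y ∉ B := fun y hy =>
    h.notMem_right (Finset.mem_erase.2 ⟨hlx y hy, lA.subset y hy⟩)
  have e1 : Ins A' x B (A'.erase x ∪ B) :=
    ⟨h'.mem, Finset.disjoint_of_subset_left (Finset.erase_subset_erase _ hA) h.disj, rfl⟩
  have e2 : Rem l C (A'.erase x ∪ B) := by
    refine ⟨lA.nodup, fun y hy => h.mem_iff.2 (Or.inl (Finset.mem_erase.2 ⟨hlx y hy, lA.subset y hy⟩)),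
      fun n => ?_⟩
    rw [h.mem_iff, Finset.mem_union, Finset.mem_erase, Finset.mem_erase, lA.mem_iff]
    have := hlB n
    tauto
  have e3 : Rem l' (A'.erase x ∪ B) C' := by
    refine ⟨lB.nodup, fun y hy => Finset.mem_union_right _ (lB.subset y hy), fun n => ?_⟩
    rw [h'.mem_iff, Finset.mem_union, lB.mem_iff]
    have h1 : n ∈ A'.erase x → n ∉ B := fun hn => e1.notMem_right hn
    have h2 := lB.subset n
    tauto
  have e4 : Rem (l ++ l') C C' := by
    refine ⟨List.nodup_append'.2 ⟨lA.nodup, lB.nodup, fun y hy hy' => hlB y hy (lB.subset y hy')⟩,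
      fun y hy => ?_, fun n => ?_⟩
    · rcases List.mem_append.1 hy with hy | hy
      · exact e2.subset y hy
      · exact h.mem_iff.2 (Or.inr (lB.subset y hy))
    · rw [e3.mem_iff, e2.mem_iff, List.mem_append]
      tauto
  rw [res_eq e4, resL_append e4 e2 e3, resL_comp_left l h e1 lA e2,
    resL_comp_right l' e1 h' lB e3]
  rfl

theorem res_comp_forget {A B C D : Finset ℕ} {x : ℕ} (h : Ins A x B C) (hA : D ⊆ A)
    (hx : x ∉ D) (hC : D ⊆ C) (hB : Disjoint D B) (t : T.X () (ar A)) (s : T.X () (ar B)) :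
    T.res hC (T.comp (cIns (A := ar A) (B := ar B) (C := ar C) h) (t, s)) = T.res hA t := by
  have lB : Rem B.toList B ∅ := ⟨Finset.nodup_toList _, by simp, by simp⟩
  have hD : D ⊆ A.erase x := fun n hn => Finset.mem_erase.2 ⟨fun e => hx (e ▸ hn), hA hn⟩
  have lA := rem_sort hD
  set l := (A.erase x \ D).toList
  have e0 : Rem (x :: l) A D := by
    refine ⟨List.nodup_cons.2 ⟨fun hn => Finset.notMem_erase x A (lA.subset x hn), lA.nodup⟩,
      fun y hy => ?_, fun n => ?_⟩
    · rcases List.mem_cons.1 hy with rfl | hy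
      · exact h.mem
      · exact Finset.mem_of_mem_erase (lA.subset y hy)
    · rw [lA.mem_iff, Finset.mem_erase, List.mem_cons]
      tauto
  have e1 : Rem B.toList C (A.erase x) := by
    refine ⟨Finset.nodup_toList _, fun y hy => h.mem_iff.2 (Or.inr (by simpa using hy)), fun n => ?_⟩
    rw [h.mem_iff, Finset.mem_toList]
    have : n ∈ A.erase x → n ∉ B := h.notMem_right
    tauto
  have e2 : Rem (B.toList ++ l) C D := by
    refine ⟨List.nodup_append'.2 ⟨Finset.nodup_toList _, lA.nodup, fun y hy hy' =>
      h.notMem_left (by simpa using hy) (lA.subset y hy')⟩, fun y hy => ?_, fun n => ?_⟩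
    · rcases List.mem_append.1 hy with hy | hy
      · exact e1.subset y hy
      · exact h.mem_iff.2 (Or.inl (lA.subset y hy))
    · rw [lA.mem_iff, e1.mem_iff, List.mem_append]
      tauto
  rw [res_eq e2, resL_append e2 e1 lA, resL_comp_right _ h (ins_empty h.mem) lB e1, res_eq e0]
  simp only [resL, ContinuousMap.comp_apply]
  congr 1
  exact congrArg (fun p => T.comp _ (t, p)) (T.eq_of_empty rfl _ _)

theorem res_self {A : Finset ℕ} (h : A ⊆ A) (t : T.X () (ar A)) : T.res h t = t := by
  rw [res_eq (l := []) ⟨List.nodup_nil, by simp, by simp⟩]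
  simp only [resL, T.rel_id]

theorem res_id {A A' : Finset ℕ} (e : A = A') (h : A' ⊆ A) (t : T.X () (ar A)) :
    T.res h t = T.rel id (reIn (A := ar A) (B := ar A') (bij_id e)) t := by
  subst e
  rw [res_self, T.rel_id]

end res
end TopOperad

end

section

theorem Ins.mem_iff' {A : Finset ℕ} {x : ℕ} {B C : Finset ℕ} (h : Ins A x B C) {n : ℕ} :
    n ∈ C ↔ (n ≠ x ∧ n ∈ A) ∨ n ∈ B := by
  rw [h.eq, Finset.mem_union, Finset.mem_erase]

namespace TopOperad

theorem rel_rel {Γ : Type} (T : TopOperad.{v} Γ) {c : Γ} {A B C : Ar Γ} (f g k : ℕ → ℕ)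
    (hf : ReIn f A B) (hg : ReIn g B C) (hk : ReIn k A C) (h : ∀ a ∈ A.set, g (f a) = k a)
    (t : T.X c A) : T.rel g hg (T.rel f hf t) = T.rel k hk t := by
  have h' : ReIn (g ∘ f) A C :=
    ⟨hk.bij.congr fun a ha => (h a ha).symm, fun a ha => by
      rw [Function.comp_apply, h a ha]; exact hk.col a ha⟩
  rw [← T.rel_trans f g hf hg h']
  exact T.rel_congr _ _ _ _ (fun a ha => h a ha) t

/-- The inputs of colour `true`. -/
def on (A : Ar Bool) : Finset ℕ := A.set.filter fun a => A.col a = true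

theorem mem_on {A : Ar Bool} {n : ℕ} : n ∈ on A ↔ n ∈ A.set ∧ A.col n = true := by
  simp [on]

theorem on_eq_empty {A : Ar Bool} : on A = ∅ ↔ ∀ a ∈ A.set, A.col a = false := by
  simp [on, Finset.filter_eq_empty_iff]

theorem on_subset (A : Ar Bool) : on A ⊆ A.set := Finset.filter_subset _ _

theorem on_bij {f : ℕ → ℕ} {A B : Ar Bool} (h : ReIn f A B) :
    Set.BijOn f (on A : Set ℕ) (on B : Set ℕ) := by
  refine ⟨fun a ha => ?_, fun a ha b hb => h.bij.injOn (mem_on.1 ha).1 (mem_on.1 hb).1,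
    fun b hb => ?_⟩
  · have ha := mem_on.1 ha
    exact mem_on.2 ⟨h.bij.mapsTo ha.1, by rw [h.col a ha.1, ha.2]⟩
  · have hb := mem_on.1 hb
    obtain ⟨a, ha, rfl⟩ := h.bij.surjOn hb.1
    exact ⟨a, mem_on.2 ⟨ha, by rw [← h.col a ha, hb.2]⟩, rfl⟩

theorem on_rel {f : ℕ → ℕ} {A B : Ar Bool} (h : ReIn f A B) (hA : on A = ∅) : on B = ∅ := by
  have := on_bij h
  rw [hA] at this
  have h2 := this.surjOn
  rw [Finset.coe_empty] at h2
  ext n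
  constructor
  · intro hn
    obtain ⟨a, ha, -⟩ := h2 hn
    exact ha.elim
  · simp

theorem on_ins {A : Ar Bool} {x : ℕ} {B C : Ar Bool} (h : CIns A x true B C) :
    Ins (on A) x (on B) (on C) := by
  refine ⟨mem_on.2 ⟨h.ins.mem, h.col⟩, ?_, ?_⟩
  · exact Finset.disjoint_of_subset_left (Finset.erase_subset_erase _ (on_subset A))
      (Finset.disjoint_of_subset_right (on_subset B) h.ins.disj)
  · ext n
    rw [Finset.mem_union, Finset.mem_erase, mem_on, mem_on, mem_on, h.ins.mem_iff']
    constructor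
    · rintro ⟨⟨h1, h2⟩ | h2, h3⟩
      · rw [h.left n (Finset.mem_erase.2 ⟨h1, h2⟩)] at h3
        exact Or.inl ⟨h1, h2, h3⟩
      · rw [h.right n h2] at h3
        exact Or.inr ⟨h2, h3⟩
    · rintro (⟨h1, h2, h3⟩ | ⟨h2, h3⟩)
      · exact ⟨Or.inl ⟨h1, h2⟩, by rw [h.left n (Finset.mem_erase.2 ⟨h1, h2⟩)]; exact h3⟩
      · exact ⟨Or.inr h2, by rw [h.right n h2]; exact h3⟩

theorem on_off {A : Ar Bool} {x : ℕ} {B C : Ar Bool} (h : CIns A x false B C) (hB : on B = ∅) :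
    on A = on C := by
  have hB' := on_eq_empty.1 hB
  ext n
  rw [mem_on, mem_on, h.ins.mem_iff']
  constructor
  · rintro ⟨h1, h2⟩
    have hx : n ≠ x := by
      rintro rfl
      rw [h.col] at h2
      exact Bool.noConfusion h2
    exact ⟨Or.inl ⟨hx, h1⟩, by rw [h.left n (Finset.mem_erase.2 ⟨hx, h1⟩)]; exact h2⟩
  · rintro ⟨⟨h1, h2⟩ | h2, h3⟩
    · rw [h.left n (Finset.mem_erase.2 ⟨h1, h2⟩)] at h3
      exact ⟨h2, h3⟩
    · rw [h.right n h2, hB' n h2] at h3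
      exact Bool.noConfusion h3

/-- If the output colour is `false`, then all inputs are of colour `false`. -/
def Ok (c : Bool) (A : Ar Bool) : Prop := c = false → on A = ∅

theorem Ok.rel {c : Bool} {f : ℕ → ℕ} {A B : Ar Bool} (hA : Ok c A) (h : ReIn f A B) : Ok c B :=
  fun hc => on_rel h (hA hc)

theorem Ok.ins {c : Bool} {A : Ar Bool} {x : ℕ} {d : Bool} {B C : Ar Bool} (h : CIns A x d B C)
    (hA : Ok c A) (hB : Ok d B) : Ok c C := by
  intro hc
  have hA := hA hc
  have hd : d = false := by
    rw [← h.col]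
    exact on_eq_empty.1 hA x h.ins.mem
  subst hd
  rw [← on_off h (hB rfl), hA]

theorem Ok.one {A : Ar Bool} {x : ℕ} {c : Bool} (h : IsOne A x c) : Ok c A := by
  rintro rfl
  rw [on_eq_empty, h.set]
  intro a ha
  rw [Finset.mem_singleton.1 ha, h.col]

theorem insU {Γ : Type} {A : Ar Γ} {x : ℕ} {d : Γ} {B C : Ar Γ} (h : CIns A x d B C) :
    CIns (ar A.set) x () (ar B.set) (ar C.set) := cIns h.ins

/-- Relabelling of inputs in the operad `paint`. -/
def paintRel (T : TopOperad.{v} Unit) {c : Bool} {A B : Ar Bool} (f : ℕ → ℕ) (h : ReIn f A B) :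
    C({_t : T.X () (ar A.set) // Ok c A}, {_t : T.X () (ar B.set) // Ok c B}) where
  toFun t := ⟨T.rel f (reIn h.bij) t.1, t.2.rel h⟩
  continuous_toFun := by fun_prop

/-- Composition in the operad `paint`. -/
def paintComp (T : TopOperad.{v} Unit) {c : Bool} {A : Ar Bool} {x : ℕ} {d : Bool} {B C : Ar Bool}
    (h : CIns A x d B C) :
    C({_t : T.X () (ar A.set) // Ok c A} × {_t : T.X () (ar B.set) // Ok d B},
      {_t : T.X () (ar C.set) // Ok c C}) where
  toFun p := ⟨T.comp (insU h) (p.1.1, p.2.1), Ok.ins h p.1.2 p.2.2⟩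
  continuous_toFun := by fun_prop

/-- The operad with the operations `T(A)` for the output colour `true`, where the inputs `A` have
arbitrary colours, and for the output colour `false`, if all inputs have the colour `false`. -/
def paint (T : TopOperad.{v} Unit) : TopOperad.{v} Bool where
  X c A := {_t : T.X () (ar A.set) // Ok c A}
  rel f h := T.paintRel f h
  comp h := T.paintComp h
  one h := ⟨T.one ⟨h.set, rfl⟩, Ok.one h⟩
  rel_congr f g hf hg h a := Subtype.ext (T.rel_congr f g _ _ h a.1)
  rel_id h a := Subtype.ext (T.rel_id _ a.1)
  rel_trans f g hf hg h a := Subtype.ext (T.rel_trans f g _ _ _ a.1)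
  rel_comp h f g k h' hf hg hk h1 h2 a b :=
    Subtype.ext (T.rel_comp (insU h) f g k (insU h') _ _ _ h1 h2 a.1 b.1)
  assoc_seq h₁ h₂ h₃ h₄ a b z := Subtype.ext (T.assoc_seq (insU h₁) (insU h₂) (insU h₃)
    (insU h₄) a.1 b.1 z.1)
  assoc_par hxy h₁ h₂ h₃ h₄ a b z := Subtype.ext (T.assoc_par hxy (insU h₁) (insU h₂)
    (insU h₃) (insU h₄) a.1 b.1 z.1)
  rel_one hA f hB hf := Subtype.ext (T.rel_one _ f _ _)
  one_comp hA B h b := Subtype.ext (T.one_comp _ (insU h) b.1)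
  comp_one hB h a := Subtype.ext (T.comp_one _ (insU h) a.1)

theorem reOn {f : ℕ → ℕ} {A B : Ar Bool} (h : ReIn f A B) : ReIn f (ar (on A)) (ar (on B)) :=
  reIn (on_bij h)

theorem reOff {A : Ar Bool} {x : ℕ} {B C : Ar Bool} (h : CIns A x false B C) (hB : on B = ∅) :
    ReIn id (ar (on A)) (ar (on C)) := reIn (bij_id (on_off h hB))

theorem insOn {A : Ar Bool} {x : ℕ} {B C : Ar Bool} (h : CIns A x true B C) :
    CIns (ar (on A)) x () (ar (on B)) (ar (on C)) := cIns (on_ins h)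

/-- Relabelling of inputs in the operad `triv`. -/
def trivRel (T : TopOperad.{v} Unit) {c : Bool} {A B : Ar Bool} (f : ℕ → ℕ) (h : ReIn f A B) :
    C({_t : T.X () (ar (on A)) // Ok c A}, {_t : T.X () (ar (on B)) // Ok c B}) where
  toFun t := ⟨T.rel f (reOn h) t.1, t.2.rel h⟩
  continuous_toFun := by fun_prop

/-- Composition in the operad `triv`: if the colour of the input is `true`, then it is given by
the composition in `T`, and the insertion of an operation in an input of colour `false` does not
change the operation. -/
def trivComp (T : TopOperad.{v} Unit) {c : Bool} {A : Ar Bool} {x : ℕ} : ∀ {d : Bool} {B C : Ar Bool},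
    CIns A x d B C → C({_t : T.X () (ar (on A)) // Ok c A} × {_t : T.X () (ar (on B)) // Ok d B},
      {_t : T.X () (ar (on C)) // Ok c C})
  | true, _, _, h =>
    { toFun := fun p => ⟨T.comp (insOn h) (p.1.1, p.2.1), Ok.ins h p.1.2 p.2.2⟩
      continuous_toFun := by fun_prop }
  | false, B, _, h =>
    { toFun := fun p => ⟨T.rel id (reOff h (p.2.2 rfl)) p.1.1, Ok.ins h p.1.2 p.2.2⟩
      continuous_toFun := by
        by_cases hB : on B = ∅
        · have := (T.rel (c := ()) id (reOff h hB)).continuous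
          exact (this.comp (continuous_subtype_val.comp continuous_fst)).subtype_mk _
        · have : IsEmpty ({_t : T.X () (ar (on A)) // Ok c A} ×
            {_t : T.X () (ar (on B)) // Ok false B}) := ⟨fun p => hB (p.2.2 rfl)⟩
          exact continuous_of_const fun x => this.elim x }

theorem ins_empty_false {B : Ar Bool} {y : ℕ} {e : Bool} {D E : Ar Bool} (h : CIns B y e D E)
    (hB : on B = ∅) : e = false := by
  rw [← h.col]
  exact on_eq_empty.1 hB y h.ins.mem

/-- The operad with the operations `T(A)`, where `A` is the set of inputs of colour `true`, for the
output colour `true`, and with precisely one operation for the output colour `false`, if all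
inputs have the colour `false` (for an operad `T` with precisely one operation without inputs). -/
noncomputable def triv (T : TopOperad.{v} Unit) [IsLambda T] : TopOperad.{v} Bool where
  X c A := {_t : T.X () (ar (on A)) // Ok c A}
  rel f h := T.trivRel f h
  comp h := T.trivComp h
  one {A x c} h := match c, h with
    | true, h => ⟨T.one ⟨by ext n; simp only [mem_on, h.set, Finset.mem_singleton]; exact
        ⟨fun hn => hn.1, fun hn => ⟨hn, by rw [hn, h.col]⟩⟩, rfl⟩, Ok.one h⟩
    | false, h => ⟨T.rel id (reIn (bij_id (Ok.one h rfl).symm)) T.pt, Ok.one h⟩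
  rel_congr f g hf hg h a := Subtype.ext (T.rel_congr f g _ _ (fun n hn => h (on_subset _ hn)) a.1)
  rel_id h a := Subtype.ext (T.rel_id _ a.1)
  rel_trans f g hf hg h a := Subtype.ext (T.rel_trans f g _ _ _ a.1)
  rel_comp {c A x d B C A' B' C'} h f g k h' hf hg hk h1 h2 a b := by
    apply Subtype.ext
    cases d
    · have hB := b.2 rfl
      refine (T.rel_rel _ _ k _ (reOn hk)
        (reIn ((on_bij hk).congr (fun _ _ => rfl) |> fun h' => by rw [on_off h hB]; exact h'))
        (fun _ _ => rfl) a.1).trans (T.rel_rel _ _ k (reOn hf) _ _ (fun n hn => ?_) a.1).symm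
      refine (h1 (Finset.mem_erase.2 ⟨?_, on_subset _ hn⟩)).symm
      rintro rfl
      have := (mem_on.1 hn).2
      rw [h.col] at this
      exact Bool.noConfusion this
    · exact T.rel_comp (insOn h) f g k (insOn h') (reOn hf) (reOn hg) (reOn hk)
        (fun n hn => h1 (Finset.erase_subset_erase _ (on_subset _) hn))
        (fun n hn => h2 (on_subset _ hn)) a.1 b.1
  assoc_seq {c A x d B C y e D E F} h₁ h₂ h₃ h₄ a b z := by
    apply Subtype.ext
    cases d
    · obtain rfl := ins_empty_false h₃ (b.2 rfl)
      exact T.rel_rel _ _ id _ _ _ (fun _ _ => rfl) a.1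
    · cases e
      · refine (T.rel_comp (insOn h₁) id id id (insOn h₄) (reIn (Set.bijOn_id _))
          (reOff h₃ (z.2 rfl)) _ (fun _ _ => rfl) (fun _ _ => rfl) a.1 b.1).trans ?_
        rw [T.rel_id]
        rfl
      · exact T.assoc_seq (insOn h₁) (insOn h₂) (insOn h₃) (insOn h₄) a.1 b.1 z.1
  assoc_par {c A x d B C y e D E F} hxy h₁ h₂ h₃ h₄ a b z := by
    apply Subtype.ext
    cases d <;> cases e
    · exact (T.rel_rel _ _ id _ _ (reOff h₂ (z.2 rfl) |> fun h => by
        rw [on_off h₁ (b.2 rfl)]; exact h) (fun _ _ => rfl) a.1).trans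
        (T.rel_rel _ _ id _ _ _ (fun _ _ => rfl) a.1).symm
    · refine Eq.trans ?_ (T.rel_comp (insOn h₃) id id id (insOn h₂) (reOff h₁ (b.2 rfl))
          (reIn (Set.bijOn_id _)) _ (fun _ _ => rfl) (fun _ _ => rfl) a.1 z.1).symm
      rw [T.rel_id]
      rfl
    · refine (T.rel_comp (insOn h₁) id id id (insOn h₄) (reOff h₃ (z.2 rfl))
          (reIn (Set.bijOn_id _)) _ (fun _ _ => rfl) (fun _ _ => rfl) a.1 b.1).trans ?_
      rw [T.rel_id]
      rfl
    · exact T.assoc_par hxy (insOn h₁) (insOn h₂) (insOn h₃) (insOn h₄) a.1 b.1 z.1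
  rel_one {A B x c} hA f hB hf := by
    apply Subtype.ext
    cases c
    · exact T.eq_of_empty (Ok.one hB rfl) _ _
    · exact T.rel_one _ f _ (reOn hf)
  one_comp {A x c} hA B h b := by
    apply Subtype.ext
    cases c
    · exact T.eq_of_empty (b.2 rfl) _ _
    · exact T.one_comp _ (insOn h) b.1
  comp_one {c A x d B} hB h a := by
    apply Subtype.ext
    cases d
    · exact T.rel_id _ a.1
    · exact T.comp_one _ (insOn h) a.1

end TopOperad

end

section

namespace TopOperad

section fill
variable (T : TopOperad.{v} Unit) [IsLambda T]

variable {T} in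
theorem res_cast {A B B' : Finset ℕ} (e : B = B') (h : B ⊆ A) (h' : B' ⊆ A) (t : T.X () (ar A)) :
    T.res h' t = T.rel id (reIn (A := ar B) (B := ar B') (bij_id e)) (T.res h t) := by
  subst e
  rw [T.rel_id]

/-- The morphism which inserts the operation without inputs in all inputs of colour `false`. -/
noncomputable def fill : Hom id T.paint T.triv where
  app c A :=
    { toFun := fun t => ⟨T.res (on_subset A) t.1, t.2⟩
      continuous_toFun := by
        have := (T.res (on_subset A)).continuous
        exact (this.comp continuous_subtype_val).subtype_mk _ }
  rel f hf a := Subtype.ext (res_rel f hf.bij (on_bij hf) (on_subset _) (on_subset _) a.1)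
  comp {c A x d B C} h a b := by
    apply Subtype.ext
    cases d
    · have e := on_off h (b.2 rfl)
      have h0 : on A ⊆ C.set := e ▸ on_subset C
      have hx : x ∉ on A := fun hx => by
        have := (mem_on.1 hx).2
        rw [h.col] at this
        exact Bool.noConfusion this
      refine (res_cast e h0 (on_subset C) _).trans (congrArg (T.rel id (reOff h (b.2 rfl))) ?_)
      refine res_comp_forget h.ins (on_subset A) hx h0 ?_ a.1 b.1
      refine Finset.disjoint_of_subset_left (fun n hn => ?_) h.ins.disj
      exact Finset.mem_erase.2 ⟨fun e => hx (e ▸ hn), on_subset A hn⟩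
    · exact res_comp h.ins (on_ins h) (on_subset A) (on_subset B) (on_subset C) a.1 b.1
  one {A x c} h := by
    apply Subtype.ext
    cases c
    · exact T.eq_of_empty (Ok.one h rfl) _ _
    · have e : A.set = on A := by
        ext n
        rw [mem_on]
        refine ⟨fun hn => ⟨hn, ?_⟩, fun hn => hn.1⟩
        rw [h.set, Finset.mem_singleton] at hn
        rw [hn, h.col]
      exact (res_id e (on_subset A) _).trans (T.rel_one (x := x) ⟨h.set, rfl⟩ id _ _)

end fill

/-- Functoriality of `triv`. -/
def trivMap {S T : TopOperad.{v} Unit} [IsLambda S] [IsLambda T] (f : Hom id S T) :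
    Hom id S.triv T.triv where
  app c A :=
    { toFun := fun t => ⟨f.app () (ar (on A)) t.1, t.2⟩
      continuous_toFun := by
        have := (f.app () (ar (on A))).continuous
        exact (this.comp continuous_subtype_val).subtype_mk _ }
  rel g hg a := Subtype.ext (f.rel g (reOn hg) a.1)
  comp {c A x d B C} h a b := by
    apply Subtype.ext
    cases d
    · exact f.rel id (reOff h (b.2 rfl)) a.1
    · exact f.comp (insOn h) a.1 b.1
  one {A x c} h := by
    apply Subtype.ext
    cases c
    · exact T.eq_of_empty (Ok.one h rfl) _ _
    · exact f.one _

section pullback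
variable {Γ : Type} {A B C : TopOperad.{v} Γ} (F : Hom id A C) (G : Hom id B C)

/-- The homotopy pullback of spaces: points of `X` and `Y` together with a path which connects
their images in `Z`. -/
abbrev HoPull {X Y Z : Type v} [TopologicalSpace X] [TopologicalSpace Y] [TopologicalSpace Z]
    (F : C(X, Z)) (G : C(Y, Z)) : Type v :=
  {p : X × Y × C(unitInterval, Z) // p.2.2 0 = F p.1 ∧ p.2.2 1 = G p.2.1}

/-- The homotopy pullback of operads. -/
def hoPullback : TopOperad.{v} Γ where
  X c D := HoPull (F.app c D) (G.app c D)
  rel {c D E} f hf :=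
    { toFun := fun p => ⟨(A.rel f hf p.1.1, B.rel f hf p.1.2.1, (C.rel f hf).comp p.1.2.2),
        (congrArg (C.rel f hf) p.2.1).trans (F.rel f hf _).symm,
        (congrArg (C.rel f hf) p.2.2).trans (G.rel f hf _).symm⟩
      continuous_toFun := by
        have := ContinuousMap.continuous_postcomp (X := unitInterval) (C.rel (c := c) f hf)
        refine Continuous.subtype_mk ?_ _
        exact ((A.rel f hf).continuous.comp (by fun_prop)).prodMk
          (((B.rel f hf).continuous.comp (by fun_prop)).prodMk (this.comp (by fun_prop))) }
  comp {c D x d E E'} h :=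
    { toFun := fun p => ⟨(A.comp h (p.1.1.1, p.2.1.1), B.comp h (p.1.1.2.1, p.2.1.2.1),
        (C.comp h).comp (p.1.1.2.2.prodMk p.2.1.2.2)),
        (congrArg₂ (fun a b => C.comp h (a, b)) p.1.2.1 p.2.2.1).trans (F.comp h _ _).symm,
        (congrArg₂ (fun a b => C.comp h (a, b)) p.1.2.2 p.2.2.2).trans (G.comp h _ _).symm⟩
      continuous_toFun := by
        refine Continuous.subtype_mk ?_ _
        refine ((A.comp h).continuous.comp (by fun_prop)).prodMk
          (((B.comp h).continuous.comp (by fun_prop)).prodMk ?_)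
        apply ContinuousMap.continuous_of_continuous_uncurry
        refine (C.comp h).continuous.comp (Continuous.prodMk ?_ ?_)
        · exact Continuous.eval (by fun_prop) (by fun_prop)
        · exact Continuous.eval (by fun_prop) (by fun_prop) }
  one h := ⟨(A.one h, B.one h, ContinuousMap.const _ (C.one h)), (F.one h).symm, (G.one h).symm⟩
  rel_congr f g hf hg h a := Subtype.ext (Prod.ext (A.rel_congr f g hf hg h _)
    (Prod.ext (B.rel_congr f g hf hg h _) (ContinuousMap.ext fun _ => C.rel_congr f g hf hg h _)))
  rel_id h a := Subtype.ext (Prod.ext (A.rel_id h _)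
    (Prod.ext (B.rel_id h _) (ContinuousMap.ext fun _ => C.rel_id h _)))
  rel_trans f g hf hg h a := Subtype.ext (Prod.ext (A.rel_trans f g hf hg h _)
    (Prod.ext (B.rel_trans f g hf hg h _) (ContinuousMap.ext fun _ => C.rel_trans f g hf hg h _)))
  rel_comp h f g k h' hf hg hk h1 h2 a b :=
    Subtype.ext (Prod.ext (A.rel_comp h f g k h' hf hg hk h1 h2 _ _)
    (Prod.ext (B.rel_comp h f g k h' hf hg hk h1 h2 _ _)
      (ContinuousMap.ext fun _ => C.rel_comp h f g k h' hf hg hk h1 h2 _ _)))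
  assoc_seq h₁ h₂ h₃ h₄ a b z := Subtype.ext (Prod.ext (A.assoc_seq h₁ h₂ h₃ h₄ _ _ _)
    (Prod.ext (B.assoc_seq h₁ h₂ h₃ h₄ _ _ _)
      (ContinuousMap.ext fun _ => C.assoc_seq h₁ h₂ h₃ h₄ _ _ _)))
  assoc_par hxy h₁ h₂ h₃ h₄ a b z := Subtype.ext (Prod.ext (A.assoc_par hxy h₁ h₂ h₃ h₄ _ _ _)
    (Prod.ext (B.assoc_par hxy h₁ h₂ h₃ h₄ _ _ _)
      (ContinuousMap.ext fun _ => C.assoc_par hxy h₁ h₂ h₃ h₄ _ _ _)))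
  rel_one hA f hB hf := Subtype.ext (Prod.ext (A.rel_one hA f hB hf)
    (Prod.ext (B.rel_one hA f hB hf) (ContinuousMap.ext fun _ => C.rel_one hA f hB hf)))
  one_comp hA D h b := Subtype.ext (Prod.ext (A.one_comp hA h _)
    (Prod.ext (B.one_comp hA h _) (ContinuousMap.ext fun _ => C.one_comp hA h _)))
  comp_one hB h a := Subtype.ext (Prod.ext (A.comp_one hB h _)
    (Prod.ext (B.comp_one hB h _) (ContinuousMap.ext fun _ => C.comp_one hB h _)))

end pullback

/-- The operad with two colours defined by a morphism of unitary operads. -/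
noncomputable def ESC {S T : TopOperad.{v} Unit} [IsLambda S] [IsLambda T] (f : Hom id S T) :
    TopOperad.{v} Bool :=
  hoPullback (trivMap f) T.fill


section incl
variable {S T : TopOperad.{v} Unit} [IsLambda S] [IsLambda T] (f : Hom id S T)

theorem on_true (A : Ar Unit) : A.set = on (A.map fun _ => true) := by
  ext n
  simp [mem_on, Ar.map]

theorem on_false (A : Ar Unit) : on (A.map fun _ => false) = ∅ := by
  simp [on_eq_empty, Ar.map]

theorem reTrue (A : Ar Unit) : ReIn id A (ar (on (A.map fun _ => true))) :=
  reIn (bij_id (on_true A))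

theorem reFalse (A : Ar Unit) : ReIn id (ar ∅) (ar (on (A.map fun _ => false))) :=
  reIn (bij_id (on_false A).symm)

variable (T) in
/-- The identification of `T(A)` with the operations of `triv` of colour `true`. -/
noncomputable def trueTriv (A : Ar Unit) : C(T.X () A, T.triv.X true (A.map fun _ => true)) where
  toFun t := ⟨T.rel id (reTrue A) t, fun h => Bool.noConfusion h⟩
  continuous_toFun := (T.rel id (reTrue A)).continuous.subtype_mk _

variable (T) in
/-- The identification of `T(A)` with the operations of `paint` with inputs and output of colour
`c`. -/
noncomputable def toPaint (c : Bool) (A : Ar Unit) : C(T.X () A, T.paint.X c (A.map fun _ => c)) where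
  toFun t := ⟨t, fun h => h ▸ on_false A⟩
  continuous_toFun := continuous_id.subtype_mk _

variable (T) in
/-- The operation of `triv` with inputs and output of colour `false`. -/
noncomputable def falseTriv (A : Ar Unit) : T.triv.X false (A.map fun _ => false) :=
  ⟨T.rel id (reFalse A) T.pt, fun _ => on_false A⟩

theorem trueTriv_rel {A B : Ar Unit} (g : ℕ → ℕ) (hg : ReIn g A B) (t : T.X () A) :
    T.trueTriv B (T.rel g hg t) = T.triv.rel g (hg.map fun _ => true) (T.trueTriv A t) :=
  Subtype.ext ((T.rel_rel g id g hg (reTrue B) ⟨(on_true B) ▸ hg.bij, fun _ _ => rfl⟩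
    (fun _ _ => rfl) t).trans
    (T.rel_rel id g g (reTrue A) _ ⟨(on_true B) ▸ hg.bij, fun _ _ => rfl⟩ (fun _ _ => rfl) t).symm)

theorem trueTriv_comp {A : Ar Unit} {x : ℕ} {B C : Ar Unit} (h : CIns A x () B C) (a : T.X () A)
    (b : T.X () B) : T.trueTriv C (T.comp h (a, b)) =
      T.triv.comp (h.map fun _ => true) (T.trueTriv A a, T.trueTriv B b) :=
  Subtype.ext (T.rel_comp h id id id (insOn (h.map fun _ => true)) (reTrue A) (reTrue B) (reTrue C)
    (fun _ _ => rfl) (fun _ _ => rfl) a b)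

theorem trueTriv_one {A : Ar Unit} {x : ℕ} (h : IsOne A x ()) :
    T.trueTriv A (T.one h) = T.triv.one (h.map fun _ => true) :=
  Subtype.ext (T.rel_one h id _ (reTrue A))

theorem falseTriv_eq {A : Ar Unit} (a b : T.triv.X false (A.map fun _ => false)) : a = b :=
  Subtype.ext (T.eq_of_empty (on_false A) _ _)

/-- The operad `S` consists of the operations with inputs and output of colour `true`: the path
connecting the two points of `T(A)` is constant. -/
noncomputable def inclS : Hom (fun _ => true) S (ESC f) where
  app c A :=
    { toFun := fun s => ⟨(S.trueTriv A s, T.toPaint true A (f.app () A s),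
        ContinuousMap.const _ (T.trueTriv A (f.app () A s))),
        Subtype.ext (f.rel id (reTrue A) s).symm,
        Subtype.ext (res_id (on_true A) _ (f.app () A s)).symm⟩
      continuous_toFun := by
        refine Continuous.subtype_mk ((S.trueTriv A).continuous.prodMk
          (((T.toPaint true A).comp (f.app () A)).continuous.prodMk ?_)) _
        exact ContinuousMap.continuous_const'.comp ((T.trueTriv A).comp (f.app () A)).continuous }
  rel {c A B} g hg a := Subtype.ext (Prod.ext (trueTriv_rel g hg a)
    (Prod.ext (Subtype.ext (f.rel g hg a)) (ContinuousMap.ext fun _ =>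
      (congrArg (T.trueTriv B) (f.rel g hg a)).trans (trueTriv_rel g hg _))))
  comp {c A x d B C} h a b := Subtype.ext (Prod.ext (trueTriv_comp h a b)
    (Prod.ext (Subtype.ext (f.comp h a b)) (ContinuousMap.ext fun _ =>
      (congrArg (T.trueTriv C) (f.comp h a b)).trans (trueTriv_comp h _ _))))
  one {A x c} h := Subtype.ext (Prod.ext (trueTriv_one h)
    (Prod.ext (Subtype.ext (f.one h)) (ContinuousMap.ext fun _ =>
      (congrArg (T.trueTriv A) (f.one h)).trans (trueTriv_one h))))

/-- The operad `T` consists of the operations with inputs and output of colour `false`. -/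
noncomputable def inclT : Hom (fun _ => false) T (ESC f) where
  app c A :=
    { toFun := fun t => ⟨(S.falseTriv A, T.toPaint false A t,
        ContinuousMap.const _ (T.falseTriv A)), falseTriv_eq _ _, falseTriv_eq _ _⟩
      continuous_toFun := Continuous.subtype_mk (continuous_const.prodMk
          ((T.toPaint false A).continuous.prodMk continuous_const)) _ }
  rel {c A B} f hf a := Subtype.ext (Prod.ext (falseTriv_eq _ _)
    (Prod.ext rfl (ContinuousMap.ext fun _ => falseTriv_eq _ _)))
  comp {c A x d B C} h a b := Subtype.ext (Prod.ext (falseTriv_eq _ _)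
    (Prod.ext rfl (ContinuousMap.ext fun _ => falseTriv_eq _ _)))
  one {A x c} h := Subtype.ext (Prod.ext (falseTriv_eq _ _)
    (Prod.ext rfl (ContinuousMap.ext fun _ => falseTriv_eq _ _)))

end incl

section pos

/-- The suboperad of the operations with at least one input. -/
def pos {Γ : Type} (T : TopOperad.{v} Γ) : TopOperad.{v} Γ where
  X c A := {_t : T.X c A // A.set.Nonempty}
  rel f hf := ⟨fun t => ⟨T.rel f hf t.1, t.2.elim fun a ha => ⟨f a, hf.bij.mapsTo ha⟩⟩, by fun_prop⟩
  comp h := ⟨fun p => ⟨T.comp h (p.1.1, p.2.1), p.2.2.elim fun b hb => ⟨b, h.ins.mem_iff'.2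
    (Or.inr hb)⟩⟩, by
      exact ((T.comp h).continuous.comp (by fun_prop)).subtype_mk _⟩
  one {A x c} h := ⟨T.one h, ⟨x, by rw [h.set]; exact Finset.mem_singleton_self x⟩⟩
  rel_congr f g hf hg h a := Subtype.ext (T.rel_congr f g hf hg h a.1)
  rel_id h a := Subtype.ext (T.rel_id h a.1)
  rel_trans f g hf hg h a := Subtype.ext (T.rel_trans f g hf hg h a.1)
  rel_comp h f g k h' hf hg hk h1 h2 a b :=
    Subtype.ext (T.rel_comp h f g k h' hf hg hk h1 h2 a.1 b.1)
  assoc_seq h₁ h₂ h₃ h₄ a b z := Subtype.ext (T.assoc_seq h₁ h₂ h₃ h₄ a.1 b.1 z.1)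
  assoc_par hxy h₁ h₂ h₃ h₄ a b z := Subtype.ext (T.assoc_par hxy h₁ h₂ h₃ h₄ a.1 b.1 z.1)
  rel_one hA f hB hf := Subtype.ext (T.rel_one hA f hB hf)
  one_comp hA _ h b := Subtype.ext (T.one_comp hA h b.1)
  comp_one hB h a := Subtype.ext (T.comp_one hB h a.1)

/-- Functoriality of `pos`. -/
def Hom.pos {Γ Δ : Type} {γ : Γ → Δ} {S : TopOperad.{v} Γ} {T : TopOperad.{v} Δ} (F : Hom γ S T) :
    Hom γ S.pos T.pos where
  app c A := ⟨fun t => ⟨F.app c A t.1, t.2⟩, by fun_prop⟩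
  rel f hf a := Subtype.ext (F.rel f hf a.1)
  comp h a b := Subtype.ext (F.comp h a.1 b.1)
  one h := Subtype.ext (F.one h)

end pos
end TopOperad

end

section

variable {K : Type u} [Field K]

namespace ColDGOperad
variable (D : ColDGOperad.{u, w} K Bool)

/-- Families of operations of all degrees with output colour `true`, for all sets of inputs with
the colouring `col`. -/
abbrev Fam (col : ℕ → Bool) := ∀ (C : Finset ℕ) (r : ℤ), (D.X true ⟨C, col⟩).X r

variable {D} {col : ℕ → Bool}

open Classical in
/-- Insertion of the operation `z` in the input `x` of the members of a family. -/
noncomputable def ins (x : ℕ) {d : Bool} {B : Ar Bool} {k : ℤ} (z : (D.X d B).X k) :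
    D.Fam col →ₗ[K] D.Fam col where
  toFun v C r := if h : CIns ⟨insert x (C \ B.set), col⟩ x d B ⟨C, col⟩ then
    D.comp h (sub_add_cancel r k) (v _ _) z else 0
  map_add' v v' := by
    funext C r
    simp only [Pi.add_apply]
    split_ifs
    · simp
    · simp
  map_smul' c v := by
    funext C r
    simp only [Pi.smul_apply]
    split_ifs
    · simp
    · simp

theorem cins_eq {C₀ : Finset ℕ} {x : ℕ} {d : Bool} {B : Ar Bool} {C : Finset ℕ}
    (h : CIns ⟨C₀, col⟩ x d B ⟨C, col⟩) : C₀ = insert x (C \ B.set) := by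
  have h0 := h.ins
  ext n
  rw [Finset.mem_insert, Finset.mem_sdiff, show n ∈ C ↔ _ from h0.mem_iff']
  have h1 : n ∈ C₀.erase x → n ∉ B.set := fun hn => h0.notMem_right hn
  have h2 : x ∈ C₀ := h0.mem
  rw [Finset.mem_erase] at h1
  by_cases hx : n = x
  · subst hx; tauto
  · tauto

theorem ins_apply {x : ℕ} {d : Bool} {B : Ar Bool} {k : ℤ} (z : (D.X d B).X k) (v : D.Fam col)
    {C₀ C : Finset ℕ} (h : CIns ⟨C₀, col⟩ x d B ⟨C, col⟩) {i r : ℤ} (hn : i + k = r) :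
    ins x z v C r = D.comp h hn (v C₀ i) z := by
  obtain rfl := cins_eq h
  obtain rfl : i = r - k := by omega
  exact dif_pos h

theorem ins_zero {x : ℕ} {d : Bool} {B : Ar Bool} {k : ℤ} (z : (D.X d B).X k) (v : D.Fam col)
    {C : Finset ℕ} {r : ℤ} (h : ∀ C₀, CIns ⟨C₀, col⟩ x d B ⟨C, col⟩ → v C₀ (r - k) = 0) :
    ins x z v C r = 0 := by
  by_cases h' : CIns ⟨insert x (C \ B.set), col⟩ x d B ⟨C, col⟩
  · rw [ins_apply z v h' (sub_add_cancel r k), h _ h', map_zero, LinearMap.zero_apply]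
  · exact dif_neg h'

theorem ins_ne {x : ℕ} {d : Bool} {B : Ar Bool} {k : ℤ} {z : (D.X d B).X k} {v : D.Fam col}
    {C : Finset ℕ} {r : ℤ} (h : ins x z v C r ≠ 0) :
    ∃ C₀, CIns ⟨C₀, col⟩ x d B ⟨C, col⟩ ∧ v C₀ (r - k) ≠ 0 := by
  by_contra! h'
  exact h (ins_zero z v h')

theorem ins_isLinear (x : ℕ) {d : Bool} {B : Ar Bool} {k : ℤ} (v : D.Fam col) (C : Finset ℕ)
    (r : ℤ) : IsLinearMap K fun z : (D.X d B).X k => ins x z v C r := by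
  by_cases h' : CIns ⟨insert x (C \ B.set), col⟩ x d B ⟨C, col⟩
  · have : (fun z : (D.X d B).X k => ins x z v C r) =
        D.comp h' (sub_add_cancel r k) (v _ _) := by
      funext z
      exact ins_apply z v h' _
    rw [this]
    exact LinearMap.isLinear _
  · have : (fun z : (D.X d B).X k => ins x z v C r) =
        (0 : (D.X d B).X k →ₗ[K] (D.X true ⟨C, col⟩).X r) := by
      funext z
      exact dif_neg h'
    rw [this]
    exact LinearMap.isLinear _

/-- The differential of a family. -/
def dFam : D.Fam col →ₗ[K] D.Fam col where
  toFun v C r := (D.X true ⟨C, col⟩).d (r - 1) r (v C (r - 1))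
  map_add' v v' := by funext C r; simp
  map_smul' c v := by funext C r; simp

theorem dFam_apply (v : D.Fam col) (C : Finset ℕ) {i r : ℤ} (h : i + 1 = r) :
    dFam v C r = (D.X true ⟨C, col⟩).d i r (v C i) := by
  obtain rfl : i = r - 1 := by omega
  rfl

theorem dFam_ins {x : ℕ} {d : Bool} {B : Ar Bool} {k : ℤ} (z : (D.X d B).X k) (v : D.Fam col)
    {e : ℤ} (hv : ∀ C r, r ≠ e → v C r = 0) :
    dFam (ins x z v) = ins x z (dFam v) + sg e • ins x ((D.X d B).d k (k + 1) z) v := by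
  funext C r
  rw [Pi.add_apply, Pi.add_apply, Pi.smul_apply, Pi.smul_apply, dFam_apply _ _ (sub_add_cancel r 1)]
  by_cases h' : CIns ⟨insert x (C \ B.set), col⟩ x d B ⟨C, col⟩
  · rw [ins_apply z v h' (i := r - 1 - k) (by omega),
      ins_apply z (dFam v) h' (i := r - 1 - k + 1) (by omega),
      ins_apply _ v h' (i := r - 1 - k) (by omega), dFam_apply _ _ rfl,
      D.d_comp h' (by omega) rfl rfl (by omega)]
    congr 1
    by_cases he : r - 1 - k = e
    · subst he; rfl
    · rw [hv _ _ he, map_zero, LinearMap.zero_apply, smul_zero, smul_zero]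
  · have h0 : ∀ C₀, ¬ CIns ⟨C₀, col⟩ x d B ⟨C, col⟩ := by
      intro C₀ h
      obtain rfl := cins_eq h
      exact h' h
    rw [ins_zero z v fun C₀ h => (h0 C₀ h).elim, ins_zero z _ fun C₀ h => (h0 C₀ h).elim,
      ins_zero _ v fun C₀ h => (h0 C₀ h).elim, map_zero, smul_zero, add_zero]

theorem ins_hom {x : ℕ} {d : Bool} {B : Ar Bool} {k : ℤ} (z : (D.X d B).X k) {v : D.Fam col}
    {e : ℤ} (hv : ∀ C r, r ≠ e → v C r = 0) : ∀ C r, r ≠ e + k → ins x z v C r = 0 :=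
  fun _ _ hr => ins_zero z v fun _ _ => hv _ _ (by omega)

theorem cins_swap {A : Finset ℕ} {y : ℕ} {e : Bool} {B : Ar Bool} {E : Finset ℕ} {x : ℕ} {d : Bool}
    {B' : Ar Bool} {C : Finset ℕ} (hxy : x ≠ y) (hy : y ∉ B'.set) (hx : x ∉ B.set)
    (h₁ : CIns ⟨A, col⟩ y e B ⟨E, col⟩) (h₂ : CIns ⟨E, col⟩ x d B' ⟨C, col⟩) :
    ∃ E' : Finset ℕ, CIns ⟨A, col⟩ x d B' ⟨E', col⟩ ∧ CIns ⟨E', col⟩ y e B ⟨C, col⟩ := by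
  have i1 := h₁.ins
  have i2 := h₂.ins
  have hE : ∀ n, n ∈ E ↔ _ := fun n => i1.mem_iff'
  have hC : ∀ n, n ∈ C ↔ _ := fun n => i2.mem_iff'
  have hxA : x ∈ A := by
    rcases (hE x).1 i2.mem with h | h
    · exact h.2
    · exact (hx h).elim
  have hyA : y ∈ A := i1.mem
  have dB : ∀ n ∈ A, n ≠ y → n ∉ B.set := fun n hn hny =>
    i1.notMem_right (Finset.mem_erase.2 ⟨hny, hn⟩)
  have dB' : ∀ n ∈ E, n ≠ x → n ∉ B'.set := fun n hn hny =>
    i2.notMem_right (Finset.mem_erase.2 ⟨hny, hn⟩)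
  refine ⟨A.erase x ∪ B'.set, ⟨⟨hxA, ?_, rfl⟩, h₂.col, fun _ _ => rfl, h₂.right⟩,
    ⟨⟨?_, ?_, ?_⟩, h₁.col, fun _ _ => rfl, h₁.right⟩⟩
  · rw [Finset.disjoint_left]
    intro n hn
    obtain ⟨hn1, hn2⟩ := Finset.mem_erase.1 hn
    by_cases e : n = y
    · subst e; exact hy
    · exact dB' n ((hE n).2 (Or.inl ⟨e, hn2⟩)) hn1
  · exact Finset.mem_union_left _ (Finset.mem_erase.2 ⟨hxy.symm, hyA⟩)
  · rw [Finset.disjoint_left]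
    intro n hn hnB
    obtain ⟨hn1, hn2⟩ := Finset.mem_erase.1 hn
    rcases Finset.mem_union.1 hn2 with h | h
    · exact dB n (Finset.mem_of_mem_erase h) hn1 hnB
    · refine dB' n ((hE n).2 (Or.inr hnB)) ?_ h
      rintro rfl; exact hx hnB
  · ext n
    rw [hC, hE, Finset.mem_union, Finset.mem_erase, Finset.mem_union, Finset.mem_erase]
    by_cases e : n = y
    · subst e; tauto
    · by_cases e' : n = x
      · subst e'; tauto
      · tauto

theorem ins_comm {x y : ℕ} {d e : Bool} {B B' : Ar Bool} {k l : ℤ} (z : (D.X d B').X k)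
    (t : (D.X e B).X l) (hxy : x ≠ y) (hy : y ∉ B'.set) (hx : x ∉ B.set) (v : D.Fam col) :
    ins x z (ins y t v) = sg (l * k) • ins y t (ins x z v) := by
  funext C r
  rw [Pi.smul_apply, Pi.smul_apply]
  by_cases h : ∃ A E : Finset ℕ, CIns ⟨A, col⟩ y e B ⟨E, col⟩ ∧ CIns ⟨E, col⟩ x d B' ⟨C, col⟩
  · obtain ⟨A, E, h₁, h₂⟩ := h
    obtain ⟨E', h₃, h₄⟩ := cins_swap hxy hy hx h₁ h₂
    rw [ins_apply z _ h₂ (sub_add_cancel r k), ins_apply t _ h₁ (sub_add_cancel _ l),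
      ins_apply t _ h₄ (sub_add_cancel r l),
      ins_apply z _ h₃ (i := r - k - l) (by omega)]
    exact D.assoc_par hxy.symm h₁ h₂ h₃ h₄ _ _ _ _ _ _ _
  · rw [ins_zero, ins_zero, smul_zero]
    · intro E' h₄
      refine ins_zero _ _ fun A h₃ => ?_
      obtain ⟨E, h₁, h₂⟩ := cins_swap hxy.symm hx hy h₃ h₄
      exact (h ⟨A, E, h₁, h₂⟩).elim
    · intro E h₂
      exact ins_zero _ _ fun A h₁ => (h ⟨A, E, h₁, h₂⟩).elim

theorem cins_seq {A : Finset ℕ} {x : ℕ} {d : Bool} {B E : Ar Bool} {C : Finset ℕ} {y : ℕ} {e : Bool}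
    {B' : Ar Bool} (h₃ : CIns B y e B' E) (hB : ∀ b ∈ B.set, col b = B.col b) (hy : y ∈ A → y = x)
    (h₄ : CIns ⟨A, col⟩ x d E ⟨C, col⟩) :
    ∃ F : Finset ℕ, CIns ⟨A, col⟩ x d B ⟨F, col⟩ ∧ CIns ⟨F, col⟩ y e B' ⟨C, col⟩ := by
  have i3 := h₃.ins
  have i4 := h₄.ins
  have hE : ∀ n, n ∈ E.set ↔ _ := fun n => i3.mem_iff'
  have hC : ∀ n, n ∈ C ↔ _ := fun n => i4.mem_iff'
  have hyB : y ∈ B.set := i3.mem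
  have d3 : ∀ n ∈ B.set, n ≠ y → n ∉ B'.set := fun n hn hny =>
    i3.notMem_right (Finset.mem_erase.2 ⟨hny, hn⟩)
  have d4 : ∀ n ∈ A, n ≠ x → n ∉ E.set := fun n hn hny =>
    i4.notMem_right (Finset.mem_erase.2 ⟨hny, hn⟩)
  refine ⟨A.erase x ∪ B.set, ⟨⟨i4.mem, ?_, rfl⟩, h₄.col, fun _ _ => rfl, hB⟩,
    ⟨⟨Finset.mem_union_right _ hyB, ?_, ?_⟩, ?_, fun _ _ => rfl, ?_⟩⟩
  · rw [Finset.disjoint_left]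
    intro n hn hnB
    obtain ⟨hn1, hn2⟩ := Finset.mem_erase.1 hn
    refine d4 n hn2 hn1 ((hE n).2 (Or.inl ⟨?_, hnB⟩))
    rintro rfl; exact hn1 (hy hn2)
  · rw [Finset.disjoint_left]
    intro n hn hnB
    obtain ⟨hn1, hn2⟩ := Finset.mem_erase.1 hn
    rcases Finset.mem_union.1 hn2 with h | h
    · obtain ⟨h1, h2⟩ := Finset.mem_erase.1 h
      exact d4 n h2 h1 ((hE n).2 (Or.inr hnB))
    · exact d3 n h hn1 hnB
  · ext n
    rw [hC, hE, Finset.mem_union, Finset.mem_erase, Finset.mem_union, Finset.mem_erase]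
    have : n = y → n ∈ A → n = x := by rintro rfl; exact hy
    tauto
  · rw [← h₃.col]
    exact hB y hyB
  · intro b hb
    rw [← h₃.right b hb]
    exact h₄.right b ((hE b).2 (Or.inr hb))

theorem cins_seq' {A : Finset ℕ} {x : ℕ} {d : Bool} {B : Ar Bool} {C F : Finset ℕ} {y : ℕ} {e : Bool}
    {B' : Ar Bool} (hy : y ∈ B.set) (h₁ : CIns ⟨A, col⟩ x d B ⟨F, col⟩)
    (h₂ : CIns ⟨F, col⟩ y e B' ⟨C, col⟩) :
    CIns B y e B' ⟨B.set.erase y ∪ B'.set, col⟩ ∧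
      CIns ⟨A, col⟩ x d ⟨B.set.erase y ∪ B'.set, col⟩ ⟨C, col⟩ := by
  have i1 := h₁.ins
  have i2 := h₂.ins
  have hF : ∀ n, n ∈ F ↔ _ := fun n => i1.mem_iff'
  have hC : ∀ n, n ∈ C ↔ _ := fun n => i2.mem_iff'
  have d1 : ∀ n ∈ A, n ≠ x → n ∉ B.set := fun n hn hny =>
    i1.notMem_right (Finset.mem_erase.2 ⟨hny, hn⟩)
  have d2 : ∀ n ∈ F, n ≠ y → n ∉ B'.set := fun n hn hny =>
    i2.notMem_right (Finset.mem_erase.2 ⟨hny, hn⟩)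
  refine ⟨⟨⟨hy, ?_, rfl⟩, ?_, ?_, h₂.right⟩, ⟨⟨i1.mem, ?_, ?_⟩, h₁.col, fun _ _ => rfl,
    fun _ _ => rfl⟩⟩
  · rw [Finset.disjoint_left]
    intro n hn
    obtain ⟨hn1, hn2⟩ := Finset.mem_erase.1 hn
    exact d2 n ((hF n).2 (Or.inr hn2)) hn1
  · rw [← h₁.right y hy]
    exact h₂.col
  · intro b hb
    exact h₁.right b (Finset.mem_of_mem_erase hb)
  · rw [Finset.disjoint_left]
    intro n hn hnB
    obtain ⟨hn1, hn2⟩ := Finset.mem_erase.1 hn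
    rcases Finset.mem_union.1 hnB with h | h
    · exact d1 n hn2 hn1 (Finset.mem_of_mem_erase h)
    · refine d2 n ((hF n).2 (Or.inl ⟨hn1, hn2⟩)) ?_ h
      rintro rfl; exact d1 n hn2 hn1 hy
  · ext n
    rw [hC, hF, Finset.mem_union, Finset.mem_union, Finset.mem_erase, Finset.mem_erase]
    have : n = y → n ∉ A ∨ n = x := by
      rintro rfl
      by_contra! h
      exact d1 n h.1 h.2 hy
    tauto

theorem ins_seq {x : ℕ} {d : Bool} {B E : Ar Bool} {y : ℕ} {e : Bool} {B' : Ar Bool}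
    (h : CIns B y e B' E) (hB : ∀ b ∈ B.set, col b = B.col b) {k l n : ℤ} (hn : k + l = n)
    (z : (D.X d B).X k) (t : (D.X e B').X l) (v : D.Fam col) (hv : ∀ C r, y ∈ C → y ≠ x → v C r = 0) :
    ins x (D.comp h hn z t) v = ins y t (ins x z v) := by
  funext C r
  by_cases h4 : ∃ A : Finset ℕ, (y ∈ A → y = x) ∧ CIns ⟨A, col⟩ x d E ⟨C, col⟩
  · obtain ⟨A, hy, h₄⟩ := h4
    obtain ⟨F, h₁, h₂⟩ := cins_seq h hB hy h₄
    rw [ins_apply _ _ h₄ (sub_add_cancel r n), ins_apply t _ h₂ (sub_add_cancel r l),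
      ins_apply z _ h₁ (i := r - n) (by omega)]
    exact (D.assoc_seq h₁ h₂ h h₄ _ _ _ _ _ _ _).symm
  · rw [ins_zero, ins_zero]
    · intro F h₂
      refine ins_zero _ _ fun A h₁ => ?_
      by_cases hy : y ∈ A ∧ y ≠ x
      · exact hv _ _ hy.1 hy.2
      · exfalso
        refine h4 ⟨A, by tauto, ?_⟩
        obtain ⟨h3, h4⟩ := cins_seq' h.ins.mem h₁ h₂
        have e : E.set = B.set.erase y ∪ B'.set := h.ins.eq
        refine ⟨by rw [e]; exact h4.ins, h4.col, h4.left, fun b hb => ?_⟩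
        rw [e] at hb
        rcases Finset.mem_union.1 hb with hb | hb
        · rw [h.left b hb]
          exact hB b (Finset.mem_of_mem_erase hb)
        · rw [h.right b hb]
          exact h₂.right b hb
    · intro A h₄
      by_cases hy : y ∈ A ∧ y ≠ x
      · exact hv _ _ hy.1 hy.2
      · exact (h4 ⟨A, by tauto, h₄⟩).elim

end ColDGOperad

end

section

variable {K : Type u} [Field K]

namespace ColDGOperad
section
variable {D : ColDGOperad.{u, w} K Bool} {col col' : ℕ → Bool}

/-- The family `v'` is obtained from `v` by the relabelling `g` of the labels in `U`. -/
def RelFam (g : ℕ → ℕ) (U : Set ℕ) (v : D.Fam col) (v' : D.Fam col') : Prop :=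
  ∀ (C C' : Finset ℕ) (hg : ReIn g ⟨C, col⟩ ⟨C', col'⟩), (C : Set ℕ) ⊆ U → ∀ r,
    v' C' r = (D.rel g hg).f r (v C r)

theorem RelFam.ins {g : ℕ → ℕ} {U : Set ℕ} (hU : Set.InjOn g U) {v : D.Fam col} {v' : D.Fam col'}
    (hv : RelFam g U v v') {x : ℕ} (hx : x ∈ U) (hxc : col' (g x) = col x) {d : Bool} {B B' : Ar Bool}
    (hB : (B.set : Set ℕ) ⊆ U) (hg : ReIn g B B') {k : ℤ} (z : (D.X d B).X k) :
    RelFam g U (ColDGOperad.ins x z v) (ColDGOperad.ins (g x) ((D.rel g hg).f k z) v') := by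
  intro C C' hC hCU r
  by_cases h : ∃ C₀ : Finset ℕ, CIns ⟨C₀, col⟩ x d B ⟨C, col⟩
  · obtain ⟨C₀, h⟩ := h
    have i := h.ins
    have hmem : ∀ n, n ∈ C ↔ _ := fun n => i.mem_iff'
    have hC₀ : (C₀ : Set ℕ) ⊆ U := by
      intro n hn
      by_cases e : n = x
      · rw [e]; exact hx
      · exact hCU ((hmem n).2 (Or.inl ⟨e, hn⟩))
    have hcol : ∀ a ∈ C₀, col' (g a) = col a := by
      intro n hn
      by_cases e : n = x
      · rw [e]; exact hxc
      · exact hC.col n ((hmem n).2 (Or.inl ⟨e, hn⟩))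
    have hre : ReIn g ⟨C₀, col⟩ ⟨C₀.image g, col'⟩ :=
      ⟨⟨fun n hn => Finset.mem_coe.2 (Finset.mem_image_of_mem g hn), hU.mono hC₀,
        fun n hn => by
          obtain ⟨a, ha, e⟩ := Finset.mem_image.1 hn
          exact ⟨a, ha, e⟩⟩, hcol⟩
    have hBC : ∀ b ∈ B.set, b ∈ C := fun b hb => (hmem b).2 (Or.inr hb)
    have h' : CIns ⟨C₀.image g, col'⟩ (g x) d B' ⟨C', col'⟩ := by
      refine ⟨⟨Finset.mem_image_of_mem g i.mem, ?_, ?_⟩, hxc.trans h.col, fun _ _ => rfl, ?_⟩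
      · rw [Finset.disjoint_left]
        intro n hn hnB
        obtain ⟨hn1, hn2⟩ := Finset.mem_erase.1 hn
        obtain ⟨a, ha, rfl⟩ := Finset.mem_image.1 hn2
        obtain ⟨b, hb, e⟩ := hg.bij.surjOn hnB
        have : b = a := hU (hB hb) (hC₀ ha) e
        subst this
        refine i.notMem_right (Finset.mem_erase.2 ⟨?_, ha⟩) hb
        rintro rfl; exact hn1 rfl
      · ext n
        rw [Finset.mem_union, Finset.mem_erase, Finset.mem_image]
        constructor
        · intro hn
          obtain ⟨c, hc, rfl⟩ := hC.bij.surjOn hn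
          rcases (hmem c).1 hc with ⟨h1, h2⟩ | h1
          · exact Or.inl ⟨fun e => h1 (hU (hCU hc) hx e), c, h2, rfl⟩
          · exact Or.inr (hg.bij.mapsTo h1)
        · rintro (⟨h1, a, ha, rfl⟩ | h1)
          · refine hC.bij.mapsTo ((hmem a).2 (Or.inl ⟨?_, ha⟩))
            rintro rfl; exact h1 rfl
          · obtain ⟨b, hb, rfl⟩ := hg.bij.surjOn h1
            exact hC.bij.mapsTo (hBC b hb)
      · intro b hb
        obtain ⟨a, ha, rfl⟩ := hg.bij.surjOn hb
        exact (hC.col a (hBC a ha)).trans ((h.right a ha).trans (hg.col a ha).symm)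
    rw [ins_apply _ _ h' (sub_add_cancel r k), ins_apply _ _ h (sub_add_cancel r k),
      hv C₀ _ hre hC₀]
    exact (D.rel_comp h g g g h' hre hg hC (fun _ _ => rfl) (fun _ _ => rfl) _ _ _).symm
  · rw [ins_zero z v fun C₀ h' => (h ⟨C₀, h'⟩).elim, map_zero]
    refine ins_zero _ _ fun C₀' h' => (h ⟨insert x (C \ B.set), ?_⟩).elim
    have i' := h'.ins
    have hmem : ∀ n, n ∈ C' ↔ _ := fun n => i'.mem_iff'
    have hBC : ∀ b ∈ B.set, b ∈ C := by
      intro b hb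
      obtain ⟨c, hc, e⟩ := hC.bij.surjOn ((hmem (g b)).2 (Or.inr (hg.bij.mapsTo hb)))
      rw [← hU (hCU hc) (hB hb) e]
      exact hc
    have hx' : x ∉ C \ B.set := by
      intro hn
      obtain ⟨h1, h2⟩ := Finset.mem_sdiff.1 hn
      rcases (hmem (g x)).1 (hC.bij.mapsTo h1) with ⟨h3, -⟩ | h3
      · exact h3 rfl
      · obtain ⟨b, hb, e⟩ := hg.bij.surjOn h3
        rw [hU (hB hb) hx e] at hb
        exact h2 hb
    refine ⟨⟨Finset.mem_insert_self _ _, ?_, ?_⟩, hxc.symm.trans h'.col, fun _ _ => rfl, ?_⟩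
    · change Disjoint ((insert x (C \ B.set)).erase x) B.set
      rw [Finset.erase_insert hx']
      exact Finset.sdiff_disjoint
    · change C = (insert x (C \ B.set)).erase x ∪ B.set
      rw [Finset.erase_insert hx', Finset.sdiff_union_of_subset hBC]
    · intro b hb
      exact (hC.col b (hBC b hb)).symm.trans ((h'.right (g b) (hg.bij.mapsTo hb)).trans
        (hg.col b hb))

end

section rmod
variable (D : ColDGOperad.{u, w} K Bool) {Q : DGOperad.{u, w} K}
  (G : Q.toNUOperad ⟶ (D.mono false).toNUOperad)
  (hG : ∀ x, (NUOperad.Hom.app G {x}).f 0 (Q.one x) = (D.mono false).one x)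

/-- The insertion of `B` in the input `x` of `A`, where all inputs are of colour `false`. -/
theorem insF {A : Finset ℕ} {x : ℕ} {B C : Finset ℕ} (h : Ins A x B C) :
    CIns (Ar.const false A) x false (Ar.const false B) (Ar.const false C) := CIns.const h

theorem app_d {P Q : NUOperad.{u, w} K} (F : P ⟶ Q) {A : Finset ℕ} (i j : ℤ) (a : (P.X A).X i) :
    (NUOperad.Hom.app F A).f j ((P.X A).d i j a) = (Q.X A).d i j ((NUOperad.Hom.app F A).f i a) :=
  (congrArg (fun t => (ModuleCat.Hom.hom t) a) ((NUOperad.Hom.app F A).comm i j)).symm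

theorem app_rel {P Q : NUOperad.{u, w} K} (F : P ⟶ Q) {A B : Finset ℕ} (f : ℕ → ℕ)
    (hf : Set.BijOn f (A : Set ℕ) B) (i : ℤ) (a : (P.X A).X i) :
    (NUOperad.Hom.app F B).f i ((P.rel f hf).f i a) =
      (Q.rel f hf).f i ((NUOperad.Hom.app F A).f i a) :=
  congrArg (fun t => (ModuleCat.Hom.hom (HomologicalComplex.Hom.f t i)) a)
    (NUOperad.Hom.rel F f hf)

/-- The operations with output of colour `true` and inputs of colour `false`, as a right module over
an operad `Q` which maps to the operad of the operations of colour `false`. -/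
def rmod : RightMod Q where
  X A := D.X true (Ar.const false A)
  rel f hf := D.rel f (.const hf)
  act {A x B C} h {i j n} hn := LinearMap.compl₂ (D.comp (insF h) hn)
    ((NUOperad.Hom.app G B).f j).hom
  rel_congr f g _ _ h := D.rel_congr f g _ _ h
  rel_id _ := D.rel_id _
  rel_trans f g _ _ _ := D.rel_trans f g _ _ _
  d_act {A x B C} h {i j n i' j' n'} hn hi hj hn' a b := by
    refine (D.d_comp (insF h) hn hi hj hn' a ((NUOperad.Hom.app G B).f j b)).trans ?_
    refine congrArg (fun t => D.comp (insF h) _ ((D.X true (Ar.const false A)).d i i' a)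
      ((NUOperad.Hom.app G B).f j b) + sg i • D.comp (insF h) _ a t) ?_
    exact (app_d G j j' b).symm
  rel_act {A x B C A' B' C'} h f g k h' hf hg hk h1 h2 i j n hn a b := by
    refine (D.rel_comp (insF h) f g k (insF h') (.const hf) (.const hg) (.const hk) h1 h2 hn a
      ((NUOperad.Hom.app G B).f j b)).trans ?_
    exact congrArg (fun t => D.comp (insF h') hn ((D.rel f (.const hf)).f i a) t)
      (app_rel G g hg j b).symm
  assoc_seq {A x B C y E F I} h₁ h₂ h₃ h₄ i j l m n p hm hn hp hq a b c := by
    refine (D.assoc_seq (insF h₁) (insF h₂) (insF h₃) (insF h₄) hm hn hp hq a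
      ((NUOperad.Hom.app G _).f _ b) ((NUOperad.Hom.app G _).f _ c)).trans ?_
    exact congrArg (D.comp (insF h₄) hq a) (NUOperad.Hom.comp G h₃ hp b c).symm
  assoc_par {A x B C y E F I} hxy h₁ h₂ h₃ h₄ i j l m n p hm hn hp hq a b c :=
    D.assoc_par hxy (insF h₁) (insF h₂) (insF h₃) (insF h₄) hm hn hp hq a
      ((NUOperad.Hom.app G _).f _ b) ((NUOperad.Hom.app G _).f _ c)
  act_one {A x} h n hn a := by
    refine Eq.trans ?_ (D.comp_one (B := Ar.const false {x}) ⟨rfl, rfl⟩ (insF h) hn a)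
    exact congrArg (D.comp (insF h) hn a) (hG x)

end rmod
end ColDGOperad

end

section

variable {K : Type u} [Field K]

namespace ColDGOperad
variable {D : ColDGOperad.{u, w} K Bool} {Q : DGOperad.{u, w} K}
  {G : Q.toNUOperad ⟶ (D.mono false).toNUOperad}
  {hG : ∀ x, (NUOperad.Hom.app G {x}).f 0 (Q.one x) = (D.mono false).one x} {col col' : ℕ → Bool}

/-- Insertion of an element of the module `rmod`. -/
noncomputable def insE (x : ℕ) (e : (D.rmod G hG).Elt) : D.Fam col →ₗ[K] D.Fam col :=
  ins (d := true) (B := Ar.const false e.ar) (k := e.deg) x e.val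

/-- Insertion of the elements `m j` in the inputs `x j`, for `j` in a list. -/
noncomputable def chain (x : ℕ → ℕ) : List ℕ → (ℕ → (D.rmod G hG).Elt) → D.Fam col →ₗ[K] D.Fam col
  | [], _ => LinearMap.id
  | j :: l, m => chain x l m ∘ₗ insE (x j) (m j)

theorem chain_cons (x : ℕ → ℕ) (j : ℕ) (l : List ℕ) (m : ℕ → (D.rmod G hG).Elt) (v : D.Fam col) :
    chain x (j :: l) m v = chain x l m (insE (x j) (m j) v) := rfl

theorem chain_append (x : ℕ → ℕ) (l l' : List ℕ) (m : ℕ → (D.rmod G hG).Elt) (v : D.Fam col) :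
    chain x (l ++ l') m v = chain x l' m (chain x l m v) := by
  induction l generalizing v with
  | nil => rfl
  | cons j l ih => exact ih _

theorem chain_map (x f : ℕ → ℕ) (l : List ℕ) (m : ℕ → (D.rmod G hG).Elt) (v : D.Fam col) :
    chain x (l.map f) m v = chain (fun j => x (f j)) l (m ∘ f) v := by
  induction l generalizing v with
  | nil => rfl
  | cons j l ih => exact ih _

theorem chain_loc (x : ℕ → ℕ) {l : List ℕ} {m m' : ℕ → (D.rmod G hG).Elt}
    (h : ∀ j ∈ l, m j = m' j) : chain (col := col) x l m = chain x l m' := by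
  induction l with
  | nil => rfl
  | cons j l ih =>
    rw [chain, chain, h j (by simp), ih fun i hi => h i (by simp [hi])]

theorem chain_upd (x : ℕ → ℕ) {l : List ℕ} (m : ℕ → (D.rmod G hG).Elt) {j : ℕ} (hj : j ∉ l)
    (e : (D.rmod G hG).Elt) : chain (col := col) x l (Function.update m j e) = chain x l m :=
  chain_loc x fun i hi => Function.update_of_ne (fun (h : i = j) => hj (h ▸ hi)) _ _

theorem chain_hom (x : ℕ → ℕ) (l : List ℕ) (m : ℕ → (D.rmod G hG).Elt) {v : D.Fam col} {e : ℤ}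
    (hv : ∀ C r, r ≠ e → v C r = 0) :
    ∀ C r, r ≠ e + (l.map fun j => (m j).deg).sum → chain x l m v C r = 0 := by
  induction l generalizing v e with
  | nil =>
    intro C r hr
    exact hv C r (by simpa using hr)
  | cons j l ih =>
    intro C r hr
    refine ih (ins_hom _ hv) C r ?_
    rw [List.map_cons, List.sum_cons] at hr
    omega

/-- The combinatorial conditions for the insertion of `m j` in the input `x j` of an operation with
inputs `C₀`, such that the inputs of the result are `C`. -/
structure Supp (col : ℕ → Bool) (x : ℕ → ℕ) (l : List ℕ) (A : ℕ → Finset ℕ) (C₀ C : Finset ℕ) :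
    Prop where
  sub : ∀ i ∈ l, x i ∈ C₀
  colx : ∀ i ∈ l, col (x i) = true
  cola : ∀ i ∈ l, ∀ n ∈ A i, col n = false
  disj : ∀ i ∈ l, ∀ j ∈ l, i ≠ j → Disjoint (A i) (A j)
  disj0 : ∀ i ∈ l, ∀ n ∈ C₀, (∀ j ∈ l, n ≠ x j) → n ∉ A i
  mem : ∀ n, n ∈ C ↔ (n ∈ C₀ ∧ ∀ j ∈ l, n ≠ x j) ∨ ∃ j ∈ l, n ∈ A j

theorem supp_cons {x : ℕ → ℕ} {a : ℕ} {l : List ℕ} {A : ℕ → Finset ℕ} {C₀ E C : Finset ℕ}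
    (hx : ∀ i ∈ l, x i ≠ x a)
    (h : CIns ⟨C₀, col⟩ (x a) true (Ar.const false (A a)) ⟨E, col⟩) (h' : Supp col x l A E C) :
    Supp col x (a :: l) A C₀ C := by
  have hi0 := h.ins
  have hE : ∀ n, n ∈ E ↔ (n ≠ x a ∧ n ∈ C₀) ∨ n ∈ A a := fun n => hi0.mem_iff'
  have ca : ∀ n ∈ A a, col n = false := fun n hn => h.right n hn
  have dE : ∀ n ∈ C₀, n ≠ x a → n ∉ A a := fun n hn hny =>
    hi0.notMem_right (Finset.mem_erase.2 ⟨hny, hn⟩)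
  have hxa : col (x a) = true := h.col
  have hxA : ∀ i ∈ a :: l, ∀ n ∈ A a, n ≠ x i := by
    intro i hi n hn e
    have h1 := ca n hn
    rw [e] at h1
    rcases List.mem_cons.1 hi with rfl | hi
    · rw [hxa] at h1; exact Bool.noConfusion h1
    · rw [h'.colx i hi] at h1; exact Bool.noConfusion h1
  have daA : ∀ j ∈ l, ∀ n ∈ A a, n ∉ A j := fun j hj n hn =>
    h'.disj0 j hj n ((hE n).2 (Or.inr hn)) fun i hi => hxA i (by simp [hi]) n hn
  constructor
  · intro i hi
    rcases List.mem_cons.1 hi with rfl | hi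
    · exact h.ins.mem
    · rcases (hE _).1 (h'.sub i hi) with h1 | h1
      · exact h1.2
      · exact (hxA i (by simp [hi]) _ h1 rfl).elim
  · intro i hi
    rcases List.mem_cons.1 hi with rfl | hi
    · exact hxa
    · exact h'.colx i hi
  · intro i hi
    rcases List.mem_cons.1 hi with rfl | hi
    · exact ca
    · exact h'.cola i hi
  · intro i hi j hj hij
    rcases List.mem_cons.1 hi with e1 | hi1 <;> rcases List.mem_cons.1 hj with e2 | hj1
    · exact (hij (e1.trans e2.symm)).elim
    · rw [e1]
      exact Finset.disjoint_left.2 (daA j hj1)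
    · rw [e2]
      exact Finset.disjoint_right.2 (daA i hi1)
    · exact h'.disj i hi1 j hj1 hij
  · intro i hi n hn hnx
    have hna : n ≠ x a := hnx a (by simp)
    rcases List.mem_cons.1 hi with rfl | hi
    · exact dE n hn hna
    · exact h'.disj0 i hi n ((hE n).2 (Or.inl ⟨hna, hn⟩)) fun j hj => hnx j (by simp [hj])
  · intro n
    rw [h'.mem, hE]
    have := hxA
    simp only [List.mem_cons, forall_eq_or_imp, exists_eq_or_imp] at this ⊢
    have h1 := this.1 n
    have h2 : n ∈ A a → ∀ j ∈ l, n ≠ x j := fun hn j hj => this.2 j hj n hn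
    tauto

theorem chain_ne {x : ℕ → ℕ} {l : List ℕ} (hl : l.Nodup) (hx : Set.InjOn x {i | i ∈ l})
    {m : ℕ → (D.rmod G hG).Elt} {v : D.Fam col} {C : Finset ℕ} {r : ℤ} (h : chain x l m v C r ≠ 0) :
    ∃ C₀, Supp col x l (fun j => (m j).ar) C₀ C ∧ v C₀ (r - (l.map fun j => (m j).deg).sum) ≠ 0 := by
  induction l generalizing v with
  | nil =>
    refine ⟨C, ⟨by simp, by simp, by simp, by simp, by simp, by simp⟩, ?_⟩
    rw [List.map_nil, List.sum_nil, sub_zero]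
    exact h
  | cons a l ih =>
    rw [List.nodup_cons] at hl
    obtain ⟨E, hE, h1⟩ := ih hl.2 (hx.mono fun i hi => by simp only [Set.mem_setOf_eq] at hi ⊢; simp [hi])
      (v := insE (x a) (m a) v) h
    obtain ⟨C₀, h2, h3⟩ := ins_ne h1
    refine ⟨C₀, supp_cons (A := fun j => (m j).ar) (fun i hi e => ?_) h2 hE, ?_⟩
    · have : i = a := hx (by simp [hi]) (by simp) e
      exact hl.1 (this ▸ hi)
    · rw [List.map_cons, List.sum_cons, add_comm, ← sub_sub]
      exact h3

theorem chain_isLinear (x : ℕ → ℕ) {l : List ℕ} (hl : l.Nodup) (m : ℕ → (D.rmod G hG).Elt) {j : ℕ}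
    (hj : j ∈ l) (A : Finset ℕ) (k : ℤ) (v : D.Fam col) (C : Finset ℕ) (r : ℤ) :
    IsLinearMap K fun z : ((D.rmod G hG).X A).X k =>
      chain x l (Function.update m j ⟨A, k, z⟩) v C r := by
  induction l generalizing v with
  | nil => simp at hj
  | cons a l ih =>
    rw [List.nodup_cons] at hl
    simp only [chain_cons]
    by_cases e : j = a
    · subst e
      have : (fun z : ((D.rmod G hG).X A).X k => chain x l (Function.update m j ⟨A, k, z⟩)
          (insE (x j) (Function.update m j ⟨A, k, z⟩ j) v) C r) =
          ((LinearMap.proj r ∘ₗ LinearMap.proj C) ∘ₗ chain x l m) ∘ₗ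
            LinearMap.pi fun C => LinearMap.pi fun r => (ins_isLinear (d := true)
              (B := Ar.const false A) (k := k) (x j) v C r).mk' := by
        funext z
        rw [chain_upd x m hl.1, Function.update_self]
        rfl
      rw [this]
      exact LinearMap.isLinear _
    · have hj' : j ∈ l := by
        rcases List.mem_cons.1 hj with h | h
        · exact (e h).elim
        · exact h
      simp only [Function.update_of_ne (Ne.symm e)]
      exact ih hl.2 hj' _

theorem chain_comm (x : ℕ → ℕ) (l : List ℕ) (m : ℕ → (D.rmod G hG).Elt) {y : ℕ} {e : Bool} {B : Ar Bool}
    {k : ℤ} (t : (D.X e B).X k) (h1 : ∀ i ∈ l, x i ≠ y) (h2 : ∀ i ∈ l, y ∉ (m i).ar)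
    (h3 : ∀ i ∈ l, x i ∉ B.set) (v : D.Fam col) :
    chain x l m (ins y t v) = sg (k * (l.map fun i => ((m i).deg : ZMod 2)).sum) •
      ins y t (chain x l m v) := by
  induction l generalizing v with
  | nil => simp [chain, sg_zero]
  | cons a l ih =>
    rw [chain_cons, chain_cons]
    have := ins_comm (d := true) (B' := Ar.const false (m a).ar) (k := (m a).deg) (m a).val t
      (h1 a (by simp)) (h2 a (by simp)) (h3 a (by simp)) v
    rw [show insE (x a) (m a) (ins y t v) = _ from this, map_zsmul,
      ih (fun i hi => h1 i (by simp [hi])) (fun i hi => h2 i (by simp [hi]))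
        (fun i hi => h3 i (by simp [hi])), sg_smul, List.map_cons, List.sum_cons, mul_add]
    rfl

theorem relFam_chain {g : ℕ → ℕ} {U : Set ℕ} (hU : Set.InjOn g U) {v : D.Fam col} {v' : D.Fam col'}
    (hv : RelFam g U v v') {x x' : ℕ → ℕ} (l : List ℕ) {m m' : ℕ → (D.rmod G hG).Elt}
    (hx : ∀ i ∈ l, x i ∈ U) (hxx : ∀ i ∈ l, x' i = g (x i)) (hxc : ∀ i ∈ l, col' (x' i) = col (x i))
    (hA : ∀ i ∈ l, ((m i).ar : Set ℕ) ⊆ U)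
    (hm : ∀ i ∈ l, ∃ (B : Finset ℕ) (hB : Set.BijOn g (m i).ar B), m' i = (m i).rel g hB) :
    RelFam g U (chain x l m v) (chain x' l m' v') := by
  induction l generalizing v v' with
  | nil => exact hv
  | cons a l ih =>
    rw [chain_cons, chain_cons]
    refine ih ?_ (fun i hi => hx i (by simp [hi])) (fun i hi => hxx i (by simp [hi]))
      (fun i hi => hxc i (by simp [hi])) (fun i hi => hA i (by simp [hi]))
      (fun i hi => hm i (by simp [hi]))
    obtain ⟨B, hB, e⟩ := hm a (by simp)
    have h1 := hxx a (by simp)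
    have h2 := hxc a (by simp)
    rw [e, h1]
    rw [h1] at h2
    exact RelFam.ins hU hv (hx a (by simp)) h2 (B := Ar.const false (m a).ar) (d := true)
      (hA a (by simp)) (.const hB) (m a).val

/-- The exponent of the sign of the permutation which sorts a list of elements of degrees `k`. -/
def inv (k : ℕ → ZMod 2) : List ℕ → ZMod 2
  | [] => 0
  | a :: l => inv k l + (l.map fun b => lo b a * k a * k b).sum

theorem chain_perm {x : ℕ → ℕ} {l l' : List ℕ} (p : l.Perm l') (hl : l.Nodup)
    (hx : Set.InjOn x {i | i ∈ l}) (m : ℕ → (D.rmod G hG).Elt)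
    (hm : ∀ i ∈ l, ∀ j ∈ l, x i ∉ (m j).ar) (v : D.Fam col) :
    chain x l m v = sg (inv (fun j => (m j).deg) l + inv (fun j => (m j).deg) l') •
      chain x l' m v := by
  induction p generalizing v with
  | nil => simp [chain, inv, sg_zero]
  | @cons a l l' p ih =>
    rw [List.nodup_cons] at hl
    have hsub : {i | i ∈ l} ⊆ {i | i ∈ a :: l} := fun i hi => by
      simp only [Set.mem_setOf_eq] at hi ⊢; simp [hi]
    rw [chain_cons, chain_cons, ih hl.2 (hx.mono hsub)
      (fun i hi j hj => hm i (hsub hi) j (hsub hj)), inv, inv, (p.map _).sum_eq]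
    congr 2
    linear_combination (-1 : ZMod 2) * z2 ((l'.map fun b => lo b a * ((m a).deg : ZMod 2) *
      ((m b).deg : ZMod 2)).sum)
  | swap a b l =>
    have hab : b ≠ a := by
      simp only [List.nodup_cons, List.mem_cons, not_or] at hl
      exact hl.1.1
    simp only [chain_cons]
    have h1 : x a ≠ x b := fun e => hab (hx (by simp) (by simp) e.symm)
    have := ins_comm (d := true) (e := true) (B' := Ar.const false (m a).ar)
      (B := Ar.const false (m b).ar) (k := (m a).deg) (l := (m b).deg) (m a).val (m b).val h1
      (hm b (by simp) a (by simp)) (hm a (by simp) b (by simp)) v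
    rw [show insE (x a) (m a) (insE (x b) (m b) v) = _ from this, map_zsmul]
    refine congrArg₂ (fun s t => sg s • t) ?_ rfl
    simp only [inv, List.map_cons, List.sum_cons, lo_swap hab]
    linear_combination (-1 : ZMod 2) * z2 (inv (fun j => ((m j).deg : ZMod 2)) l) -
      z2 ((l.map fun c => lo c a * ((m a).deg : ZMod 2) * ((m c).deg : ZMod 2)).sum) -
      z2 ((l.map fun c => lo c b * ((m b).deg : ZMod 2) * ((m c).deg : ZMod 2)).sum) -
      z2 (lo b a * ((m a).deg : ZMod 2) * ((m b).deg : ZMod 2))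
  | trans p q ih1 ih2 =>
    have hmem : ∀ i, i ∈ _ ↔ i ∈ _ := fun i => p.mem_iff
    rw [ih1 hl hx hm, ih2 (p.nodup_iff.1 hl) (hx.mono fun i hi => p.mem_iff.2 hi)
      (fun i hi j hj => hm i (p.mem_iff.2 hi) j (p.mem_iff.2 hj)), sg_smul]
    refine congrArg₂ (fun s t => sg s • t) ?_ rfl
    rename_i l1 l2 l3
    linear_combination z2 (inv (fun j => ((m j).deg : ZMod 2)) l2)

theorem dFam_chain (x : ℕ → ℕ) (l : List ℕ) (hl : l.Pairwise (· < ·)) (m : ℕ → (D.rmod G hG).Elt)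
    {v : D.Fam col} {e : ℤ} (hv : ∀ C r, r ≠ e → v C r = 0) :
    dFam (chain x l m v) = chain x l m (dFam v) + sg e • (l.map fun j =>
      sg ((l.map fun i => lo i j * ((m i).deg : ZMod 2)).sum) •
        chain x l (Function.update m j (m j).d) v).sum := by
  induction l generalizing v e with
  | nil => simp [chain]
  | cons a l ih =>
    rw [List.pairwise_cons] at hl
    have hal : a ∉ l := fun h => lt_irrefl _ (hl.1 a h)
    rw [chain_cons, chain_cons, ih hl.2 (v := insE (x a) (m a) v) (ins_hom _ hv)]
    have h1 : dFam (insE (x a) (m a) v) = insE (x a) (m a) (dFam v) + sg e • insE (x a) (m a).d v :=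
      dFam_ins (d := true) (B := Ar.const false (m a).ar) (m a).val v hv
    rw [h1, map_add, map_zsmul, add_assoc]
    congr 1
    rw [List.map_cons, List.sum_cons, smul_add]
    congr 1
    · rw [List.map_cons, List.sum_cons, lo_self, zero_mul, zero_add]
      have h0 : (l.map fun i => lo i a * ((m i).deg : ZMod 2)).sum = 0 := by
        apply List.sum_eq_zero
        intro z hz
        obtain ⟨i, hi, rfl⟩ := List.mem_map.1 hz
        have := hl.1 i hi
        rw [lo, if_neg (by omega), zero_mul]
      rw [h0, sg_zero, one_smul, chain_cons, Function.update_self, chain_upd x m hal]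
    · rw [show ((e + (m a).deg : ℤ) : ZMod 2) = (e : ZMod 2) + ((m a).deg : ZMod 2) by push_cast; rfl,
        ← sg_smul]
      congr 1
      rw [List.smul_sum, List.map_map]
      congr 1
      apply List.map_congr_left
      intro j hj
      have haj := hl.1 j hj
      rw [Function.comp_apply, List.map_cons, List.sum_cons, sg_smul, chain_cons,
        Function.update_of_ne (by omega), lo, if_pos haj, one_mul]

end ColDGOperad

end

section

variable {K : Type u} [Field K]

namespace ColDGOperad
variable {D : ColDGOperad.{u, w} K Bool} {col col' : ℕ → Bool}

theorem relrel {c : Bool} {A B C : Ar Bool} (f g k : ℕ → ℕ)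
    (hf : ReIn f A B) (hg : ReIn g B C) (hk : ReIn k A C) (h : ∀ a ∈ A.set, g (f a) = k a)
    {r : ℤ} (t : (D.X c A).X r) : (D.rel g hg).f r ((D.rel f hf).f r t) = (D.rel k hk).f r t := by
  have h' : ReIn (g ∘ f) A C :=
    ⟨hk.bij.congr fun a ha => (h a ha).symm, fun a ha => by
      rw [Function.comp_apply, h a ha]; exact hk.col a ha⟩
  have e1 := D.rel_trans (c := c) f g hf hg h'
  have e2 := D.rel_congr (c := c) (g ∘ f) k h' hk (fun a ha => h a ha)
  rw [← e2, e1]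
  rfl

theorem relid {c : Bool} {A : Ar Bool} (h : ReIn id A A) {r : ℤ} (t : (D.X c A).X r) :
    (D.rel id h).f r t = t := by
  rw [D.rel_id]
  rfl

/-- The family whose only member which does not vanish is `z`. -/
noncomputable def delta (B : Finset ℕ) (k : ℤ) : (D.X true ⟨B, col⟩).X k →ₗ[K] D.Fam col :=
  LinearMap.single K (fun C : Finset ℕ => ∀ r : ℤ, (D.X true ⟨C, col⟩).X r) B ∘ₗ
    LinearMap.single K (fun r : ℤ => (D.X true ⟨B, col⟩).X r) k

theorem delta_self (B : Finset ℕ) (k : ℤ) (z : (D.X true ⟨B, col⟩).X k) : delta B k z B k = z := by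
  simp [delta]

theorem delta_ar {B : Finset ℕ} {k : ℤ} (z : (D.X true ⟨B, col⟩).X k) {C : Finset ℕ} {r : ℤ}
    (h : C ≠ B) : delta B k z C r = 0 := by
  simp [delta, Pi.single_eq_of_ne h]

theorem delta_deg {B : Finset ℕ} {k : ℤ} (z : (D.X true ⟨B, col⟩).X k) {C : Finset ℕ} {r : ℤ}
    (h : r ≠ k) : delta B k z C r = 0 := by
  by_cases e : C = B
  · subst e
    simp [delta, Pi.single_eq_of_ne h]
  · exact delta_ar z e

theorem delta_ext {B : Finset ℕ} {k : ℤ} (z : (D.X true ⟨B, col⟩).X k) {v : D.Fam col}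
    (h1 : v B k = z) (h2 : ∀ C r, C ≠ B → v C r = 0) (h3 : ∀ r, r ≠ k → v B r = 0) :
    v = delta B k z := by
  funext C r
  by_cases e : C = B
  · subst e
    by_cases e' : r = k
    · subst e'
      rw [h1, delta_self]
    · rw [h3 _ e', delta_deg z e']
  · rw [h2 _ _ e, delta_ar z e]

/-- The colouring such that the labels `n ≥ s` are of colour `true`. -/
def colS (s : ℕ) : ℕ → Bool := fun n => decide (s ≤ n)

theorem colS_true {s n : ℕ} : colS s n = true ↔ s ≤ n := by simp [colS]

theorem colS_false {s n : ℕ} : colS s n = false ↔ n < s := by simp [colS]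

theorem reShift (s : ℕ) (J : Finset ℕ) :
    ReIn (· + s) (Ar.const true J) ⟨J.image (· + s), colS s⟩ := by
  refine ⟨⟨fun n hn => ?_, fun a _ b _ h => ?_, fun n hn => ?_⟩, fun a ha => ?_⟩
  · exact Finset.mem_coe.2 (Finset.mem_image_of_mem _ hn)
  · exact Nat.add_right_cancel h
  · obtain ⟨a, ha, e⟩ := Finset.mem_image.1 (Finset.mem_coe.1 hn)
    exact ⟨a, ha, e⟩
  · exact colS_true.2 (Nat.le_add_left _ _)

/-- The inputs of an operation with all inputs of colour `true` are shifted by `s`. -/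
noncomputable def start (s : ℕ) (J : Finset ℕ) (d : ℤ) :
    (D.X true (Ar.const true J)).X d →ₗ[K] D.Fam (colS s) :=
  delta (J.image (· + s)) d ∘ₗ ((D.rel (· + s) (reShift s J)).f d).hom

variable {Q : DGOperad.{u, w} K}
  {G : Q.toNUOperad ⟶ (D.mono false).toNUOperad}
  {hG : ∀ x, (NUOperad.Hom.app G {x}).f 0 (Q.one x) = (D.mono false).one x}

open Classical in
variable (D G hG) in
/-- The member of degree `r` of a family with the set of inputs `N`, if all elements of `N` are
smaller than `s` (and hence of colour `false`). -/
noncomputable def evS (s : ℕ) (N : Finset ℕ) (r : ℤ) :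
    D.Fam (colS s) →ₗ[K] ((D.rmod G hG).X N).X r :=
  if h : ReIn id ⟨N, colS s⟩ (Ar.const false N) then
    ((D.rel id h).f r).hom ∘ₗ LinearMap.proj r ∘ₗ LinearMap.proj N
  else 0

theorem reEv {s : ℕ} {N : Finset ℕ} (h : ∀ n ∈ N, n < s) :
    ReIn id ⟨N, colS s⟩ (Ar.const false N) :=
  ⟨Set.bijOn_id _, fun n hn => (colS_false.2 (h n hn)).symm⟩

theorem evS_apply {s : ℕ} {N : Finset ℕ} (h : ∀ n ∈ N, n < s) (r : ℤ) (v : D.Fam (colS s)) :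
    evS D G hG s N r v = (D.rel id (reEv h)).f r (v N r) := by
  unfold evS
  rw [dif_pos (reEv h)]
  rfl

theorem evS_ne {s : ℕ} {N : Finset ℕ} {r : ℤ} {v : D.Fam (colS s)} (h : evS D G hG s N r v ≠ 0) :
    (∀ n ∈ N, n < s) ∧ v N r ≠ 0 := by
  have h1 : ∀ n ∈ N, n < s := by
    by_contra h'
    refine h ?_
    unfold evS
    rw [dif_neg]
    · rfl
    · intro hr
      exact h' fun n hn => colS_false.1 (hr.col n hn).symm
  refine ⟨h1, fun h2 => h ?_⟩
  rw [evS_apply h1, h2]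
  exact map_zero _

/-- A label which is larger than all elements of `N`. -/
def bd (N : Finset ℕ) : ℕ := N.sup id + 1

theorem lt_bd {N : Finset ℕ} : ∀ n ∈ N, n < bd N := fun _ hn =>
  Nat.lt_succ_of_le (Finset.le_sup (f := id) hn)

variable (D G hG) in
/-- The left action, with a given choice of the shift `s`. -/
noncomputable def leftS (s : ℕ) (J : Finset ℕ) (d : ℤ) (m : ℕ → (D.rmod G hG).Elt) (N : Finset ℕ)
    (r : ℤ) : (D.X true (Ar.const true J)).X d →ₗ[K] ((D.rmod G hG).X N).X r :=
  evS D G hG s N r ∘ₗ chain (· + s) (J.sort (· ≤ ·)) m ∘ₗ start s J d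

variable (D G hG) in
/-- The left action of the operations with all inputs, and the output, of colour `true` on the
operations with all inputs of colour `false` and output of colour `true`: the elements `m j`,
`j ∈ J`, are successively inserted in the inputs of the operation (after a shift of the labels of
these inputs which makes them different from the labels of the inputs of the elements `m j`). -/
noncomputable def leftPre (J : Finset ℕ) (d : ℤ) :
    (D.X true (Ar.const true J)).X d →ₗ[K] (D.rmod G hG).PreEnd :=
  LinearMap.pi fun m => LinearMap.pi fun N => LinearMap.pi fun r => leftS D G hG (bd N) J d m N r

theorem sum_sort {V : Type*} [AddCommMonoid V] (J : Finset ℕ) (F : ℕ → V) :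
    ((J.sort (· ≤ ·)).map F).sum = ∑ j ∈ J, F j := by
  rw [← List.sum_toFinset F (J.sort_nodup (· ≤ ·)), Finset.sort_toFinset]

theorem start_ne {s : ℕ} {J : Finset ℕ} {d : ℤ} {p : (D.X true (Ar.const true J)).X d} {C : Finset ℕ}
    {r : ℤ} (h : start s J d p C r ≠ 0) : C = J.image (· + s) ∧ r = d := by
  constructor
  · by_contra h'
    exact h (delta_ar _ h')
  · by_contra h'
    exact h (delta_deg _ h')

theorem injOn_add (s : ℕ) (S : Set ℕ) : Set.InjOn (· + s) S :=
  fun _ _ _ _ h => Nat.add_right_cancel h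

theorem chain_start_ne {s : ℕ} {J : Finset ℕ} {d : ℤ} {p : (D.X true (Ar.const true J)).X d}
    {m : ℕ → (D.rmod G hG).Elt} {N : Finset ℕ} {r : ℤ}
    (h : chain (· + s) (J.sort (· ≤ ·)) m (start s J d p) N r ≠ 0) :
    Part (fun j : J => (m j).ar) N ∧ d + ∑ j ∈ J, (m j).deg = r := by
  obtain ⟨C₀, h1, h2⟩ := chain_ne (J.sort_nodup (· ≤ ·)) (injOn_add s _) h
  obtain ⟨rfl, h3⟩ := start_ne h2
  rw [sum_sort] at h3
  refine ⟨?_, by omega⟩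
  rw [part_iff (A := fun j => (m j).ar)]
  refine ⟨fun i hi j hj hij => h1.disj i (by simpa using hi) j (by simpa using hj) hij, fun n => ?_⟩
  rw [h1.mem]
  simp only [Finset.mem_sort, Finset.mem_image]
  constructor
  · rintro (⟨⟨j, hj, rfl⟩, h⟩ | h)
    · exact (h j hj rfl).elim
    · exact h
  · exact Or.inr

theorem leftS_ne {s : ℕ} {J : Finset ℕ} {d : ℤ} {p : (D.X true (Ar.const true J)).X d}
    {m : ℕ → (D.rmod G hG).Elt} {N : Finset ℕ} {r : ℤ} (h : leftS D G hG s J d m N r p ≠ 0) :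
    (∀ n ∈ N, n < s) ∧ Part (fun j : J => (m j).ar) N ∧ d + ∑ j ∈ J, (m j).deg = r := by
  obtain ⟨h1, h2⟩ := evS_ne h
  exact ⟨h1, chain_start_ne h2⟩

theorem start_rel {s s' : ℕ} {J J' : Finset ℕ} {d : ℤ} (p : (D.X true (Ar.const true J)).X d)
    {f g : ℕ → ℕ} (hf : Set.BijOn f J J') {U : Set ℕ} (hU : Set.InjOn g U) (hJ : ∀ j ∈ J, j + s ∈ U)
    (hg : ∀ j ∈ J, g (j + s) = f j + s') :
    RelFam g U (start s J d p) (start s' J' d ((D.rel f (.const hf)).f d p)) := by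
  intro C C' hC hCU r
  have key : C = J.image (· + s) ↔ C' = J'.image (· + s') := by
    constructor
    · rintro rfl
      ext n
      constructor
      · intro hn
        obtain ⟨c, hc, rfl⟩ := hC.bij.surjOn hn
        obtain ⟨j, hj, rfl⟩ := Finset.mem_image.1 (Finset.mem_coe.1 hc)
        refine Finset.mem_image.2 ⟨f j, hf.mapsTo hj, (hg j hj).symm⟩
      · intro hn
        obtain ⟨j', hj', rfl⟩ := Finset.mem_image.1 hn
        obtain ⟨j, hj, rfl⟩ := hf.surjOn hj'
        have := hC.bij.mapsTo (Finset.mem_coe.2 (Finset.mem_image_of_mem (· + s) hj))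
        rw [hg j hj] at this
        exact this
    · rintro rfl
      ext n
      constructor
      · intro hn
        obtain ⟨j', hj', e⟩ := Finset.mem_image.1 (Finset.mem_coe.1 (hC.bij.mapsTo hn))
        obtain ⟨j, hj, rfl⟩ := hf.surjOn hj'
        have : j + s = n := hU (hJ j hj) (hCU hn) ((hg j hj).trans e)
        exact Finset.mem_image.2 ⟨j, hj, this⟩
      · intro hn
        obtain ⟨j, hj, rfl⟩ := Finset.mem_image.1 hn
        obtain ⟨c, hc, e⟩ := hC.bij.surjOn (Finset.mem_coe.2 (Finset.mem_image_of_mem (· + s')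
          (hf.mapsTo hj)))
        have : c = j + s := hU (hCU hc) (hJ j hj) (e.trans (hg j hj).symm)
        rw [← this]
        exact hc
  by_cases h : C = J.image (· + s)
  · have h' := key.1 h
    subst h h'
    by_cases e : r = d
    · subst e
      have e1 : start s J r p (J.image (· + s)) r = (D.rel (· + s) (reShift s J)).f r p :=
        delta_self _ _ _
      have e2 : start s' J' r ((D.rel f (.const hf)).f r p) (J'.image (· + s')) r =
        (D.rel (· + s') (reShift s' J')).f r ((D.rel f (.const hf)).f r p) := delta_self _ _ _
      rw [e1, e2]
      have hk : ReIn (fun j => f j + s') (Ar.const true J) ⟨J'.image (· + s'), colS s'⟩ :=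
        ⟨(reShift s' J').bij.comp hf, fun a ha => colS_true.2 (Nat.le_add_left _ _)⟩
      rw [relrel f (· + s') (fun j => f j + s') _ _ hk (fun _ _ => rfl),
        relrel (· + s) g (fun j => f j + s') _ _ hk hg]
    · rw [show start s J d p _ r = 0 from delta_deg _ e,
        show start s' J' d _ _ r = 0 from delta_deg _ e, map_zero]
  · rw [show start s J d p _ r = 0 from delta_ar _ h,
      show start s' J' d _ _ r = 0 from delta_ar _ (fun e => h (key.2 e)), map_zero]

theorem left_rel {s s' : ℕ} {J J' : Finset ℕ} {d : ℤ} (p : (D.X true (Ar.const true J)).X d)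
    {f h : ℕ → ℕ} (hf : Set.BijOn f J J') {N N' : Finset ℕ} (hN : ∀ n ∈ N, n < s)
    (hN' : ∀ n ∈ N', n < s') (hh : Set.BijOn h (N : Set ℕ) N') {m m' : ℕ → (D.rmod G hG).Elt}
    (hA : ∀ j ∈ J, (m j).ar ⊆ N)
    (hm : ∀ j ∈ J, ∃ (B : Finset ℕ) (hB : Set.BijOn h (m j).ar B), m' j = (m j).rel h hB) (r : ℤ) :
    evS D G hG s' N' r (chain (fun j => f j + s') (J.sort (· ≤ ·)) m'
      (start s' J' d ((D.rel f (.const hf)).f d p))) =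
    ((D.rmod G hG).rel h hh).f r (leftS D G hG s J d m N r p) := by
  set g : ℕ → ℕ := fun n => if n < s then h n else f (n - s) + s' with hg
  have g1 : ∀ n ∈ N, g n = h n := fun n hn => if_pos (hN n hn)
  have g2 : ∀ j, g (j + s) = f j + s' := fun j => by
    rw [hg]
    dsimp only
    rw [if_neg (by omega), Nat.add_sub_cancel]
  set U : Set ℕ := {n | n ∈ N ∨ ∃ j ∈ J, n = j + s}
  have hU : Set.InjOn g U := by
    rintro a (ha | ⟨i, hi, rfl⟩) b (hb | ⟨j, hj, rfl⟩) e
    · rw [g1 a ha, g1 b hb] at e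
      exact hh.injOn ha hb e
    · rw [g1 a ha, g2] at e
      have := hN' _ (hh.mapsTo ha)
      omega
    · rw [g1 b hb, g2] at e
      have := hN' _ (hh.mapsTo hb)
      omega
    · rw [g2, g2] at e
      rw [hf.injOn hi hj (Nat.add_right_cancel e)]
  have hC : ReIn g ⟨N, colS s⟩ ⟨N', colS s'⟩ := by
    refine ⟨hh.congr fun n hn => (g1 n hn).symm, fun n hn => ?_⟩
    change colS s' (g n) = colS s n
    rw [g1 n hn, colS_false.2 (hN n hn), colS_false.2 (hN' _ (hh.mapsTo hn))]
  have key := relFam_chain hU (start_rel p hf hU (fun j hj => Or.inr ⟨j, hj, rfl⟩) fun j _ => g2 j)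
    (x := (· + s)) (x' := fun j => f j + s') (J.sort (· ≤ ·)) (m := m) (m' := m')
    (fun i hi => Or.inr ⟨i, by simpa using hi, rfl⟩) (fun i _ => (g2 i).symm)
    (fun i _ => by rw [colS_true.2 (Nat.le_add_left _ _), colS_true.2 (Nat.le_add_left _ _)])
    (fun i hi n hn => Or.inl (hA i (by simpa using hi) hn)) (fun i hi => by
      obtain ⟨B, hB, e⟩ := hm i (by simpa using hi)
      have hg' : ∀ n ∈ (m i).ar, h n = g n := fun n hn => (g1 n (hA i (by simpa using hi) hn)).symm
      refine ⟨B, hB.congr hg', ?_⟩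
      rw [e, RightMod.Elt.rel, RightMod.Elt.rel, (D.rmod G hG).rel_congr h g _ _ hg'])
    N N' hC (fun n hn => Or.inl hn) r
  rw [evS_apply hN', key]
  have e1 : leftS D G hG s J d m N r p = _ := evS_apply hN r _
  rw [e1]
  have hk : ReIn h ⟨N, colS s⟩ (Ar.const false N') :=
    ⟨hh, fun n hn => (colS_false.2 (hN n hn)).symm⟩
  refine (relrel g id h _ _ hk g1 _).trans (relrel id h h _ (.const hh) hk (fun _ _ => rfl) _).symm

theorem part_sub {J : Finset ℕ} (A : ℕ → Finset ℕ) {N : Finset ℕ} (h : Part (fun j : J => A j) N)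
    {j : ℕ} (hj : j ∈ J) : A j ⊆ N := fun _ hn => (h.mem_iff _).2 ⟨⟨j, hj⟩, hn⟩

theorem bijid (A : Finset ℕ) : Set.BijOn id (A : Set ℕ) A := Set.bijOn_id _

theorem rel_id_elt (e : (D.rmod G hG).Elt) : e = e.rel id (bijid e.ar) := by
  rw [RightMod.Elt.rel, (D.rmod G hG).rel_id]
  rfl

theorem leftS_eq {s s' : ℕ} {J : Finset ℕ} {d : ℤ} (p : (D.X true (Ar.const true J)).X d)
    {N : Finset ℕ} (hN : ∀ n ∈ N, n < s) (hN' : ∀ n ∈ N, n < s') (m : ℕ → (D.rmod G hG).Elt) (r : ℤ) :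
    leftS D G hG s' J d m N r p = leftS D G hG s J d m N r p := by
  by_cases hP : Part (fun j : J => (m j).ar) N
  · have := left_rel p (bijid J) hN hN' (bijid N) (m := m) (m' := m) (fun j hj => part_sub (fun j => (m j).ar) hP hj)
      (fun j hj => ⟨_, bijid _, rel_id_elt _⟩) r
    rw [(D.rmod G hG).rel_id, relid] at this
    exact this
  · have h1 : ∀ s, leftS D G hG s J d m N r p = 0 := fun s => by
      by_contra h
      exact hP (leftS_ne h).2.1
    rw [h1, h1]

theorem leftPre_apply {s : ℕ} {J : Finset ℕ} {d : ℤ} (p : (D.X true (Ar.const true J)).X d)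
    {N : Finset ℕ} (hN : ∀ n ∈ N, n < s) (m : ℕ → (D.rmod G hG).Elt) (r : ℤ) :
    leftPre D G hG J d p m N r = leftS D G hG s J d m N r p := leftS_eq p hN lt_bd m r

theorem sort_split {J : Finset ℕ} {j : ℕ} (hj : j ∈ J) : ∃ l₁ l₂ : List ℕ,
    J.sort (· ≤ ·) = l₁ ++ j :: l₂ ∧ (∀ i ∈ l₁, i < j) ∧ (∀ i ∈ l₂, j < i) := by
  obtain ⟨l₁, l₂, e⟩ := List.append_of_mem ((Finset.mem_sort (· ≤ ·)).2 hj)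
  have h1 : (J.sort (· ≤ ·)).Pairwise (· < ·) := Finset.sortedLT_sort J |>.pairwise
  rw [e, List.pairwise_append, List.pairwise_cons] at h1
  exact ⟨l₁, l₂, e, fun i hi => h1.2.2 i hi j (by simp), fun i hi => h1.2.1.1 i hi⟩

theorem leftPre_isEnd {J : Finset ℕ} {d : ℤ} (p : (D.X true (Ar.const true J)).X d) :
    RightMod.IsEnd J d (leftPre D G hG J d p) := by
  constructor
  · intro m N r h
    exact (leftS_ne h).2
  · intro m m' h
    funext N r
    change evS D G hG _ N r _ = evS D G hG _ N r _
    exact congrArg (fun F => evS D G hG (bd N) N r (F (start (bd N) J d p)))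
      (chain_loc (· + bd N) fun j hj => h j ((Finset.mem_sort (· ≤ ·)).1 hj))
  · intro m j hj A k N r
    set F := (chain_isLinear (· + bd N) (J.sort_nodup (· ≤ ·)) m
      ((Finset.mem_sort (· ≤ ·)).2 hj) A k (start (bd N) J d p) N r).mk'
    have h1 : (fun z : ((D.rmod G hG).X A).X k =>
        leftPre D G hG J d p (Function.update m j ⟨A, k, z⟩) N r) =
          ((D.rel id (reEv (N := N) lt_bd)).f r).hom ∘ₗ F := by
      funext z
      exact evS_apply lt_bd r _
    rw [h1]
    exact LinearMap.isLinear _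
  · intro m m' N N' h hh hP hm r
    have := left_rel p (bijid J) lt_bd lt_bd hh (m := m) (m' := m') (fun j hj => part_sub (fun j => (m j).ar) hP hj) hm r
    rw [relid] at this
    exact this
  · intro m j hj e x B C N N' h h' hP l n r r' hn hr q
    obtain ⟨l₁, l₂, hs, hl₁, hl₂⟩ := sort_split hj
    set s := max (bd N) (bd N')
    have hN : ∀ n ∈ N, n < s := fun n hn => (lt_bd n hn).trans_le (le_max_left _ _)
    have hN' : ∀ n ∈ N', n < s := fun n hn => (lt_bd n hn).trans_le (le_max_right _ _)
    have hnd := J.sort_nodup (· ≤ ·)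
    rw [hs] at hnd
    have hnd1 : l₁.Nodup := hnd.of_append_left
    have hj1 : j ∉ l₁ := fun h => lt_irrefl _ (hl₁ j h)
    have hj2 : j ∉ l₂ := fun h => lt_irrefl _ (hl₂ j h)
    have hmem : ∀ i, i ∈ J ↔ i ∈ l₁ ++ j :: l₂ := fun i => by rw [← hs, Finset.mem_sort]
    have he : e.ar ⊆ N := by
      have := part_sub (fun i => (Function.update m j e i).ar) hP hj
      simpa using this
    have hdis : ∀ i ∈ J, i ≠ j → Disjoint (m i).ar e.ar ∧ (m i).ar ⊆ N := by
      intro i hi hij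
      have h1 := hP.disj ⟨i, hi⟩ ⟨j, hj⟩ (fun e => hij (congrArg Subtype.val e))
      have h2 := part_sub (fun i => (Function.update m j e i).ar) hP hi
      simp only [Function.update_of_ne hij, Function.update_self] at h1 h2
      exact ⟨h1, h2⟩
    have hxe : x ∈ e.ar := h.mem
    have hBs : ∀ b ∈ B, b < s := fun b hb => hN' b (h'.mem_iff.2 (Or.inr hb))
    have hxs : x < s := hN x (he hxe)
    rw [leftPre_apply p hN', leftPre_apply p hN]
    have hu : ∀ e', chain (col := colS s) (· + s) (J.sort (· ≤ ·)) (Function.update m j e')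
        (start s J d p) = chain (· + s) l₂ m (insE (j + s) e' (chain (· + s) l₁ m
          (start s J d p))) := by
      intro e'
      rw [hs, chain_append, chain_cons, Function.update_self, chain_upd _ m hj1, chain_upd _ m hj2]
    have h1 : leftS D G hG s J d (Function.update m j (e.act h hn q)) N' r' p = _ :=
      evS_apply hN' r' _
    have h2 : leftS D G hG s J d (Function.update m j e) N r p = _ := evS_apply hN r _
    change _ = sg (l * ∑ i ∈ J, lo j i * ((m i).deg : ZMod 2)) • D.comp (insF h') hr
      (leftS D G hG s J d (Function.update m j e) N r p) ((NUOperad.Hom.app G B).f l q)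
    rw [h1, h2]
    simp only [LinearMap.comp_apply]
    rw [hu, hu]
    set v := chain (col := colS s) (· + s) l₁ m (start s J d p)
    set t : (D.X false (Ar.const false B)).X l := (NUOperad.Hom.app G B).f l q
    have h3 : insE (j + s) (e.act h hn q) v = ins x t (insE (j + s) e v) := by
      refine ins_seq (d := true) (B := Ar.const false e.ar) (E := Ar.const false C) (insF h)
        (fun b hb => colS_false.2 (hN b (he hb))) hn e.val t v ?_
      intro C' r' hxC _
      by_contra h0
      obtain ⟨C₀, h4, h5⟩ := chain_ne hnd1 (injOn_add s _) h0
      obtain ⟨rfl, -⟩ := start_ne h5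
      rcases (h4.mem x).1 hxC with ⟨h6, -⟩ | ⟨i, hi, h6⟩
      · obtain ⟨i, -, e⟩ := Finset.mem_image.1 h6
        omega
      · refine Finset.disjoint_left.1 (hdis i ((hmem i).2 (by simp [hi])) ?_).1 h6 hxe
        have := hl₁ i hi
        omega
    rw [h3, chain_comm (· + s) l₂ m t (fun i _ => by omega) (fun i hi hx => ?_) (fun i _ hx => ?_)]
    · have h4 : CIns ⟨N, colS s⟩ x false (Ar.const false B) ⟨N', colS s⟩ :=
        ⟨h', colS_false.2 hxs, fun _ _ => rfl, fun b hb => colS_false.2 (hBs b hb)⟩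
      have hsum : ∑ i ∈ J, lo j i * ((m i).deg : ZMod 2) =
          (l₂.map fun i => ((m i).deg : ZMod 2)).sum := by
        rw [← sum_sort, hs, List.map_append, List.sum_append, List.map_cons, List.sum_cons, lo_self,
          zero_mul, zero_add, List.sum_eq_zero, zero_add]
        · congr 1
          apply List.map_congr_left
          intro i hi
          rw [lo, if_pos (hl₂ i hi), one_mul]
        · intro z hz
          obtain ⟨i, hi, rfl⟩ := List.mem_map.1 hz
          have := hl₁ i hi
          rw [lo, if_neg (by omega), zero_mul]
      rw [hsum, Pi.smul_apply, Pi.smul_apply, map_zsmul, ins_apply t _ h4 hr]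
      congr 1
      have := D.rel_comp h4 id id id (insF h') (reEv hN) (ReIn.const (bijid B)) (reEv hN')
        (fun _ _ => rfl) (fun _ _ => rfl) hr (chain (· + s) l₂ m (insE (j + s) e v) N r) t
      rw [relid] at this
      exact this
    · refine Finset.disjoint_left.1 (hdis i ((hmem i).2 (by simp [hi])) ?_).1 hx hxe
      have := hl₂ i hi
      omega
    · have := hBs _ hx
      omega

end ColDGOperad

end

section

variable {K : Type u} [Field K]

namespace ColDGOperad
variable {D : ColDGOperad.{u, w} K Bool} {col : ℕ → Bool} {Q : DGOperad.{u, w} K}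
  {G : Q.toNUOperad ⟶ (D.mono false).toNUOperad}
  {hG : ∀ x, (NUOperad.Hom.app G {x}).f 0 (Q.one x) = (D.mono false).one x}

theorem rel_d {c : Bool} {A B : Ar Bool} (f : ℕ → ℕ) (hf : ReIn f A B) (i j : ℤ) (a : (D.X c A).X i) :
    (D.rel f hf).f j ((D.X c A).d i j a) = (D.X c B).d i j ((D.rel f hf).f i a) :=
  (congrArg (fun t => (ModuleCat.Hom.hom t) a) ((D.rel f hf).comm i j)).symm

theorem dFam_delta (B : Finset ℕ) {k k' : ℤ} (hk : k + 1 = k') (z : (D.X true ⟨B, col⟩).X k) :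
    dFam (delta B k z) = delta B k' ((D.X true ⟨B, col⟩).d k k' z) := by
  apply delta_ext
  · rw [dFam_apply _ _ hk, delta_self]
  · intro C r hC
    rw [dFam_apply _ _ (sub_add_cancel r 1), delta_ar z hC, map_zero]
  · intro r hr
    rw [dFam_apply _ _ (sub_add_cancel r 1), delta_deg z (by omega), map_zero]

theorem evS_dFam (s : ℕ) (N : Finset ℕ) {r r' : ℤ} (hr : r' + 1 = r) (v : D.Fam (colS s)) :
    evS D G hG s N r (dFam v) = ((D.rmod G hG).X N).d r' r (evS D G hG s N r' v) := by
  by_cases h : ∀ n ∈ N, n < s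
  · rw [evS_apply h, evS_apply h, dFam_apply v N hr]
    exact rel_d _ _ _ _ _
  · have h0 : ∀ (r : ℤ) (v : D.Fam (colS s)), evS D G hG s N r v = 0 := fun r v => by
      by_contra h'
      exact h (evS_ne h').1
    rw [h0, h0, map_zero]

theorem dEnd_left {J : Finset ℕ} {d d' : ℤ} (hd : d + 1 = d') (p : (D.X true (Ar.const true J)).X d) :
    RightMod.dEnd J d (leftPre D G hG J d p) =
      leftPre D G hG J d' ((D.X true (Ar.const true J)).d d d' p) := by
  funext m N r
  rw [RightMod.dEnd_apply _ _ _ (sub_add_cancel r 1), sub_eq_iff_eq_add]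
  have h1 := dFam_chain (· + bd N) (J.sort (· ≤ ·)) (Finset.sortedLT_sort J).pairwise m
    (v := start (bd N) J d p) (e := d) (fun C r hr => delta_deg _ hr)
  have h2 : dFam (start (bd N) J d p) =
      start (bd N) J d' ((D.X true (Ar.const true J)).d d d' p) := by
    refine (dFam_delta _ hd _).trans ?_
    exact congrArg (delta _ d') (rel_d _ _ _ _ _).symm
  have h3 := congrArg (evS D G hG (bd N) N r) h1
  rw [evS_dFam _ _ (sub_add_cancel r 1), map_add, map_zsmul, map_list_sum, h2, List.map_map] at h3
  refine h3.trans ?_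
  congr 2
  rw [← sum_sort]
  congr 1
  apply List.map_congr_left
  intro j _
  rw [Function.comp_apply, map_zsmul, sum_sort]
  rfl

theorem inv_map {l : List ℕ} (hl : l.Pairwise (· < ·)) (f : ℕ → ℕ) (k : ℕ → ZMod 2) :
    inv k (l.map f) = (l.map fun i => (l.map fun j =>
      lo i j * lo (f j) (f i) * k (f i) * k (f j)).sum).sum := by
  induction l with
  | nil => rfl
  | cons a l ih =>
    rw [List.pairwise_cons] at hl
    rw [List.map_cons, inv, ih hl.2, List.map_cons, List.sum_cons, List.map_cons, List.sum_cons,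
      lo_self, add_comm]
    congr 1
    · rw [List.map_map]
      simp only [zero_mul, zero_add]
      congr 1
      apply List.map_congr_left
      intro j hj
      rw [Function.comp_apply, lo, lo, if_pos (hl.1 j hj), one_mul]
    · congr 1
      apply List.map_congr_left
      intro i hi
      have := hl.1 i hi
      rw [List.map_cons, List.sum_cons, lo, if_neg (by omega)]
      simp only [zero_mul, zero_add]

theorem inv_sorted {l : List ℕ} (hl : l.Pairwise (· < ·)) (k : ℕ → ZMod 2) : inv k l = 0 := by
  induction l with
  | nil => rfl
  | cons a l ih =>
    rw [List.pairwise_cons] at hl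
    rw [inv, ih hl.2, zero_add]
    apply List.sum_eq_zero
    intro z hz
    obtain ⟨i, hi, rfl⟩ := List.mem_map.1 hz
    have := hl.1 i hi
    rw [lo, if_neg (by omega)]
    simp only [zero_mul]

theorem inv_append (k : ℕ → ZMod 2) (l l' : List ℕ) : inv k (l ++ l') = inv k l + inv k l' +
    (l.map fun a => (l'.map fun b => lo b a * k a * k b).sum).sum := by
  induction l with
  | nil => simp [inv]
  | cons a l ih =>
    rw [List.cons_append, inv, inv, ih, List.map_append, List.sum_append, List.map_cons, List.sum_cons]
    ring

theorem relEnd_left {J J' : Finset ℕ} {d : ℤ} {f : ℕ → ℕ} (hf : Set.BijOn f J J')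
    (p : (D.X true (Ar.const true J)).X d) :
    leftPre D G hG J' d ((D.rel f (.const hf)).f d p) =
      RightMod.relEnd J f (leftPre D G hG J d p) := by
  funext m N r
  by_cases hP : Part (fun j : J' => (m j).ar) N
  · have h0 := left_rel p hf lt_bd lt_bd (bijid N) (m := m ∘ f) (m' := m ∘ f)
      (fun j hj => part_sub (fun j => (m j).ar) hP (hf.mapsTo hj))
      (fun j hj => ⟨_, bijid _, rel_id_elt _⟩) r
    have h1 : leftPre D G hG J d p (m ∘ f) N r = evS D G hG (bd N) N r
        (chain (fun j => f j + bd N) (J.sort (· ≤ ·)) (m ∘ f)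
          (start (bd N) J' d ((D.rel f (.const hf)).f d p))) := by
      rw [h0, (D.rmod G hG).rel_id]
      rfl
    rw [← chain_map (· + bd N) f] at h1
    have hs := (Finset.sortedLT_sort J).pairwise
    have hs' := (Finset.sortedLT_sort J').pairwise
    have hnd : ((J.sort (· ≤ ·)).map f).Nodup := List.Nodup.map_on
      (fun a ha b hb e => hf.injOn (by simpa using ha) (by simpa using hb) e) (J.sort_nodup _)
    have hp : ((J.sort (· ≤ ·)).map f).Perm (J'.sort (· ≤ ·)) := by
      rw [List.perm_ext_iff_of_nodup hnd (J'.sort_nodup _)]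
      intro n
      rw [List.mem_map, Finset.mem_sort]
      constructor
      · rintro ⟨a, ha, rfl⟩
        exact hf.mapsTo (by simpa using ha)
      · intro hn
        obtain ⟨a, ha, e⟩ := hf.surjOn hn
        exact ⟨a, by simpa using ha, e⟩
    rw [chain_perm hp hnd (injOn_add _ _) m, inv_map hs, inv_sorted hs', add_zero, map_zsmul] at h1
    · change leftPre D G hG J' d ((D.rel f (.const hf)).f d p) m N r =
        sg (RightMod.relExp J f fun i => ((m (f i)).deg : ZMod 2)) •
          leftPre D G hG J d p (m ∘ f) N r
      have h2 : RightMod.relExp J f (fun i => ((m (f i)).deg : ZMod 2)) =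
        ((J.sort (· ≤ ·)).map fun i => ((J.sort (· ≤ ·)).map fun j =>
          lo i j * lo (f j) (f i) * ((m (f i)).deg : ZMod 2) * ((m (f j)).deg : ZMod 2)).sum).sum := by
        rw [sum_sort]
        apply Finset.sum_congr rfl
        intro i _
        rw [sum_sort]
      rw [h1, ← h2, sg_smul, z2, sg_zero, one_smul]
      rfl
    · intro i hi j hj hij
      have hj' : j ∈ J' := (Finset.mem_sort (· ≤ ·)).1 (hp.mem_iff.1 hj)
      have := lt_bd _ (part_sub (fun j => (m j).ar) hP hj' hij)
      omega
  · have h1 := leftPre_isEnd (G := G) (hG := hG) ((D.rel f (.const hf)).f d p)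
    have h2 := RightMod.IsEnd.relEnd hf (leftPre_isEnd (G := G) (hG := hG) p)
    rw [h1.eq_zero fun h => hP h.1]
    exact (h2.eq_zero fun h => hP h.1).symm

theorem ins_cast {x : ℕ} {d : Bool} {B B' : Ar Bool} (h : ReIn id B B') {k : ℤ} (z : (D.X d B).X k)
    (v : D.Fam col) : ins x ((D.rel id h).f k z) v = ins x z v := by
  have h0 : RelFam id Set.univ v v := by
    intro C C' hC _ r
    have e : C = C' := by
      have := hC.bij.image_eq
      rw [Set.image_id] at this
      exact Finset.coe_injective this
    subst e
    rw [relid]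
  have h1 := RelFam.ins (g := id) (fun a _ b _ e => e) h0 (x := x) (Set.mem_univ _) rfl (Set.subset_univ _) h z
  funext C r
  have := h1 C C ⟨bijid C, fun _ _ => rfl⟩ (Set.subset_univ _) r
  rw [relid] at this
  exact this

theorem chain_ins {X : ℕ} {x : ℕ → ℕ} {l : List ℕ} (hl : l.Nodup) (hx : Set.InjOn x {i | i ∈ l})
    (m : ℕ → (D.rmod G hG).Elt) {v : D.Fam col} (hv : ∀ j ∈ l, ∀ C r, x j ∈ C → x j ≠ X → v C r = 0)
    (hc : ∀ j ∈ l, col (x j) = true) (ha : ∀ j ∈ l, ∀ n ∈ (m j).ar, col n = false)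
    {B : Finset ℕ} {k : ℤ} (z : (D.X true ⟨B, col⟩).X k) (hB : ∀ j ∈ l, x j ∈ B)
    {B' : Finset ℕ} (hB' : ∀ n, n ∈ B' ↔ (n ∈ B ∧ ∀ j ∈ l, n ≠ x j) ∨ ∃ j ∈ l, n ∈ (m j).ar)
    {k' : ℤ} (hk' : k' = k + (l.map fun j => (m j).deg).sum) :
    chain x l m (ins (B := ⟨B, col⟩) X z v) =
      ins (B := ⟨B', col⟩) X (chain x l m (delta B k z) B' k') v := by
  induction l generalizing B k with
  | nil =>
    have e : B' = B := by ext n; simp [hB']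
    subst e
    obtain rfl : k' = k := by simpa using hk'
    change _ = ins (B := ⟨B', col⟩) X (delta B' k' z B' k') v
    rw [delta_self]
    rfl
  | cons a l ih =>
    rw [List.nodup_cons] at hl
    have hsub : ∀ {i}, i ∈ l → i ∈ a :: l := fun h => by simp [h]
    have hxa : ∀ j ∈ l, x j ≠ x a := fun j hj e => hl.1 (hx (hsub hj) (by simp) e ▸ hj)
    have hxA : ∀ i ∈ a :: l, x i ∉ (m a).ar := fun i hi hn => by
      have := ha a (by simp) _ hn
      rw [hc i hi] at this
      exact Bool.noConfusion this
    rw [chain_cons, chain_cons]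
    by_cases hd : Disjoint (B.erase (x a)) (m a).ar
    · have h : CIns ⟨B, col⟩ (x a) true (Ar.const false (m a).ar)
          ⟨B.erase (x a) ∪ (m a).ar, col⟩ :=
        ⟨⟨hB a (by simp), hd, rfl⟩, hc a (by simp), fun _ _ => rfl, ha a (by simp)⟩
      have e1 : insE (x a) (m a) (ins (B := ⟨B, col⟩) X z v) =
          ins (B := ⟨B.erase (x a) ∪ (m a).ar, col⟩) X (D.comp h rfl z (m a).val) v :=
        (ins_seq h (fun _ _ => rfl) rfl z (m a).val v (hv a (by simp))).symm
      have e2 : insE (x a) (m a) (delta B k z) =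
          delta (B.erase (x a) ∪ (m a).ar) (k + (m a).deg) (D.comp h rfl z (m a).val) := by
        apply delta_ext
        · refine (ins_apply _ _ h rfl).trans ?_
          rw [delta_self]
        · intro C r hC
          refine ins_zero _ _ fun C₀ h0 => ?_
          refine delta_ar z ?_
          rintro rfl
          exact hC h0.ins.eq
        · intro r hr
          refine ins_zero _ _ fun C₀ h0 => delta_deg z (by omega)
      rw [e1, e2]
      refine ih hl.2 (hx.mono fun i hi => hsub hi) (fun j hj => hv j (hsub hj))
        (fun j hj => hc j (hsub hj)) (fun j hj => ha j (hsub hj)) _ (fun j hj => ?_) (fun n => ?_) ?_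
      · exact Finset.mem_union_left _ (Finset.mem_erase.2 ⟨hxa j hj, hB j (hsub hj)⟩)
      · rw [hB', Finset.mem_union, Finset.mem_erase]
        simp only [List.mem_cons, forall_eq_or_imp, exists_eq_or_imp]
        have : n ∈ (m a).ar → ∀ j ∈ l, n ≠ x j := fun hn j hj e => hxA j (hsub hj) (e ▸ hn)
        generalize (∀ j ∈ l, n ≠ x j) = p1 at this ⊢
        generalize (∃ j ∈ l, n ∈ (m j).ar) = p2
        generalize (n ∈ (m a).ar) = p3 at this ⊢
        generalize (n ∈ B) = p4
        constructor
        · rintro (⟨h1, h2, h3⟩ | h1 | h1)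
          · exact Or.inl ⟨Or.inl ⟨h2, h1⟩, h3⟩
          · exact Or.inl ⟨Or.inr h1, this h1⟩
          · exact Or.inr h1
        · rintro (⟨⟨h1, h2⟩ | h1, h3⟩ | h1)
          · exact Or.inl ⟨h2, h1, h3⟩
          · exact Or.inr (Or.inl h1)
          · exact Or.inr (Or.inr h1)
      · rw [hk', List.map_cons, List.sum_cons]
        ring
    · have e1 : insE (x a) (m a) (ins (B := ⟨B, col⟩) X z v) = 0 := by
        funext C r
        refine ins_zero _ _ fun C₀ h0 => ins_zero _ _ fun C₁ h1 => (hd ?_).elim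
        rw [Finset.disjoint_left]
        intro n hn
        obtain ⟨hn1, hn2⟩ := Finset.mem_erase.1 hn
        have h2 := h1.ins
        have : n ∈ C₀ := h2.mem_iff'.2 (Or.inr hn2)
        exact h0.ins.notMem_right (Finset.mem_erase.2 ⟨hn1, this⟩)
      have e2 : insE (x a) (m a) (delta B k z) = 0 := by
        funext C r
        refine ins_zero _ _ fun C₀ h0 => delta_ar z ?_
        rintro rfl
        exact hd h0.ins.disj
      refine (congrArg (chain x l m) e1).trans ?_
      refine (chain x l m).map_zero.trans ?_
      refine Eq.trans ?_ (congrArg (fun t => ins (D := D) (B := ⟨B', col⟩) X (t B' k') v)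
        ((congrArg (chain x l m) e2).trans (chain x l m).map_zero)).symm
      funext C r
      exact (ins_isLinear (d := true) (B := ⟨B', col⟩) (k := k') X v C r).map_zero.symm

theorem exp_comp {A B : Finset ℕ} {x : ℕ} {l₁ l₂ : List ℕ} (hs : A.sort (· ≤ ·) = l₁ ++ x :: l₂)
    (n1 : l₁.Nodup) (n2 : l₂.Nodup) (hl₁ : ∀ i ∈ l₁, i < x) (hl₂ : ∀ i ∈ l₂, x < i)
    (hB : ∀ b ∈ l₂, b ∉ B) (q : ZMod 2) (k : ℕ → ZMod 2) :
    0 + (0 + 0 + ((B.sort (· ≤ ·)).map fun a => (l₂.map fun b => lo b a * k a * k b).sum).sum) +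
      (l₁.map fun a => ((B.sort (· ≤ ·) ++ l₂).map fun b => lo b a * k a * k b).sum).sum +
      q * (l₁.map k).sum = RightMod.compExp A x B q k := by
  have hx : x ∈ A := by
    rw [← Finset.mem_sort (· ≤ ·), hs]
    simp
  have key : ∀ F : ℕ → ZMod 2, ∑ a ∈ A.erase x, F a = ∑ a ∈ l₁.toFinset, F a + ∑ a ∈ l₂.toFinset, F a := by
    intro F
    have h1 := sum_sort A F
    rw [hs, List.map_append, List.sum_append, List.map_cons, List.sum_cons, ← Finset.add_sum_erase A F hx,
      ← List.sum_toFinset F n1, ← List.sum_toFinset F n2] at h1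
    linear_combination -h1
  rw [RightMod.compExp, key]
  simp only [List.map_append, List.sum_append, sum_sort, ← List.sum_toFinset _ n1, ← List.sum_toFinset _ n2]
  rw [Finset.sum_add_distrib]
  have e0 : ∑ a ∈ l₁.toFinset, ∑ b ∈ l₂.toFinset, lo b a * k a * k b = 0 := by
    refine Finset.sum_eq_zero fun a ha => Finset.sum_eq_zero fun b hb => ?_
    have h1 := hl₁ a (List.mem_toFinset.1 ha)
    have h2 := hl₂ b (List.mem_toFinset.1 hb)
    rw [lo, if_neg (by omega), zero_mul, zero_mul]
  have e1 : ∑ a ∈ l₁.toFinset, (q * lo a x + ∑ i ∈ B, (lo i a + lo x a) * k i) * k a =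
      q * ∑ a ∈ l₁.toFinset, k a + ∑ a ∈ l₁.toFinset, ∑ b ∈ B, lo b a * k a * k b := by
    rw [Finset.mul_sum, ← Finset.sum_add_distrib]
    refine Finset.sum_congr rfl fun a ha => ?_
    have h1 := hl₁ a (List.mem_toFinset.1 ha)
    rw [show lo a x = 1 from if_pos h1, show lo x a = 0 from if_neg (by omega), add_mul, Finset.sum_mul]
    congr 1
    · ring
    · exact Finset.sum_congr rfl fun b _ => by ring
  have e2 : ∑ a ∈ l₂.toFinset, (q * lo a x + ∑ i ∈ B, (lo i a + lo x a) * k i) * k a =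
      ∑ a ∈ B, ∑ b ∈ l₂.toFinset, lo b a * k a * k b := by
    rw [Finset.sum_comm]
    refine Finset.sum_congr rfl fun a ha => ?_
    have h0 := List.mem_toFinset.1 ha
    have h1 := hl₂ a h0
    rw [show lo a x = 0 from if_neg (by omega), show lo x a = 1 from if_pos h1, mul_zero, zero_add,
      Finset.sum_mul]
    refine Finset.sum_congr rfl fun b hb => ?_
    rw [lo_swap (i := b) (j := a) fun e => hB a h0 (e ▸ hb)]
  rw [e0, e1, e2]
  ring

theorem ins_shift {A : Finset ℕ} {x : ℕ} {B C : Finset ℕ} (h : Ins A x B C) (s : ℕ) :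
    CIns ⟨A.image (· + s), colS s⟩ (x + s) true ⟨B.image (· + s), colS s⟩
      ⟨C.image (· + s), colS s⟩ := by
  refine ⟨⟨Finset.mem_image_of_mem (· + s) h.mem, ?_, ?_⟩, colS_true.2 (Nat.le_add_left _ _),
    fun _ _ => rfl, fun _ _ => rfl⟩
  · rw [Finset.disjoint_left]
    intro n hn hnB
    obtain ⟨h1, h2⟩ := Finset.mem_erase.1 hn
    obtain ⟨a, ha, rfl⟩ := Finset.mem_image.1 h2
    obtain ⟨b, hb, e⟩ := Finset.mem_image.1 hnB
    obtain rfl : b = a := Nat.add_right_cancel e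
    refine h.notMem_right (Finset.mem_erase.2 ⟨?_, ha⟩) hb
    rintro rfl; exact h1 rfl
  · ext n
    rw [Finset.mem_union, Finset.mem_erase, Finset.mem_image, Finset.mem_image, Finset.mem_image]
    constructor
    · rintro ⟨c, hc, rfl⟩
      rcases h.mem_iff'.1 hc with ⟨h1, h2⟩ | h1
      · exact Or.inl ⟨fun e => h1 (Nat.add_right_cancel e), c, h2, rfl⟩
      · exact Or.inr ⟨c, h1, rfl⟩
    · rintro (⟨h1, a, ha, rfl⟩ | ⟨b, hb, rfl⟩)
      · refine ⟨a, h.mem_iff'.2 (Or.inl ⟨?_, ha⟩), rfl⟩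
        rintro rfl; exact h1 rfl
      · exact ⟨b, h.mem_iff'.2 (Or.inr hb), rfl⟩

theorem start_comp {A : Finset ℕ} {x : ℕ} {B C : Finset ℕ} (h : Ins A x B C) (s : ℕ) {i j n : ℤ}
    (hn : i + j = n) (p : (D.X true (Ar.const true A)).X i) (q : (D.X true (Ar.const true B)).X j) :
    start s C n (D.comp (.const h) hn p q) =
      ins (x + s) ((D.rel (· + s) (reShift s B)).f j q) (start s A i p) := by
  refine (delta_ext _ ?_ ?_ ?_).symm
  · refine (ins_apply _ _ (ins_shift h s) hn).trans ?_
    rw [show start s A i p (A.image (· + s)) i = _ from delta_self _ _ _]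
    exact (D.rel_comp (.const h) (· + s) (· + s) (· + s) (ins_shift h s) (reShift s A) (reShift s B)
      (reShift s C) (fun _ _ => rfl) (fun _ _ => rfl) hn p q).symm
  · intro C' r hC
    refine ins_zero _ _ fun C₀ h0 => ?_
    refine delta_ar _ ?_
    rintro rfl
    have h1 := h0.ins.eq
    have h2 := (ins_shift h s).ins.eq
    exact hC (h1.trans h2.symm)
  · intro r hr
    exact ins_zero _ _ fun C₀ h0 => delta_deg _ (by omega)

theorem compEnd_left {A : Finset ℕ} {x : ℕ} {B C : Finset ℕ} (h : Ins A x B C) {i j n : ℤ}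
    (hn : i + j = n) (p : (D.X true (Ar.const true A)).X i) (q : (D.X true (Ar.const true B)).X j) :
    leftPre D G hG C n (D.comp (.const h) hn p q) =
      RightMod.compEnd A x B j (leftPre D G hG A i p) (leftPre D G hG B j q) := by
  funext m N r
  by_cases hP : Part (fun j : C => (m j).ar) N
  · set s := bd N
    have hmC : ∀ c ∈ C, ∀ n ∈ (m c).ar, n < s := fun c hc n hn =>
      lt_bd n (part_sub (fun j => (m j).ar) hP hc hn)
    have hAC : ∀ a ∈ A, a ≠ x → a ∈ C := fun a ha hax => h.mem_iff'.2 (Or.inl ⟨hax, ha⟩)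
    have hBC : ∀ b ∈ B, b ∈ C := fun b hb => h.mem_iff'.2 (Or.inr hb)
    have hAB : ∀ a ∈ A, a ≠ x → a ∉ B := fun a ha hax =>
      h.notMem_right (Finset.mem_erase.2 ⟨hax, ha⟩)
    obtain ⟨l₁, l₂, hs, hl₁, hl₂⟩ := sort_split h.mem
    have hx1 : x ∉ l₁ := fun h => lt_irrefl _ (hl₁ x h)
    have hx2 : x ∉ l₂ := fun h => lt_irrefl _ (hl₂ x h)
    have hpw := (Finset.sortedLT_sort A).pairwise
    have hpwB := (Finset.sortedLT_sort B).pairwise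
    rw [hs] at hpw
    have hpw1 := (List.pairwise_append.1 hpw).1
    have hpw2 := (List.pairwise_cons.1 (List.pairwise_append.1 hpw).2.1).2
    have hpw12 : ∀ a ∈ l₁, ∀ b ∈ l₂, a < b := fun a ha b hb => (hl₁ a ha).trans (hl₂ b hb)
    have hA : ∀ a, a ∈ A ↔ a ∈ l₁ ∨ a = x ∨ a ∈ l₂ := fun a => by
      rw [← Finset.mem_sort (· ≤ ·), hs]; simp
    have hA1 : ∀ a ∈ l₁, a ∈ A ∧ a ≠ x := fun a ha =>
      ⟨(hA a).2 (Or.inl ha), fun e => hx1 (e ▸ ha)⟩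
    have hA2 : ∀ a ∈ l₂, a ∈ A ∧ a ≠ x := fun a ha =>
      ⟨(hA a).2 (Or.inr (Or.inr ha)), fun e => hx2 (e ▸ ha)⟩
    set L := B.sort (· ≤ ·)
    have hL : ∀ b, b ∈ L ↔ b ∈ B := fun b => Finset.mem_sort _
    have hnd : (l₁ ++ (L ++ l₂)).Nodup := by
      refine List.nodup_append'.2 ⟨hpw1.imp fun h => ne_of_lt h, List.nodup_append'.2
        ⟨B.sort_nodup _, hpw2.imp fun h => ne_of_lt h, fun a ha ha' => ?_⟩, fun a ha ha' => ?_⟩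
      · exact hAB a (hA2 a ha').1 (hA2 a ha').2 ((hL a).1 ha)
      · rcases List.mem_append.1 ha' with ha' | ha'
        · exact hAB a (hA1 a ha).1 (hA1 a ha).2 ((hL a).1 ha')
        · exact lt_irrefl _ (hpw12 a ha a ha')
    have hmemC : ∀ c, c ∈ l₁ ++ (L ++ l₂) ↔ c ∈ C := by
      intro c
      rw [List.mem_append, List.mem_append, hL, h.mem_iff', hA]
      have h1 := hA1 c
      have h2 := hA2 c
      tauto
    have hperm : (C.sort (· ≤ ·)).Perm (l₁ ++ (L ++ l₂)) := by
      rw [List.perm_ext_iff_of_nodup (C.sort_nodup _) hnd]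
      intro c
      rw [hmemC, Finset.mem_sort]
    have hm1 : ∀ a ∈ l₁, a ∈ C := fun a ha => hAC a (hA1 a ha).1 (hA1 a ha).2
    have hm2 : ∀ a ∈ l₂, a ∈ C := fun a ha => hAC a (hA2 a ha).1 (hA2 a ha).2
    set q' := (D.rel (· + s) (reShift s B)).f j q
    set v := start s A i p
    set v₁ := chain (col := colS s) (· + s) l₁ m v
    set blk := RightMod.block B j (leftPre D G hG B j q) m
    have hblk : ∀ n ∈ blk.ar, n < s := by
      intro n hn
      obtain ⟨b, hb, hn⟩ := Finset.mem_biUnion.1 hn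
      exact hmC b (hBC b hb) n hn
    have hv₁ : ∀ b ∈ B, ∀ C' r, b + s ∈ C' → b + s ≠ x + s → v₁ C' r = 0 := by
      intro b hb C' r hbC hbx
      by_contra h0
      obtain ⟨C₀, h1, h2⟩ := chain_ne (hpw1.imp fun h => ne_of_lt h) (injOn_add s _) h0
      obtain ⟨rfl, -⟩ := start_ne h2
      rcases (h1.mem _).1 hbC with ⟨h3, h4⟩ | ⟨a, ha, h3⟩
      · obtain ⟨a, ha, e⟩ := Finset.mem_image.1 h3
        obtain rfl : a = b := Nat.add_right_cancel e
        exact hAB a ha (fun e => hbx (congrArg (· + s) e)) hb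
      · have := hmC a (hm1 a ha) _ h3
        omega
    have e1 : chain (· + s) L m (ins (x + s) q' v₁) = insE (x + s) blk v₁ := by
      have hval : blk.val = (D.rel id (reEv hblk)).f blk.deg (chain (col := colS s) (· + s) L m
          (delta (B.image (· + s)) j q') blk.ar blk.deg) :=
        (leftPre_apply q hblk m blk.deg).trans (evS_apply hblk _ _)
      have h1 : insE (x + s) blk v₁ =
        ins (d := true) (B := Ar.const false blk.ar) (k := blk.deg) (x + s) blk.val v₁ := rfl
      rw [h1, hval, ins_cast]
      refine chain_ins (B.sort_nodup _) (injOn_add s _) m (fun b hb => hv₁ b ((hL b).1 hb))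
        (fun b _ => colS_true.2 (Nat.le_add_left _ _))
        (fun b hb n hn => colS_false.2 (hmC b (hBC b ((hL b).1 hb)) n hn)) q'
        (fun b hb => Finset.mem_image_of_mem (· + s) ((hL b).1 hb)) (fun n => ?_) ?_
      · change n ∈ B.biUnion (fun i => (m i).ar) ↔ _
        rw [Finset.mem_biUnion, Finset.mem_image]
        simp only [L, Finset.mem_sort]
        constructor
        · exact Or.inr
        · rintro (⟨⟨b, hb, rfl⟩, h⟩ | h)
          · exact (h b hb rfl).elim
          · exact h
      · rw [sum_sort]
        rfl
    have e2 : chain (· + s) l₁ m (ins (x + s) q' v) =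
        sg (j * (l₁.map fun i => ((m i).deg : ZMod 2)).sum) • ins (x + s) q' v₁ := by
      refine chain_comm (· + s) l₁ m q' (fun i hi e => ?_) (fun i hi e => ?_) (fun i hi e => ?_) v
      · exact (hA1 i hi).2 (Nat.add_right_cancel e)
      · have := hmC i (hm1 i hi) _ e
        omega
      · obtain ⟨b, hb, e⟩ := Finset.mem_image.1 e
        obtain rfl : b = i := Nat.add_right_cancel e
        exact hAB b (hA1 b hi).1 (hA1 b hi).2 hb
    have e3 : chain (· + s) (A.sort (· ≤ ·)) (Function.update m x blk) v =
        chain (· + s) l₂ m (insE (x + s) blk v₁) := by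
      rw [hs, chain_append, chain_cons, Function.update_self, chain_upd _ m hx1, chain_upd _ m hx2]
    have e4 : leftPre D G hG C n (D.comp (.const h) hn p q) m N r =
      evS D G hG s N r (chain (· + s) (C.sort (· ≤ ·)) m (ins (x + s) q' v)) := by
      rw [← start_comp h s hn p q]
      rfl
    rw [RightMod.compEnd_apply, e4, chain_perm hperm (C.sort_nodup _) (injOn_add s _) m,
      inv_sorted (Finset.sortedLT_sort C).pairwise, zero_add, chain_append, chain_append, e2,
      map_zsmul (chain (col := colS s) (· + s) L m), e1,
      map_zsmul (chain (col := colS s) (· + s) l₂ m), ← e3, map_zsmul, map_zsmul,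
      sg_smul]
    · refine congrArg₂ (fun a b => sg a • b) ?_ (leftPre_apply p lt_bd _ r).symm
      rw [inv_append, inv_append, inv_sorted hpw1, inv_sorted hpw2, inv_sorted hpwB]
      exact exp_comp hs (hpw1.imp fun h => ne_of_lt h) (hpw2.imp fun h => ne_of_lt h) hl₁ hl₂
        (fun b hb hb' => hAB b (hA2 b hb).1 (hA2 b hb).2 hb') _ _
    · intro a ha b hb hab
      have := hmC b ((Finset.mem_sort (· ≤ ·)).1 hb) _ hab
      omega
  · have h1 := leftPre_isEnd (G := G) (hG := hG) (D.comp (.const h) hn p q)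
    have h2 := RightMod.IsEnd.compEnd h hn (leftPre_isEnd (G := G) (hG := hG) p)
      (leftPre_isEnd (G := G) (hG := hG) q)
    rw [h1.eq_zero fun h => hP h.1, h2.eq_zero fun h => hP h.1]

end ColDGOperad

end

section

variable {K : Type u} [Field K]

namespace ColDGOperad
section bimod
variable (D : ColDGOperad.{u, w} K Bool) {P Q : DGOperad.{u, w} K}
  (F : P.toNUOperad ⟶ (D.mono true).toNUOperad)
  (G : Q.toNUOperad ⟶ (D.mono false).toNUOperad)
  (hF : ∀ x, (NUOperad.Hom.app F {x}).f 0 (P.one x) = (D.mono true).one x)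
  (hG : ∀ x, (NUOperad.Hom.app G {x}).f 0 (Q.one x) = (D.mono false).one x)

/-- The left action on `rmod` of the operad of the operations with all inputs, and the output, of
colour `true`. -/
noncomputable def lam : (D.mono true).toNUOperad ⟶ (D.rmod G hG).End where
  app J :=
    { f := fun i => ModuleCat.ofHom
        ((leftPre D G hG J i).codRestrict ((D.rmod G hG).endSub J i) fun p => leftPre_isEnd p)
      comm' := by
        intro i j h
        obtain rfl : i + 1 = j := h
        apply ModuleCat.hom_ext
        apply LinearMap.ext
        intro p
        exact (RightMod.endCx_d _ rfl _).trans (Subtype.ext (dEnd_left rfl p)) }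
  rel f hf := by
    ext i p
    exact Subtype.ext (relEnd_left hf p)
  comp h i j n hn p q := Subtype.ext (compEnd_left h hn p q)

theorem left_unit (x : ℕ) (m : ℕ → (D.rmod G hG).Elt) :
    leftPre D G hG {x} 0 ((D.mono true).one x) m (m x).ar (m x).deg = (m x).val := by
  set s := bd (m x).ar
  have h : ∀ n ∈ (m x).ar, n < s := lt_bd
  have e1 : leftPre D G hG {x} 0 ((D.mono true).one x) m (m x).ar (m x).deg = _ := evS_apply h _ _
  rw [e1]
  have hA : IsOne (⟨({x} : Finset ℕ).image (· + s), colS s⟩ : Ar Bool) (x + s) true :=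
    ⟨by simp, colS_true.2 (Nat.le_add_left _ _)⟩
  have hI : CIns (⟨({x} : Finset ℕ).image (· + s), colS s⟩ : Ar Bool) (x + s) true
      ⟨(m x).ar, colS s⟩ ⟨(m x).ar, colS s⟩ :=
    ⟨⟨by simp, by simp, by simp⟩, hA.col, by simp, fun _ _ => rfl⟩
  have hI' : CIns (⟨({x} : Finset ℕ).image (· + s), colS s⟩ : Ar Bool) (x + s) true
      (Ar.const false (m x).ar) ⟨(m x).ar, colS s⟩ :=
    ⟨⟨by simp, by simp [Ar.const], by simp [Ar.const]⟩, hA.col, by simp, fun n hn => colS_false.2 (h n hn)⟩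
  have e2 : chain (col := colS s) (· + s) (({x} : Finset ℕ).sort (· ≤ ·)) m
      (start s {x} 0 ((D.mono true).one x)) (m x).ar (m x).deg =
      D.comp hI' (zero_add _) (D.one hA) (m x).val := by
    rw [Finset.sort_singleton]
    refine (ins_apply (m x).val _ hI' (zero_add _)).trans ?_
    rw [show start s {x} 0 ((D.mono true).one x) (({x} : Finset ℕ).image (· + s)) 0 = _ from
      delta_self _ _ _]
    exact congrArg (fun t => D.comp hI' (zero_add _) t (m x).val)
      (D.rel_one (A := Ar.const true {x}) (x := x) ⟨rfl, rfl⟩ (· + s) hA (reShift s {x}))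
  refine (congrArg _ e2).trans ?_
  have hB : IsOne (⟨({x} : Finset ℕ).image (· + s), fun n => decide (n = x + s)⟩ : Ar Bool)
    (x + s) true := ⟨by simp, by simp⟩
  have hr : ReIn id (⟨({x} : Finset ℕ).image (· + s), colS s⟩ : Ar Bool)
      ⟨({x} : Finset ℕ).image (· + s), fun n => decide (n = x + s)⟩ :=
    ⟨Set.bijOn_id _, fun n hn => by
      obtain rfl : n = x + s := by simpa using hn
      exact hB.col.trans hA.col.symm⟩
  have hJ : CIns (⟨({x} : Finset ℕ).image (· + s), fun n => decide (n = x + s)⟩ : Ar Bool) (x + s)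
      true (Ar.const false (m x).ar) (Ar.const false (m x).ar) :=
    ⟨⟨by simp, by simp [Ar.const], by simp [Ar.const]⟩, hB.col, by simp, fun _ _ => rfl⟩
  have := D.rel_comp hI' id id id hJ hr (ReIn.const (bijid _)) (reEv h) (fun _ _ => rfl)
    (fun _ _ => rfl) (zero_add _) (D.one hA) (m x).val
  exact this.trans ((congrArg₂ (fun a b => D.comp hJ (zero_add _) a b) (D.rel_one hA id hB hr)
    (relid (D := D) _ _)).trans (D.one_comp hB hJ (zero_add _) _))

/-- The operations of a two-coloured dg operad with inputs of colour `false` and output of colour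
`true`, as a bimodule over operads `P` and `Q` which map to the operads of operations of colour
`true` and `false`, respectively. -/
noncomputable def bimod : Bimod P Q where
  toRightMod := D.rmod G hG
  left := F ≫ D.lam G hG
  left_one x m := by
    have := left_unit D G hG x m
    rw [← hF] at this
    exact this

end bimod
end ColDGOperad

namespace TopOperad

variable {Γ Δ : Type} {S : TopOperad.{v} Γ} {T : TopOperad.{v} Δ} {γ : Γ → Δ}

theorem isCube_const {Y : Type v} [TopologicalSpace Y] (y : Y) :
    IsCube 0 (ContinuousMap.const (ℕ → unitInterval) y) := ⟨le_rfl, fun _ _ _ => rfl⟩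

theorem Hom.chains_one (F : Hom γ S T) (c : Γ) (x : ℕ) :
    (NUOperad.Hom.app (F.chains K c) {x}).f 0 (((S.chains K).mono c).one x) =
      ((T.chains K).mono (γ c)).one x := by
  refine (mapCh_br _ (isCube_const _)).trans ?_
  refine congrArg (br K 0) ?_
  ext t
  exact F.one _

section torsor
variable (K)
variable {S T : TopOperad.{v} Unit} [IsLambda S] [IsLambda T] (f : Hom id S T)

/-- The dg operad of chains of the operations with at least one input. -/
noncomputable abbrev chainOperad (T : TopOperad.{v} Unit) : DGOperad.{u, max u v} K := (T.pos.chains K).mono ()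

/-- The map of dg operads of chains defined by `f`. -/
noncomputable abbrev chainMap : (chainOperad K S).toNUOperad ⟶ (chainOperad K T).toNUOperad := f.pos.chains K ()

/-- The chains on the operations of `ESC f` with inputs of colour `false` and output of colour
`true`, as a bimodule over the chains of `S` and `T`. -/
noncomputable def escBimod : Bimod (chainOperad K S) (chainOperad K T) :=
  ((ESC f).pos.chains K).bimod ((inclS f).pos.chains K ()) ((inclT f).pos.chains K ())
    ((inclS f).pos.chains_one ()) ((inclT f).pos.chains_one ())

/-- The operation of `ESC f` with a single input of colour `false` and with output of colour `true`
defined by the unit of `T`. -/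
noncomputable def escOne : (ESC f).pos.X true (Ar.const false {0}) :=
  ⟨⟨(⟨S.rel id (reIn (bij_id (on_false (ar {0})).symm)) S.pt, fun h => Bool.noConfusion h⟩,
      ⟨T.one ⟨rfl, rfl⟩, fun h => Bool.noConfusion h⟩,
      ContinuousMap.const _ ⟨T.rel id (reIn (bij_id (on_false (ar {0})).symm)) T.pt,
        fun h => Bool.noConfusion h⟩),
    Subtype.ext (T.eq_of_empty (on_false (ar {0})) _ _),
    Subtype.ext (T.eq_of_empty (on_false (ar {0})) _ _)⟩, ⟨0, Finset.mem_singleton_self 0⟩⟩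

/-- The class of this operation. -/
noncomputable def escUnit : (((escBimod K f).X {0}).X 0 : Type max u v) :=
  br K 0 (ContinuousMap.const _ (escOne f))

end torsor
end TopOperad

end

end OperadTorsor

/-!
The argument rests on the observation that, for a non-empty set `A` of inputs, the spaces
`(ESC f).X true (Ar.const false A)` are homeomorphic to the spaces of operations of `T`: the
remaining data are points, and paths, of spaces of operations without inputs, which consist of one
point. On chains, this is the isomorphism of right modules `escProj`, whose inverse is the map
`escIncl`, `q ↦ 1 ∘ q`. Hence the bimodule of chains is a torsor and a resolution of itself.

Let `N` be a resolution, with the cofibration `ι : Q ⟶ N`, and let `π₀ : N ⟶ Q` be the composition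
of the resolution with `escProj`. It is a retraction of `ι` and, moreover, it intertwines the left
action of the chains `P` of `S` on `N` with the left action `escSection : P ⟶ End Q` which is
obtained by transport of structure.

As `ι` is a cofibration and a quasi-isomorphism, it lifts against its path object, and any
retraction `π` of `ι` is part of a deformation retraction by means of a `Q`-linear homotopy `h` with
`h ι = 0` and `π h = 0` (`exists_contraction`). By application of `h` to the inputs or to the value
of an operation, cocycles of the endomorphism operad of `N` are seen to be cohomologous to their
compositions with `ι π`. Three quasi-isomorphisms of operads follow: the conjugation
`End Q ⟶ End N`, and two projections of the operads of the pairs of operations of `End Q` and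
`End N` which are intertwined by `ι` and by `π`, respectively. The first of these operads
(`Contraction.quasiIso_fst`) shows that, in the localization, the conjugation does not depend on the
retraction. The second one (`Contraction.quasiIso_snd`), for the retraction `π₀`, identifies the
left action on `N` with the composition of `escSection` and the conjugation (`Contraction.map_eq`).

It remains to compose `escSection` with the evaluation `ev : End Q ⟶ Q` at the units. The result is
the map of chains defined by `f` (`escSection_ev`): insertion of units in all inputs of an operation
only changes the labels of these inputs. For the identity of `T`, this provides a section of `ev`;
since `ev` is injective (`eq_zero_of_units`), it is a quasi-isomorphism.
-/

namespace OperadTorsor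

section

variable {K : Type u} [Field K]

/-! ### Cochain complexes -/

theorem comp_f_apply {X Y Z : Cx.{u, w} K} (F : X ⟶ Y) (G : Y ⟶ Z) (i : ℤ) (x : X.X i) :
    (F ≫ G).f i x = G.f i (F.f i x) := rfl

theorem hom_f_d {X Y : Cx.{u, w} K} (F : X ⟶ Y) (i j : ℤ) (x : X.X i) :
    F.f j (X.d i j x) = Y.d i j (F.f i x) :=
  (congrArg (fun t => (ModuleCat.Hom.hom t) x) (F.comm i j)).symm

theorem d_d_apply (X : Cx.{u, w} K) (i j k : ℤ) (x : X.X i) : X.d j k (X.d i j x) = 0 :=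
  congrArg (fun t => (ModuleCat.Hom.hom t) x) (X.d_comp_d i j k)

/-- An endomorphism of a complex which differs from the identity by boundaries on cocycles is the
identity on cohomology. -/
theorem homologyMap_eq_id {X : Cx.{u, w} K} (E : X ⟶ X)
    (h : ∀ (i j k : ℤ), i + 1 = j → j + 1 = k → ∀ x : X.X j, X.d j k x = 0 →
      ∃ y : X.X i, E.f j x = x + X.d i j y) (j : ℤ) :
    HomologicalComplex.homologyMap E j = 𝟙 _ := by
  rw [← cancel_epi (X.homologyπ j), HomologicalComplex.homologyπ_naturality, Category.comp_id]
  ext c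
  have hx : X.d j (j + 1) (X.iCycles j c) = 0 :=
    congrArg (fun t => (ModuleCat.Hom.hom t) c) (X.iCycles_d j (j + 1))
  obtain ⟨y, hy⟩ := h (j - 1) j (j + 1) (by omega) rfl (X.iCycles j c) hx
  have hinj : Function.Injective (X.iCycles j) :=
    (ModuleCat.mono_iff_injective _).1 inferInstance
  have e1 : HomologicalComplex.cyclesMap E j c = c + X.toCycles (j - 1) j y := by
    apply hinj
    rw [map_add]
    have e2 : X.iCycles j (HomologicalComplex.cyclesMap E j c) = E.f j (X.iCycles j c) :=
      congrArg (fun t => (ModuleCat.Hom.hom t) c) (HomologicalComplex.cyclesMap_i E j)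
    have e3 : X.iCycles j (X.toCycles (j - 1) j y) = X.d (j - 1) j y :=
      congrArg (fun t => (ModuleCat.Hom.hom t) y) (X.toCycles_i (j - 1) j)
    rw [e2, e3, hy]
  have e4 : X.homologyπ j (X.toCycles (j - 1) j y) = 0 :=
    congrArg (fun t => (ModuleCat.Hom.hom t) y) (X.toCycles_comp_homologyπ (j - 1) j)
  change X.homologyπ j (HomologicalComplex.cyclesMap E j c) = X.homologyπ j c
  rw [e1, map_add, e4, add_zero]

/-- A morphism `F` of complexes with a section `s` is a quasi-isomorphism, together with `s`, if the
kernel of `F` is acyclic. -/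
theorem quasiIso_of_section {X Y : Cx.{u, w} K} (F : X ⟶ Y) (s : Y ⟶ X) (hs : s ≫ F = 𝟙 Y)
    (h : ∀ (i j k : ℤ), i + 1 = j → j + 1 = k → ∀ x : X.X j, X.d j k x = 0 → F.f j x = 0 →
      ∃ y : X.X i, X.d i j y = x) : QuasiIso F ∧ QuasiIso s := by
  have hs' : ∀ i y, F.f i (s.f i y) = y := fun i y =>
    congrArg (fun t => (ModuleCat.Hom.hom (HomologicalComplex.Hom.f t i)) y) hs
  have h1 : ∀ j, HomologicalComplex.homologyMap F j ≫ HomologicalComplex.homologyMap s j = 𝟙 _ := by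
    intro j
    rw [← HomologicalComplex.homologyMap_comp]
    apply homologyMap_eq_id
    intro i j k hi hk x hx
    obtain ⟨y, hy⟩ := h i j k hi hk (s.f j (F.f j x) - x)
      (by rw [map_sub, ← hom_f_d, ← hom_f_d, hx, map_zero, map_zero, sub_zero])
      (by rw [map_sub, hs', sub_self])
    refine ⟨y, ?_⟩
    rw [hy, comp_f_apply]
    abel
  have h2 : ∀ j, HomologicalComplex.homologyMap s j ≫ HomologicalComplex.homologyMap F j = 𝟙 _ := by
    intro j
    rw [← HomologicalComplex.homologyMap_comp, hs, HomologicalComplex.homologyMap_id]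
  constructor
  · refine ⟨fun j => ?_⟩
    rw [quasiIsoAt_iff_isIso_homologyMap]
    exact ⟨_, h1 j, h2 j⟩
  · refine ⟨fun j => ?_⟩
    rw [quasiIsoAt_iff_isIso_homologyMap]
    exact ⟨_, h2 j, h1 j⟩

/-! ### Path objects of right modules -/

/-- Transport of the elements of a complex along an equality of degrees. -/
def tr (X : Cx.{u, w} K) {i j : ℤ} (h : i = j) : X.X i →ₗ[K] X.X j :=
  (eqToHom (congrArg X.X h)).hom

theorem tr_rfl (X : Cx.{u, w} K) {i : ℤ} (x : X.X i) : tr X rfl x = x := rfl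

theorem tr_tr (X : Cx.{u, w} K) {i j k : ℤ} (h : i = j) (h' : j = k) (x : X.X i) :
    tr X h' (tr X h x) = tr X (h.trans h') x := by
  subst h h'; rfl

theorem d_tr (X : Cx.{u, w} K) {i j k : ℤ} (h : i = j) (x : X.X i) :
    X.d j k (tr X h x) = X.d i k x := by
  subst h; rfl

theorem tr_d (X : Cx.{u, w} K) {i j k : ℤ} (h : j = k) (x : X.X i) :
    tr X h (X.d i j x) = X.d i k x := by
  subst h; rfl

theorem hom_f_tr {X Y : Cx.{u, w} K} (F : X ⟶ Y) {i j : ℤ} (h : i = j) (x : X.X i) :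
    F.f j (tr X h x) = tr Y h (F.f i x) := by
  subst h; rfl

namespace RightMod

variable {Q : DGOperad.{u, w} K}

theorem act_tr (N : RightMod Q) {A : Finset ℕ} {x : ℕ} {B C : Finset ℕ} (h : Ins A x B C)
    {i i' j n n' : ℤ} (hi : i = i') (hn : i' + j = n') (hn' : i + j = n) (e : n = n')
    (a : (N.X A).X i) (b : (Q.X B).X j) :
    N.act h hn (tr _ hi a) b = tr _ e (N.act h hn' a b) := by
  subst hi e; rfl

variable {A N : RightMod Q} (F : A ⟶ N)

/-- The complex of triples `(q, n, b)`, where `b` is a path from `F q` to `n`. -/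
def pathCx (B : Finset ℕ) : Cx.{u, w} K where
  X i := ModuleCat.of K ((A.X B).X i × (N.X B).X i × (N.X B).X (i - 1))
  d i j := if h : i + 1 = j then ModuleCat.ofHom
      (((((A.X B).d i j).hom ∘ₗ LinearMap.fst K _ _).prod
        ((((N.X B).d i j).hom ∘ₗ LinearMap.fst K _ _ ∘ₗ LinearMap.snd K _ _).prod
        ((tr (N.X B) (show i = j - 1 by omega)) ∘ₗ
          (LinearMap.fst K _ _ ∘ₗ LinearMap.snd K _ _ -
            ((Hom.app F B).f i).hom ∘ₗ LinearMap.fst K _ _) -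
          ((N.X B).d (i - 1) (j - 1)).hom ∘ₗ LinearMap.snd K _ _ ∘ₗ LinearMap.snd K _ _))))
    else 0
  shape i j h := dif_neg h
  d_comp_d' i j k h h' := by
    obtain rfl : i + 1 = j := h
    obtain rfl : i + 1 + 1 = k := h'
    rw [dif_pos rfl, dif_pos rfl]
    apply ModuleCat.hom_ext
    apply LinearMap.ext
    rintro ⟨q, n, b⟩
    refine Prod.ext (d_d_apply (A.X B) _ _ _ q) (Prod.ext (d_d_apply (N.X B) _ _ _ n) ?_)
    change tr (N.X B) _ ((N.X B).d i (i + 1) n - (Hom.app F B).f (i + 1) ((A.X B).d i (i + 1) q)) -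
      (N.X B).d (i + 1 - 1) (i + 1 + 1 - 1) (tr (N.X B) _ (n - (Hom.app F B).f i q) -
        (N.X B).d (i - 1) (i + 1 - 1) b) = 0
    rw [map_sub ((N.X B).d _ _).hom, d_d_apply, sub_zero, d_tr, hom_f_d, ← map_sub, tr_d, sub_self]

theorem pathCx_d (B : Finset ℕ) {i j : ℤ} (h : i + 1 = j) (q : (A.X B).X i) (n : (N.X B).X i)
    (b : (N.X B).X (i - 1)) :
    (pathCx F B).d i j (q, n, b) = ((A.X B).d i j q, (N.X B).d i j n,
      tr (N.X B) (show i = j - 1 by omega) (n - (Hom.app F B).f i q) -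
        (N.X B).d (i - 1) (j - 1) b) := by
  simp only [pathCx, dif_pos h]
  rfl

variable (A N) in
/-- The componentwise action on triples. -/
def pathAct {B : Finset ℕ} {x : ℕ} {C D : Finset ℕ} (h : Ins B x C D) {i j n : ℤ}
    (hn : i + j = n) : ((A.X B).X i × (N.X B).X i × (N.X B).X (i - 1)) →ₗ[K] (Q.X C).X j →ₗ[K]
      ((A.X D).X n × (N.X D).X n × (N.X D).X (n - 1)) :=
  LinearMap.mk₂ K (fun a b => (A.act h hn a.1 b, N.act h hn a.2.1 b,
    N.act h (show i - 1 + j = n - 1 by omega) a.2.2 b))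
    (fun _ _ _ => by simp) (fun _ _ _ => by simp) (fun _ _ _ => by simp) (fun _ _ _ => by simp)

/-- The path object of a morphism `F` of right modules. -/
def pathMod : RightMod Q where
  X B := pathCx F B
  rel {B C} f hf :=
    { f := fun i => ModuleCat.ofHom (LinearMap.prodMap ((A.rel f hf).f i).hom
        (LinearMap.prodMap ((N.rel f hf).f i).hom ((N.rel f hf).f (i - 1)).hom))
      comm' := by
        intro i j h
        obtain rfl : i + 1 = j := h
        apply ModuleCat.hom_ext
        apply LinearMap.ext
        rintro ⟨q, n, b⟩
        refine (pathCx_d F C rfl _ _ _).trans ((congrArg (LinearMap.prodMap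
          ((A.rel f hf).f (i + 1)).hom (LinearMap.prodMap ((N.rel f hf).f (i + 1)).hom
            ((N.rel f hf).f (i + 1 - 1)).hom)) (pathCx_d F B rfl q n b)).trans ?_).symm
        refine Prod.ext (rel_d f hf _ _ q) (Prod.ext (rel_d f hf _ _ n) ?_)
        refine (map_sub ((N.rel f hf).f (i + 1 - 1)).hom _ _).trans ?_
        refine congrArg₂ (· - ·) ?_ (rel_d f hf _ _ b)
        refine (hom_f_tr (N.rel f hf) _ _).trans (congrArg _ ?_)
        refine (map_sub ((N.rel f hf).f i).hom _ _).trans ?_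
        exact congrArg _ (Hom.app_rel F f hf i q).symm }
  act h _ _ _ hn := pathAct A N h hn
  rel_congr f g hf hg h := by
    ext i a
    refine Prod.ext ?_ (Prod.ext ?_ ?_)
    · exact congrArg (fun t => (ModuleCat.Hom.hom (HomologicalComplex.Hom.f t i)) a.1)
        (A.rel_congr f g hf hg h)
    · exact congrArg (fun t => (ModuleCat.Hom.hom (HomologicalComplex.Hom.f t i)) a.2.1)
        (N.rel_congr f g hf hg h)
    · exact congrArg (fun t => (ModuleCat.Hom.hom (HomologicalComplex.Hom.f t (i - 1))) a.2.2)
        (N.rel_congr f g hf hg h)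
  rel_id h := by
    ext i a
    refine Prod.ext ?_ (Prod.ext ?_ ?_)
    · exact congrArg (fun t => (ModuleCat.Hom.hom (HomologicalComplex.Hom.f t i)) a.1)
        (A.rel_id h)
    · exact congrArg (fun t => (ModuleCat.Hom.hom (HomologicalComplex.Hom.f t i)) a.2.1)
        (N.rel_id h)
    · exact congrArg (fun t => (ModuleCat.Hom.hom (HomologicalComplex.Hom.f t (i - 1))) a.2.2)
        (N.rel_id h)
  rel_trans f g hf hg h := by
    ext i a
    refine Prod.ext ?_ (Prod.ext ?_ ?_)
    · exact congrArg (fun t => (ModuleCat.Hom.hom (HomologicalComplex.Hom.f t i)) a.1)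
        (A.rel_trans f g hf hg h)
    · exact congrArg (fun t => (ModuleCat.Hom.hom (HomologicalComplex.Hom.f t i)) a.2.1)
        (N.rel_trans f g hf hg h)
    · exact congrArg (fun t => (ModuleCat.Hom.hom (HomologicalComplex.Hom.f t (i - 1))) a.2.2)
        (N.rel_trans f g hf hg h)
  d_act {B x C D} h i j n i' j' n' hn hi hj hn' a q := by
    obtain ⟨a, m, b⟩ := a
    refine (pathCx_d F D hn' _ _ _).trans ?_
    rw [pathCx_d F B hi a m b]
    refine Prod.ext (A.d_act h hn hi hj hn' a q) (Prod.ext (N.d_act h hn hi hj hn' m q) ?_)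
    change tr (N.X D) _ (N.act h hn m q - (Hom.app F D).f n (A.act h hn a q)) -
      (N.X D).d (n - 1) (n' - 1) (N.act h _ b q) =
      N.act h _ (tr (N.X B) _ (m - (Hom.app F B).f i a) - (N.X B).d (i - 1) (i' - 1) b) q +
      sg i • N.act h _ b ((Q.X C).d j j' q)
    rw [Hom.act F, N.d_act h (show i - 1 + j = n - 1 by omega) (show i - 1 + 1 = i' - 1 by omega) hj
        (by omega), map_sub (N.act h _), LinearMap.sub_apply,
      act_tr N h (show i = i' - 1 by omega) _ hn (show n = n' - 1 by omega), map_sub (N.act h hn),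
      LinearMap.sub_apply]
    have e : ((i : ℤ) : ZMod 2) = ((i - 1 : ℤ) : ZMod 2) + 1 := by push_cast; ring
    rw [e, sg_add_one]
    abel
  rel_act h f g k h' hf hg hk h1 h2 i j n hn a b := Prod.ext
    (A.rel_act h f g k h' hf hg hk h1 h2 hn a.1 b)
    (Prod.ext (N.rel_act h f g k h' hf hg hk h1 h2 hn a.2.1 b)
      (N.rel_act h f g k h' hf hg hk h1 h2 _ a.2.2 b))
  assoc_seq h₁ h₂ h₃ h₄ i j l m n p hm hn hp hq a b c := Prod.ext
    (A.assoc_seq h₁ h₂ h₃ h₄ hm hn hp hq a.1 b c)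
    (Prod.ext (N.assoc_seq h₁ h₂ h₃ h₄ hm hn hp hq a.2.1 b c)
      (N.assoc_seq h₁ h₂ h₃ h₄ _ _ hp _ a.2.2 b c))
  assoc_par hxy h₁ h₂ h₃ h₄ i j l m n p hm hn hp hq a b c := Prod.ext
    (A.assoc_par hxy h₁ h₂ h₃ h₄ hm hn hp hq a.1 b c)
    (Prod.ext (N.assoc_par hxy h₁ h₂ h₃ h₄ hm hn hp hq a.2.1 b c)
      (N.assoc_par hxy h₁ h₂ h₃ h₄ _ _ _ _ a.2.2 b c))
  act_one h n hn a := Prod.ext (A.act_one h hn a.1)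
    (Prod.ext (N.act_one h hn a.2.1) (N.act_one h _ a.2.2))

/-- The morphism which sends `q` to the constant path at `F q`. -/
def pathIn : A ⟶ pathMod F where
  app B :=
    { f := fun i => ModuleCat.ofHom (LinearMap.prod LinearMap.id
        (LinearMap.prod ((Hom.app F B).f i).hom 0))
      comm' := by
        intro i j h
        obtain rfl : i + 1 = j := h
        apply ModuleCat.hom_ext
        apply LinearMap.ext
        intro q
        refine (pathCx_d F B rfl _ _ _).trans ?_
        refine Prod.ext rfl (Prod.ext (Hom.app_d F _ _ q).symm ?_)
        refine (congrArg (fun t => t - (N.X B).d (i - 1) (i + 1 - 1) 0) ((congrArg (tr (N.X B) _)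
          (sub_self ((Hom.app F B).f i q))).trans (map_zero _))).trans ?_
        rw [map_zero, sub_zero]
        rfl }
  rel {B C} f hf := by
    ext i q
    refine Prod.ext rfl (Prod.ext (Hom.app_rel F f hf i q) ?_)
    exact (map_zero ((N.rel f hf).f (i - 1)).hom).symm
  act {B x C D} h i j n hn a b := by
    refine Prod.ext rfl (Prod.ext (Hom.act F h hn a b) ?_)
    change 0 = N.act h (show i - 1 + j = n - 1 by omega) 0 b
    rw [map_zero, LinearMap.zero_apply]

/-- The starting point of a path. -/
def pathFst (B : Finset ℕ) : (pathMod F).X B ⟶ A.X B where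
  f i := ModuleCat.ofHom (LinearMap.fst K _ _)
  comm' := by
    intro i j h
    obtain rfl : i + 1 = j := h
    apply ModuleCat.hom_ext
    apply LinearMap.ext
    rintro ⟨q, n, b⟩
    exact (congrArg Prod.fst (pathCx_d F B rfl q n b)).symm

/-- The end point of a path. -/
def pathOut : pathMod F ⟶ N where
  app B :=
    { f := fun i => ModuleCat.ofHom (LinearMap.fst K _ _ ∘ₗ LinearMap.snd K _ _)
      comm' := by
        intro i j h
        obtain rfl : i + 1 = j := h
        apply ModuleCat.hom_ext
        apply LinearMap.ext
        rintro ⟨q, n, b⟩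
        exact (congrArg (fun t => t.2.1) (pathCx_d F B rfl q n b)).symm }
  rel _ _ := rfl
  act _ _ _ _ _ _ _ := rfl

theorem pathIn_pathOut : pathIn F ≫ pathOut F = F := rfl

theorem pathIn_quasiIso (B : Finset ℕ) : QuasiIso (Hom.app (pathIn F) B) := by
  refine (quasiIso_of_section (pathFst F B) (Hom.app (pathIn F) B) rfl ?_).2
  rintro i j k rfl rfl ⟨q, n, b⟩ hx hq
  obtain rfl : q = 0 := hq
  have h1 := (pathCx_d F B rfl 0 n b).symm.trans hx
  have h2 := congrArg (fun t => t.2.2) h1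
  refine ⟨(0, tr (N.X B) (by omega) b, 0), ?_⟩
  refine (pathCx_d F B rfl _ _ _).trans ?_
  have h3 : tr (N.X B) (show i + 1 = i + 1 + 1 - 1 by omega) n =
      (N.X B).d (i + 1 - 1) (i + 1 + 1 - 1) b := by
    rw [map_zero ((Hom.app F B).f (i + 1)).hom, sub_zero] at h2
    exact sub_eq_zero.1 h2
  refine Prod.ext (map_zero _) (Prod.ext ?_ ?_)
  · change (N.X B).d i (i + 1) (tr (N.X B) _ b) = n
    rw [d_tr]
    have h4 := congrArg (tr (N.X B) (show i + 1 + 1 - 1 = i + 1 by omega)) h3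
    rw [tr_d, tr_tr] at h4
    exact h4.symm
  · change tr (N.X B) _ (tr (N.X B) _ b - (Hom.app F B).f i 0) - (N.X B).d (i - 1) (i + 1 - 1) 0 = b
    rw [map_zero ((Hom.app F B).f i).hom, sub_zero, map_zero ((N.X B).d _ _).hom, sub_zero, tr_tr]
    rfl

theorem pathOut_quasiIso (hF : IsQuasiIso F) : IsQuasiIso (pathOut F) := by
  intro B
  have h1 := pathIn_quasiIso F B
  have h2 : QuasiIso (Hom.app (pathIn F) B ≫ Hom.app (pathOut F) B) := hF B
  exact quasiIso_of_comp_left (Hom.app (pathIn F) B) (Hom.app (pathOut F) B)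

end RightMod

/-! ### Deformation retractions of right modules -/

namespace RightMod

variable {Q : DGOperad.{u, w} K}

/-- A contracting homotopy `h` for a retraction `π` of a morphism `ι` of right modules: `h` is
linear over the operad, `1 - ι π = d h + h d`, and `h` satisfies the side conditions `h ι = 0` and
`π h = 0`. -/
structure Contraction {A N : RightMod Q} (ι : A ⟶ N) (π : N ⟶ A) where
  h : ∀ (B : Finset ℕ) (i j : ℤ), j + 1 = i → ((N.X B).X i →ₗ[K] (N.X B).X j)
  rel : ∀ {B C : Finset ℕ} (f : ℕ → ℕ) (hf : Set.BijOn f B C) {i j : ℤ} (hj : j + 1 = i)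
    (a : (N.X B).X i), (N.rel f hf).f j (h B i j hj a) = h C i j hj ((N.rel f hf).f i a)
  act : ∀ {B : Finset ℕ} {x : ℕ} {C D : Finset ℕ} (hi : Ins B x C D) {i l n i' n' : ℤ}
    (hn : i + l = n) (hn' : i' + l = n') (h1 : i' + 1 = i) (h2 : n' + 1 = n) (a : (N.X B).X i)
    (b : (Q.X C).X l), h D n n' h2 (N.act hi hn a b) = N.act hi hn' (h B i i' h1 a) b
  dh : ∀ (B : Finset ℕ) {i j k : ℤ} (hj : j + 1 = i) (hk : i + 1 = k) (a : (N.X B).X i),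
    (N.X B).d j i (h B i j hj a) + h B k i hk ((N.X B).d i k a) =
      a - (Hom.app ι B).f i ((Hom.app π B).f i a)
  h_ι : ∀ (B : Finset ℕ) {i j : ℤ} (hj : j + 1 = i) (a : (A.X B).X i),
    h B i j hj ((Hom.app ι B).f i a) = 0
  π_h : ∀ (B : Finset ℕ) {i j : ℤ} (hj : j + 1 = i) (a : (N.X B).X i),
    (Hom.app π B).f j (h B i j hj a) = 0

section contraction

variable {A N : RightMod Q} (ι : A ⟶ N) (π : N ⟶ A)

/-- The projection `1 - ι π`. -/
def coproj (B : Finset ℕ) (i : ℤ) : (N.X B).X i →ₗ[K] (N.X B).X i :=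
  LinearMap.id - ((Hom.app ι B).f i).hom ∘ₗ ((Hom.app π B).f i).hom

theorem coproj_apply (B : Finset ℕ) (i : ℤ) (a : (N.X B).X i) :
    coproj ι π B i a = a - (Hom.app ι B).f i ((Hom.app π B).f i a) := rfl

theorem coproj_d (B : Finset ℕ) (i j : ℤ) (a : (N.X B).X i) :
    coproj ι π B j ((N.X B).d i j a) = (N.X B).d i j (coproj ι π B i a) := by
  rw [coproj_apply, coproj_apply, Hom.app_d, Hom.app_d, map_sub]

theorem coproj_rel {B C : Finset ℕ} (f : ℕ → ℕ) (hf : Set.BijOn f (B : Set ℕ) C) (i : ℤ)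
    (a : (N.X B).X i) :
    coproj ι π C i ((N.rel f hf).f i a) = (N.rel f hf).f i (coproj ι π B i a) := by
  rw [coproj_apply, coproj_apply, Hom.app_rel, Hom.app_rel, map_sub]

theorem coproj_act {B : Finset ℕ} {x : ℕ} {C D : Finset ℕ} (h : Ins B x C D) {i l n : ℤ}
    (hn : i + l = n) (a : (N.X B).X i) (b : (Q.X C).X l) :
    coproj ι π D n (N.act h hn a b) = N.act h hn (coproj ι π B i a) b := by
  rw [coproj_apply, coproj_apply, Hom.act π, Hom.act ι, map_sub, LinearMap.sub_apply]

variable {ι π}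

theorem coproj_ι (hπ : ι ≫ π = 𝟙 A) (B : Finset ℕ) (i : ℤ) (a : (A.X B).X i) :
    coproj ι π B i ((Hom.app ι B).f i a) = 0 := by
  rw [coproj_apply, map_map_id ι π hπ, sub_self]

theorem π_coproj (hπ : ι ≫ π = 𝟙 A) (B : Finset ℕ) (i : ℤ) (a : (N.X B).X i) :
    (Hom.app π B).f i (coproj ι π B i a) = 0 := by
  rw [coproj_apply, map_sub, map_map_id ι π hπ, sub_self]

theorem coproj_coproj (hπ : ι ≫ π = 𝟙 A) (B : Finset ℕ) (i : ℤ) (a : (N.X B).X i) :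
    coproj ι π B i (coproj ι π B i a) = coproj ι π B i a := by
  rw [coproj_apply, π_coproj hπ, map_zero, sub_zero]

/-- A cofibration `ι` which is a quasi-isomorphism lifts against its path object: this yields the
components `p` and `s` of a map `a ↦ (p a, a, s a)`, where `s` is a homotopy from `ι p` to the
identity. -/
theorem exists_homotopy (hι : IsCofibration ι) (hq : IsQuasiIso ι) :
    ∃ (p : ∀ B i, (N.X B).X i →ₗ[K] (A.X B).X i) (s : ∀ B i, (N.X B).X i →ₗ[K] (N.X B).X (i - 1)),
      (∀ {B C : Finset ℕ} (f : ℕ → ℕ) (hf : Set.BijOn f B C) (i : ℤ) (a : (N.X B).X i),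
        s C i ((N.rel f hf).f i a) = (N.rel f hf).f (i - 1) (s B i a)) ∧
      (∀ {B : Finset ℕ} {x : ℕ} {C D : Finset ℕ} (h : Ins B x C D) {i l n : ℤ}
        (hn : i + l = n) (a : (N.X B).X i) (b : (Q.X C).X l), s D n (N.act h hn a b) =
          N.act h (show i - 1 + l = n - 1 by omega) (s B i a) b) ∧
      ∀ B (i j k : ℤ) (hj : j + 1 = i) (hk : i + 1 = k) (a : (N.X B).X i),
        (N.X B).d j i (tr (N.X B) (show i - 1 = j by omega) (s B i a)) +
          tr (N.X B) (show k - 1 = i by omega) (s B k ((N.X B).d i k a)) =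
        a - (Hom.app ι B).f i (p B i a) := by
  have hlp := hι _ _ (pathOut ι) (pathOut_quasiIso ι hq)
    (fun B i n => ⟨((0 : (A.X B).X i), n, (0 : (N.X B).X (i - 1))), rfl⟩)
  have sq : CommSq (pathIn ι) ι (pathOut ι) (𝟙 N) := ⟨pathIn_pathOut ι⟩
  obtain ⟨⟨r, -, hr⟩⟩ := (hlp.sq_hasLift sq).exists_lift
  -- the endpoint of the path `r a` is `a`
  have hr2 : ∀ B i (a : (N.X B).X i), ((Hom.app r B).f i a).2.1 = a := fun B i a =>
    congrArg (fun t => (ModuleCat.Hom.hom (HomologicalComplex.Hom.f (Hom.app t B) i)) a) hr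
  refine ⟨fun B i => LinearMap.fst K _ _ ∘ₗ ((Hom.app r B).f i).hom,
    fun B i => LinearMap.snd K _ _ ∘ₗ LinearMap.snd K _ _ ∘ₗ ((Hom.app r B).f i).hom, ?_, ?_, ?_⟩
  · intro B C f hf i a
    exact congrArg (fun t => t.2.2) (Hom.app_rel r f hf i a)
  · intro B x C D h i l n hn a b
    exact congrArg (fun t => t.2.2) (Hom.act r h hn a b)
  · rintro B i j k hj rfl a
    have h1 := (Hom.app_d r i (i + 1) a).trans (pathCx_d ι B rfl _ _ _)
    have h2 : ((Hom.app r B).f (i + 1) ((N.X B).d i (i + 1) a)).2.2 =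
        tr (N.X B) (show i = i + 1 - 1 by omega) (a - (Hom.app ι B).f i ((Hom.app r B).f i a).1) -
          (N.X B).d (i - 1) (i + 1 - 1) ((Hom.app r B).f i a).2.2 :=
      (congrArg (fun t => t.2.2) h1).trans (congrArg (fun n => tr (N.X B)
        (show i = i + 1 - 1 by omega) (n - (Hom.app ι B).f i ((Hom.app r B).f i a).1) -
          (N.X B).d (i - 1) (i + 1 - 1) ((Hom.app r B).f i a).2.2) (hr2 B i a))
    refine (congrArg (fun t => (N.X B).d j i (tr (N.X B) (show i - 1 = j by omega)
      ((Hom.app r B).f i a).2.2) + tr (N.X B) (show i + 1 - 1 = i by omega) t) h2).trans ?_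
    rw [map_sub (tr _ _), tr_tr, d_tr, tr_d, tr_rfl]
    exact add_sub_cancel _ _

/-- A cofibration which is a quasi-isomorphism and which has a retraction is a deformation retract:
the projection `1 - ι π` on both sides adapts the homotopy to the given retraction. -/
theorem exists_contraction (hι : IsCofibration ι) (hq : IsQuasiIso ι) (hπ : ι ≫ π = 𝟙 A) :
    Nonempty (Contraction ι π) := by
  obtain ⟨p, s, hs1, hs2, hd⟩ := exists_homotopy hι hq
  refine ⟨{
    h := fun B i j hj => coproj ι π B j ∘ₗ tr (N.X B) (show i - 1 = j by omega) ∘ₗ s B i ∘ₗ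
      coproj ι π B i
    rel := ?_
    act := ?_
    dh := ?_
    h_ι := ?_
    π_h := ?_ }⟩
  · intro B C f hf i j hj a
    simp only [LinearMap.comp_apply]
    rw [coproj_rel, hs1, ← hom_f_tr, coproj_rel]
  · intro B x C D hi i l n i' n' hn hn' h1 h2 a b
    simp only [LinearMap.comp_apply]
    rw [coproj_act, hs2, ← coproj_act,
      act_tr N hi _ hn' (show i - 1 + l = n - 1 by omega) (by omega)]
  · intro B i j k hj hk a
    simp only [LinearMap.comp_apply]
    -- for the projection `ε = 1 - ι π`, which satisfies `ε ι = 0`: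
    -- `d (ε s ε) + (ε s ε) d = ε (d s + s d) ε = ε (1 - ι p) ε = ε`
    rw [← coproj_d, coproj_d ι π B i k, ← map_add, hd B i j k hj hk, map_sub, coproj_ι hπ, sub_zero,
      coproj_coproj hπ]
    rfl
  · intro B i j hj a
    simp only [LinearMap.comp_apply]
    rw [coproj_ι hπ, map_zero, map_zero, map_zero]
  · intro B i j hj a
    exact π_coproj hπ _ _ _

end contraction

end RightMod

/-! ### Linear endomorphisms as operations of arity one -/

theorem ins_right {J : Finset ℕ} {x : ℕ} (hx : x ∈ J) : Ins J x {x} J :=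
  ⟨hx, by simp, by
    ext n
    by_cases h : n = x
    · simp [h, hx]
    · simp [h]⟩

namespace RightMod

variable {Q : DGOperad.{u, w} K}

section unary

variable (M : RightMod Q)

/-- A homogeneous linear endomorphism of degree `k` of a right module. The components which do
not agree with the degree vanish. -/
structure GMap (k : ℤ) where
  f : ∀ (A : Finset ℕ) (i j : ℤ), (M.X A).X i →ₗ[K] (M.X A).X j
  supp : ∀ (A : Finset ℕ) (i j : ℤ), i + k ≠ j → f A i j = 0
  rel : ∀ {A B : Finset ℕ} (g : ℕ → ℕ) (hg : Set.BijOn g A B) (i j : ℤ) (a : (M.X A).X i),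
    (M.rel g hg).f j (f A i j a) = f B i j ((M.rel g hg).f i a)
  act : ∀ {A : Finset ℕ} {x : ℕ} {B C : Finset ℕ} (h : Ins A x B C) {i l n i' n' : ℤ}
    (hn : i + l = n) (hn' : i' + l = n') (a : (M.X A).X i) (b : (Q.X B).X l),
    f C n n' (M.act h hn a b) = M.act h hn' (f A i i' a) b

variable {M}

/-- A morphism as a homogeneous map of degree zero. -/
def GMap.ofHom (F : M ⟶ M) : GMap M 0 where
  f A i j := if h : i = j then tr (M.X A) h ∘ₗ ((Hom.app F A).f i).hom else 0
  supp A i j h := dif_neg (by omega)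
  rel g hg i j a := by
    split_ifs with h
    · subst h
      exact (Hom.app_rel F g hg i a).symm
    · exact map_zero _
  act {A x B C} h i l n i' n' hn hn' a b := by
    by_cases e : i = i'
    · obtain rfl : n = n' := by omega
      subst e
      rw [dif_pos rfl, dif_pos rfl]
      exact Hom.act F h hn a b
    · rw [dif_neg (by omega), dif_neg e]
      simp

theorem GMap.ofHom_apply (F : M ⟶ M) (A : Finset ℕ) (i : ℤ) (a : (M.X A).X i) :
    (GMap.ofHom F).f A i i a = (Hom.app F A).f i a := by
  simp only [GMap.ofHom, dif_pos]
  rfl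

/-- A contracting homotopy as a homogeneous map of degree `-1`. -/
def Contraction.gmap {A N : RightMod Q} {ι : A ⟶ N} {π : N ⟶ A} (c : Contraction ι π) :
    GMap N (-1) where
  f B i j := if h : j + 1 = i then c.h B i j h else 0
  supp B i j h := dif_neg (by omega)
  rel g hg i j a := by
    split_ifs with h
    · exact c.rel g hg h a
    · exact map_zero _
  act {B x C D} h i l n i' n' hn hn' a b := by
    by_cases e : i' + 1 = i
    · rw [dif_pos e, dif_pos (show n' + 1 = n by omega)]
      exact c.act h hn hn' e _ a b
    · rw [dif_neg (by omega), dif_neg e]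
      simp

theorem Contraction.gmap_apply {A N : RightMod Q} {ι : A ⟶ N} {π : N ⟶ A} (c : Contraction ι π)
    (B : Finset ℕ) {i j : ℤ} (h : j + 1 = i) (a : (N.X B).X i) :
    c.gmap.f B i j a = c.h B i j h a := by
  simp only [Contraction.gmap, dif_pos h]

theorem part_singleton {x : ℕ} {m : ℕ → M.Elt} {N : Finset ℕ} :
    Part (fun j : ({x} : Finset ℕ) => (m j).ar) N ↔ (m x).ar = N := by
  rw [part_iff (A := fun j => (m j).ar)]
  constructor
  · rintro ⟨-, h⟩
    ext n
    simp [h]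
  · rintro rfl
    simp

namespace GMap

variable {k : ℤ} (g : GMap M k)

/-- The value of a homogeneous map, in arity `B` and degree `r`. -/
def val (e : M.Elt) (B : Finset ℕ) (r : ℤ) : (M.X B).X r :=
  if h : e.ar = B then (M.rel id (TopOperad.bij_id h)).f r (g.f e.ar e.deg r e.val) else 0

/-- A homogeneous map, as an operation with the single input `x` of the endomorphism operad. -/
def pre (x : ℕ) : M.PreEnd := fun m => g.val (m x)

theorem pre_apply {x : ℕ} {m : ℕ → M.Elt} {B : Finset ℕ} {i : ℤ} {a : (M.X B).X i}
    (h : m x = ⟨B, i, a⟩) (r : ℤ) : g.pre x m B r = g.f B i r a := by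
  unfold pre val
  rw [h, dif_pos rfl, M.rel_id]
  rfl

theorem pre_ar {x : ℕ} {m : ℕ → M.Elt} {B : Finset ℕ} (h : (m x).ar ≠ B) (r : ℤ) :
    g.pre x m B r = 0 := dif_neg h

theorem pre_isEnd (x : ℕ) : IsEnd {x} k (g.pre x) := by
  constructor
  · intro m N r h
    have h1 : (m x).ar = N := by
      by_contra h'
      exact h (g.pre_ar h' r)
    subst h1
    refine ⟨part_singleton.2 rfl, ?_⟩
    by_contra h'
    rw [g.pre_apply (a := (m x).val) rfl,
      g.supp _ _ _ (by rw [Finset.sum_singleton] at h'; omega)] at h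
    exact h rfl
  · intro m m' h
    exact congrArg g.val (h x (Finset.mem_singleton_self x))
  · intro m j hj A i N r
    obtain rfl := Finset.mem_singleton.1 hj
    by_cases e : A = N
    · subst e
      have : (fun u : (M.X A).X i => g.pre j (Function.update m j ⟨A, i, u⟩) A r) = g.f A i r := by
        funext u
        exact g.pre_apply (Function.update_self _ _ _) r
      rw [this]
      exact LinearMap.isLinear _
    · have : (fun u : (M.X A).X i => g.pre j (Function.update m j ⟨A, i, u⟩) N r) =
          (0 : (M.X A).X i →ₗ[K] (M.X N).X r) := by
        funext u
        exact g.pre_ar (by rw [Function.update_self]; exact e) r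
      rw [this]
      exact LinearMap.isLinear _
  · intro m m' N N' f hf hP h r
    obtain rfl := part_singleton.1 hP
    obtain ⟨B, hB, e⟩ := h x (Finset.mem_singleton_self x)
    have hBN : B = N' := by
      apply Finset.coe_injective
      rw [← hB.image_eq, ← hf.image_eq]
    subst hBN
    rw [g.pre_apply (i := (m x).deg) (a := (M.rel f hB).f _ (m x).val) e r,
      g.pre_apply (m := m) (a := (m x).val) rfl, g.rel]
  · intro m j hj e y B C N N' h h' hP l n r r' hn hr q
    obtain rfl := Finset.mem_singleton.1 hj
    have hN : e.ar = N := by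
      have := part_singleton.1 hP
      rwa [Function.update_self] at this
    subst hN
    obtain rfl : C = N' := h.eq.trans h'.eq.symm
    rw [Finset.sum_singleton, lo_self, zero_mul, mul_zero, sg_zero, one_smul,
      g.pre_apply (m := Function.update m j e) (a := e.val) (Function.update_self _ _ _)]
    refine (g.pre_apply (i := n) (a := M.act h hn e.val q) (Function.update_self _ _ _) r').trans ?_
    exact g.act h hn hr e.val q

theorem block_pre (x : ℕ) (m : ℕ → M.Elt) : block {x} k (g.pre x) m =
    ⟨(m x).ar, k + (m x).deg, g.f _ _ _ (m x).val⟩ := by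
  have e1 : (({x} : Finset ℕ).biUnion fun i => (m i).ar) = (m x).ar := by simp
  have e2 : k + ∑ i ∈ ({x} : Finset ℕ), (m i).deg = k + (m x).deg := by simp
  unfold block
  rw [e1, e2, g.pre_apply (a := (m x).val) rfl]

/-- Precomposition with a homogeneous map in the input `x`. -/
theorem comp_pre_right (J : Finset ℕ) (x : ℕ) (ψ : M.PreEnd) (m : ℕ → M.Elt) (N : Finset ℕ)
    (r : ℤ) : compEnd J x {x} k ψ (g.pre x) m N r =
      sg (compExp J x {x} k fun i => (m i).deg) •
        ψ (Function.update m x ⟨(m x).ar, k + (m x).deg, g.f _ _ _ (m x).val⟩) N r := by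
  rw [compEnd_apply, block_pre]

/-- Postcomposition with a homogeneous map. -/
theorem comp_pre_left {J : Finset ℕ} {d : ℤ} {ψ : M.PreEnd} (hψ : IsEnd J d ψ) (m : ℕ → M.Elt)
    (N : Finset ℕ) {i r : ℤ} (hr : k + i = r) :
    compEnd {0} 0 J d (g.pre 0) ψ m N r = g.f N i r (ψ m N i) := by
  by_cases h : Part (fun j : J => (m j).ar) N ∧ d + ∑ j ∈ J, (m j).deg = i
  · obtain ⟨h, rfl⟩ := h
    have hN : (J.biUnion fun i => (m i).ar) = N := by
      ext n
      rw [Finset.mem_biUnion]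
      exact ((part_iff.1 h).2 n).symm
    have h0 : compExp {0} 0 J d (fun i => ((m i).deg : ZMod 2)) = 0 := by simp [compExp]
    subst hN
    rw [compEnd_apply, h0, sg_zero, one_smul]
    exact g.pre_apply (Function.update_self _ _ _) r
  · rw [hψ.eq_zero h, map_zero]
    refine IsEnd.eq_zero ((g.pre_isEnd 0).compEnd (ins_self 0 J) rfl hψ) fun h' => h ⟨h'.1, ?_⟩
    omega

end GMap

theorem comp_ofHom_right (F : M ⟶ M) (J : Finset ℕ) (x : ℕ) (ψ : M.PreEnd) (m : ℕ → M.Elt) :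
    compEnd J x {x} 0 ψ ((GMap.ofHom F).pre x) m = ψ (Function.update m x ((m x).map F)) := by
  funext N r
  have h0 : compExp J x {x} 0 (fun i => ((m i).deg : ZMod 2)) = 0 := by
    refine Finset.sum_eq_zero fun j hj => ?_
    rw [Finset.sum_singleton, z2]
    ring
  have h1 : (⟨(m x).ar, 0 + (m x).deg, (GMap.ofHom F).f _ _ _ (m x).val⟩ : M.Elt) =
      (m x).map F := by
    unfold Elt.map
    rw [zero_add, GMap.ofHom_apply]
  refine ((GMap.ofHom F).comp_pre_right J x ψ m N r).trans ?_
  rw [Int.cast_zero, h0, sg_zero, one_smul, h1]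

end unary

end RightMod

/-! ### Endomorphism operads of deformation retracts -/

namespace RightMod

variable {Q : DGOperad.{u, w} K}

section

variable {A N : RightMod Q} {ι : A ⟶ N} {π : N ⟶ A}

theorem sg_neg_one : sg (((-1 : ℤ) : ℤ) : ZMod 2) = -1 := by decide

/-- In the endomorphism operad, the identity is the sum of `ι π` and of the differential of a
contracting homotopy. -/
theorem Contraction.dEnd_pre (c : Contraction ι π) (x : ℕ) :
    (GMap.ofHom (𝟙 N)).pre x = dEnd {x} (-1) (c.gmap.pre x) + (GMap.ofHom (π ≫ ι)).pre x := by
  funext m B r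
  have i1 := (GMap.ofHom (𝟙 N)).pre_isEnd x
  have i2 := (c.gmap.pre_isEnd x).dEnd (show -1 + 1 = (0 : ℤ) by norm_num)
  have i3 := (GMap.ofHom (π ≫ ι)).pre_isEnd x
  rw [Pi.add_apply, Pi.add_apply, Pi.add_apply]
  have e : c.gmap.pre x (Function.update m x (m x).d) (m x).ar (m x).deg =
      c.gmap.f _ ((m x).deg + 1) (m x).deg ((N.X _).d _ _ (m x).val) :=
    c.gmap.pre_apply (a := (N.X _).d _ _ (m x).val) (Function.update_self _ _ _) _
  by_cases h : Part (fun j : ({x} : Finset ℕ) => (m j).ar) B ∧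
    0 + ∑ j ∈ ({x} : Finset ℕ), (m j).deg = r
  · obtain ⟨h1, h2⟩ := h
    rw [part_singleton] at h1
    rw [Finset.sum_singleton, zero_add] at h2
    subst h1 h2
    rw [GMap.pre_apply _ (m := m) (a := (m x).val) rfl,
      GMap.pre_apply _ (m := m) (a := (m x).val) rfl,
      GMap.ofHom_apply, GMap.ofHom_apply, dEnd_apply _ _ _ (sub_add_cancel (m x).deg 1),
      Finset.sum_singleton, Finset.sum_singleton, lo_self, zero_mul, sg_zero, one_smul,
      GMap.pre_apply _ (m := m) (a := (m x).val) rfl, sg_neg_one, neg_one_smul, sub_neg_eq_add, e,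
      c.gmap_apply _ (sub_add_cancel _ _), c.gmap_apply _ rfl, c.dh _ _ rfl]
    exact (sub_add_cancel _ _).symm
  · rw [i1.eq_zero h, i2.eq_zero h, i3.eq_zero h, add_zero]

theorem isEnd_zero {M : RightMod Q} {J : Finset ℕ} {d : ℤ} : IsEnd J d (0 : M.PreEnd) :=
  (endSub M J d).zero_mem

theorem IsEnd.add {M : RightMod Q} {J : Finset ℕ} {d : ℤ} {φ ψ : M.PreEnd} (hφ : IsEnd J d φ)
    (hψ : IsEnd J d ψ) : IsEnd J d (φ + ψ) := (endSub M J d).add_mem hφ hψ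

/-- Postcomposition of a cocycle with `ι π` changes it by a boundary. -/
theorem Contraction.left (c : Contraction ι π) {J : Finset ℕ} {d d' : ℤ} (hd : d' + 1 = d)
    {ψ : N.PreEnd} (hψ : IsEnd J d ψ) (h0 : dEnd J d ψ = 0) :
    ∃ χ : N.PreEnd, IsEnd J d' χ ∧
      (∀ m B r, dEnd J d' χ m B r =
        ψ m B r - (Hom.app ι B).f r ((Hom.app π B).f r (ψ m B r))) ∧
      ∀ m B r, (Hom.app π B).f r (χ m B r) = 0 := by
  have hg := c.gmap.pre_isEnd 0
  refine ⟨compEnd {0} 0 J d (c.gmap.pre 0) ψ, hg.compEnd (ins_self 0 J) (by omega) hψ, ?_, ?_⟩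
  · intro m B r
    have e1 := congrFun (congrFun (congrFun (dEnd_compEnd (ins_self 0 J) (show -1 + d = d' by omega)
      hg hψ) m) B) r
    have e2 : compEnd {0} 0 J (d + 1) (c.gmap.pre 0) (dEnd J d ψ) m B r = 0 := by
      rw [h0]
      refine (c.gmap.comp_pre_left isEnd_zero m B (i := r + 1) (by omega)).trans ?_
      exact map_zero _
    have e3 : compEnd {0} 0 J d (dEnd {0} (-1) (c.gmap.pre 0)) ψ m B r =
        ψ m B r - (Hom.app ι B).f r ((Hom.app π B).f r (ψ m B r)) := by
      have e4 := (GMap.ofHom (𝟙 N)).comp_pre_left hψ m B (zero_add r)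
      have e5 := (GMap.ofHom (π ≫ ι)).comp_pre_left hψ m B (zero_add r)
      rw [GMap.ofHom_apply] at e4 e5
      rw [c.dEnd_pre, compEnd_apply, Pi.add_apply, Pi.add_apply, Pi.add_apply, smul_add,
        ← compEnd_apply, ← compEnd_apply, e5] at e4
      exact eq_sub_of_add_eq e4
    rw [e1, Pi.add_apply, Pi.add_apply, Pi.add_apply, Pi.smul_apply, Pi.smul_apply, Pi.smul_apply,
      e2, e3, smul_zero, add_zero]
  · intro m B r
    rw [c.gmap.comp_pre_left hψ m B (i := r + 1) (by omega), c.gmap_apply _ rfl, c.π_h]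

/-- Precomposition of a cocycle with `ι π` in one of the inputs changes it by a boundary. -/
theorem Contraction.right_one (c : Contraction ι π) {J : Finset ℕ} {d d' : ℤ} (hd : d' + 1 = d)
    {ψ : N.PreEnd} (hψ : IsEnd J d ψ) (h0 : dEnd J d ψ = 0) {j : ℕ} (hj : j ∈ J) :
    ∃ χ : N.PreEnd, IsEnd J d' χ ∧
      (dEnd J d' χ = ψ - fun m => ψ (Function.update m j ((m j).map (π ≫ ι)))) ∧
      (IsEnd J d fun m => ψ (Function.update m j ((m j).map (π ≫ ι)))) ∧
      ∀ m : ℕ → A.Elt, χ (fun i => (m i).map ι) = 0 := by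
  have hg := c.gmap.pre_isEnd j
  have hI := hψ.compEnd (ins_right hj) (show d + -1 = d' by omega) hg
  have e0 : compEnd J j {j} 0 ψ ((GMap.ofHom (π ≫ ι)).pre j) =
      fun m => ψ (Function.update m j ((m j).map (π ≫ ι))) := by
    funext m
    exact comp_ofHom_right _ _ _ _ _
  -- the sign cancels the one which appears in the differential of a composition with `ψ`
  refine ⟨sg d • compEnd J j {j} (-1) ψ (c.gmap.pre j), ?_, ?_, ?_, ?_⟩
  · exact zsmul_mem (show _ ∈ endSub N J d' from hI) (sg d)
  · have e1 := dEnd_compEnd (ins_right hj) (show d + -1 = d' by omega) hψ hg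
    have e2 : compEnd J j {j} (-1) (dEnd J d ψ) (c.gmap.pre j) = 0 := by
      rw [h0]
      funext m B r
      rw [compEnd_apply]
      exact smul_zero _
    have e3 : compEnd J j {j} 0 ψ ((GMap.ofHom (𝟙 N)).pre j) = ψ := by
      funext m
      rw [comp_ofHom_right]
      exact congrArg ψ (Function.update_eq_self j m)
    rw [c.dEnd_pre, compEnd_add_right (ins_right hj) hψ, e0] at e3
    rw [map_zsmul, e1, e2, zero_add, smul_smul, ← sg_add, z2, sg_zero, one_smul]
    exact eq_sub_of_add_eq e3
  · rw [← e0]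
    exact hψ.compEnd (ins_right hj) (add_zero d) ((GMap.ofHom (π ≫ ι)).pre_isEnd j)
  · intro m
    funext B r
    rw [Pi.smul_apply, Pi.smul_apply, Pi.smul_apply, c.gmap.comp_pre_right,
      c.gmap_apply _ (show -1 + ((m j).map ι).deg + 1 = ((m j).map ι).deg by omega)]
    have e : c.h ((m j).map ι).ar ((m j).map ι).deg (-1 + ((m j).map ι).deg) (by omega)
        ((m j).map ι).val = 0 := c.h_ι _ _ _
    rw [e, hψ.zero' _ hj, smul_zero, smul_zero]
    rfl

/-- Precomposition of a cocycle with `ι π` in the inputs `S` changes it by a boundary. -/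
theorem Contraction.right_set (c : Contraction ι π) {J : Finset ℕ} {d d' : ℤ} (hd : d' + 1 = d)
    {ψ : N.PreEnd} (hψ : IsEnd J d ψ) (h0 : dEnd J d ψ = 0) (S : Finset ℕ) (hS : S ⊆ J) :
    ∃ χ : N.PreEnd, IsEnd J d' χ ∧
      (dEnd J d' χ = ψ - fun m => ψ (fun i => if i ∈ S then (m i).map (π ≫ ι) else m i)) ∧
      (IsEnd J d fun m => ψ (fun i => if i ∈ S then (m i).map (π ≫ ι) else m i)) ∧
      ∀ m : ℕ → A.Elt, χ (fun i => (m i).map ι) = 0 := by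
  induction S using Finset.induction_on with
  | empty =>
    refine ⟨0, isEnd_zero, ?_, ?_, fun m => rfl⟩
    · simp
    · simpa using hψ
  | insert j S hjS ih =>
    obtain ⟨χ, h1, h2, h3, h4⟩ := ih fun i hi => hS (Finset.mem_insert_of_mem hi)
    have h5 : dEnd J d (fun m => ψ (fun i => if i ∈ S then (m i).map (π ≫ ι) else m i)) = 0 := by
      have := dEnd_dEnd hd h1
      rw [h2, map_sub, h0, zero_sub, neg_eq_zero] at this
      exact this
    obtain ⟨χ', k1, k2, k3, k4⟩ := c.right_one hd h3 h5 (hS (Finset.mem_insert_self j S))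
    have e : (fun m : ℕ → N.Elt => ψ (fun i => if i ∈ S then
        (Function.update m j ((m j).map (π ≫ ι)) i).map (π ≫ ι) else
          Function.update m j ((m j).map (π ≫ ι)) i)) =
        fun m => ψ (fun i => if i ∈ insert j S then (m i).map (π ≫ ι) else m i) := by
      funext m
      congr 1
      funext i
      by_cases hi : i = j
      · subst hi
        simp [hjS]
      · simp [hi]
    refine ⟨χ + χ', h1.add k1, ?_, ?_, ?_⟩
    · rw [map_add, h2, k2]
      refine (sub_add_sub_cancel _ _ _).trans ?_
      exact congrArg (ψ - ·) e
    · rw [← e]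
      exact k3
    · intro m
      rw [Pi.add_apply, h4, k4, add_zero]

/-- Precomposition of a cocycle with `ι π` in all inputs changes it by a boundary. -/
theorem Contraction.right (c : Contraction ι π) {J : Finset ℕ} {d d' : ℤ} (hd : d' + 1 = d)
    {ψ : N.PreEnd} (hψ : IsEnd J d ψ) (h0 : dEnd J d ψ = 0) :
    ∃ χ : N.PreEnd, IsEnd J d' χ ∧
      (dEnd J d' χ = ψ - fun m => ψ (fun i => (m i).map (π ≫ ι))) ∧
      (IsEnd J d fun m => ψ (fun i => (m i).map (π ≫ ι))) ∧
      ∀ m : ℕ → A.Elt, χ (fun i => (m i).map ι) = 0 := by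
  obtain ⟨χ, h1, h2, h3, h4⟩ := c.right_set hd hψ h0 J subset_rfl
  have e : (fun m : ℕ → N.Elt => ψ (fun i => if i ∈ J then (m i).map (π ≫ ι) else m i)) =
      fun m => ψ (fun i => (m i).map (π ≫ ι)) := by
    funext m
    exact hψ.loc _ _ fun j hj => if_pos hj
  rw [e] at h2 h3
  exact ⟨χ, h1, h2, h3, h4⟩

end

section

variable {M N : RightMod Q} (ι : N ⟶ M) (π : M ⟶ N)

theorem dEnd_conjPre (J : Finset ℕ) (d : ℤ) (φ : N.PreEnd) :
    dEnd J d (conjPre ι π φ) = conjPre ι π (dEnd J d φ) := by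
  funext m B r
  rw [conjPre_apply, dEnd_apply _ _ _ (sub_add_cancel r 1),
    dEnd_apply _ _ _ (sub_add_cancel r 1), map_sub, map_zsmul, map_sum, conjPre_apply, Hom.app_d]
  congr 2
  apply Finset.sum_congr rfl
  intro j hj
  rw [conjPre_apply, map_upd, Elt.map_d, map_zsmul]
  rfl

/-- The morphism of complexes `φ ↦ ι φ π`, where `ι` and `π` are arbitrary. -/
def conjCx (J : Finset ℕ) : N.endCx J ⟶ M.endCx J where
  f i := ModuleCat.ofHom
    (((conjPre ι π).comp (endSub N J i).subtype).codRestrict (endSub M J i)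
      fun φ => IsEnd.conj ι π φ.2)
  comm' := by
    intro i j h
    obtain rfl : i + 1 = j := h
    apply ModuleCat.hom_ext
    apply LinearMap.ext
    intro φ
    refine (endCx_d _ rfl _).trans (Eq.trans ?_ (congrArg
      (((conjPre ι π).comp (endSub N J (i + 1)).subtype).codRestrict (endSub M J (i + 1))
      fun φ => IsEnd.conj ι π φ.2) (endCx_d _ rfl φ)).symm)
    exact Subtype.ext (dEnd_conjPre ι π J i φ.1)

end

section

variable {A N : RightMod Q} {ι : A ⟶ N} {π : N ⟶ A}

theorem endCx_cocycle {M : RightMod Q} {J : Finset ℕ} {i j : ℤ} (h : i + 1 = j)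
    {φ : endSub M J i} (hφ : (M.endCx J).d i j φ = 0) : dEnd J i φ.1 = 0 :=
  congrArg Subtype.val ((endCx_d J h φ).symm.trans hφ)

theorem map_ι_map (hπ : ι ≫ π = 𝟙 A) (e : A.Elt) : (e.map ι).map π = e := by
  unfold Elt.map
  simp only [map_map_id ι π hπ]

/-- Conjugation by a deformation retract is a quasi-isomorphism of endomorphism operads. -/
theorem Contraction.quasiIso_conj (c : Contraction ι π) (hπ : ι ≫ π = 𝟙 A) :
    NUOperad.quasiIso (conj ι π hπ) := by
  intro J
  refine (quasiIso_of_section (conjCx π ι J) (conjCx ι π J) ?_ ?_).2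
  · ext i φ
    apply Subtype.ext
    funext m B r
    change (Hom.app π B).f r ((Hom.app ι B).f r (φ.1 (fun i => ((m i).map ι).map π) B r)) =
      φ.1 m B r
    simp only [map_ι_map hπ, map_map_id ι π hπ]
  · -- a cocycle `ψ` of the kernel is cohomologous to `ψ (ι π, …, ι π)`, and this operation, whose
    -- composition with `π` vanishes, is a boundary
    intro i j k hi hk (ψ : endSub N J j) hψ h0
    have hc := endCx_cocycle hk hψ
    have h1 : ∀ (m : ℕ → A.Elt) B r,
        (Hom.app π B).f r (ψ.1 (fun i => (m i).map ι) B r) = 0 := fun m B r =>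
      congrArg (fun t : endSub A J j => t.1 m B r) h0
    obtain ⟨χ, a1, a2, a3, -⟩ := c.right hi ψ.2 hc
    have a4 : dEnd J j (fun m : ℕ → N.Elt => ψ.1 (fun i => (m i).map (π ≫ ι))) = 0 := by
      have := dEnd_dEnd hi a1
      rw [a2, map_sub, hc, zero_sub, neg_eq_zero] at this
      exact this
    obtain ⟨χ', b1, b2, -⟩ := c.left hi a3 a4
    have b3 : dEnd J i χ' = fun m : ℕ → N.Elt => ψ.1 (fun i => (m i).map (π ≫ ι)) := by
      funext m B r
      rw [b2]
      have : (Hom.app π B).f r (ψ.1 (fun i => (m i).map (π ≫ ι)) B r) = 0 :=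
        h1 (fun i => (m i).map π) B r
      rw [this, map_zero, sub_zero]
    refine ⟨(⟨χ + χ', a1.add b1⟩ : endSub N J i), ?_⟩
    refine (endCx_d J hi _).trans (Subtype.ext ?_)
    change dEnd J i (χ + χ') = ψ.1
    rw [map_add, a2, b3]
    exact sub_add_cancel _ _

end

end RightMod

/-! ### Operads of intertwined pairs of operations -/

namespace NUOperad

variable {P Q R : NUOperad.{u, w} K}

/-- A linear relation between two dg operads which is compatible with all operations, i.e. a
suboperad of their product. -/
structure Relation (P Q : NUOperad.{u, w} K) where
  W : ∀ (J : Finset ℕ) (i : ℤ), Submodule K ((P.X J).X i × (Q.X J).X i)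
  d_mem : ∀ {J : Finset ℕ} {i j : ℤ}, i + 1 = j → ∀ a ∈ W J i,
    ((P.X J).d i j a.1, (Q.X J).d i j a.2) ∈ W J j
  rel_mem : ∀ {A B : Finset ℕ} (f : ℕ → ℕ) (hf : Set.BijOn f (A : Set ℕ) B) (i : ℤ), ∀ a ∈ W A i,
    ((P.rel f hf).f i a.1, (Q.rel f hf).f i a.2) ∈ W B i
  comp_mem : ∀ {A : Finset ℕ} {x : ℕ} {B C : Finset ℕ} (h : Ins A x B C) {i j n : ℤ}
    (hn : i + j = n), ∀ a ∈ W A i, ∀ b ∈ W B j,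
    (P.comp h hn a.1 b.1, Q.comp h hn a.2 b.2) ∈ W C n

namespace Relation

variable (T : Relation P Q)

/-- The differential of the suboperad. -/
def dL (J : Finset ℕ) {i j : ℤ} (h : i + 1 = j) : T.W J i →ₗ[K] T.W J j :=
  ((LinearMap.prodMap ((P.X J).d i j).hom ((Q.X J).d i j).hom).comp (T.W J i).subtype).codRestrict
    _ fun a => T.d_mem h a.1 a.2

/-- The relabellings of the suboperad. -/
def relL {A B : Finset ℕ} (f : ℕ → ℕ) (hf : Set.BijOn f (A : Set ℕ) B) (i : ℤ) :
    T.W A i →ₗ[K] T.W B i :=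
  ((LinearMap.prodMap ((P.rel f hf).f i).hom ((Q.rel f hf).f i).hom).comp
    (T.W A i).subtype).codRestrict _ fun a => T.rel_mem f hf i a.1 a.2

/-- The compositions of the suboperad. -/
def compL {A : Finset ℕ} {x : ℕ} {B C : Finset ℕ} (h : Ins A x B C) {i j n : ℤ}
    (hn : i + j = n) : T.W A i →ₗ[K] T.W B j →ₗ[K] T.W C n :=
  LinearMap.mk₂ K (fun a b => ⟨_, T.comp_mem h hn a.1 a.2 b.1 b.2⟩)
    (fun a a' b => Subtype.ext (Prod.ext
      (by simp) (by simp)))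
    (fun c a b => Subtype.ext (Prod.ext (by simp) (by simp)))
    (fun a b b' => Subtype.ext (Prod.ext (by simp) (by simp)))
    (fun c a b => Subtype.ext (Prod.ext (by simp) (by simp)))

/-- The complexes of the suboperad. -/
def cx (J : Finset ℕ) : Cx.{u, w} K where
  X i := ModuleCat.of K (T.W J i)
  d i j := if h : i + 1 = j then ModuleCat.ofHom (T.dL J h) else 0
  shape i j h := dif_neg h
  d_comp_d' i j k h h' := by
    obtain rfl : i + 1 = j := h
    obtain rfl : i + 1 + 1 = k := h'
    rw [dif_pos rfl, dif_pos rfl]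
    apply ModuleCat.hom_ext
    apply LinearMap.ext
    intro a
    exact Subtype.ext (Prod.ext (d_d_apply _ _ _ _ _) (d_d_apply _ _ _ _ _))

theorem cx_d (J : Finset ℕ) {i j : ℤ} (h : i + 1 = j) (a : T.W J i) :
    (T.cx J).d i j a = T.dL J h a := by
  simp only [cx, dif_pos h]
  rfl

/-- The suboperad of the product `P × Q` defined by a relation. -/
def operad : NUOperad.{u, w} K where
  X J := T.cx J
  rel f hf :=
    { f := fun i => ModuleCat.ofHom (T.relL f hf i)
      comm' := by
        intro i j h
        obtain rfl : i + 1 = j := h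
        apply ModuleCat.hom_ext
        apply LinearMap.ext
        intro a
        refine (cx_d _ _ rfl _).trans (Eq.trans ?_
          (congrArg (T.relL f hf (i + 1)) (cx_d _ _ rfl a)).symm)
        exact Subtype.ext (Prod.ext (hom_f_d _ _ _ _).symm (hom_f_d _ _ _ _).symm) }
  comp h _ _ _ hn := T.compL h hn
  rel_congr f g hf hg h := by
    ext i a
    refine Subtype.ext (Prod.ext ?_ ?_)
    · exact congrArg (fun t => (ModuleCat.Hom.hom (HomologicalComplex.Hom.f t i)) a.1.1)
        (P.rel_congr f g hf hg h)
    · exact congrArg (fun t => (ModuleCat.Hom.hom (HomologicalComplex.Hom.f t i)) a.1.2)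
        (Q.rel_congr f g hf hg h)
  rel_id h := by
    ext i a
    refine Subtype.ext (Prod.ext ?_ ?_)
    · exact congrArg (fun t => (ModuleCat.Hom.hom (HomologicalComplex.Hom.f t i)) a.1.1)
        (P.rel_id h)
    · exact congrArg (fun t => (ModuleCat.Hom.hom (HomologicalComplex.Hom.f t i)) a.1.2)
        (Q.rel_id h)
  rel_trans f g hf hg h := by
    ext i a
    refine Subtype.ext (Prod.ext ?_ ?_)
    · exact congrArg (fun t => (ModuleCat.Hom.hom (HomologicalComplex.Hom.f t i)) a.1.1)
        (P.rel_trans f g hf hg h)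
    · exact congrArg (fun t => (ModuleCat.Hom.hom (HomologicalComplex.Hom.f t i)) a.1.2)
        (Q.rel_trans f g hf hg h)
  d_comp h := by
    intro i j n i' j' n' hn hi hj hn' a b
    subst hi hj
    refine (cx_d _ _ hn' _).trans ?_
    refine Eq.trans ?_ (congrArg₂ (fun a' b' => T.compL h _ a' b + sg i • T.compL h _ a b')
      (cx_d _ _ rfl a) (cx_d _ _ rfl b)).symm
    exact Subtype.ext (Prod.ext (P.d_comp h hn rfl rfl hn' a.1.1 b.1.1)
      (Q.d_comp h hn rfl rfl hn' a.1.2 b.1.2))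
  rel_comp h f g k h' hf hg hk h1 h2 := by
    intro i j n hn a b
    exact Subtype.ext (Prod.ext (P.rel_comp h f g k h' hf hg hk h1 h2 hn a.1.1 b.1.1)
      (Q.rel_comp h f g k h' hf hg hk h1 h2 hn a.1.2 b.1.2))
  assoc_seq h₁ h₂ h₃ h₄ := by
    intro i j l m n p hm hn hp hq a b c
    exact Subtype.ext (Prod.ext (P.assoc_seq h₁ h₂ h₃ h₄ hm hn hp hq a.1.1 b.1.1 c.1.1)
      (Q.assoc_seq h₁ h₂ h₃ h₄ hm hn hp hq a.1.2 b.1.2 c.1.2))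
  assoc_par hxy h₁ h₂ h₃ h₄ := by
    intro i j l m n p hm hn hp hq a b c
    exact Subtype.ext (Prod.ext (P.assoc_par hxy h₁ h₂ h₃ h₄ hm hn hp hq a.1.1 b.1.1 c.1.1)
      (Q.assoc_par hxy h₁ h₂ h₃ h₄ hm hn hp hq a.1.2 b.1.2 c.1.2))

/-- The first projection. -/
def fst : T.operad ⟶ P where
  app J :=
    { f := fun i => ModuleCat.ofHom ((LinearMap.fst K _ _).comp (T.W J i).subtype)
      comm' := by
        intro i j h
        apply ModuleCat.hom_ext
        apply LinearMap.ext
        intro (a : T.W J i)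
        exact (congrArg (fun t : T.W J j => t.1.1) (T.cx_d J h a)).symm }
  rel f hf := rfl
  comp h _ _ _ hn a b := rfl

/-- The second projection. -/
def snd : T.operad ⟶ Q where
  app J :=
    { f := fun i => ModuleCat.ofHom ((LinearMap.snd K _ _).comp (T.W J i).subtype)
      comm' := by
        intro i j h
        apply ModuleCat.hom_ext
        apply LinearMap.ext
        intro (a : T.W J i)
        exact (congrArg (fun t : T.W J j => t.1.2) (T.cx_d J h a)).symm }
  rel f hf := rfl
  comp h _ _ _ hn a b := rfl

section lift

variable (F : R ⟶ P) (G : R ⟶ Q)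
  (h : ∀ J i (x : (R.X J).X i), ((Hom.app F J).f i x, (Hom.app G J).f i x) ∈ T.W J i)

/-- The morphism to the suboperad defined by two morphisms whose values are related. -/
def lift : R ⟶ T.operad where
  app J :=
    { f := fun i => ModuleCat.ofHom
        ((LinearMap.prod ((Hom.app F J).f i).hom ((Hom.app G J).f i).hom).codRestrict (T.W J i)
          (h J i))
      comm' := by
        intro i j hij
        apply ModuleCat.hom_ext
        apply LinearMap.ext
        intro x
        refine (T.cx_d J hij _).trans ?_
        exact Subtype.ext (Prod.ext (hom_f_d _ _ _ _).symm (hom_f_d _ _ _ _).symm) }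
  rel {A B} f hf := by
    ext i x
    refine Subtype.ext (Prod.ext ?_ ?_)
    · exact congrArg (fun t => (ModuleCat.Hom.hom (HomologicalComplex.Hom.f t i)) x)
        (Hom.rel F f hf)
    · exact congrArg (fun t => (ModuleCat.Hom.hom (HomologicalComplex.Hom.f t i)) x)
        (Hom.rel G f hf)
  comp hI _ _ _ hn a b := Subtype.ext (Prod.ext (Hom.comp F hI hn a b) (Hom.comp G hI hn a b))

end lift

end Relation

end NUOperad

namespace RightMod

variable {Q : DGOperad.{u, w} K}

/-- The relation between the endomorphism operads of `M` and `N` defined by a morphism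
`F : M ⟶ N`: the pairs `(φ, χ)` with `F φ = χ (F, …, F)`. -/
def intertwining {M N : RightMod Q} (F : M ⟶ N) : NUOperad.Relation M.End N.End where
  W J i :=
    { carrier := {a : endSub M J i × endSub N J i |
        ∀ m B r, (Hom.app F B).f r (a.1.1 m B r) = a.2.1 (fun j => (m j).map F) B r}
      zero_mem' := fun m B r => map_zero _
      add_mem' := by
        intro a b ha hb m B r
        exact (map_add _ _ _).trans (congrArg₂ (· + ·) (ha m B r) (hb m B r))
      smul_mem' := by
        intro c a ha m B r
        exact (map_smul _ _ _).trans (congrArg (c • ·) (ha m B r)) }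
  d_mem := by
    intro J i j h a ha m B r
    obtain ⟨φ, χ⟩ := a
    have e1 : ((M.End.X J).d i j φ : endSub M J j) = _ := endCx_d J h φ
    have e2 : ((N.End.X J).d i j χ : endSub N J j) = _ := endCx_d J h χ
    dsimp only
    rw [e1, e2]
    change (Hom.app F B).f r (dEnd J i φ.1 m B r) = dEnd J i χ.1 (fun j => (m j).map F) B r
    rw [dEnd_apply _ _ _ (sub_add_cancel r 1), dEnd_apply _ _ _ (sub_add_cancel r 1), map_sub,
      map_zsmul, map_sum, Hom.app_d, ha m B (r - 1)]
    congr 2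
    refine Finset.sum_congr rfl fun j hj => ?_
    rw [map_zsmul, ha, map_upd, Elt.map_d]
    rfl
  rel_mem := by
    intro A B f hf i a ha m C r
    exact (map_zsmul ((Hom.app F C).f r).hom _ _).trans (congrArg _ (ha _ C r))
  comp_mem := by
    intro A x B C h i j n hn a ha b hb m D r
    obtain ⟨φ, χ⟩ := a
    obtain ⟨ψ, θ⟩ := b
    change (Hom.app F D).f r (compEnd A x B j φ.1 ψ.1 m D r) =
      compEnd A x B j χ.1 θ.1 (fun j => (m j).map F) D r
    have e : (block B j ψ.1 m).map F = block B j θ.1 (fun i => (m i).map F) := by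
      unfold block Elt.map
      simp only [Elt.mk.injEq, heq_eq_eq, true_and]
      exact hb m _ _
    rw [compEnd_apply, compEnd_apply, map_zsmul, ha, map_upd, e]
    rfl

variable {A N : RightMod Q} {ι : A ⟶ N} {π : N ⟶ A}

/-- The pairs `(ι φ π, φ)` are intertwined by `π`. -/
def sectionRetract (hπ : ι ≫ π = 𝟙 A) : A.End ⟶ (intertwining π).operad :=
  (intertwining π).lift (conj ι π hπ) (𝟙 _) fun _ _ _ _ _ _ => map_map_id ι π hπ _ _ _

/-- The pairs `(φ, ι φ π)` are intertwined by `ι`. -/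
def sectionInclusion (hπ : ι ≫ π = 𝟙 A) : A.End ⟶ (intertwining ι).operad :=
  (intertwining ι).lift (𝟙 _) (conj ι π hπ) fun J i (φ : endSub A J i) m B r => by
    change _ = (Hom.app ι B).f r (φ.1 (fun i => ((m i).map ι).map π) B r)
    simp only [map_ι_map hπ]
    rfl

/-- The kernel of this projection consists of the `φ` with `π φ = 0`, and a cocycle `φ` of this kind
is the differential of `h φ`, for a contracting homotopy `h` with `π h = 0`. -/
theorem Contraction.quasiIso_snd (c : Contraction ι π) (hπ : ι ≫ π = 𝟙 A) :
    NUOperad.quasiIso (intertwining π).snd := by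
  intro J
  refine (quasiIso_of_section _ (NUOperad.Hom.app (sectionRetract hπ) J) rfl ?_).1
  intro i j k hi hk (x : (intertwining π).W J j) hx h0
  obtain ⟨⟨φ, χ⟩, hφ⟩ := x
  obtain rfl : χ = 0 := h0
  have hc : dEnd J j φ.1 = 0 := endCx_cocycle hk
    (congrArg (fun t : (intertwining π).W J k => t.1.1)
      ((NUOperad.Relation.cx_d _ J hk _).symm.trans hx))
  have h1 : ∀ m B r, (Hom.app π B).f r (φ.1 m B r) = 0 := hφ
  obtain ⟨η, a1, a2, a3⟩ := c.left hi φ.2 hc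
  refine ⟨(⟨((⟨η, a1⟩ : endSub N J i), (0 : endSub A J i)), a3⟩ : (intertwining π).W J i), ?_⟩
  refine (NUOperad.Relation.cx_d _ J hi _).trans (Subtype.ext (Prod.ext ?_ ?_))
  · refine (endCx_d J hi _).trans (Subtype.ext ?_)
    funext m B r
    refine (a2 m B r).trans ?_
    rw [h1, map_zero, sub_zero]
  · exact map_zero ((A.End.X J).d i j).hom

/-- The kernel of this projection consists of the `χ` with `χ (ι, …, ι) = 0`, and a cocycle `χ` of
this kind is the differential of an operation which is obtained by applying a contracting homotopy
to the inputs. -/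
theorem Contraction.quasiIso_fst (c : Contraction ι π) (hπ : ι ≫ π = 𝟙 A) :
    NUOperad.quasiIso (intertwining ι).fst := by
  intro J
  refine (quasiIso_of_section _ (NUOperad.Hom.app (sectionInclusion hπ) J) rfl ?_).1
  intro i j k hi hk (x : (intertwining ι).W J j) hx h0
  obtain ⟨⟨φ, χ⟩, hφ⟩ := x
  obtain rfl : φ = 0 := h0
  have hc : dEnd J j χ.1 = 0 := endCx_cocycle hk
    (congrArg (fun t : (intertwining ι).W J k => t.1.2)
      ((NUOperad.Relation.cx_d _ J hk _).symm.trans hx))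
  have h1 : ∀ m : ℕ → A.Elt, χ.1 (fun i => (m i).map ι) = 0 := by
    intro m
    funext B r
    exact (hφ m B r).symm.trans (map_zero _)
  obtain ⟨η, a1, a2, -, a3⟩ := c.right hi χ.2 hc
  refine ⟨(⟨((0 : endSub A J i), (⟨η, a1⟩ : endSub N J i)), fun m B r => ?_⟩ :
    (intertwining ι).W J i), ?_⟩
  · exact (map_zero _).trans (congrFun (congrFun (a3 m) B) r).symm
  refine (NUOperad.Relation.cx_d _ J hi _).trans (Subtype.ext (Prod.ext ?_ ?_))
  · exact map_zero ((A.End.X J).d i j).hom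
  · refine (endCx_d J hi _).trans (Subtype.ext ?_)
    refine a2.trans ?_
    have : (fun m : ℕ → N.Elt => χ.1 (fun i => (m i).map (π ≫ ι))) = 0 := by
      funext m
      exact h1 fun i => (m i).map π
    rw [this, sub_zero]

open NUOperad in
/-- In the localization, conjugation with `ι` and a retraction does not depend on the retraction:
for every retraction it factors through the operad of the pairs `(φ, χ)` which are intertwined by
`ι`, by a section of the quasi-isomorphism `(φ, χ) ↦ φ`. -/
theorem Contraction.map_conj_eq (c : Contraction ι π) (hπ : ι ≫ π = 𝟙 A) {π' : N ⟶ A}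
    (hπ' : ι ≫ π' = 𝟙 A) :
    quasiIso.Q.map (conj ι π' hπ') = quasiIso.Q.map (conj ι π hπ) := by
  have : IsIso (quasiIso.Q.map (intertwining ι).fst) :=
    quasiIso.Q_inverts _ (c.quasiIso_fst hπ)
  have key : ∀ {π'' : N ⟶ A} (h : ι ≫ π'' = 𝟙 A), quasiIso.Q.map (conj ι π'' h) =
      inv (quasiIso.Q.map (intertwining ι).fst) ≫ quasiIso.Q.map (intertwining ι).snd := by
    intro π'' h
    have e1 : quasiIso.Q.map (sectionInclusion h) = inv (quasiIso.Q.map (intertwining ι).fst) := by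
      refine IsIso.eq_inv_of_inv_hom_id ?_
      rw [← Functor.map_comp]
      exact quasiIso.Q.map_id _
    rw [← e1, ← Functor.map_comp]
    rfl
  rw [key hπ, key hπ']

open NUOperad in
/-- If the operad morphisms `F : P ⟶ End N` and `σ : P ⟶ End A` are intertwined by the retraction
`π` then, in the localization, `F` is the composition of `σ` with conjugation by `ι` and any
retraction. -/
theorem Contraction.map_eq (c : Contraction ι π) (hπ : ι ≫ π = 𝟙 A) {π' : N ⟶ A}
    (hπ' : ι ≫ π' = 𝟙 A) {P : NUOperad.{u, w} K} (F : P ⟶ N.End) (σ : P ⟶ A.End)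
    (h : ∀ J d (x : (P.X J).X d) m B r, (Hom.app π B).f r
      (N.toPre ((NUOperad.Hom.app F J).f d x) m B r) =
        A.toPre ((NUOperad.Hom.app σ J).f d x) (fun j => (m j).map π) B r) :
    quasiIso.Q.map σ ≫ quasiIso.Q.map (conj ι π' hπ') = quasiIso.Q.map F := by
  rw [c.map_conj_eq hπ hπ']
  have : IsIso (quasiIso.Q.map (intertwining π).snd) :=
    quasiIso.Q_inverts _ (c.quasiIso_snd hπ)
  have e1 : quasiIso.Q.map ((intertwining π).lift F σ h) =
      quasiIso.Q.map σ ≫ quasiIso.Q.map (sectionRetract hπ) := by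
    rw [← cancel_mono (quasiIso.Q.map (intertwining π).snd), Category.assoc, ← Functor.map_comp,
      ← Functor.map_comp]
    refine Eq.symm (Eq.trans ?_ (Category.comp_id _))
    exact congrArg _ (quasiIso.Q.map_id _)
  have e2 : quasiIso.Q.map F =
      quasiIso.Q.map ((intertwining π).lift F σ h) ≫ quasiIso.Q.map (intertwining π).fst := by
    rw [← Functor.map_comp]
    rfl
  rw [e2, e1, Category.assoc, ← Functor.map_comp, ← Functor.map_comp, ← Functor.map_comp]
  rfl

end RightMod

/-! ### Evaluation at the units -/

namespace RightMod

variable {Q : DGOperad.{u, w} K}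

theorem units_act (e : Q.regular.Elt) (x : ℕ) :
    (units Q x).act (ins_self x e.ar) (zero_add e.deg) e.val = e := by
  simp only [Elt.act, units]
  exact congrArg (Elt.mk e.ar e.deg) (Q.one_comp (ins_self x e.ar) (zero_add e.deg) e.val)

/-- Replacement of the elements with index outside of `S` by units with shifted labels. -/
def unitsOff (s : ℕ) (S : Finset ℕ) (m : ℕ → Q.regular.Elt) : ℕ → Q.regular.Elt :=
  fun j => if j ∈ S then m j else units Q (j + s)

theorem unitsOff_ar (s : ℕ) (S : Finset ℕ) (m : ℕ → Q.regular.Elt) (j : ℕ) :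
    (unitsOff s S m j).ar = if j ∈ S then (m j).ar else {j + s} := by
  unfold unitsOff
  split_ifs <;> rfl

theorem unitsOff_insert (s : ℕ) (S : Finset ℕ) (m : ℕ → Q.regular.Elt) (j : ℕ) :
    unitsOff s (insert j S) m = Function.update (unitsOff s S m) j (m j) := by
  funext i
  by_cases h : i = j
  · subst h
    simp [unitsOff]
  · simp [unitsOff, h]

theorem unitsOff_disjoint {s : ℕ} {J : Finset ℕ} (S : Finset ℕ) {m : ℕ → Q.regular.Elt}
    (hd : ∀ i ∈ J, ∀ j ∈ J, i ≠ j → Disjoint (m i).ar (m j).ar)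
    (hs : ∀ i ∈ J, ∀ n ∈ (m i).ar, n < s) :
    ∀ i ∈ J, ∀ j ∈ J, i ≠ j → Disjoint (unitsOff s S m i).ar (unitsOff s S m j).ar := by
  intro i hi j hj hij
  rw [unitsOff_ar, unitsOff_ar]
  split_ifs with h1 h2 h2
  · exact hd i hi j hj hij
  · rw [Finset.disjoint_singleton_right]
    intro h
    have := hs i hi _ h
    omega
  · rw [Finset.disjoint_singleton_left]
    intro h
    have := hs j hj _ h
    omega
  · rw [Finset.disjoint_singleton_left, Finset.mem_singleton]
    omega

/-- A multilinear endomorphism of the right module `Q` which vanishes on the units is zero: all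
elements are obtained from units by insertions. -/
theorem eq_zero_of_units {J : Finset ℕ} {d : ℤ} {φ : Q.regular.PreEnd} (hφ : IsEnd J d φ)
    (h0 : φ (units Q) J d = 0) : φ = 0 := by
  funext m N r
  by_cases hP : Part (fun j : J => (m j).ar) N
  swap
  · exact hφ.eq_zero fun h => hP h.1
  obtain ⟨hd, hN⟩ := (part_iff (A := fun j => (m j).ar)).1 hP
  set s := ColDGOperad.bd N
  have hs : ∀ i ∈ J, ∀ n ∈ (m i).ar, n < s := fun i hi n hn =>
    ColDGOperad.lt_bd n ((hN n).2 ⟨i, hi, hn⟩)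
  -- the units are replaced by the elements `m j` one by one; the shift by `s` makes the labels of
  -- the remaining units different from those of the elements which are already in place
  have key : ∀ S ⊆ J, ∀ r, φ (unitsOff s S m) (J.biUnion fun j => (unitsOff s S m j).ar) r = 0 := by
    intro S
    induction S using Finset.induction_on with
    | empty =>
      intro _ r
      have e1 : (J.biUnion fun j => (unitsOff s ∅ m j).ar) = J.image (· + s) := by
        ext n
        simp [unitsOff_ar, eq_comm]
      have hb : Set.BijOn (· + s) (J : Set ℕ) (J.image (· + s) : Finset ℕ) := by
        rw [Finset.coe_image]
        exact Set.InjOn.bijOn_image fun a _ b _ e => Nat.add_right_cancel e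
      rw [e1, hφ.rel (units Q) _ J _ (· + s) hb (units_part Q J)]
      · by_cases hr : r = d
        · rw [hr, h0, map_zero]
        · rw [hφ.eq_zero, map_zero]
          rintro ⟨-, h⟩
          apply hr
          rw [← h]
          simp [units]
      · intro j hj
        have hj' : Set.BijOn (· + s) ({j} : Finset ℕ) ({j + s} : Finset ℕ) := by simp
        refine ⟨{j + s}, hj', ?_⟩
        exact congrArg (Elt.mk (M := Q.regular) {j + s} 0) (Q.rel_one j (· + s) hj').symm
    | insert j S hjS ih =>
      intro hS r
      have hj : j ∈ J := hS (Finset.mem_insert_self j S)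
      have hS' : S ⊆ J := fun i hi => hS (Finset.mem_insert_of_mem hi)
      have e1 : unitsOff s S m j = units Q (j + s) := if_neg hjS
      have e2 : Function.update (unitsOff s S m) j (units Q (j + s)) = unitsOff s S m := by
        rw [← e1, Function.update_eq_self]
      have hI : Ins (J.biUnion fun i => (unitsOff s S m i).ar) (j + s) (m j).ar
          (J.biUnion fun i => (unitsOff s (insert j S) m i).ar) := by
        have h1 : ∀ i, i ≠ j → (unitsOff s (insert j S) m i).ar = (unitsOff s S m i).ar := by
          intro i hi
          simp [unitsOff_ar, hi]
        have h2 : (unitsOff s (insert j S) m j).ar = (m j).ar := by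
          simp [unitsOff_ar]
        have h3 : (unitsOff s S m j).ar = {j + s} := by rw [e1]; rfl
        have h4 := unitsOff_disjoint S hd hs
        have h5 := unitsOff_disjoint (insert j S) hd hs
        refine ⟨Finset.mem_biUnion.2 ⟨j, hj, by rw [h3]; exact Finset.mem_singleton_self _⟩, ?_, ?_⟩
        · rw [Finset.disjoint_left]
          intro n hn hn'
          rw [Finset.mem_erase, Finset.mem_biUnion] at hn
          obtain ⟨hn1, i, hi, hn2⟩ := hn
          by_cases e : i = j
          · subst e
            rw [h3, Finset.mem_singleton] at hn2
            exact hn1 hn2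
          · rw [← h1 i e] at hn2
            rw [← h2] at hn'
            exact Finset.disjoint_left.1 (h5 i hi j hj e) hn2 hn'
        · ext n
          rw [Finset.mem_union, Finset.mem_erase, Finset.mem_biUnion, Finset.mem_biUnion]
          constructor
          · rintro ⟨i, hi, hn⟩
            by_cases e : i = j
            · subst e
              exact Or.inr (h2 ▸ hn)
            · rw [h1 i e] at hn
              refine Or.inl ⟨?_, i, hi, hn⟩
              rintro rfl
              exact Finset.disjoint_left.1 (h4 i hi j hj e) hn
                (by rw [h3]; exact Finset.mem_singleton_self _)
          · rintro (⟨hn1, i, hi, hn⟩ | hn)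
            · have e : i ≠ j := by
                rintro rfl
                rw [h3, Finset.mem_singleton] at hn
                exact hn1 hn
              exact ⟨i, hi, by rwa [h1 i e]⟩
            · exact ⟨j, hj, by rwa [h2]⟩
      have h3 := hφ.act (unitsOff s S m) j hj (units Q (j + s))
        (ins_self (j + s) (m j).ar) hI (by
          rw [e2]
          exact (part_iff (A := fun j => (unitsOff s S m j).ar)).2
            ⟨unitsOff_disjoint S hd hs, fun n => Finset.mem_biUnion⟩)
        (zero_add (m j).deg) (sub_add_cancel r (m j).deg) (m j).val
      rw [units_act, ← unitsOff_insert, e2, ih hS', map_zero] at h3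
      exact h3.trans (smul_zero _)
  have e1 : φ m = φ (unitsOff s J m) := hφ.loc _ _ fun j hj => (if_pos hj).symm
  have e2 : N = J.biUnion fun j => (unitsOff s J m j).ar := by
    ext n
    rw [hN, Finset.mem_biUnion]
    refine exists_congr fun j => and_congr_right fun hj => ?_
    rw [unitsOff_ar, if_pos hj]
  rw [e1, e2]
  exact key J subset_rfl r

/-- The evaluation at the units is a quasi-isomorphism as soon as it has a section. -/
theorem quasiIso_ev_of_section (σ : Q.toNUOperad ⟶ Q.regular.End) (hσ : σ ≫ ev Q = 𝟙 _) :
    NUOperad.quasiIso (ev Q) := by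
  intro J
  refine (quasiIso_of_section _ (NUOperad.Hom.app σ J)
    (congrArg (fun F => NUOperad.Hom.app F J) hσ) ?_).1
  intro i j k hi hk (φ : endSub Q.regular J j) _ h0
  refine ⟨0, ?_⟩
  rw [map_zero]
  exact (Subtype.ext (eq_zero_of_units φ.2 h0)).symm

end RightMod

/-! ### The bimodule of chains -/

theorem mapCh_mapCh {X Y Z : Type v} [TopologicalSpace X] [TopologicalSpace Y] [TopologicalSpace Z]
    (F : C(X, Y)) (G : C(Y, Z)) (i : ℤ) (a : Ch K X i) :
    mapCh K G i (mapCh K F i a) = mapCh K (G.comp F) i a := by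
  refine LinearMap.congr_fun (f := (mapCh K G i).comp (mapCh K F i)) (Ch_ext fun σ hσ => ?_) a
  rw [LinearMap.comp_apply, mapCh_br F hσ, mapCh_br G (hσ.map F), mapCh_br _ hσ]
  rfl

theorem mapCh_id {X : Type v} [TopologicalSpace X] (i : ℤ) (a : Ch K X i) :
    mapCh K (ContinuousMap.id X) i a = a := by
  refine LinearMap.congr_fun (g := LinearMap.id) (Ch_ext fun σ hσ => ?_) a
  rw [mapCh_br _ hσ]
  rfl

namespace DGOperad

variable (Q : DGOperad.{u, w} K)

theorem rel_rel {A B C : Finset ℕ} (f g k : ℕ → ℕ) (hf : Set.BijOn f (A : Set ℕ) B)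
    (hg : Set.BijOn g (B : Set ℕ) C) (hk : Set.BijOn k (A : Set ℕ) C) (h : ∀ a ∈ A, g (f a) = k a)
    {i : ℤ} (a : (Q.X A).X i) :
    (Q.rel g hg).f i ((Q.rel f hf).f i a) = (Q.rel k hk).f i a := by
  have h1 := Q.rel_trans f g hf hg (hg.comp hf)
  have h2 := Q.rel_congr (g ∘ f) k (hg.comp hf) hk h
  rw [← h2, h1]
  rfl

theorem rel_eq_self {A : Finset ℕ} (k : ℕ → ℕ) (hk : Set.BijOn k (A : Set ℕ) A)
    (h : ∀ a ∈ A, k a = a) {i : ℤ} (a : (Q.X A).X i) : (Q.rel k hk).f i a = a := by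
  rw [Q.rel_congr k id hk (Set.bijOn_id _) h, Q.rel_id]
  rfl

/-- Insertion of a unit amounts to a change of the label of the input. -/
theorem comp_one_eq_rel {A : Finset ℕ} {x y : ℕ} {C : Finset ℕ} (h : Ins A x {y} C) {n : ℤ}
    (hn : n + 0 = n) (a : (Q.X A).X n) (g : ℕ → ℕ) (hg : Set.BijOn g (A : Set ℕ) C)
    (hx : g x = y) (hA : Set.EqOn g id (A.erase x : Finset ℕ)) :
    Q.comp h hn a (Q.one y) = (Q.rel g hg).f n a := by
  subst hx
  have hs : Set.BijOn g (({x} : Finset ℕ) : Set ℕ) ({g x} : Finset ℕ) := by simp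
  have h1 := Q.rel_comp (ins_right h.mem) id g g h (Set.bijOn_id _) hs hg hA (fun _ _ => rfl)
    hn a (Q.one x)
  rw [Q.comp_one, Q.rel_one, Q.rel_id] at h1
  exact h1.symm

end DGOperad

namespace TopOperad

variable {S T : TopOperad.{v} Unit} [IsLambda S] [IsLambda T] (f : Hom id S T)

/-- The morphism of operads from `ESC f` to `T` which forgets the colours, the operations of `S` and
the paths. -/
noncomputable def projT : Hom (fun _ => ()) (ESC f) T where
  app c A := ⟨fun p => p.1.2.1.1, by
    have h1 : Continuous fun p : HoPull ((trivMap f).app c A) (T.fill.app c A) => p.1.2.1 := by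
      fun_prop
    have h2 : Continuous fun t : {_t : T.X () (ar A.set) // Ok c A} => t.1 := by fun_prop
    exact h2.comp h1⟩
  rel _ _ _ := rfl
  comp _ _ _ := rfl
  one _ := rfl

/-- The operation of `ESC f` with inputs of colour `false` and output of colour `true` defined by
an operation of `T`. -/
noncomputable def inclM (A : Finset ℕ) :
    C(T.pos.X () (ar A), (ESC f).pos.X true (Ar.const false A)) where
  toFun t := ⟨⟨(⟨S.rel id (reIn (bij_id (on_false (ar A)).symm)) S.pt, fun h => Bool.noConfusion h⟩,
      ⟨t.1, fun h => Bool.noConfusion h⟩,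
      ContinuousMap.const _ ⟨T.rel id (reIn (bij_id (on_false (ar A)).symm)) T.pt,
        fun h => Bool.noConfusion h⟩),
    Subtype.ext (T.eq_of_empty (on_false (ar A)) _ _),
    Subtype.ext (T.eq_of_empty (on_false (ar A)) _ _)⟩, t.2⟩
  continuous_toFun := by
    refine Continuous.subtype_mk (Continuous.subtype_mk (continuous_const.prodMk
      (Continuous.prodMk ?_ continuous_const)) _) _
    exact continuous_subtype_val.subtype_mk _

/-- The remaining data of an operation with inputs of colour `false` are points, and paths, of
spaces of operations without inputs, which are one-point spaces. -/
theorem inclM_projT (A : Finset ℕ) (p : (ESC f).pos.X true (Ar.const false A)) :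
    inclM f A ((projT f).pos.app true (Ar.const false A) p) = p :=
  Subtype.ext (Subtype.ext (Prod.ext (Subtype.ext (S.eq_of_empty (on_false (ar A)) _ _))
    (Prod.ext rfl (ContinuousMap.ext fun _ => Subtype.ext (T.eq_of_empty (on_false (ar A)) _ _)))))

variable (K)

/-- The projection of the bimodule of chains to the chains of `T`. -/
noncomputable def escProj : (escBimod K f).toRightMod ⟶ (chainOperad K T).regular where
  app A := mapChains K ((projT f).pos.app true (Ar.const false A))
  rel {A B} g hg := by
    apply Ch_hom_ext
    intro i σ hσ
    refine (mapCh_mapCh _ _ i _).trans (Eq.trans ?_ (mapCh_mapCh _ _ i _).symm)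
    rfl
  act {A x B C} h i j n hn a b := by
    refine ((projT f).pos.compCh (ColDGOperad.insF h) hn a
      (mapCh K ((inclT f).pos.app () (ar B)) j b)).trans ?_
    refine congrArg ((chainOperad K T).comp h hn _) ?_
    refine (mapCh_mapCh _ _ j b).trans ?_
    exact mapCh_id j b

theorem escUnit_d : ((escBimod K f).X {0}).d 0 1 (escUnit K f) = 0 := by
  refine (chains_d (by norm_num) _).trans ((dCh_br _ (isCube_const _)).trans ?_)
  simp [bdry]
  rfl

theorem escProj_escUnit :
    (RightMod.Hom.app (escProj K f) {0}).f 0 (escUnit K f) = (chainOperad K T).one 0 :=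
  mapCh_br _ (isCube_const _)

/-- The map `q ↦ e ∘ q` from the chains of `T` to the bimodule of chains. -/
noncomputable def escIncl : (chainOperad K T).regular ⟶ (escBimod K f).toRightMod :=
  (escBimod K f).toRightMod.unitMap (escUnit K f) (escUnit_d K f)

theorem escIncl_escProj : escIncl K f ≫ escProj K f = 𝟙 _ := by
  apply RightMod.Hom.ext
  funext A
  apply HomologicalComplex.hom_ext
  intro i
  apply ModuleCat.hom_ext
  apply LinearMap.ext
  intro q
  refine (RightMod.Hom.act (escProj K f) (ins_self 0 A) (zero_add i) (escUnit K f) q).trans ?_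
  rw [escProj_escUnit]
  exact (chainOperad K T).one_comp (ins_self 0 A) (zero_add i) q

theorem escProj_escIncl : escProj K f ≫ escIncl K f = 𝟙 _ := by
  apply RightMod.Hom.ext
  funext A
  apply HomologicalComplex.hom_ext
  intro i
  apply ModuleCat.hom_ext
  apply LinearMap.ext
  intro a
  have hinj : Function.LeftInverse (mapCh K (inclM f A) i)
      (mapCh K ((projT f).pos.app true (Ar.const false A)) i) := by
    intro b
    refine (mapCh_mapCh _ _ i b).trans (Eq.trans ?_ (mapCh_id i b))
    exact congrArg (fun F => mapCh K F i b) (ContinuousMap.ext (inclM_projT f A))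
  apply hinj.injective
  exact congrArg (fun F => (ModuleCat.Hom.hom (HomologicalComplex.Hom.f (RightMod.Hom.app F A) i))
    ((RightMod.Hom.app (escProj K f) A).f i a)) (escIncl_escProj K f)

end TopOperad

/-! ### The left action on the chains of the target -/

namespace TopOperad

/-- The relabelling which undoes the shift by `s` of the labels. -/
def unshift (s : ℕ) (n : ℕ) : ℕ := if s ≤ n then n - s else n

theorem unshift_add (s n : ℕ) : unshift s (n + s) = n := by
  rw [unshift, if_pos (Nat.le_add_left _ _), Nat.add_sub_cancel]

theorem unshift_of_lt {s n : ℕ} (h : n < s) : unshift s n = n := if_neg (by omega)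

section

variable {S T : TopOperad.{v} Unit} [IsLambda S] [IsLambda T] {f : Hom id S T}

/-- The projection to `T` of the result of insertions of units in the inputs `j + s`, for `j` in a
list: only the labels of the inputs change. -/
theorem projT_chain {s : ℕ}
    {m : ℕ → (((ESC f).pos.chains K).rmod ((inclT f).pos.chains K ())
      ((inclT f).pos.chains_one ())).Elt}
    {w : ∀ j, ((escBimod K f).X {j}).X 0} (hm : ∀ j, m j = ⟨{j}, 0, w j⟩)
    (hw : ∀ j, (RightMod.Hom.app (escProj K f) {j}).f 0 (w j) = (chainOperad K T).one j)
    {N : Finset ℕ} {r : ℤ} (l : List ℕ) (hl : l.Nodup) (hs : ∀ j ∈ l, j < s) {C : Finset ℕ}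
    (hb : Set.BijOn (unshift s) (C : Set ℕ) N) (hC : ∀ j ∈ l, j + s ∈ C)
    (hC' : ∀ n ∈ C, s ≤ n → n - s ∈ l)
    (v : ((ESC f).pos.chains K).Fam (ColDGOperad.colS s)) :
    mapCh K ((projT f).pos.app true ⟨N, ColDGOperad.colS s⟩) r
        (ColDGOperad.chain (D := (ESC f).pos.chains K) (G := (inclT f).pos.chains K ())
          (hG := (inclT f).pos.chains_one ()) (· + s) l m v N r) =
      ((chainOperad K T).rel (unshift s) hb).f r
        (mapCh K ((projT f).pos.app true ⟨C, ColDGOperad.colS s⟩) r (v C r)) := by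
  induction l generalizing C v with
  | nil =>
    have h : ∀ n ∈ C, unshift s n = n := by
      intro n hn
      refine unshift_of_lt ?_
      by_contra h
      exact List.not_mem_nil (hC' n hn (by omega))
    obtain rfl : C = N := by
      apply Finset.coe_injective
      rw [← hb.image_eq, Set.EqOn.image_eq (f₂ := id) h, Set.image_id]
    exact ((chainOperad K T).rel_eq_self _ hb h _).symm
  | cons j l ih =>
    have hj : j < s := hs j (by simp)
    have hjC : j + s ∈ C := hC j (by simp)
    have hjC' : j ∉ C := by
      intro h
      have := hb.injOn h hjC (by rw [unshift_add, unshift_of_lt hj])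
      omega
    have hI : Ins C (j + s) {j} (insert j (C.erase (j + s))) :=
      ⟨hjC, by simp [hjC'], by rw [Finset.union_comm]; rfl⟩
    have hI' : CIns (⟨C, ColDGOperad.colS s⟩ : Ar Bool) (j + s) true (Ar.const false {j})
        ⟨insert j (C.erase (j + s)), ColDGOperad.colS s⟩ :=
      ⟨hI, ColDGOperad.colS_true.2 (Nat.le_add_left _ _), fun _ _ => rfl, fun n hn => by
        obtain rfl := Finset.mem_singleton.1 hn
        exact ColDGOperad.colS_false.2 hj⟩
    -- the insertion of the unit `j` in the input `j + s` amounts to a relabelling by `g`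
    set g : ℕ → ℕ := Function.update id (j + s) j
    have hg : Set.BijOn g (C : Set ℕ) (insert j (C.erase (j + s)) : Finset ℕ) := by
      refine ⟨fun n hn => ?_, fun a ha b hb e => ?_, fun n hn => ?_⟩
      · by_cases e : n = j + s
        · subst e
          simp [g]
        · have : g n = n := Function.update_of_ne e _ _
          rw [this]
          exact Finset.mem_coe.2 (Finset.mem_insert_of_mem (Finset.mem_erase.2 ⟨e, hn⟩))
      · by_cases ea : a = j + s <;> by_cases eb : b = j + s
        · rw [ea, eb]
        · have h1 : g b = b := Function.update_of_ne eb _ _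
          have h2 : g a = j := by rw [ea]; exact Function.update_self _ _ _
          rw [h1, h2] at e
          exact (hjC' (e ▸ hb)).elim
        · have h1 : g a = a := Function.update_of_ne ea _ _
          have h2 : g b = j := by rw [eb]; exact Function.update_self _ _ _
          rw [h1, h2] at e
          exact (hjC' (e ▸ ha)).elim
        · have h1 : g b = b := Function.update_of_ne eb _ _
          have h2 : g a = a := Function.update_of_ne ea _ _
          rw [h1, h2] at e
          exact e
      · rcases Finset.mem_insert.1 (Finset.mem_coe.1 hn) with rfl | hn
        · exact ⟨n + s, hjC, Function.update_self _ _ _⟩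
        · obtain ⟨h1, h2⟩ := Finset.mem_erase.1 hn
          exact ⟨n, h2, Function.update_of_ne h1 _ _⟩
    have hgu : ∀ n ∈ C, unshift s (g n) = unshift s n := by
      intro n _
      by_cases e : n = j + s
      · subst e
        rw [show g (j + s) = j from Function.update_self _ _ _, unshift_add, unshift_of_lt hj]
      · rw [show g n = n from Function.update_of_ne e _ _]
    have hb' : Set.BijOn (unshift s) (insert j (C.erase (j + s)) : Finset ℕ) (N : Set ℕ) := by
      have h1 : Set.BijOn (unshift s ∘ g) (C : Set ℕ) N := hb.congr fun n hn => (hgu n hn).symm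
      rw [← hg.image_eq]
      refine ⟨?_, ?_, ?_⟩
      · rintro _ ⟨n, hn, rfl⟩
        exact h1.mapsTo hn
      · rintro _ ⟨a, ha, rfl⟩ _ ⟨b, hb, rfl⟩ e
        rw [h1.injOn ha hb e]
      · intro n hn
        obtain ⟨a, ha, e⟩ := h1.surjOn hn
        exact ⟨g a, ⟨a, ha, rfl⟩, e⟩
    rw [List.nodup_cons] at hl
    refine (ih hl.2 (fun i hi => hs i (List.mem_cons_of_mem _ hi)) hb' ?_ ?_
      (ColDGOperad.insE (j + s) (m j) v)).trans ?_
    rotate_left 2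
    · have e1 : ColDGOperad.insE (j + s) (m j) v =
          ColDGOperad.ins (d := true) (B := Ar.const false {j}) (k := 0) (j + s) (w j) v := by
        rw [hm]
        rfl
      have e2 : ColDGOperad.insE (j + s) (m j) v (insert j (C.erase (j + s))) r =
          (ESC f).pos.compCh K hI' (add_zero r) (v C r) (w j) := by
        rw [e1]
        exact ColDGOperad.ins_apply (w j) v hI' (add_zero r)
      rw [e2]
      have e3 := (projT f).pos.compCh hI' (add_zero r) (v C r) (w j)
      have e4 : mapCh K ((projT f).pos.app true (Ar.const false {j})) 0 (w j) = _ := hw j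
      rw [e4] at e3
      refine (congrArg (((chainOperad K T).rel (unshift s) hb').f r) (e3.trans
        ((chainOperad K T).comp_one_eq_rel hI (add_zero r) _ g hg (Function.update_self _ _ _)
          fun n hn => Function.update_of_ne (Finset.ne_of_mem_erase hn) _ _))).trans ?_
      exact (chainOperad K T).rel_rel g (unshift s) (unshift s) hg hb' hb hgu _
    · intro i hi
      refine Finset.mem_insert_of_mem (Finset.mem_erase.2 ⟨?_, hC i (List.mem_cons_of_mem _ hi)⟩)
      intro e
      obtain rfl : i = j := Nat.add_right_cancel e
      exact hl.1 hi
    · intro n hn hsn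
      rcases Finset.mem_insert.1 hn with rfl | hn
      · omega
      · obtain ⟨h1, h2⟩ := Finset.mem_erase.1 hn
        rcases List.mem_cons.1 (hC' n h2 hsn) with h3 | h3
        · omega
        · exact h3

end

section

variable {S T : TopOperad.{v} Unit} [IsLambda S] [IsLambda T] (f : Hom id S T)

variable (K) in
/-- The left action of the chains of `S` on the chains of `T`, which is obtained from the left
action on the bimodule of chains of `ESC f`. -/
noncomputable def escSection :
    (chainOperad K S).toNUOperad ⟶ (chainOperad K T).regular.End :=
  (escBimod K f).left ≫ RightMod.conj (escProj K f) (escIncl K f) (escProj_escIncl K f)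

theorem escSection_ev : escSection K f ≫ RightMod.ev (chainOperad K T) = chainMap K f := by
  apply NUOperad.Hom.ext
  funext A
  apply Ch_hom_ext
  intro i σ hσ
  set p : Ch K (S.pos.X () (ar A)) i := br K i σ
  set s := ColDGOperad.bd A
  have hA : ∀ n ∈ A, n < s := ColDGOperad.lt_bd
  set p' : Ch K ((ESC f).pos.X true (Ar.const true A)) i :=
    mapCh K ((inclS f).pos.app () (ar A)) i p
  set m : ℕ → (((ESC f).pos.chains K).rmod ((inclT f).pos.chains K ())
      ((inclT f).pos.chains_one ())).Elt :=
    fun j => (RightMod.units (chainOperad K T) j).map (escIncl K f)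
  have hU : Set.BijOn (unshift s) (A.image (· + s) : Finset ℕ) (A : Set ℕ) := by
    refine ⟨fun n hn => ?_, fun a ha b hb e => ?_, fun n hn => ?_⟩
    · obtain ⟨a, ha, rfl⟩ := Finset.mem_image.1 (Finset.mem_coe.1 hn)
      rw [unshift_add]
      exact ha
    · obtain ⟨a, -, rfl⟩ := Finset.mem_image.1 (Finset.mem_coe.1 ha)
      obtain ⟨b, -, rfl⟩ := Finset.mem_image.1 (Finset.mem_coe.1 hb)
      rw [unshift_add, unshift_add] at e
      rw [e]
    · exact ⟨n + s, Finset.mem_image_of_mem (· + s) hn, unshift_add s n⟩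
  -- the left action is given by a shift of the labels, insertions of units, which undo the shift,
  -- and a relabelling by the identity
  have e1 : ColDGOperad.leftPre ((ESC f).pos.chains K) ((inclT f).pos.chains K ())
      ((inclT f).pos.chains_one ()) A i p' m A i = _ := ColDGOperad.evS_apply hA i _
  have e2 := projT_chain (f := f) (s := s) (m := m) (r := i) (N := A)
    (w := fun j => (RightMod.Hom.app (escIncl K f) {j}).f 0 ((chainOperad K T).one j))
    (fun _ => rfl) (fun j => RightMod.map_map_id _ _ (escIncl_escProj K f) _ _ _)
    (A.sort (· ≤ ·)) (A.sort_nodup _) (fun j hj => hA j ((Finset.mem_sort _).1 hj))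
    (C := A.image (· + s)) hU
    (fun j hj => Finset.mem_image_of_mem (· + s) ((Finset.mem_sort _).1 hj))
    (fun n hn _ => by
      obtain ⟨a, ha, rfl⟩ := Finset.mem_image.1 hn
      rw [Nat.add_sub_cancel]
      exact (Finset.mem_sort _).2 ha)
    (ColDGOperad.start (D := (ESC f).pos.chains K) s A i p')
  have e3 : ColDGOperad.start (D := (ESC f).pos.chains K) s A i p' (A.image (· + s)) i =
      mapCh K ((ESC f).pos.rel (· + s) (ColDGOperad.reShift s A)) i p' :=
    ColDGOperad.delta_self _ _ _
  rw [e3] at e2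
  have hS : Set.BijOn (· + s) (A : Set ℕ) (A.image (· + s) : Finset ℕ) :=
    (ColDGOperad.reShift s A).bij
  have e4 : mapCh K ((projT f).pos.app true ⟨A.image (· + s), ColDGOperad.colS s⟩) i
      (mapCh K ((ESC f).pos.rel (· + s) (ColDGOperad.reShift s A)) i p') =
      ((chainOperad K T).rel (· + s) hS).f i
        (mapCh K (f.pos.app () (ar A)) i p) := by
    refine (mapCh_mapCh _ _ i _).trans ((mapCh_mapCh _ _ i _).trans
      (Eq.trans ?_ (mapCh_mapCh _ _ i _).symm))
    rfl
  rw [e4] at e2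
  have e5 := e2.trans ((chainOperad K T).rel_rel (· + s) (unshift s) id hS hU (Set.bijOn_id _)
    (fun n _ => unshift_add s n) _)
  have e6 := e5.trans ((chainOperad K T).rel_eq_self id (Set.bijOn_id _) (fun _ _ => rfl) _)
  refine (congrArg (mapCh K ((projT f).pos.app true (Ar.const false A)) i) e1).trans ?_
  refine (mapCh_mapCh _ _ i _).trans (Eq.trans ?_ e6)
  refine congrArg (fun F => mapCh K F i (ColDGOperad.chain (· + s) (A.sort (· ≤ ·)) m
    (ColDGOperad.start (D := (ESC f).pos.chains K) s A i p') A i)) (ContinuousMap.ext fun x => ?_)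
  exact T.pos.rel_id (reIn (Set.bijOn_id _))
    ((projT f).pos.app true ⟨A, ColDGOperad.colS s⟩ x)

end

end TopOperad

/-! ### Torsors and resolutions -/

section chains

variable {Y : Type v} [TopologicalSpace Y]

/-- A one-point space has no non-degenerate cubes of positive dimension. -/
theorem ch_eq_zero [Subsingleton Y] {i : ℤ} (hi : i ≠ 0) (a : Ch K Y i) : a = 0 := by
  refine LinearMap.congr_fun (f := LinearMap.id) (g := 0) (Ch_ext fun σ hσ => ?_) a
  exact br_degen ⟨0, by have := hσ.le; simp only [Nat.cast_zero]; omega,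
    fun _ _ _ => Subsingleton.elim _ _⟩

/-- The augmentation of the chains of degree zero. -/
noncomputable def augCh (K : Type u) [Field K] (Y : Type v) [TopologicalSpace Y] :
    Ch K Y 0 →ₗ[K] K :=
  liftCh (fun _ => 1) (fun _ _ ⟨k, hk, _⟩ => by omega) (fun _ _ k hk => by omega)

theorem augCh_const (y : Y) : augCh K Y (br K 0 (ContinuousMap.const _ y)) = 1 :=
  liftCh_br _ _ _ (TopOperad.isCube_const _)

theorem ch_zero_eq_smul [Subsingleton Y] (y : Y) (a : Ch K Y 0) :
    a = augCh K Y a • br K 0 (ContinuousMap.const _ y) := by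
  refine LinearMap.congr_fun (f := LinearMap.id)
    (g := (augCh K Y).smulRight (br K 0 (ContinuousMap.const _ y))) (Ch_ext fun σ hσ => ?_) a
  have h : σ = ContinuousMap.const _ y := ContinuousMap.ext fun _ => Subsingleton.elim _ _
  rw [LinearMap.smulRight_apply, h, augCh_const, one_smul, LinearMap.id_apply]

end chains

namespace RightMod

variable {Q : DGOperad.{u, w} K} {M N : RightMod Q}

theorem isQuasiIso_of_iso (F : M ⟶ N) (G : N ⟶ M) (h : F ≫ G = 𝟙 M) (h' : G ≫ F = 𝟙 N) :
    IsQuasiIso F := by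
  intro A
  have : IsIso (Hom.app F A) := ⟨Hom.app G A, congrArg (fun F => Hom.app F A) h,
    congrArg (fun F => Hom.app F A) h'⟩
  infer_instance

theorem isCofibration_of_iso (F : M ⟶ N) (G : N ⟶ M) (h : F ≫ G = 𝟙 M) (h' : G ≫ F = 𝟙 N) :
    IsCofibration F := by
  intro X Y H _ _
  have : IsIso F := ⟨G, h, h'⟩
  infer_instance

/-- A morphism of right modules maps the map `q ↦ e ∘ q` to the map defined by the image of `e`. -/
theorem unitMap_comp (F : M ⟶ N) {e : (M.X {0}).X 0} (he : (M.X {0}).d 0 1 e = 0)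
    {e' : (N.X {0}).X 0} (he' : (N.X {0}).d 0 1 e' = 0) (h : (Hom.app F {0}).f 0 e = e') :
    M.unitMap e he ≫ F = N.unitMap e' he' := by
  subst h
  apply Hom.ext
  funext A
  apply HomologicalComplex.hom_ext
  intro i
  apply ModuleCat.hom_ext
  apply LinearMap.ext
  intro q
  exact Hom.act F (ins_self 0 A) (zero_add i) e q

end RightMod

namespace TopOperad

/-- The identity of an operad. -/
def idHom (T : TopOperad.{v} Unit) : Hom id T T where
  app _ _ := ContinuousMap.id _
  rel _ _ _ := rfl
  comp _ _ _ := rfl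
  one _ := rfl

theorem chainMap_idHom (T : TopOperad.{v} Unit) :
    chainMap K (idHom T) = 𝟙 (chainOperad K T).toNUOperad := by
  apply NUOperad.Hom.ext
  funext A
  apply Ch_hom_ext
  intro i σ hσ
  exact mapCh_id i _

variable {S T : TopOperad.{v} Unit} [IsLambda S] [IsLambda T] (f : Hom id S T)

theorem escBimod_isTorsor [IsReduced T] : (escBimod K f).IsTorsor (escUnit K f) := by
  have hT : Subsingleton (T.pos.X () (ar {0})) := by
    have := (IsReduced.unique (T := T) (ar {0}) rfl).some
    exact inferInstanceAs (Subsingleton {_t : T.X () (ar {0}) // _})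
  have hY : Subsingleton ((ESC f).pos.X true (Ar.const false {0})) :=
    ⟨fun a b => Function.LeftInverse.injective (inclM_projT f {0}) (hT.elim _ _)⟩
  refine ⟨escUnit_d K f, fun i hi => ?_, fun z _ => ?_, ?_⟩
  · apply HomologicalComplex.ExactAt.of_isZero
    have : Subsingleton (((escBimod K f).X {0}).X i) :=
      ⟨fun a b => (ch_eq_zero (Y := (ESC f).pos.X true (Ar.const false {0})) hi a).trans
        (ch_eq_zero hi b).symm⟩
    exact ModuleCat.isZero_of_subsingleton _
  · have h1 := ch_zero_eq_smul (escOne f) z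
    refine ⟨augCh K _ z, ⟨0, ?_⟩, ?_⟩
    · rw [map_zero, add_zero]
      exact h1
    · rintro c ⟨y, hy⟩
      have hy0 : y = 0 := ch_eq_zero (Y := (ESC f).pos.X true (Ar.const false {0})) (by norm_num) y
      rw [hy0, map_zero, add_zero] at hy
      have h2 := congrArg (augCh K _) hy
      refine Eq.symm (h2.trans ((map_smul (augCh K _) c _).trans ?_))
      exact (congrArg (c • ·) (augCh_const (escOne f))).trans (mul_one c)
  · exact RightMod.isQuasiIso_of_iso _ _ (escIncl_escProj K f) (escProj_escIncl K f)

variable (K) in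
/-- The bimodule of chains, as a resolution of itself. -/
noncomputable def escResolution : (escBimod K f).Resolution (escUnit K f) where
  N := escBimod K f
  p := 𝟙 _
  p_left _ _ _ _ _ _ := rfl
  p_quasiIso := RightMod.isQuasiIso_of_iso _ (𝟙 _) (Category.id_comp _) (Category.id_comp _)
  one := escUnit K f
  d_one := escUnit_d K f
  p_one := rfl
  cofibration := RightMod.isCofibration_of_iso _ _ (escIncl_escProj K f) (escProj_escIncl K f)

section resolution

variable {f} (R : (escBimod K f).Resolution (escUnit K f))

theorem resolution_ι_p : R.ι ≫ R.p = escIncl K f := RightMod.unitMap_comp _ _ _ R.p_one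

theorem resolution_retract : R.ι ≫ R.p ≫ escProj K f = 𝟙 _ := by
  rw [← Category.assoc, resolution_ι_p, escIncl_escProj]

theorem resolution_ι_quasiIso : RightMod.IsQuasiIso R.ι := by
  intro A
  have h1 : QuasiIso (RightMod.Hom.app R.p A) := R.p_quasiIso A
  have h2 : QuasiIso (RightMod.Hom.app R.ι A ≫ RightMod.Hom.app R.p A) := by
    have h3 : QuasiIso (RightMod.Hom.app (escIncl K f) A) :=
      RightMod.isQuasiIso_of_iso _ _ (escIncl_escProj K f) (escProj_escIncl K f) A
    rw [← resolution_ι_p R] at h3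
    exact h3
  exact quasiIso_of_comp_right _ (RightMod.Hom.app R.p A)

/-- The retraction `p ≫ escProj` intertwines the action of the chains of `S` on a resolution with
the action on the chains of `T`. -/
theorem resolution_intertwine (J : Finset ℕ) (d : ℤ) (x : ((chainOperad K S).X J).X d)
    (m : ℕ → R.N.toRightMod.Elt) (B : Finset ℕ) (r : ℤ) :
    (RightMod.Hom.app (R.p ≫ escProj K f) B).f r
        (R.N.toRightMod.toPre ((NUOperad.Hom.app R.N.left J).f d x) m B r) =
      (chainOperad K T).regular.toPre ((NUOperad.Hom.app (escSection K f) J).f d x)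
        (fun j => (m j).map (R.p ≫ escProj K f)) B r := by
  refine (congrArg ((RightMod.Hom.app (escProj K f) B).f r) (R.p_left J d x m B r)).trans ?_
  have h : ∀ e : (escBimod K f).toRightMod.Elt, (e.map (escProj K f)).map (escIncl K f) = e := by
    intro e
    exact congrArg (fun F => RightMod.Elt.map F e) (escProj_escIncl K f)
  have h1 : (fun j => (m j).map R.p) =
      fun j => (((m j).map R.p).map (escProj K f)).map (escIncl K f) :=
    funext fun j => (h _).symm
  rw [h1]
  rfl

/-- The morphism in the localization which compares the zigzag with the map of chains is the
class of `escSection`. -/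
theorem resolution_encodes (π : R.N.toRightMod ⟶ (chainOperad K T).regular)
    (hπ : R.ι ≫ π = 𝟙 _) : R.Encodes π hπ (chainMap K f) := by
  obtain ⟨c⟩ := RightMod.exists_contraction R.cofibration (resolution_ι_quasiIso R) hπ
  obtain ⟨c₀⟩ := RightMod.exists_contraction R.cofibration (resolution_ι_quasiIso R)
    (resolution_retract R)
  refine ⟨c.quasiIso_conj hπ, RightMod.quasiIso_ev_of_section (escSection K (idHom T))
    ((escSection_ev (idHom T)).trans (chainMap_idHom T)),
    NUOperad.quasiIso.Q.map (escSection K f), ?_, ?_⟩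
  · exact c₀.map_eq (resolution_retract R) hπ R.N.left (escSection K f) (resolution_intertwine R)
  · rw [← Functor.map_comp, escSection_ev]

end resolution

end TopOperad

end

end OperadTorsor

theorem mainTheorem5 {K : Type u} [Field K] [CharZero K]
    (S T : OperadTorsor.TopOperad.{v} Unit) [S.IsLambda] [T.IsLambda] [S.IsReduced] [T.IsReduced]
    (f : OperadTorsor.TopOperad.Hom id S T) :
    (OperadTorsor.TopOperad.escBimod K f).IsTorsor (OperadTorsor.TopOperad.escUnit K f) ∧
      Nonempty (OperadTorsor.Bimod.Resolution (OperadTorsor.TopOperad.escBimod K f)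
        (OperadTorsor.TopOperad.escUnit K f)) ∧
      ∀ R : OperadTorsor.Bimod.Resolution (OperadTorsor.TopOperad.escBimod K f)
          (OperadTorsor.TopOperad.escUnit K f),
        (∃ π : R.N.toRightMod ⟶ (OperadTorsor.TopOperad.chainOperad K T).regular,
          R.ι ≫ π = 𝟙 (OperadTorsor.TopOperad.chainOperad K T).regular) ∧
        ∀ (π : R.N.toRightMod ⟶ (OperadTorsor.TopOperad.chainOperad K T).regular)
          (hπ : R.ι ≫ π = 𝟙 (OperadTorsor.TopOperad.chainOperad K T).regular),
          R.Encodes π hπ (OperadTorsor.TopOperad.chainMap K f) :=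
  ⟨OperadTorsor.TopOperad.escBimod_isTorsor f, ⟨OperadTorsor.TopOperad.escResolution K f⟩, fun R =>
    ⟨⟨_, OperadTorsor.TopOperad.resolution_retract R⟩,
      OperadTorsor.TopOperad.resolution_encodes R⟩⟩
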